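/- Let $H$ be a directed multigraph (loops and parallel arcs allowed) with $n\ge 1$ vertices and $M$ arcs in which every vertex has in-degree and out-degree $2$. A transition system $\tau$ of $H$ matches, at every vertex, the incoming with the outgoing arcs; it is a tour if the permutation of the arcs sending each arc to the one matched with it has exactly one cycle. Flipping a vertex exchanges the successors of its two incoming arcs. One step of the flip–repair chain flips a uniformly random vertex $x$ of the current tour, and then flips a vertex chosen uniformly among all vertices $y$ for which flipping $y$ as well gives a tour ($y=x$ is always possible). The machine is a randomized word RAM whose words hold integers bounded by a fixed power of $M+B$; arithmetic, comparisons, memory accesses, and drawing a uniformly random integer in $\{0,\dots,k-1\}$ for a word $k\ge 1$, take unit time. Space is the number of memory cells. **Theorem (degree-two implementation).** The flip–repair chain can be implemented by one program that receives $H$, an initial tour $\tau$ of $H$ and an integer $B\ge 1$, uses $$O\!\left(M+\frac{M^2}{B^2}\right)$$ space and preprocessing time, and $$O\!\left(B\log M+\frac MB\log M\right)$$ amortized time per step: for every $T$, the first $T$ steps after the preprocessing take at most $T$ times this bound in total, for every outcome of the random choices. The current tour is kept in memory, as the table of the successors of all arcs, after the preprocessing and after every step, and the sequence of these tours has exactly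 the law of the flip–repair chain started at $\tau$. All implied constants are absolute. With $B=\lceil\sqrt M\rceil$ this is $O(M)$ space and preprocessing time, $O(\sqrt M\log M)$ amortized time per step, and words bounded by a fixed power of $M$. -/

import Mathlib

namespace FlipRepair

/-! ### Graphs, transition systems and tours -/

/-- A directed multigraph with vertices `Fin n` and arcs `Fin M` (loops and parallel arcs are
allowed) in which every vertex has in-degree two and out-degree two. -/
structure Graph (n M : ℕ) where
  tail : Fin M → Fin n
  head : Fin M → Fin n
  two_out : ∀ v, (Finset.univ.filter fun e => tail e = v).card = 2
  two_in : ∀ v, (Finset.univ.filter fun e => head e = v).card = 2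

variable {n M : ℕ}

namespace Graph

/-- The incoming arcs of a vertex. A loop is both an incoming and an outgoing arc. -/
def inArcs (H : Graph n M) (v : Fin n) : Finset (Fin M) :=
  Finset.univ.filter fun e => H.head e = v

theorem inArcs_nonempty (H : Graph n M) (v : Fin n) : (H.inArcs v).Nonempty := by
  have h : (H.inArcs v).card = 2 := H.two_in v
  exact Finset.card_pos.mp (by omega)

/-- One of the two incoming arcs of `v`. -/
def inArcA (H : Graph n M) (v : Fin n) : Fin M := (H.inArcs v).min' (H.inArcs_nonempty v)

/-- The other incoming arc of `v`. -/
def inArcB (H : Graph n M) (v : Fin n) : Fin M := (H.inArcs v).max' (H.inArcs_nonempty v)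

theorem head_inArcA (H : Graph n M) (v : Fin n) : H.head (H.inArcA v) = v := by
  have h : H.inArcA v ∈ H.inArcs v := Finset.min'_mem _ _
  simpa [inArcs] using h

theorem head_inArcB (H : Graph n M) (v : Fin n) : H.head (H.inArcB v) = v := by
  have h : H.inArcB v ∈ H.inArcs v := Finset.max'_mem _ _
  simpa [inArcs] using h

end Graph

/-- A transition system: a permutation `next` of the arcs that continues every arc `e` by an arc
leaving the head of `e`. Restricted to the incoming arcs of a vertex `v`, it is a bijection onto
the outgoing arcs of `v`, and every family of such local bijections arises in this way. -/
@[ext] structure TransitionSystem (H : Graph n M) where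
  next : Equiv.Perm (Fin M)
  tail_next : ∀ e, H.tail (next e) = H.head e

namespace TransitionSystem

variable {H : Graph n M}

/-- The induced permutation of the arcs has exactly one cycle. -/
def IsTour (τ : TransitionSystem H) : Prop := τ.next.IsCycleOn Set.univ

/-- Flipping `v`: exchange the successors of the two incoming arcs of `v`. -/
def flip (τ : TransitionSystem H) (v : Fin n) : TransitionSystem H where
  next := τ.next * Equiv.swap (H.inArcA v) (H.inArcB v)
  tail_next e := by
    rw [Equiv.Perm.mul_apply, τ.tail_next]
    by_cases ha : e = H.inArcA v
    · rw [ha, Equiv.swap_apply_left, H.head_inArcA, H.head_inArcB]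
    · by_cases hb : e = H.inArcB v
      · rw [hb, Equiv.swap_apply_right, H.head_inArcA, H.head_inArcB]
      · rw [Equiv.swap_apply_of_ne_of_ne ha hb]

theorem flip_flip (τ : TransitionSystem H) (v : Fin n) : (τ.flip v).flip v = τ := by
  ext e
  simp [flip]

open Classical in
/-- The feasible repair flips after `x` has been flipped in `τ`: the vertices `y` for which
flipping `y` as well gives a tour. -/
noncomputable def repairs (τ : TransitionSystem H) (x : Fin n) : Finset (Fin n) :=
  Finset.univ.filter fun y => ((τ.flip x).flip y).IsTour

end TransitionSystem

/-- The one-cycle transition systems of `H`, the states of the chain. -/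
def Tour (H : Graph n M) : Type := {τ : TransitionSystem H // τ.IsTour}

namespace Tour

variable {H : Graph n M}

theorem repairs_nonempty (τ : Tour H) (x : Fin n) : (τ.1.repairs x).Nonempty :=
  ⟨x, by simpa [TransitionSystem.repairs, TransitionSystem.flip_flip] using τ.2⟩

/-- The tour obtained by flipping `x` and then a feasible repair vertex `y`. -/
def move (τ : Tour H) (x : Fin n) (y : {y // y ∈ τ.1.repairs x}) : Tour H :=
  ⟨(τ.1.flip x).flip y.1, by
    have hy := y.2
    simpa [TransitionSystem.repairs] using hy⟩

instance (τ : Tour H) (x : Fin n) : Nonempty {y // y ∈ τ.1.repairs x} :=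
  (τ.repairs_nonempty x).to_subtype

/-- One step of the flip–repair chain: flip a uniformly random vertex `x`, and then flip a
uniformly random vertex among those whose flip restores a tour. -/
noncomputable def kernel [NeZero n] (τ : Tour H) : PMF (Tour H) :=
  (PMF.uniformOfFintype (Fin n)).bind fun x =>
    (PMF.uniformOfFintype {y // y ∈ τ.1.repairs x}).map fun y => τ.move x y

/-- The law of the first `T + 1` states of the flip–repair chain started at `τ`. -/
noncomputable def path [NeZero n] : ℕ → Tour H → PMF (List (Tour H))
  | 0, τ => PMF.pure [τ]
  | T + 1, τ => (kernel τ).bind fun τ' => (path T τ').map fun l => τ :: l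

end Tour

/-! ### A randomized word RAM -/

/-- Binary word operations; `sub` is truncated at zero, `lt` and `eq` return `1` or `0`. -/
inductive Op
  | add | sub | mul | div | mod | lt | eq

def Op.eval : Op → ℕ → ℕ → ℕ
  | .add, a, b => a + b
  | .sub, a, b => a - b
  | .mul, a, b => a * b
  | .div, a, b => a / b
  | .mod, a, b => a % b
  | .lt, a, b => if a < b then 1 else 0
  | .eq, a, b => if a = b then 1 else 0

/-- Programs. The arguments of the instructions are register numbers, except for the literal
in `const`. A program mentions only finitely many registers. -/
inductive Cmd
  /-- do nothing -/
  | skip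
  /-- `reg x := k` -/
  | const (x k : ℕ)
  /-- `reg x := reg y ∘ reg z` -/
  | op (o : Op) (x y z : ℕ)
  /-- `reg x := mem (reg y)` -/
  | load (x y : ℕ)
  /-- `mem (reg x) := reg y` -/
  | store (x y : ℕ)
  /-- `reg x :=` a fresh uniformly random element of `{0, …, reg y - 1}` -/
  | rand (x y : ℕ)
  /-- run `c`, then `d` -/
  | seq (c d : Cmd)
  /-- run `c` if `reg x ≠ 0`, and `d` otherwise -/
  | ite (x : ℕ) (c d : Cmd)
  /-- run `c` as long as `reg x ≠ 0` -/
  | while (x : ℕ) (c : Cmd)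

/-- Contents of the registers and of the memory. -/
structure State where
  reg : ℕ → ℕ
  mem : ℕ → ℕ

def State.setReg (s : State) (x a : ℕ) : State := { s with reg := Function.update s.reg x a }

def State.setMem (s : State) (i a : ℕ) : State := { s with mem := Function.update s.mem i a }

/-- `exec S W t k s` runs the commands in the list `k` one after another from the state `s` on a
machine with the memory cells `0, …, S - 1` and with words `0, …, W`, for at most `t` time units;
every executed instruction and every evaluated test takes one time unit. The result is the law of
the final state together with the unused time. The value `none` records a failure: the time ran
out, a memory address was at least `S`, the result of an operation was greater than `W`, or a
random element of the empty set was requested. -/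
noncomputable def exec (S W : ℕ) : ℕ → List Cmd → State → PMF (Option (State × ℕ))
  | t, [], s => PMF.pure (some (s, t))
  | 0, _ :: _, _ => PMF.pure none
  | t + 1, .skip :: k, s => exec S W t k s
  | t + 1, .const x a :: k, s =>
      if a ≤ W then exec S W t k (s.setReg x a) else PMF.pure none
  | t + 1, .op o x y z :: k, s =>
      if o.eval (s.reg y) (s.reg z) ≤ W
      then exec S W t k (s.setReg x (o.eval (s.reg y) (s.reg z))) else PMF.pure none
  | t + 1, .load x y :: k, s =>
      if s.reg y < S then exec S W t k (s.setReg x (s.mem (s.reg y))) else PMF.pure none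
  | t + 1, .store x y :: k, s =>
      if s.reg x < S then exec S W t k (s.setMem (s.reg x) (s.reg y)) else PMF.pure none
  | t + 1, .rand x y :: k, s =>
      if h : s.reg y = 0 then PMF.pure none
      else
        haveI : NeZero (s.reg y) := ⟨h⟩
        (PMF.uniformOfFintype (Fin (s.reg y))).bind fun r => exec S W t k (s.setReg x r)
  | t + 1, .seq c d :: k, s => exec S W t (c :: d :: k) s
  | t + 1, .ite x c d :: k, s =>
      if s.reg x ≠ 0 then exec S W t (c :: k) s else exec S W t (d :: k) s
  | t + 1, .while x c :: k, s =>
      if s.reg x ≠ 0 then exec S W t (c :: .while x c :: k) s else exec S W t k s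

/-! ### Implementations of the chain -/

/-- The contents of the cells `0, …, M - 1`. -/
def State.table (M : ℕ) (s : State) : Fin M → ℕ := fun e => s.mem e

/-- The table of a tour: the entry of an arc is the arc that follows it. -/
def Tour.table {H : Graph n M} (τ : Tour H) : Fin M → ℕ := fun e => τ.1.next e

/-- The initial state of the machine. The registers `0`, `1`, `2` hold `n`, `M` and the
parameter `B`; the table of the tour is in the cells `0, …, M - 1`, the heads of the arcs in the
cells `M, …, 2 * M - 1`, and their tails in the cells `2 * M, …, 3 * M - 1`. All else is zero. -/
def inputState (H : Graph n M) (τ : Tour H) (B : ℕ) : State where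
  reg x := if x = 0 then n else if x = 1 then M else if x = 2 then B else 0
  mem i :=
    if h : i < M then (τ.1.next ⟨i, h⟩ : ℕ)
    else if h : i - M < M then (H.head ⟨i - M, h⟩ : ℕ)
    else if h : i - 2 * M < M then (H.tail ⟨i - 2 * M, h⟩ : ℕ)
    else 0

/-- Run the program `step` `T` times in a row from the state `s`, with a total time of at most
`t`, and record the table in the memory at the start and after each of the `T` runs. -/
noncomputable def runSteps (M S W : ℕ) (step : Cmd) :
    ℕ → ℕ → State → PMF (Option (List (Fin M → ℕ)))
  | 0, _, s => PMF.pure (some [s.table M])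
  | T + 1, t, s => (exec S W t [step] s).bind fun r =>
      match r with
      | none => PMF.pure none
      | some (s', t') => (runSteps M S W step T t' s').map (Option.map fun l => s.table M :: l)

/-- Run `init` once on the input, in time at most `t₀`, and then `step` `T` times, in total time
at most `t`; record the table in the memory after `init` and after each run of `step`. -/
noncomputable def session (H : Graph n M) (τ : Tour H) (B S W : ℕ) (init step : Cmd)
    (t₀ T t : ℕ) : PMF (Option (List (Fin M → ℕ))) :=
  (exec S W t₀ [init] (inputState H τ B)).bind fun r =>
    match r with
    | none => PMF.pure none
    | some (s, _) => runSteps M S W step T t s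

/-- The programs `init` and `step`, with the parameter `B`, implement the flip–repair chain of `H`
from the tour `τ` on a machine with `S` memory cells and words `0, …, W`, with preprocessing time
at most `t₀` and a total time of at most `t T` for the first `T` steps, for every `T`. The machine
never fails, whatever the random choices, and the tours that it has in its memory after the
preprocessing and after each step have the joint law of the chain started at `τ`. -/
def Implements [NeZero n] (H : Graph n M) (τ : Tour H) (B : ℕ) (init step : Cmd)
    (S W t₀ : ℕ) (t : ℕ → ℕ) : Prop :=
  ∀ T : ℕ, session H τ B S W init step t₀ T (t T) =
    (Tour.path T τ).map fun l => some (l.map Tour.table)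

end FlipRepair

namespace FlipRepair

/-! ### A structured language with expressions and arrays, and its compiler -/

/-- Variables and arrays. -/
structure HS where
  v : ℕ → ℕ
  a : ℕ → ℕ → ℕ

def HS.set (h : HS) (x y : ℕ) : HS := { h with v := Function.update h.v x y }

def HS.put (h : HS) (k i y : ℕ) : HS :=
  { h with a := Function.update h.a k (Function.update (h.a k) i y) }

@[simp] theorem HS.set_v (h : HS) (x y z : ℕ) :
    (h.set x y).v z = if z = x then y else h.v z := by
  simp [HS.set, Function.update_apply]

@[simp] theorem HS.set_a (h : HS) (x y : ℕ) : (h.set x y).a = h.a := rfl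

@[simp] theorem HS.put_v (h : HS) (k i y : ℕ) : (h.put k i y).v = h.v := rfl

theorem HS.put_a (h : HS) (k i y k' : ℕ) :
    (h.put k i y).a k' = if k' = k then Function.update (h.a k) i y else h.a k' := by
  simp only [HS.put, Function.update_apply]

@[simp] theorem HS.put_a_same (h : HS) (k i y : ℕ) :
    (h.put k i y).a k = Function.update (h.a k) i y := by
  simp [HS.put_a]

@[simp] theorem HS.put_a_ne (h : HS) (k i y k' : ℕ) (hk : k' ≠ k) :
    (h.put k i y).a k' = h.a k' := by
  simp [HS.put_a, hk]

/-- Expressions: variables, literals, operations, array accesses. -/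
inductive Exp
  | v (x : ℕ)
  | c (k : ℕ)
  | bin (o : Op) (a b : Exp)
  | get (k : ℕ) (i : Exp)

def Exp.eval : Exp → HS → ℕ
  | .v x, h => h.v x
  | .c k, _ => k
  | .bin o a b, h => o.eval (a.eval h) (b.eval h)
  | .get k i, h => h.a k (i.eval h)

/-- The running time of an address computation. -/
def adrCost : ℕ → ℕ
  | 0 => 0
  | _ + 1 => 10

/-- The exact running time of the compiled expression. -/
def Exp.cost : Exp → ℕ
  | .v _ => 1
  | .c _ => 1
  | .bin _ a b => a.cost + b.cost + 3
  | .get k i => i.cost + adrCost k + 2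

/-- Bounds: `D` for the indices of array zero, `Z` for those of the other arrays, `W` for words. -/
structure Lim where
  D : ℕ
  Z : ℕ
  W : ℕ

def Lim.bd (l : Lim) (k : ℕ) : ℕ := if k = 0 then l.D else l.Z

@[simp] theorem Lim.bd_zero (l : Lim) : l.bd 0 = l.D := rfl
theorem Lim.bd_pos (l : Lim) (k : ℕ) (h : k ≠ 0) : l.bd k = l.Z := by simp [Lim.bd, h]

def Exp.ok (l : Lim) : Exp → HS → Prop
  | .v x, _ => x < 50
  | .c k, _ => k ≤ l.W
  | .bin o a b, h => a.ok l h ∧ b.ok l h ∧ o.eval (a.eval h) (b.eval h) ≤ l.W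
  | .get k i, h => k < 16 ∧ i.ok l h ∧ i.eval h < l.bd k

/-- Structured programs. -/
inductive HC
  | skip
  | asg (x : ℕ) (e : Exp)
  | put (k : ℕ) (i e : Exp)
  | seq (c d : HC)
  | ite (e : Exp) (c d : HC)
  | loop (e : Exp) (c : HC)

infixr:20 " ;; " => HC.seq
infixl:65 " +~ " => Exp.bin Op.add
infixl:65 " -~ " => Exp.bin Op.sub
infixl:70 " *~ " => Exp.bin Op.mul
infixl:70 " /~ " => Exp.bin Op.div
infixl:70 " %~ " => Exp.bin Op.mod
infix:50 " <~ " => Exp.bin Op.lt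
infix:50 " =~ " => Exp.bin Op.eq

section compile

/-- Turn an index in register `60 + d` into the address of that entry of array `k`. -/
def cadr (c : Cmd) (d : ℕ) : ℕ → Cmd
  | 0 => c
  | k + 1 =>
      .seq c (.seq (.const 52 16) (.seq (.op .mul (60 + d) (60 + d) 52)
        (.seq (.op .add (60 + d) (60 + d) 50) (.seq (.const 52 (k + 1))
          (.op .add (60 + d) (60 + d) 52)))))

/-- Evaluate an expression into register `60 + d`. -/
def cexp : ℕ → Exp → Cmd
  | d, .v x => .op .add (60 + d) x 51
  | d, .c k => .const (60 + d) k
  | d, .bin o a b => .seq (cexp d a) (.seq (cexp (d + 1) b) (.op o (60 + d) (60 + d) (61 + d)))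
  | d, .get k i => .seq (cadr (cexp d i) d k) (.load (60 + d) (60 + d))

def ccmd : HC → Cmd
  | .skip => .skip
  | .asg x e => .seq (cexp 0 e) (.op .add x 60 51)
  | .put k i e => .seq (cadr (cexp 0 i) 0 k) (.seq (cexp 1 e) (.store 60 61))
  | .seq c d => .seq (ccmd c) (ccmd d)
  | .ite e c d => .seq (cexp 0 e) (.ite 60 (ccmd c) (ccmd d))
  | .loop e c => .seq (cexp 0 e) (.while 60 (.seq (ccmd c) (cexp 0 e)))

end compile

/-- The command runs from `s` to `s'` in exactly `k` time units. -/
def Run (S W : ℕ) (c : Cmd) (s s' : State) (k : ℕ) : Prop :=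
  ∀ t rest, exec S W (t + k) (c :: rest) s = exec S W t rest s'

namespace Run

variable {S W : ℕ}

theorem seq {c d : Cmd} {s s₁ s' : State} {k₁ k₂ : ℕ} (h₁ : Run S W c s s₁ k₁)
    (h₂ : Run S W d s₁ s' k₂) : Run S W (.seq c d) s s' (k₁ + k₂ + 1) := by
  intro t rest
  have : t + (k₁ + k₂ + 1) = (t + k₂ + k₁) + 1 := by ring
  rw [this, exec, h₁, h₂]

theorem skip (s : State) : Run S W .skip s s 1 := by
  intro t rest
  rw [exec]

theorem const {x a : ℕ} (s : State) (h : a ≤ W) : Run S W (.const x a) s (s.setReg x a) 1 := by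
  intro t rest
  rw [exec, if_pos h]

theorem op {o : Op} {x y z : ℕ} (s : State) (h : o.eval (s.reg y) (s.reg z) ≤ W) :
    Run S W (.op o x y z) s (s.setReg x (o.eval (s.reg y) (s.reg z))) 1 := by
  intro t rest
  rw [exec, if_pos h]

theorem load {x y : ℕ} (s : State) (h : s.reg y < S) :
    Run S W (.load x y) s (s.setReg x (s.mem (s.reg y))) 1 := by
  intro t rest
  rw [exec, if_pos h]

theorem store {x y : ℕ} (s : State) (h : s.reg x < S) :
    Run S W (.store x y) s (s.setMem (s.reg x) (s.reg y)) 1 := by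
  intro t rest
  rw [exec, if_pos h]

theorem ite_true {x : ℕ} {c d : Cmd} {s s' : State} {k : ℕ} (h : s.reg x ≠ 0)
    (hc : Run S W c s s' k) : Run S W (.ite x c d) s s' (k + 1) := by
  intro t rest
  rw [← add_assoc, exec, if_pos h, hc]

theorem ite_false {x : ℕ} {c d : Cmd} {s s' : State} {k : ℕ} (h : s.reg x = 0)
    (hd : Run S W d s s' k) : Run S W (.ite x c d) s s' (k + 1) := by
  intro t rest
  rw [← add_assoc, exec, if_neg (by simpa using h), hd]

theorem while_false {x : ℕ} {c : Cmd} {s : State} (h : s.reg x = 0) :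
    Run S W (.while x c) s s 1 := by
  intro t rest
  rw [exec, if_neg (by simpa using h)]

theorem while_true {x : ℕ} {c : Cmd} {s s₁ s' : State} {k₁ k₂ : ℕ} (h : s.reg x ≠ 0)
    (h₁ : Run S W c s s₁ k₁) (h₂ : Run S W (.while x c) s₁ s' k₂) :
    Run S W (.while x c) s s' (k₁ + k₂ + 1) := by
  intro t rest
  have : t + (k₁ + k₂ + 1) = (t + k₂ + k₁) + 1 := by ring
  rw [this, exec, if_pos h, h₁, h₂]

end Run

@[simp] theorem State.setReg_reg (s : State) (x a y : ℕ) :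
    (s.setReg x a).reg y = if y = x then a else s.reg y := by
  simp [State.setReg, Function.update_apply]

@[simp] theorem State.setReg_mem (s : State) (x a : ℕ) : (s.setReg x a).mem = s.mem := rfl

@[simp] theorem State.setMem_reg (s : State) (x a : ℕ) : (s.setMem x a).reg = s.reg := rfl

@[simp] theorem State.setMem_mem (s : State) (x a y : ℕ) :
    (s.setMem x a).mem y = if y = x then a else s.mem y := by
  simp [State.setMem, Function.update_apply]

/-- The machine state `s` represents the variables and arrays of `h`. -/
structure Sim (l : Lim) (s : State) (h : HS) : Prop where
  var : ∀ x < 50, s.reg x = h.v x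
  regD : s.reg 50 = l.D
  regZ : s.reg 51 = 0
  arr0 : ∀ i < l.D, s.mem i = h.a 0 i
  arr : ∀ k i, 0 < k → k < 16 → s.mem (l.D + 16 * i + k) = h.a k i
  regW : ∀ x, s.reg x ≤ l.W
  memW : ∀ i, s.mem i ≤ l.W

/-- The bounds fit into the machine with `S` cells and words up to `l.W`. -/
def Lim.Fits (l : Lim) (S : ℕ) : Prop :=
  l.D + 16 * l.Z ≤ S ∧ l.D + 16 * l.Z ≤ l.W ∧ 16 ≤ l.W ∧ l.D ≤ S

variable {l : Lim} {S : ℕ}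

theorem Sim.setTemp {s : State} {h : HS} (hs : Sim l s h) {x a : ℕ} (hx : 52 ≤ x)
    (ha : a ≤ l.W) : Sim l (s.setReg x a) h where
  var y hy := by
    rw [State.setReg_reg, if_neg (by omega)]
    exact hs.var y hy
  regD := by
    rw [State.setReg_reg, if_neg (by omega)]
    exact hs.regD
  regZ := by
    rw [State.setReg_reg, if_neg (by omega)]
    exact hs.regZ
  arr0 := hs.arr0
  arr := hs.arr
  regW y := by
    rw [State.setReg_reg]
    split_ifs
    · exact ha
    · exact hs.regW y
  memW := hs.memW

theorem Sim.setVar {s : State} {h : HS} (hs : Sim l s h) {x a : ℕ} (hx : x < 50)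
    (ha : a ≤ l.W) : Sim l (s.setReg x a) (h.set x a) where
  var y hy := by
    rw [State.setReg_reg, HS.set_v, hs.var y hy]
  regD := by
    rw [State.setReg_reg, if_neg (by omega)]
    exact hs.regD
  regZ := by
    rw [State.setReg_reg, if_neg (by omega)]
    exact hs.regZ
  arr0 := hs.arr0
  arr := hs.arr
  regW y := by
    rw [State.setReg_reg]
    split_ifs
    · exact ha
    · exact hs.regW y
  memW := hs.memW

theorem Sim.put_zero {s : State} {h : HS} (hs : Sim l s h) {i a : ℕ} (hi : i < l.D)
    (ha : a ≤ l.W) : Sim l (s.setMem i a) (h.put 0 i a) where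
  var := hs.var
  regD := hs.regD
  regZ := hs.regZ
  arr0 j hj := by
    rw [State.setMem_mem, HS.put_a_same, Function.update_apply, hs.arr0 j hj]
  arr k j hk hk' := by
    rw [State.setMem_mem, if_neg (by omega), HS.put_a_ne _ _ _ _ _ (by omega), hs.arr k j hk hk']
  regW := hs.regW
  memW j := by
    rw [State.setMem_mem]
    split_ifs
    · exact ha
    · exact hs.memW j

theorem Sim.put_pos {s : State} {h : HS} (hs : Sim l s h) {k i a : ℕ} (hk : 0 < k)
    (hk' : k < 16) (ha : a ≤ l.W) : Sim l (s.setMem (l.D + 16 * i + k) a) (h.put k i a) where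
  var := hs.var
  regD := hs.regD
  regZ := hs.regZ
  arr0 j hj := by
    rw [State.setMem_mem, if_neg (by omega), HS.put_a_ne _ _ _ _ _ (by omega), hs.arr0 j hj]
  arr k₂ j hk₂ hk₂' := by
    rw [State.setMem_mem, HS.put_a, hs.arr k₂ j hk₂ hk₂']
    by_cases h1 : k₂ = k
    · subst h1
      by_cases h2 : j = i
      · simp [h2]
      · rw [if_neg (by omega), if_pos rfl, Function.update_of_ne h2]
    · rw [if_neg (by omega), if_neg h1]
  regW := hs.regW
  memW j := by
    rw [State.setMem_mem]
    split_ifs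
    · exact ha
    · exact hs.memW j

theorem eval_le {e : Exp} {h : HS} {s : State} (hs : Sim l s h) (he : e.ok l h) : e.eval h ≤ l.W := by
  cases e with
  | v x =>
    simp only [Exp.eval]
    rw [← hs.var x he]
    exact hs.regW x
  | c k => exact he
  | bin o a b => exact he.2.2
  | get k i =>
    obtain ⟨hk, _, hi⟩ := he
    rcases Nat.eq_zero_or_pos k with rfl | hk0
    · have := hs.arr0 _ hi
      simp only [Exp.eval]
      rw [← this]
      exact hs.memW _
    · have := hs.arr k (i.eval h) hk0 hk
      simp only [Exp.eval]
      rw [← this]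
      exact hs.memW _

/-- The effect of a command that only computes a value into register `60 + d`. -/
def Computes (l : Lim) (S : ℕ) (c : Cmd) (d : ℕ) (s : State) (h : HS) (val k : ℕ) : Prop :=
  ∃ s', Run S l.W c s s' k ∧ Sim l s' h ∧ s'.reg (60 + d) = val ∧
    ∀ d' < d, s'.reg (60 + d') = s.reg (60 + d')

theorem computes_addr (hf : l.Fits S) {d : ℕ} {s : State} {h : HS} {val k j : ℕ} {c : Cmd}
    (hc : Computes l S c d s h val k) (hj : j + 1 < 16) (hv : val < l.Z) :
    Computes l S (.seq c (.seq (.const 52 16) (.seq (.op .mul (60 + d) (60 + d) 52)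
        (.seq (.op .add (60 + d) (60 + d) 50) (.seq (.const 52 (j + 1))
          (.op .add (60 + d) (60 + d) 52)))))) d s h (l.D + 16 * val + (j + 1)) (k + 10) := by
  obtain ⟨s₁, r₁, m₁, v₁, f₁⟩ := hc
  obtain ⟨hf1, hf2, hf3, -⟩ := hf
  have m₂ := m₁.setTemp (x := 52) (a := 16) le_rfl hf3
  have r₂ : Run S l.W (.const 52 16) s₁ _ 1 := Run.const s₁ hf3
  set s₂ := s₁.setReg 52 16 with hs₂
  have e₃ : Op.mul.eval (s₂.reg (60 + d)) (s₂.reg 52) = val * 16 := by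
    simp only [hs₂, Op.eval, State.setReg_reg]
    rw [if_neg (by omega), v₁]
    simp
  have r₃ : Run S l.W (.op .mul (60 + d) (60 + d) 52) s₂ _ 1 := Run.op s₂ (by rw [e₃]; omega)
  rw [e₃] at r₃
  have m₃ := m₂.setTemp (x := 60 + d) (a := val * 16) (by omega) (by omega)
  set s₃ := s₂.setReg (60 + d) (val * 16) with hs₃
  have e₄ : Op.add.eval (s₃.reg (60 + d)) (s₃.reg 50) = val * 16 + l.D := by
    simp only [Op.eval, m₃.regD]
    simp [hs₃]
  have r₄ : Run S l.W (.op .add (60 + d) (60 + d) 50) s₃ _ 1 := Run.op s₃ (by rw [e₄]; omega)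
  rw [e₄] at r₄
  have m₄ := m₃.setTemp (x := 60 + d) (a := val * 16 + l.D) (by omega) (by omega)
  set s₄ := s₃.setReg (60 + d) (val * 16 + l.D) with hs₄
  have r₅ : Run S l.W (.const 52 (j + 1)) s₄ _ 1 := Run.const s₄ (by omega)
  have m₅ := m₄.setTemp (x := 52) (a := j + 1) le_rfl (by omega)
  set s₅ := s₄.setReg 52 (j + 1) with hs₅
  have e₆ : Op.add.eval (s₅.reg (60 + d)) (s₅.reg 52) = l.D + 16 * val + (j + 1) := by
    simp only [Op.eval, hs₅, hs₄, State.setReg_reg]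
    rw [if_neg (by omega)]
    simp
    ring
  have r₆ : Run S l.W (.op .add (60 + d) (60 + d) 52) s₅ _ 1 := Run.op s₅ (by rw [e₆]; omega)
  rw [e₆] at r₆
  have m₆ := m₅.setTemp (x := 60 + d) (a := l.D + 16 * val + (j + 1)) (by omega) (by omega)
  refine ⟨_, (r₁.seq (r₂.seq (r₃.seq (r₄.seq (r₅.seq r₆))))), m₆, by simp, ?_⟩
  intro d' hd'
  rw [← f₁ d' hd']
  simp only [hs₅, hs₄, hs₃, hs₂, State.setReg_reg]
  rw [if_neg (by omega), if_neg (by omega), if_neg (by omega), if_neg (by omega),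
    if_neg (by omega)]

theorem computes_cadr (hf : l.Fits S) {d : ℕ} {s : State} {h : HS} {val n k : ℕ} {c : Cmd}
    (hc : Computes l S c d s h val n) (hk : k < 16) (hv : val < l.bd k) :
    Computes l S (cadr c d k) d s h (if k = 0 then val else l.D + 16 * val + k)
      (n + adrCost k) := by
  cases k with
  | zero => simpa [cadr, adrCost] using hc
  | succ j =>
    rw [if_neg (by omega)]
    exact computes_addr hf hc hk (by simpa [Lim.bd] using hv)

theorem adr_lt (hf : l.Fits S) {k val : ℕ} (hk : k < 16) (hv : val < l.bd k) :
    (if k = 0 then val else l.D + 16 * val + k) < S := by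
  obtain ⟨hf1, hf2, hf3, hf4⟩ := hf
  split_ifs with h
  · subst h
    rw [Lim.bd_zero] at hv
    omega
  · rw [Lim.bd_pos _ _ h] at hv
    omega

theorem Sim.mem_adr {s : State} {h : HS} (hs : Sim l s h) {k i : ℕ} (hk : k < 16)
    (hi : i < l.bd k) : s.mem (if k = 0 then i else l.D + 16 * i + k) = h.a k i := by
  split_ifs with h0
  · subst h0
    exact hs.arr0 i hi
  · exact hs.arr k i (by omega) hk

theorem Sim.put_adr {s : State} {h : HS} (hs : Sim l s h) {k i a : ℕ} (hk : k < 16)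
    (hi : i < l.bd k) (ha : a ≤ l.W) :
    Sim l (s.setMem (if k = 0 then i else l.D + 16 * i + k) a) (h.put k i a) := by
  split_ifs with h0
  · subst h0
    exact hs.put_zero hi ha
  · exact hs.put_pos (by omega) hk ha

theorem computes_cexp (hf : l.Fits S) {h : HS} :
    ∀ (e : Exp) (d : ℕ) (s : State), Sim l s h → e.ok l h →
      Computes l S (cexp d e) d s h (e.eval h) e.cost := by
  intro e
  induction e with
  | v x =>
    intro d s hs he
    have hx : s.reg x + s.reg 51 = h.v x := by rw [hs.regZ, hs.var x he, add_zero]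
    have hw : h.v x ≤ l.W := by rw [← hs.var x he]; exact hs.regW x
    have r : Run S l.W (.op .add (60 + d) x 51) s _ 1 :=
      Run.op s (by simp only [Op.eval]; rw [hx]; exact hw)
    refine ⟨_, r, ?_, ?_, ?_⟩
    · simp only [Op.eval, hx]
      exact hs.setTemp (by omega) hw
    · simp [Op.eval, hx, Exp.eval]
    · intro d' hd'
      rw [State.setReg_reg, if_neg (by omega)]
  | c k =>
    intro d s hs he
    refine ⟨_, Run.const s he, hs.setTemp (by omega) he, by simp [Exp.eval], ?_⟩
    intro d' hd'
    rw [State.setReg_reg, if_neg (by omega)]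
  | bin o a b iha ihb =>
    intro d s hs he
    obtain ⟨s₁, r₁, m₁, v₁, f₁⟩ := iha d s hs he.1
    obtain ⟨s₂, r₂, m₂, v₂, f₂⟩ := ihb (d + 1) s₁ m₁ he.2.1
    have hv : o.eval (s₂.reg (60 + d)) (s₂.reg (61 + d)) = o.eval (a.eval h) (b.eval h) := by
      rw [f₂ d (by omega), v₁]
      have : 61 + d = 60 + (d + 1) := by ring
      rw [this, v₂]
    have r₃ : Run S l.W (.op o (60 + d) (60 + d) (61 + d)) s₂ _ 1 :=
      Run.op s₂ (by rw [hv]; exact he.2.2)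
    have r := r₁.seq (r₂.seq r₃)
    have hcost : a.cost + (b.cost + 1 + 1) + 1 = (Exp.bin o a b).cost := by
      simp only [Exp.cost]; ring
    rw [hcost] at r
    refine ⟨_, r, ?_, ?_, ?_⟩
    · rw [hv]
      exact m₂.setTemp (by omega) he.2.2
    · rw [hv]
      simp [Exp.eval]
    · intro d' hd'
      rw [State.setReg_reg, if_neg (by omega), f₂ d' (by omega), f₁ d' hd']
  | get k i ih =>
    intro d s hs he
    obtain ⟨hk, hi, hb⟩ := he
    obtain ⟨s₁, r₁, m₁, v₁, f₁⟩ := computes_cadr hf (ih d s hs hi) hk hb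
    have r₂ : Run S l.W (.load (60 + d) (60 + d)) s₁ _ 1 :=
      Run.load s₁ (by rw [v₁]; exact adr_lt hf hk hb)
    rw [v₁, m₁.mem_adr hk hb] at r₂
    refine ⟨_, r₁.seq r₂, m₁.setTemp (by omega) ?_, ?_, ?_⟩
    · rw [← m₁.mem_adr hk hb]
      exact m₁.memW _
    · simp [Exp.eval]
    · intro d' hd'
      rw [State.setReg_reg, if_neg (by omega), f₁ d' hd']

/-! ### Weakest preconditions -/

/-- `wpLoop e body n h Q`: the loop with test `e` ends after fewer than `n` rounds and satisfies
`Q`, which also receives the running time. -/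
def wpLoop (l : Lim) (e : Exp) (body : HS → (HS → ℕ → Prop) → Prop) :
    ℕ → HS → (HS → ℕ → Prop) → Prop
  | 0, _, _ => False
  | n + 1, h, Q => e.ok l h ∧ ((e.eval h = 0 → Q h (e.cost + 2)) ∧
      (e.eval h ≠ 0 → body h fun h₁ k₁ =>
        wpLoop l e body n h₁ fun h₂ k₂ => Q h₂ (k₁ + k₂ + e.cost + 2)))

/-- The program runs from `h` without violating the bounds, and the final state and the running
time satisfy `Q`. -/
def wp (l : Lim) : HC → HS → (HS → ℕ → Prop) → Prop
  | .skip, h, Q => Q h 1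
  | .asg x e, h, Q => x < 50 ∧ e.ok l h ∧ Q (h.set x (e.eval h)) (e.cost + 2)
  | .put k i e, h, Q => k < 16 ∧ i.ok l h ∧ i.eval h < l.bd k ∧ e.ok l h ∧
      Q (h.put k (i.eval h) (e.eval h)) (i.cost + e.cost + adrCost k + 3)
  | .seq c d, h, Q => wp l c h fun h₁ k₁ => wp l d h₁ fun h₂ k₂ => Q h₂ (k₁ + k₂ + 1)
  | .ite e c d, h, Q => e.ok l h ∧
      (e.eval h ≠ 0 → wp l c h fun h₁ k₁ => Q h₁ (k₁ + e.cost + 2)) ∧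
      (e.eval h = 0 → wp l d h fun h₁ k₁ => Q h₁ (k₁ + e.cost + 2))
  | .loop e c, h, Q => ∃ n, wpLoop l e (wp l c) n h Q

theorem wpLoop_mono {e : Exp} {body body' : HS → (HS → ℕ → Prop) → Prop}
    (hb : ∀ h (Q Q' : HS → ℕ → Prop), (∀ h' k, Q h' k → Q' h' k) → body h Q → body' h Q') :
    ∀ (n : ℕ) (h : HS) (Q Q' : HS → ℕ → Prop), (∀ h' k, Q h' k → Q' h' k) →
      wpLoop l e body n h Q → wpLoop l e body' n h Q' := by
  intro n
  induction n with
  | zero => intro h Q Q' _ h1; exact h1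
  | succ n ih =>
    intro h Q Q' hQ h1
    refine ⟨h1.1, fun h0 => hQ _ _ (h1.2.1 h0), fun h0 => hb _ _ _ ?_ (h1.2.2 h0)⟩
    intro h' k hk
    exact ih _ _ _ (fun h'' k' => hQ _ _) hk

theorem wp.mono {c : HC} {h : HS} {Q Q' : HS → ℕ → Prop} (h1 : wp l c h Q)
    (hQ : ∀ h' k, Q h' k → Q' h' k) : wp l c h Q' := by
  induction c generalizing h Q Q' with
  | skip => exact hQ _ _ h1
  | asg x e => exact ⟨h1.1, h1.2.1, hQ _ _ h1.2.2⟩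
  | put k i e => exact ⟨h1.1, h1.2.1, h1.2.2.1, h1.2.2.2.1, hQ _ _ h1.2.2.2.2⟩
  | seq c d ihc ihd => exact ihc h1 fun h' k hk => ihd hk fun h'' k' => hQ _ _
  | ite e c d ihc ihd =>
    exact ⟨h1.1, fun h0 => ihc (h1.2.1 h0) fun _ _ => hQ _ _,
      fun h0 => ihd (h1.2.2 h0) fun _ _ => hQ _ _⟩
  | loop e c ih =>
    obtain ⟨n, hn⟩ := h1
    exact ⟨n, wpLoop_mono (body' := wp l c) (fun h Q Q' hQ hc => ih hc hQ) n h Q Q' hQ hn⟩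

/-- The compiled program runs as predicted by the weakest precondition. -/
theorem wp_run (hf : l.Fits S) {c : HC} {h : HS} {Q : HS → ℕ → Prop} (h1 : wp l c h Q)
    {s : State} (hs : Sim l s h) :
    ∃ s' h' k, Run S l.W (ccmd c) s s' k ∧ Sim l s' h' ∧ Q h' k := by
  induction c generalizing h Q s with
  | skip => exact ⟨s, h, 1, Run.skip s, hs, h1⟩
  | asg x e =>
    obtain ⟨hx, he, hQ⟩ := h1
    obtain ⟨s₁, r₁, m₁, v₁, -⟩ := computes_cexp hf e 0 s hs he
    have hw := eval_le hs he
    have hv : s₁.reg 60 + s₁.reg 51 = e.eval h := by rw [m₁.regZ, add_zero]; exact v₁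
    have r₂ : Run S l.W (.op .add x 60 51) s₁ _ 1 :=
      Run.op s₁ (by simp only [Op.eval]; rw [hv]; exact hw)
    refine ⟨_, _, _, r₁.seq r₂, ?_, hQ⟩
    simp only [Op.eval]
    rw [hv]
    exact m₁.setVar hx hw
  | put k i e =>
    obtain ⟨hk, hi, hb, he, hQ⟩ := h1
    obtain ⟨s₁, r₁, m₁, v₁, -⟩ := computes_cadr hf (computes_cexp hf i 0 s hs hi) hk hb
    obtain ⟨s₂, r₂, m₂, v₂, f₂⟩ := computes_cexp hf e 1 s₁ m₁ he
    have v₁' : s₂.reg 60 = _ := (f₂ 0 (by omega)).trans v₁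
    have v₂' : s₂.reg 61 = e.eval h := v₂
    have r₃ : Run S l.W (.store 60 61) s₂ _ 1 :=
      Run.store s₂ (by rw [v₁']; exact adr_lt hf hk hb)
    rw [v₁', v₂'] at r₃
    refine ⟨_, _, _, r₁.seq (r₂.seq r₃), m₂.put_adr hk hb (eval_le hs he), ?_⟩
    convert hQ using 1
    ring
  | seq c d ihc ihd =>
    obtain ⟨s₁, h₁, k₁, r₁, m₁, q₁⟩ := ihc h1 hs
    obtain ⟨s₂, h₂, k₂, r₂, m₂, q₂⟩ := ihd q₁ m₁
    exact ⟨s₂, h₂, _, r₁.seq r₂, m₂, q₂⟩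
  | ite e c d ihc ihd =>
    obtain ⟨he, hc, hd⟩ := h1
    obtain ⟨s₁, r₁, m₁, v₁, -⟩ := computes_cexp hf e 0 s hs he
    have v₁' : s₁.reg 60 = e.eval h := v₁
    by_cases h0 : e.eval h = 0
    · obtain ⟨s₂, h₂, k₂, r₂, m₂, q₂⟩ := ihd (hd h0) m₁
      refine ⟨s₂, h₂, _, r₁.seq (Run.ite_false (v₁'.trans h0) r₂), m₂, ?_⟩
      convert q₂ using 1
      ring
    · obtain ⟨s₂, h₂, k₂, r₂, m₂, q₂⟩ := ihc (hc h0) m₁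
      refine ⟨s₂, h₂, _, r₁.seq (Run.ite_true (by rw [v₁']; exact h0) r₂), m₂, ?_⟩
      convert q₂ using 1
      ring
  | loop e c ih =>
    obtain ⟨n, hn⟩ := h1
    have key : ∀ (n : ℕ) (h : HS) (Q : HS → ℕ → Prop), wpLoop l e (wp l c) n h Q →
        ∀ s, Sim l s h → ∃ s' h' k, (∃ s₁ k₁, Run S l.W (cexp 0 e) s s₁ e.cost ∧
          Run S l.W (.while 60 (.seq (ccmd c) (cexp 0 e))) s₁ s' k₁ ∧ e.cost + k₁ + 1 = k) ∧
          Sim l s' h' ∧ Q h' k := by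
      intro n
      induction n with
      | zero => intro h Q h1; exact h1.elim
      | succ n ihn =>
        intro h Q h1 s hs
        obtain ⟨he, hz, hnz⟩ := h1
        obtain ⟨s₁, r₁, m₁, v₁, -⟩ := computes_cexp hf e 0 s hs he
        have v₁' : s₁.reg 60 = e.eval h := v₁
        by_cases h0 : e.eval h = 0
        · exact ⟨s₁, h, _, ⟨s₁, 1, r₁, Run.while_false (v₁'.trans h0), rfl⟩, m₁, hz h0⟩
        · obtain ⟨s₂, h₂, k₂, r₂, m₂, q₂⟩ := ih (hnz h0) m₁
          obtain ⟨s₃, h₃, k₃, ⟨s₄, k₄, r₄, r₅, hk⟩, m₃, q₃⟩ := ihn _ _ q₂ s₂ m₂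
          refine ⟨s₃, h₃, _, ⟨s₁, _, r₁,
            Run.while_true (by rw [v₁']; exact h0) (r₂.seq r₄) r₅, rfl⟩, m₃, ?_⟩
          convert q₃ using 1
          omega
    obtain ⟨s', h', k, ⟨s₁, k₁, r₁, r₂, rfl⟩, m, q⟩ := key n h Q hn s hs
    exact ⟨s', h', _, r₁.seq r₂, m, q⟩

/-! ### Frames -/

/-- The variables a program may write. -/
def HC.wv : HC → List ℕ
  | .skip => []
  | .asg x _ => [x]
  | .put _ _ _ => []
  | .seq c d => c.wv ++ d.wv
  | .ite _ c d => c.wv ++ d.wv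
  | .loop _ c => c.wv

/-- The arrays a program may write. -/
def HC.wa : HC → List ℕ
  | .skip => []
  | .asg _ _ => []
  | .put k _ _ => [k]
  | .seq c d => c.wa ++ d.wa
  | .ite _ c d => c.wa ++ d.wa
  | .loop _ c => c.wa

/-- The two states agree outside of what `c` may write. -/
structure Fr (c : HC) (h h' : HS) : Prop where
  v : ∀ x, x ∉ c.wv → h'.v x = h.v x
  a : ∀ k, k ∉ c.wa → h'.a k = h.a k

theorem Fr.refl (c : HC) (h : HS) : Fr c h h := ⟨fun _ _ => rfl, fun _ _ => rfl⟩

theorem Fr.trans {c : HC} {h₁ h₂ h₃ : HS} (h12 : Fr c h₁ h₂) (h23 : Fr c h₂ h₃) : Fr c h₁ h₃ :=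
  ⟨fun x hx => (h23.v x hx).trans (h12.v x hx), fun x hx => (h23.a x hx).trans (h12.a x hx)⟩

theorem Fr.sub {c d : HC} {h h' : HS} (hf : Fr c h h') (hv : ∀ x ∈ c.wv, x ∈ d.wv)
    (ha : ∀ x ∈ c.wa, x ∈ d.wa) : Fr d h h' :=
  ⟨fun x hx => hf.v x fun h => hx (hv x h), fun x hx => hf.a x fun h => hx (ha x h)⟩

theorem wp_frame_aux {c : HC} {h : HS} {Q : HS → ℕ → Prop} (h1 : wp l c h Q) :
    wp l c h fun h' k => Q h' k ∧ Fr c h h' := by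
  induction c generalizing h Q with
  | skip => exact ⟨h1, Fr.refl _ _⟩
  | asg x e =>
    refine ⟨h1.1, h1.2.1, h1.2.2, ⟨fun y hy => ?_, fun _ _ => rfl⟩⟩
    simp only [HC.wv, List.mem_singleton] at hy
    simp [hy]
  | put k i e =>
    refine ⟨h1.1, h1.2.1, h1.2.2.1, h1.2.2.2.1, h1.2.2.2.2, ⟨fun _ _ => rfl, fun y hy => ?_⟩⟩
    simp only [HC.wa, List.mem_singleton] at hy
    exact HS.put_a_ne _ _ _ _ _ hy
  | seq c d ihc ihd =>
    refine (ihc h1).mono fun h₁ k₁ ⟨q₁, f₁⟩ => (ihd q₁).mono fun h₂ k₂ ⟨q₂, f₂⟩ => ⟨q₂, ?_⟩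
    exact (f₁.sub (by simp +contextual [HC.wv]) (by simp +contextual [HC.wa])).trans
      (f₂.sub (by simp +contextual [HC.wv]) (by simp +contextual [HC.wa]))
  | ite e c d ihc ihd =>
    refine ⟨h1.1, fun h0 => (ihc (h1.2.1 h0)).mono fun h₁ k₁ ⟨q₁, f₁⟩ => ⟨q₁, ?_⟩,
      fun h0 => (ihd (h1.2.2 h0)).mono fun h₁ k₁ ⟨q₁, f₁⟩ => ⟨q₁, ?_⟩⟩
    · exact f₁.sub (by simp +contextual [HC.wv]) (by simp +contextual [HC.wa])
    · exact f₁.sub (by simp +contextual [HC.wv]) (by simp +contextual [HC.wa])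
  | loop e c ih =>
    obtain ⟨n, hn⟩ := h1
    refine ⟨n, ?_⟩
    induction n generalizing h Q with
    | zero => exact hn
    | succ n ihn =>
      refine ⟨hn.1, fun h0 => ⟨hn.2.1 h0, Fr.refl _ _⟩, fun h0 => ?_⟩
      refine (ih (hn.2.2 h0)).mono fun h₁ k₁ ⟨q₁, f₁⟩ => ?_
      refine wpLoop_mono (fun h Q Q' hQ hc => hc.mono hQ) n _ _ _ ?_ (ihn q₁)
      intro h₂ k₂ ⟨q₂, f₂⟩
      exact ⟨q₂, Fr.trans (c := .loop e c) (f₁.sub (fun _ hx => hx) fun _ hx => hx) f₂⟩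

/-- Use a specification of `c` together with the frame of `c`. -/
theorem wp.frame {c : HC} {h : HS} {Q Q' : HS → ℕ → Prop} (h1 : wp l c h Q)
    (hQ : ∀ h' k, Q h' k → Fr c h h' → Q' h' k) : wp l c h Q' :=
  (wp_frame_aux h1).mono fun h' k ⟨q, f⟩ => hQ h' k q f

/-! ### Rules -/

theorem wp_seq {c d : HC} {h : HS} {Q : HS → ℕ → Prop} :
    wp l (c ;; d) h Q ↔ wp l c h fun h₁ k₁ => wp l d h₁ fun h₂ k₂ => Q h₂ (k₁ + k₂ + 1) :=
  Iff.rfl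

theorem wp_asg {x : ℕ} {e : Exp} {h : HS} {Q : HS → ℕ → Prop} :
    wp l (.asg x e) h Q ↔ x < 50 ∧ e.ok l h ∧ Q (h.set x (e.eval h)) (e.cost + 2) :=
  Iff.rfl

theorem wp_put {k : ℕ} {i e : Exp} {h : HS} {Q : HS → ℕ → Prop} :
    wp l (.put k i e) h Q ↔ k < 16 ∧ i.ok l h ∧ i.eval h < l.bd k ∧ e.ok l h ∧
      Q (h.put k (i.eval h) (e.eval h)) (i.cost + e.cost + adrCost k + 3) :=
  Iff.rfl

theorem wp_ite {e : Exp} {c d : HC} {h : HS} {Q : HS → ℕ → Prop} :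
    wp l (.ite e c d) h Q ↔ e.ok l h ∧
      (e.eval h ≠ 0 → wp l c h fun h₁ k₁ => Q h₁ (k₁ + e.cost + 2)) ∧
      (e.eval h = 0 → wp l d h fun h₁ k₁ => Q h₁ (k₁ + e.cost + 2)) :=
  Iff.rfl

theorem wp_skip {h : HS} {Q : HS → ℕ → Prop} : wp l .skip h Q ↔ Q h 1 := Iff.rfl

/-- Loop rule: `I m` holds in a state with at most `m` rounds to go, and the remaining rounds
take time at most `R m`. -/
theorem wp_loop_rank {e : Exp} {c : HC} {h : HS} {I : ℕ → HS → Prop} {R : ℕ → ℕ} {m : ℕ}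
    (h0 : I m h)
    (hI : ∀ m h', I m h' → Fr c h h' → e.ok l h' ∧ (e.eval h' ≠ 0 →
      ∃ m', m = m' + 1 ∧ wp l c h' fun h'' k => k + e.cost + 2 + R m' ≤ R m ∧ I m' h'')) :
    wp l (.loop e c) h fun h' k =>
      k ≤ R m + e.cost + 2 ∧ Fr c h h' ∧ ∃ m', I m' h' ∧ e.eval h' = 0 := by
  have key : ∀ (m : ℕ) (h' : HS), I m h' → Fr c h h' → wpLoop l e (wp l c) (m + 1) h'
      fun h'' k => k ≤ R m + e.cost + 2 ∧ Fr c h h'' ∧ ∃ m', I m' h'' ∧ e.eval h'' = 0 := by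
    intro m
    induction m with
    | zero =>
      intro h' hI' hF
      obtain ⟨ho, hn⟩ := hI 0 h' hI' hF
      refine ⟨ho, fun hz => ⟨by omega, hF, 0, hI', hz⟩, fun hz => ?_⟩
      obtain ⟨m', hm, -⟩ := hn hz
      omega
    | succ m ih =>
      intro h' hI' hF
      obtain ⟨ho, hn⟩ := hI (m + 1) h' hI' hF
      refine ⟨ho, fun hz => ⟨by omega, hF, _, hI', hz⟩, fun hz => ?_⟩
      obtain ⟨m', hm, hb⟩ := hn hz
      obtain rfl : m' = m := by omega
      refine hb.frame fun h₁ k₁ ⟨hk, hI₁⟩ hF₁ => ?_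
      refine wpLoop_mono (fun h Q Q' hQ hc => hc.mono hQ) _ _ _ _ ?_ (ih h₁ hI₁ (hF.trans hF₁))
      intro h₂ k₂ ⟨hk₂, hF₂, hex⟩
      exact ⟨by omega, hF₂, hex⟩
  exact ⟨m + 1, key m h h0 (Fr.refl _ _)⟩

theorem wp_loop {e : Exp} {c : HC} {h : HS} {I : ℕ → HS → Prop} {C m : ℕ}
    (h0 : I m h)
    (hI : ∀ m h', I m h' → Fr c h h' → e.ok l h' ∧ (e.eval h' ≠ 0 →
      ∃ m', m = m' + 1 ∧ wp l c h' fun h'' k => k ≤ C ∧ I m' h'')) :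
    wp l (.loop e c) h fun h' k =>
      k ≤ m * (C + e.cost + 2) + e.cost + 2 ∧ Fr c h h' ∧ ∃ m', I m' h' ∧ e.eval h' = 0 := by
  refine wp_loop_rank (R := fun m => m * (C + e.cost + 2)) h0 fun m h' hI' hF => ?_
  obtain ⟨ho, hn⟩ := hI m h' hI' hF
  refine ⟨ho, fun hz => ?_⟩
  obtain ⟨m', rfl, hb⟩ := hn hz
  refine ⟨m', rfl, hb.mono fun h'' k ⟨hk, hI''⟩ => ⟨?_, hI''⟩⟩
  ring_nf
  omega

theorem Op.eval_lt_le (a b : ℕ) : Op.lt.eval a b ≤ 1 := by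
  simp only [Op.eval]
  split_ifs <;> simp

theorem Op.eval_eq_le (a b : ℕ) : Op.eq.eval a b ≤ 1 := by
  simp only [Op.eval]
  split_ifs <;> simp

/-- `for i in 0..b do c`. -/
def HC.for (i b : ℕ) (c : HC) : HC :=
  .asg i (.c 0) ;; .loop (.v i <~ .v b) (c ;; .asg i (.v i +~ .c 1))

theorem wp_for {i b : ℕ} {c : HC} {h : HS} {I : ℕ → HS → Prop} {C n : ℕ}
    (hi : i < 50) (hb : b < 50) (hib : i ≠ b) (hic : i ∉ c.wv) (hbc : b ∉ c.wv)
    (hn : h.v b = n) (hW : n < l.W)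
    (h0 : I 0 (h.set i 0))
    (hI : ∀ j h', j < n → h'.v i = j → I j h' → Fr (HC.for i b c) h h' →
      wp l c h' fun h'' k => k ≤ C ∧ I (j + 1) (h''.set i (j + 1))) :
    wp l (HC.for i b c) h fun h' k =>
      k ≤ n * (C + 15) + 12 ∧ h'.v i = n ∧ I n h' := by
  have hW1 : 1 ≤ l.W := by omega
  unfold HC.for
  rw [wp_seq, wp_asg]
  refine ⟨hi, Nat.zero_le _, ?_⟩
  have e0 : (Exp.c 0).eval h = 0 := rfl
  rw [e0]
  have hib' : b ≠ i := fun h => hib h.symm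
  have hl := wp_loop (l := l) (e := .v i <~ .v b) (c := c ;; .asg i (.v i +~ .c 1))
    (h := h.set i 0) (I := fun m h' => m + h'.v i = n ∧ I (h'.v i) h') (C := C + 8) (m := n)
    (by simpa using h0) (by
      intro m h' ⟨hm, hI'⟩ hF
      have hvb : h'.v b = n := by
        rw [hF.v b (by simp [HC.wv, hbc, hib']), HS.set_v, if_neg hib', hn]
      refine ⟨⟨hi, hb, ?_⟩, fun hz => ?_⟩
      · exact (Op.eval_lt_le _ _).trans hW1
      · have hlt : h'.v i < n := by
          simp only [Op.eval, Exp.eval, hvb] at hz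
          by_contra hc
          simp [hc] at hz
        refine ⟨m - 1, by omega, ?_⟩
        rw [wp_seq]
        have hF' : Fr (HC.for i b c) h h' := by
          refine Fr.trans (h₂ := h.set i 0) ⟨fun x hx => ?_, fun _ _ => rfl⟩
            (hF.sub (by simp +contextual [HC.wv, HC.for]) (by simp +contextual [HC.wa, HC.for]))
          simp only [HC.for, HC.wv, List.mem_append, List.mem_singleton, not_or] at hx
          simp [hx.1]
        refine (hI (h'.v i) h' hlt rfl hI' hF').frame fun h₁ k₁ ⟨hk₁, hI₁⟩ hF₁ => ?_
        have hv1 : h₁.v i = h'.v i := hF₁.v i hic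
        have he : (Exp.bin Op.add (.v i) (.c 1)).eval h₁ = h'.v i + 1 := by
          simp [Exp.eval, Op.eval, hv1]
        rw [wp_asg]
        refine ⟨hi, ⟨hi, hW1, ?_⟩, ?_, ?_, ?_⟩
        · simp only [Op.eval, Exp.eval, hv1]
          omega
        · simp only [Exp.cost]
          omega
        · rw [he]
          simp only [HS.set_v, if_true]
          omega
        · rw [he]
          simpa using hI₁)
  refine hl.mono fun h' k ⟨hk, hF, m', ⟨hm', hI'⟩, hz⟩ => ?_
  have hvb : h'.v b = n := by
    rw [hF.v b (by simp [HC.wv, hbc, hib']), HS.set_v, if_neg hib', hn]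
  have : ¬ h'.v i < n := by
    intro hc
    simp [Op.eval, Exp.eval, hvb, hc] at hz
  have hv : h'.v i = n := by omega
  refine ⟨?_, hv, hv ▸ hI'⟩
  simp only [Exp.cost] at hk ⊢
  have : n * (C + 8 + (1 + 1 + 3) + 2) = n * (C + 15) := by ring
  omega

end FlipRepair

namespace FlipRepair

/-! ### A hierarchy of groups of consecutive arcs -/

/-- The nodes of level `k`. -/
def Nd (base N : ℕ → ℕ) (k : ℕ) : Finset ℕ := Finset.Ico (base k) (base k + N k)

theorem mem_Nd {base N : ℕ → ℕ} {k G : ℕ} :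
    G ∈ Nd base N k ↔ base k ≤ G ∧ G < base k + N k := by simp [Nd]

/-- The level-`k` group of the arc `e`. -/
def anc (par : ℕ → ℕ) (k e : ℕ) : ℕ := par^[k] e

@[simp] theorem anc_zero (par : ℕ → ℕ) (e : ℕ) : anc par 0 e = e := rfl

theorem anc_succ (par : ℕ → ℕ) (k e : ℕ) : anc par (k + 1) e = par (anc par k e) :=
  Function.iterate_succ_apply' par k e

/-- Disjoint levels `0, …, K` of nodes with parents. The nodes of level zero are the arcs
`0, …, N 0 - 1`. -/
structure Lev (K : ℕ) (base N par : ℕ → ℕ) : Prop where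
  disj : ∀ k < K, base k + N k ≤ base (k + 1)
  base_zero : base 0 = 0
  par_mem : ∀ k < K, ∀ c ∈ Nd base N k, par c ∈ Nd base N (k + 1)

namespace Lev

variable {K : ℕ} {base N par : ℕ → ℕ}

theorem base_le (h : Lev K base N par) {i j : ℕ} (hij : i < j) (hj : j ≤ K) :
    base i + N i ≤ base j := by
  induction j, hij using Nat.le_induction with
  | base => exact h.disj i (by omega)
  | succ j hij ih =>
    have := ih (by omega)
    have := h.disj j (by omega)
    omega

theorem lvl_unique (h : Lev K base N par) {i j G : ℕ} (hi : i ≤ K) (hj : j ≤ K)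
    (hGi : G ∈ Nd base N i) (hGj : G ∈ Nd base N j) : i = j := by
  rw [mem_Nd] at hGi hGj
  rcases lt_trichotomy i j with hlt | heq | hlt
  · have := h.base_le hlt hj
    omega
  · exact heq
  · have := h.base_le hlt hi
    omega

theorem mem_zero (h : Lev K base N par) {e : ℕ} : e ∈ Nd base N 0 ↔ e < N 0 := by
  rw [mem_Nd, h.base_zero]
  omega

theorem anc_mem (h : Lev K base N par) {k e : ℕ} (hk : k ≤ K) (he : e < N 0) :
    anc par k e ∈ Nd base N k := by
  induction k with
  | zero => exact h.mem_zero.mpr he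
  | succ k ih =>
    rw [anc_succ]
    exact h.par_mem k (by omega) _ (ih (by omega))

end Lev

/-- Levels `0, …, K` of groups of arcs. The nodes of level zero are the arcs `0, …, N 0 - 1`, and
`nxt` maps each arc to its successor. Each group of a level is a path of arcs with the
first arc `fa`, the last arc `la` and positions `rk`; `nxt` maps each group to the one after it. -/
structure Inv (K : ℕ) (base N nxt par la fa : ℕ → ℕ) (rk : ℕ → ℕ → ℕ) : Prop where
  disj : ∀ k < K, base k + N k ≤ base (k + 1)
  base_zero : base 0 = 0
  nxt_lt : ∀ e < N 0, nxt e < N 0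
  nxt_inj : ∀ e < N 0, ∀ e' < N 0, nxt e = nxt e' → e = e'
  par_mem : ∀ k < K, ∀ c ∈ Nd base N k, par c ∈ Nd base N (k + 1)
  la_mem : ∀ k ≤ K, ∀ G ∈ Nd base N k, la G < N 0 ∧ anc par k (la G) = G
  fa_mem : ∀ k ≤ K, ∀ G ∈ Nd base N k, fa G < N 0 ∧ anc par k (fa G) = G
  la_down : ∀ k < K, ∀ e < N 0, la (anc par (k + 1) e) = e → la (anc par k e) = e
  step : ∀ k ≤ K, ∀ e < N 0, la (anc par k e) ≠ e →
    anc par k (nxt e) = anc par k e ∧ rk k (nxt e) = rk k e + 1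
  last : ∀ k ≤ K, ∀ e < N 0, la (anc par k e) = e →
    nxt (anc par k e) = anc par k (nxt e) ∧ fa (anc par k (nxt e)) = nxt e
  inj : ∀ k ≤ K, ∀ e < N 0, ∀ e' < N 0, anc par k e = anc par k e' → rk k e = rk k e' → e = e'
  fa_le : ∀ k ≤ K, ∀ e < N 0, rk k (fa (anc par k e)) ≤ rk k e

/-- `nxt` is a permutation of the arcs. -/
def ActsAs {M : ℕ} (nxt : ℕ → ℕ) (T : Equiv.Perm (Fin M)) : Prop := ∀ e : Fin M, nxt e = T e

namespace Inv

variable {K : ℕ} {base N nxt par la fa : ℕ → ℕ} {rk : ℕ → ℕ → ℕ}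

theorem lev (h : Inv K base N nxt par la fa rk) : Lev K base N par :=
  ⟨h.disj, h.base_zero, h.par_mem⟩

theorem base_le (h : Inv K base N nxt par la fa rk) {i j : ℕ} (hij : i < j) (hj : j ≤ K) :
    base i + N i ≤ base j := h.lev.base_le hij hj

theorem lvl_unique (h : Inv K base N nxt par la fa rk) {i j G : ℕ} (hi : i ≤ K) (hj : j ≤ K)
    (hGi : G ∈ Nd base N i) (hGj : G ∈ Nd base N j) : i = j := h.lev.lvl_unique hi hj hGi hGj

theorem mem_zero (h : Inv K base N nxt par la fa rk) {e : ℕ} : e ∈ Nd base N 0 ↔ e < N 0 :=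
  h.lev.mem_zero

theorem anc_mem (h : Inv K base N nxt par la fa rk) {k e : ℕ} (hk : k ≤ K) (he : e < N 0) :
    anc par k e ∈ Nd base N k := h.lev.anc_mem hk he

theorem la_arc (h : Inv K base N nxt par la fa rk) {e : ℕ} (he : e < N 0) : la e = e :=
  (h.la_mem 0 (Nat.zero_le _) e (h.mem_zero.mpr he)).2

theorem la_lt (h : Inv K base N nxt par la fa rk) {k e : ℕ} (hk : k ≤ K) (he : e < N 0) :
    la (anc par k e) < N 0 := (h.la_mem k hk _ (h.anc_mem hk he)).1

theorem anc_la (h : Inv K base N nxt par la fa rk) {k e : ℕ} (hk : k ≤ K) (he : e < N 0) :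
    anc par k (la (anc par k e)) = anc par k e := (h.la_mem k hk _ (h.anc_mem hk he)).2

theorem la_down' (h : Inv K base N nxt par la fa rk) {k k' e : ℕ} (hkk' : k ≤ k') (hk' : k' ≤ K)
    (he : e < N 0) (hl : la (anc par k' e) = e) : la (anc par k e) = e := by
  induction k', hkk' using Nat.le_induction with
  | base => exact hl
  | succ k' _ ih => exact ih (by omega) (h.la_down k' (by omega) e he hl)

/-- Induction along a group towards its last arc. -/
theorem walk (h : Inv K base N nxt par la fa rk) {k : ℕ} (hk : k ≤ K) {p : ℕ → Prop}
    (hlast : ∀ e < N 0, la (anc par k e) = e → p e)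
    (hstep : ∀ e < N 0, la (anc par k e) ≠ e → p (nxt e) → p e) : ∀ e < N 0, p e := by
  obtain ⟨R, hR⟩ : ∃ R, ∀ e < N 0, rk k e ≤ R :=
    ⟨∑ e ∈ Finset.range (N 0), rk k e, fun e he =>
      Finset.single_le_sum (f := rk k) (fun _ _ => Nat.zero_le _) (Finset.mem_range.mpr he)⟩
  have key : ∀ n, ∀ e < N 0, R - rk k e ≤ n → p e := by
    intro n
    induction n with
    | zero =>
      intro e he hn
      by_cases hl : la (anc par k e) = e
      · exact hlast e he hl
      · have := (h.step k hk e he hl).2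
        have h1 := hR _ (h.nxt_lt e he)
        omega
    | succ n ih =>
      intro e he hn
      by_cases hl : la (anc par k e) = e
      · exact hlast e he hl
      · have := (h.step k hk e he hl).2
        have h1 := hR _ (h.nxt_lt e he)
        exact hstep e he hl (ih _ (h.nxt_lt e he) (by omega))
  exact fun e he => key _ e he le_rfl

theorem rk_le_la (h : Inv K base N nxt par la fa rk) {k k' e : ℕ} (hkk' : k ≤ k') (hk' : k' ≤ K)
    (he : e < N 0) : rk k' e ≤ rk k' (la (anc par k e)) := by
  refine h.walk (p := fun e => rk k' e ≤ rk k' (la (anc par k e)))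
    (hkk'.trans hk') (fun e _ hl => by rw [hl]) (fun e he hl ih => ?_) e he
  have h1 := h.step k (hkk'.trans hk') e he hl
  have h2 := h.step k' hk' e he fun hc => hl (h.la_down' hkk' hk' he hc)
  rw [h1.1] at ih
  omega

theorem rk_lt_la (h : Inv K base N nxt par la fa rk) {k e : ℕ} (hk : k ≤ K)
    (he : e < N 0) (hl : la (anc par k e) ≠ e) : rk k e < rk k (la (anc par k e)) := by
  refine lt_of_le_of_ne (h.rk_le_la le_rfl hk he) fun hc => hl ?_
  exact h.inj k hk _ (h.la_lt hk he) _ he (h.anc_la hk he) hc.symm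

/-- A child group lies on one side of the end `e₀` of a child group. -/
theorem side (h : Inv K base N nxt par la fa rk) {k e₀ : ℕ} (hk : k < K) (he₀ : e₀ < N 0)
    (hl₀ : la (anc par k e₀) = e₀) {e : ℕ} (he : e < N 0)
    (hg : anc par (k + 1) e = anc par (k + 1) e₀) :
    rk (k + 1) e₀ < rk (k + 1) (la (anc par k e)) ↔ rk (k + 1) e₀ < rk (k + 1) e := by
  constructor
  · revert e
    have := h.walk (k := k) hk.le (p := fun e => anc par (k + 1) e = anc par (k + 1) e₀ →
      rk (k + 1) e₀ < rk (k + 1) (la (anc par k e)) → rk (k + 1) e₀ < rk (k + 1) e) ?_ ?_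
    · exact fun {e} he hg => this e he hg
    · intro e he hl hg hr
      rwa [hl] at hr
    · intro e he hl ih hg hr
      have hs := h.step k hk.le e he hl
      have hs' := h.step (k + 1) hk e he fun hc => hl (h.la_down k hk e he hc)
      rw [hs.1, hs'.1] at ih
      have h1 := ih hg hr
      have h2 : rk (k + 1) e ≠ rk (k + 1) e₀ := fun hc => hl (by
        rw [h.inj (k + 1) hk e he e₀ he₀ hg hc]
        exact hl₀)
      omega
  · intro hr
    exact hr.trans_le (h.rk_le_la (show k ≤ k + 1 by omega) hk he)

/-- The group that follows the group `anc par k e`, seen in the group one level higher. -/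
theorem next_child (h : Inv K base N nxt par la fa rk) {k : ℕ} (hk : k < K) {f : ℕ}
    (hf : f ∈ Nd base N k) (hl : la (par f) ≠ la f) :
    nxt f ∈ Nd base N k ∧ par (nxt f) = par f ∧
      rk (k + 1) (la f) < rk (k + 1) (la (nxt f)) ∧
      ∀ c ∈ Nd base N k, par c = par f → rk (k + 1) (la f) < rk (k + 1) (la c) →
        rk (k + 1) (la c) ≤ rk (k + 1) (la (nxt f)) → c = nxt f := by
  obtain ⟨hz, haz⟩ := h.la_mem k hk.le f hf
  set z := la f with hzdef
  have hlz : la (anc par k z) = z := by rw [haz]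
  obtain ⟨hn1, hn2⟩ := h.last k hk.le z hz hlz
  rw [haz] at hn1
  have hpz : anc par (k + 1) z = par f := by rw [anc_succ, haz]
  have hs := h.step (k + 1) hk z hz (by rw [hpz]; exact hl)
  have hnz := h.nxt_lt z hz
  rw [hpz] at hs
  have hnm : nxt f ∈ Nd base N k := by rw [hn1]; exact h.anc_mem hk.le hnz
  have hle := h.rk_le_la (show k ≤ k + 1 by omega) hk hnz
  rw [← hn1] at hle
  refine ⟨hnm, ?_, by omega, ?_⟩
  · rw [hn1, ← anc_succ par, hs.1]
  · intro c hc hpc hlt hle'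
    obtain ⟨hy, hay⟩ := h.la_mem k hk.le c hc
    have hpy : anc par (k + 1) (la c) = par f := by rw [anc_succ, hay, hpc]
    have hlafn := h.la_mem k hk.le _ hnm
    have := h.walk (k := k) hk.le (p := fun e => anc par k e = nxt f →
      anc par (k + 1) e = par f → rk (k + 1) e ≤ rk (k + 1) (la c) → c = nxt f) ?_ ?_ (nxt z) hnz
        hn1.symm hs.1 (by omega)
    · exact this
    · intro e he hl he1 he2 he3
      rw [he1] at hl
      rw [hl] at hle'
      have := h.inj (k + 1) hk _ hy e he (by rw [hpy, he2]) (by omega)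
      rw [← hay, this, he1]
    · intro e he hl ih he1 he2 he3
      have hs := h.step k hk.le e he hl
      have hs' := h.step (k + 1) hk e he fun hc => hl (h.la_down k hk e he hc)
      rw [hs.1, hs'.1, hs'.2] at ih
      refine ih he1 he2 (lt_of_le_of_ne he3 fun hc => hl ?_)
      rw [h.inj (k + 1) hk e he _ hy (by rw [hpy, he2]) hc, hay]

/-! ### Splitting a group -/

section split

variable {k e₀ : ℕ} {par' : ℕ → ℕ}

/-- `par'` moves the children after the arc `e₀` to the new group. -/
def SplitPar (base N par la : ℕ → ℕ) (rk : ℕ → ℕ → ℕ) (k e₀ : ℕ) (par' : ℕ → ℕ) : Prop :=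
  ∀ c, par' c = if c ∈ Nd base N k ∧ par c = anc par (k + 1) e₀ ∧
      rk (k + 1) e₀ < rk (k + 1) (la c) then base (k + 1) + N (k + 1)
    else if c = base (k + 1) + N (k + 1) then par (anc par (k + 1) e₀) else par c

theorem new_not_mem (h : Inv K base N nxt par la fa rk) (hk : k < K)
    (hroom : k + 1 < K → base (k + 1) + N (k + 1) < base (k + 2)) {i : ℕ} (hi : i ≤ K) :
    base (k + 1) + N (k + 1) ∉ Nd base N i := by
  rw [mem_Nd]
  rcases Nat.lt_or_ge (k + 1) i with hlt | hge
  · have h1 := hroom (by omega)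
    rcases Nat.lt_or_ge (k + 2) i with h2 | h2
    · have := h.base_le h2 hi
      omega
    · obtain rfl : i = k + 2 := by omega
      omega
  · rcases Nat.lt_or_ge i (k + 1) with h2 | h2
    · have := h.base_le h2 hk
      omega
    · obtain rfl : i = k + 1 := by omega
      omega

theorem split_anc_le (h : Inv K base N nxt par la fa rk) (hk : k < K)
    (hroom : k + 1 < K → base (k + 1) + N (k + 1) < base (k + 2))
    (hp : SplitPar base N par la rk k e₀ par') {i e : ℕ} (hi : i ≤ k) (he : e < N 0) :
    anc par' i e = anc par i e := by
  induction i with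
  | zero => rfl
  | succ i ih =>
    have hm := h.anc_mem (k := i) (by omega) he
    rw [anc_succ, anc_succ, ih (by omega), hp, if_neg, if_neg]
    · rintro hc
      exact h.new_not_mem hk hroom (i := i) (by omega) (hc ▸ hm)
    · rintro ⟨hc, -⟩
      have := h.lvl_unique (i := i) (j := k) (by omega) (by omega) hm hc
      omega

theorem split_anc_eq (h : Inv K base N nxt par la fa rk) (hk : k < K)
    (hroom : k + 1 < K → base (k + 1) + N (k + 1) < base (k + 2))
    (he₀ : e₀ < N 0) (hl₀ : la (anc par k e₀) = e₀)
    (hp : SplitPar base N par la rk k e₀ par') {e : ℕ} (he : e < N 0) :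
    anc par' (k + 1) e = if anc par (k + 1) e = anc par (k + 1) e₀ ∧ rk (k + 1) e₀ < rk (k + 1) e
      then base (k + 1) + N (k + 1) else anc par (k + 1) e := by
  have hm := h.anc_mem (k := k) (by omega) he
  rw [anc_succ par', h.split_anc_le hk hroom hp le_rfl he, hp, ← anc_succ par]
  by_cases hg : anc par (k + 1) e = anc par (k + 1) e₀
  · simp only [h.side hk he₀ hl₀ he hg, hm, hg, true_and]
    refine if_congr Iff.rfl rfl (if_neg ?_)
    rintro hc
    exact h.new_not_mem hk hroom (i := k) (by omega) (hc ▸ hm)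
  · simp only [hg, false_and, and_false, if_false]
    refine if_neg ?_
    rintro hc
    exact h.new_not_mem hk hroom (i := k) (by omega) (hc ▸ hm)

theorem split_anc_gt (h : Inv K base N nxt par la fa rk) (hk : k < K)
    (hroom : k + 1 < K → base (k + 1) + N (k + 1) < base (k + 2))
    (he₀ : e₀ < N 0) (hl₀ : la (anc par k e₀) = e₀)
    (hp : SplitPar base N par la rk k e₀ par') {i e : ℕ} (hi : k + 1 < i) (hiK : i ≤ K)
    (he : e < N 0) : anc par' i e = anc par i e := by
  induction i, hi using Nat.le_induction with
  | base =>
    have hm := h.anc_mem (k := k + 1) (by omega) he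
    rw [anc_succ par', h.split_anc_eq hk hroom he₀ hl₀ hp he, hp, anc_succ par (k + 1)]
    by_cases h1 : anc par (k + 1) e = anc par (k + 1) e₀ ∧ rk (k + 1) e₀ < rk (k + 1) e
    · simp only [if_pos h1]
      rw [if_neg fun hc => h.new_not_mem hk hroom (i := k) (by omega) hc.1, if_true, h1.1]
    · simp only [if_neg h1]
      rw [if_neg, if_neg]
      · exact fun hc => h.new_not_mem hk hroom (i := k + 1) (by omega) (hc ▸ hm)
      · intro hc
        have := h.lvl_unique (i := k + 1) (j := k) (by omega) (by omega) hm hc.1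
        omega
  | succ i hi ih =>
    have hm := h.anc_mem (k := i) (by omega) he
    rw [anc_succ par', anc_succ par, ih (by omega), hp, if_neg, if_neg]
    · rintro hc
      exact h.new_not_mem hk hroom (i := i) (by omega) (hc ▸ hm)
    · rintro ⟨hc, -⟩
      have := h.lvl_unique (i := i) (j := k) (by omega) (by omega) hm hc
      omega

theorem mem_Nd_update {base N : ℕ → ℕ} {k i G : ℕ} :
    G ∈ Nd base (Function.update N k (N k + 1)) i ↔
      G ∈ Nd base N i ∨ (i = k ∧ G = base k + N k) := by
  rw [mem_Nd, mem_Nd, Function.update_apply]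
  by_cases h : i = k
  · subst h
    simp only [if_true, true_and]
    omega
  · simp [h]

theorem split (h : Inv K base N nxt par la fa rk) (hk : k < K)
    (hroom : k + 1 < K → base (k + 1) + N (k + 1) < base (k + 2))
    (he₀ : e₀ < N 0) (hl₀ : la (anc par k e₀) = e₀) (hl₁ : la (anc par (k + 1) e₀) ≠ e₀)
    (hp : SplitPar base N par la rk k e₀ par') {nxt' la' fa' : ℕ → ℕ}
    (hnxt : nxt' = Function.update (Function.update nxt (base (k + 1) + N (k + 1))
      (nxt (anc par (k + 1) e₀))) (anc par (k + 1) e₀) (base (k + 1) + N (k + 1)))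
    (hla : la' = Function.update (Function.update la (base (k + 1) + N (k + 1))
      (la (anc par (k + 1) e₀))) (anc par (k + 1) e₀) e₀)
    (hfa : fa' = Function.update fa (base (k + 1) + N (k + 1)) (nxt e₀)) :
    Inv K base (Function.update N (k + 1) (N (k + 1) + 1)) nxt' par' la' fa' rk := by
  set hn := base (k + 1) + N (k + 1) with hhn
  set g := anc par (k + 1) e₀ with hg
  set N' := Function.update N (k + 1) (N (k + 1) + 1) with hN'
  have hnew : ∀ i ≤ K, hn ∉ Nd base N i := fun i hi => h.new_not_mem hk hroom hi
  have hgm : g ∈ Nd base N (k + 1) := h.anc_mem hk he₀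
  have hgn : g ≠ hn := fun hc => hnew (k + 1) hk (hc ▸ hgm)
  have hgi : ∀ i ≤ K, i ≠ k + 1 → g ∉ Nd base N i := fun i hi hne hc =>
    hne (h.lvl_unique hi hk hc hgm)
  have hN0 : N' 0 = N 0 := by simp [hN']
  have Ale : ∀ i ≤ k, ∀ e < N 0, anc par' i e = anc par i e := fun i hi e he =>
    h.split_anc_le hk hroom hp hi he
  have Aeq : ∀ e < N 0, anc par' (k + 1) e =
      if anc par (k + 1) e = g ∧ rk (k + 1) e₀ < rk (k + 1) e then hn else anc par (k + 1) e :=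
    fun e he => h.split_anc_eq hk hroom he₀ hl₀ hp he
  have Ane : ∀ i ≤ K, i ≠ k + 1 → ∀ e < N 0, anc par' i e = anc par i e := by
    intro i hi hne e he
    rcases Nat.lt_or_ge i (k + 1) with h1 | h1
    · exact Ale i (by omega) e he
    · exact h.split_anc_gt hk hroom he₀ hl₀ hp (by omega) hi he
  have hz := h.la_lt hk he₀
  have haz := h.anc_la hk he₀
  have hrz := h.rk_lt_la hk he₀ hl₁
  rw [← hg] at hz haz hrz
  set z := la g with hzdef
  have hs₀ := h.step (k + 1) hk e₀ he₀ hl₁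
  rw [← hg] at hs₀
  have harc : ∀ e < N 0, nxt' e = nxt e := by
    intro e he
    have := h.mem_zero.mpr he
    rw [hnxt, Function.update_of_ne, Function.update_of_ne]
    · rintro rfl
      exact hnew 0 (by omega) this
    · rintro rfl
      exact hgi 0 (by omega) (by omega) this
  have lane : ∀ G, G ≠ g → G ≠ hn → la' G = la G := by
    intro G h1 h2
    rw [hla, Function.update_of_ne h1, Function.update_of_ne h2]
  have lag : la' g = e₀ := by rw [hla, Function.update_self]
  have lah : la' hn = z := by rw [hla, Function.update_of_ne hgn.symm, Function.update_self]
  have nne : ∀ G, G ≠ g → G ≠ hn → nxt' G = nxt G := by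
    intro G h1 h2
    rw [hnxt, Function.update_of_ne h1, Function.update_of_ne h2]
  have ng : nxt' g = hn := by rw [hnxt, Function.update_self]
  have nh : nxt' hn = nxt g := by rw [hnxt, Function.update_of_ne hgn.symm, Function.update_self]
  have fne : ∀ G, G ≠ hn → fa' G = fa G := by
    intro G h1
    rw [hfa, Function.update_of_ne h1]
  have fh : fa' hn = nxt e₀ := by rw [hfa, Function.update_self]
  have mne : ∀ i ≤ K, i ≠ k + 1 → ∀ G ∈ Nd base N i, G ≠ g ∧ G ≠ hn := fun i hi hne G hG =>
    ⟨fun hc => hgi i hi hne (hc ▸ hG), fun hc => hnew i hi (hc ▸ hG)⟩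
  have hsub : ∀ i G, G ∈ Nd base N i → G ∈ Nd base N' i := fun i G hG =>
    mem_Nd_update.mpr (Or.inl hG)
  have hnN' : hn ∈ Nd base N' (k + 1) := mem_Nd_update.mpr (Or.inr ⟨rfl, rfl⟩)
  -- the first arc of a group stays in the group
  have hfirst : ∀ e < N 0, la (anc par (k + 1) e) = e →
      anc par' (k + 1) (nxt e) = anc par (k + 1) (nxt e) := by
    intro e he hl
    rw [Aeq _ (h.nxt_lt e he), if_neg]
    rintro ⟨h1, h2⟩
    have h3 := (h.last (k + 1) hk e he hl).2
    have h4 := h.fa_le (k + 1) hk e₀ he₀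
    rw [← hg] at h4
    rw [h1] at h3
    rw [h3] at h4
    omega
  refine
    { disj := ?_, base_zero := h.base_zero, nxt_lt := ?_, nxt_inj := ?_, par_mem := ?_,
      la_mem := ?_, fa_mem := ?_, la_down := ?_, step := ?_, last := ?_, inj := ?_, fa_le := ?_ }
  · intro i hi
    have := h.disj i hi
    rw [hN', Function.update_apply]
    split_ifs with hc
    · subst hc
      have : hn < base (k + 1 + 1) := hroom hi
      omega
    · exact this
  · rw [hN0]
    intro e he
    rw [harc e he]
    exact h.nxt_lt e he
  · rw [hN0]
    intro e he e' he'
    rw [harc e he, harc e' he']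
    exact h.nxt_inj e he e' he'
  · intro i hi c hc
    rw [hp]
    split_ifs with h1 h2
    · rcases mem_Nd_update.mp hc with h3 | ⟨-, h3⟩
      · obtain rfl := h.lvl_unique (by omega) (by omega) h3 h1.1
        exact hnN'
      · exact absurd h1.1 (h3 ▸ hnew k (by omega))
    · rcases mem_Nd_update.mp hc with h3 | ⟨rfl, -⟩
      · exact absurd h3 (h2 ▸ hnew i (by omega))
      · exact hsub _ _ (h.par_mem (k + 1) hi g hgm)
    · rcases mem_Nd_update.mp hc with h3 | ⟨-, h3⟩
      · exact hsub _ _ (h.par_mem i hi c h3)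
      · exact absurd h3 h2
  · rw [hN0]
    intro i hi G hG
    rcases mem_Nd_update.mp hG with h3 | ⟨rfl, rfl⟩
    · by_cases hGg : G = g
      · subst hGg
        obtain rfl : i = k + 1 := by
          by_contra hc
          exact hgi i hi hc h3
        rw [lag]
        refine ⟨he₀, ?_⟩
        rw [Aeq e₀ he₀, if_neg (by omega)]
      · have hGn : G ≠ hn := fun hc => hnew i hi (hc ▸ h3)
        rw [lane G hGg hGn]
        obtain ⟨h4, h5⟩ := h.la_mem i hi G h3
        refine ⟨h4, ?_⟩
        by_cases hik : i = k + 1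
        · subst hik
          rw [Aeq _ h4, h5, if_neg (fun hc => hGg hc.1)]
        · rw [Ane i hi hik _ h4, h5]
    · rw [← hhn, lah]
      exact ⟨hz, by rw [Aeq z hz, if_pos ⟨haz, hrz⟩]⟩
  · rw [hN0]
    intro i hi G hG
    rcases mem_Nd_update.mp hG with h3 | ⟨rfl, rfl⟩
    · have hGn : G ≠ hn := fun hc => hnew i hi (hc ▸ h3)
      rw [fne G hGn]
      obtain ⟨h4, h5⟩ := h.fa_mem i hi G h3
      refine ⟨h4, ?_⟩
      by_cases hik : i = k + 1
      · subst hik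
        rw [Aeq _ h4, h5, if_neg]
        rintro ⟨rfl, h6⟩
        have := h.fa_le (k + 1) hk e₀ he₀
        rw [← hg] at this
        omega
      · rw [Ane i hi hik _ h4, h5]
    · rw [← hhn, fh]
      refine ⟨h.nxt_lt e₀ he₀, ?_⟩
      rw [Aeq _ (h.nxt_lt e₀ he₀), if_pos ⟨hs₀.1, by omega⟩]
  · rw [hN0]
    intro i hi e he hl
    rcases lt_trichotomy i (k + 1) with hik | rfl | hik
    · have hi1 := mne i (by omega) (by omega) _ (h.anc_mem (k := i) (by omega) he)
      rw [Ane i (by omega) (by omega) e he, lane _ hi1.1 hi1.2]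
      by_cases hik' : i = k
      · subst hik'
        rw [Aeq e he] at hl
        split_ifs at hl with h1
        · rw [lah] at hl
          refine h.la_down i hk e he ?_
          rw [h1.1]
          exact hl
        · by_cases h2 : anc par (i + 1) e = g
          · rw [h2, lag] at hl
            rw [← hl]
            exact hl₀
          · rw [lane _ h2 fun hc => hnew (i + 1) hk (hc ▸ h.anc_mem hk he)] at hl
            exact h.la_down i hk e he hl
      · have hi2 := mne (i + 1) (by omega) (by omega) _ (h.anc_mem (k := i + 1) (by omega) he)
        rw [Ane (i + 1) (by omega) (by omega) e he, lane _ hi2.1 hi2.2] at hl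
        exact h.la_down i (by omega) e he hl
    · have hi2 := mne (k + 1 + 1) (by omega) (by omega) _
        (h.anc_mem (k := k + 1 + 1) (by omega) he)
      rw [Ane (k + 1 + 1) (by omega) (by omega) e he, lane _ hi2.1 hi2.2] at hl
      have h1 := h.la_down (k + 1) (by omega) e he hl
      by_cases h2 : anc par (k + 1) e = g
      · rw [h2] at h1
        have h3 : e = z := h1.symm
        rw [Aeq e he, if_pos ⟨h2, by rw [h3]; exact hrz⟩, lah, h3]
      · rw [Aeq e he, if_neg (fun hc => h2 hc.1), lane _ h2 fun hc =>
          hnew (k + 1) hk (hc ▸ h.anc_mem hk he), h1]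
    · have hi1 := mne i (by omega) (by omega) _ (h.anc_mem (k := i) (by omega) he)
      have hi2 := mne (i + 1) (by omega) (by omega) _ (h.anc_mem (k := i + 1) (by omega) he)
      rw [Ane (i + 1) (by omega) (by omega) e he, lane _ hi2.1 hi2.2] at hl
      rw [Ane i (by omega) (by omega) e he, lane _ hi1.1 hi1.2]
      exact h.la_down i (by omega) e he hl
  · rw [hN0]
    intro i hi e he hl
    rw [harc e he]
    have hne := h.nxt_lt e he
    by_cases hik : i = k + 1
    · subst hik
      rw [Aeq _ hne, Aeq e he]
      rw [Aeq e he] at hl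
      by_cases h2 : anc par (k + 1) e = g
      · by_cases h3 : rk (k + 1) e₀ < rk (k + 1) e
        · rw [if_pos ⟨h2, h3⟩, lah] at hl
          have h4 := h.step (k + 1) hk e he (by rw [h2]; exact hl)
          rw [if_pos ⟨by rw [h4.1, h2], by omega⟩, if_pos ⟨h2, h3⟩]
          exact ⟨rfl, h4.2⟩
        · rw [if_neg (fun hc => h3 hc.2), h2, lag] at hl
          have h4 := h.step (k + 1) hk e he (by
            rw [h2]
            rintro hc
            rw [← hc] at h3
            exact h3 hrz)
          have h5 : rk (k + 1) e ≠ rk (k + 1) e₀ := fun hc =>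
            hl (h.inj (k + 1) hk e he e₀ he₀ h2 hc).symm
          rw [if_neg (by rintro ⟨-, hc⟩; omega), if_neg (by rintro ⟨-, hc⟩; omega)]
          exact h4
      · rw [if_neg (fun hc => h2 hc.1), lane _ h2 fun hc =>
          hnew (k + 1) hk (hc ▸ h.anc_mem hk he)] at hl
        have h4 := h.step (k + 1) hk e he hl
        rw [if_neg (fun hc => h2 (h4.1 ▸ hc.1)), if_neg (fun hc => h2 hc.1)]
        exact h4
    · have hi1 := mne i (by omega) (by omega) _ (h.anc_mem (k := i) (by omega) he)
      rw [Ane i hi hik e he, Ane i hi hik _ hne]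
      rw [Ane i hi hik e he, lane _ hi1.1 hi1.2] at hl
      exact h.step i hi e he hl
  · rw [hN0]
    intro i hi e he hl
    rw [harc e he]
    have hne := h.nxt_lt e he
    by_cases hik : i = k + 1
    · subst hik
      by_cases h2 : anc par (k + 1) e = g
      · by_cases h3 : rk (k + 1) e₀ < rk (k + 1) e
        · rw [Aeq e he, if_pos ⟨h2, h3⟩, lah] at hl
          have hle : la (anc par (k + 1) e) = e := by rw [h2]; exact hl
          rw [Aeq e he, if_pos ⟨h2, h3⟩, nh, hfirst e he hle, fne _ fun hc =>
            hnew (k + 1) hk (hc ▸ h.anc_mem hk hne), ← h2]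
          exact h.last (k + 1) hk e he hle
        · rw [Aeq e he, if_neg (fun hc => h3 hc.2), h2, lag] at hl
          subst hl
          rw [Aeq e₀ he, if_neg (fun hc => h3 hc.2), h2, ng, Aeq _ hne,
            if_pos ⟨hs₀.1, by omega⟩, fh]
          exact ⟨rfl, rfl⟩
      · have hen : anc par (k + 1) e ≠ hn := fun hc =>
          hnew (k + 1) hk (hc ▸ h.anc_mem hk he)
        rw [Aeq e he, if_neg (fun hc => h2 hc.1), lane _ h2 hen] at hl
        rw [Aeq e he, if_neg (fun hc => h2 hc.1), nne _ h2 hen, hfirst e he hl, fne _ fun hc =>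
            hnew (k + 1) hk (hc ▸ h.anc_mem hk hne)]
        exact h.last (k + 1) hk e he hl
    · have hi1 := mne i (by omega) (by omega) _ (h.anc_mem (k := i) (by omega) he)
      have hi2 := mne i (by omega) (by omega) _ (h.anc_mem (k := i) (by omega) hne)
      rw [Ane i hi hik e he, Ane i hi hik _ hne, nne _ hi1.1 hi1.2, fne _ hi2.2]
      rw [Ane i hi hik e he, lane _ hi1.1 hi1.2] at hl
      exact h.last i hi e he hl
  · rw [hN0]
    intro i hi e he e' he' hA hr
    by_cases hik : i = k + 1
    · subst hik
      refine h.inj (k + 1) hk e he e' he' ?_ hr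
      rw [Aeq e he, Aeq e' he'] at hA
      split_ifs at hA with h1 h2 h2
      · rw [h1.1, h2.1]
      · exact absurd (hA ▸ h.anc_mem hk he') (hnew (k + 1) hk)
      · exact absurd (hA ▸ h.anc_mem hk he) (hnew (k + 1) hk)
      · exact hA
    · rw [Ane i hi hik e he, Ane i hi hik e' he'] at hA
      exact h.inj i hi e he e' he' hA hr
  · rw [hN0]
    intro i hi e he
    by_cases hik : i = k + 1
    · subst hik
      rw [Aeq e he]
      split_ifs with h1
      · rw [fh]
        omega
      · rw [fne _ fun hc => hnew (k + 1) hk (hc ▸ h.anc_mem hk he)]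
        exact h.fa_le (k + 1) hk e he
    · rw [Ane i hi hik e he, fne _ (mne i hi hik _ (h.anc_mem hi he)).2]
      exact h.fa_le i hi e he

end split

end Inv

end FlipRepair

namespace FlipRepair

namespace Inv

variable {K : ℕ} {base N nxt par la fa : ℕ → ℕ} {rk : ℕ → ℕ → ℕ}

/-! ### Exchanging successors -/

theorem flip (h : Inv K base N nxt par la fa rk) {a b : ℕ} (ha : a < N 0) (hb : b < N 0)
    (hla : ∀ k ≤ K, la (anc par k a) = a) (hlb : ∀ k ≤ K, la (anc par k b) = b) {nxt' : ℕ → ℕ}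
    (hn : ∀ k ≤ K, ∀ G ∈ Nd base N k, nxt' G = if G = anc par k a then nxt (anc par k b)
      else if G = anc par k b then nxt (anc par k a) else nxt G) :
    Inv K base N nxt' par la fa rk := by
  have h0 : ∀ e < N 0, nxt' e = nxt (if e = a then b else if e = b then a else e) := by
    intro e he
    have h1 := hn 0 (Nat.zero_le _) e (h.mem_zero.mpr he)
    by_cases hea : e = a
    · rw [if_pos (show e = anc par 0 a from hea)] at h1
      rw [if_pos hea]
      exact h1
    · rw [if_neg (show ¬ e = anc par 0 a from hea)] at h1
      rw [if_neg hea]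
      by_cases heb : e = b
      · rw [if_pos (show e = anc par 0 b from heb)] at h1
        rw [if_pos heb]
        exact h1
      · rw [if_neg (show ¬ e = anc par 0 b from heb)] at h1
        rw [if_neg heb]
        exact h1
  have hlt : ∀ e < N 0, (if e = a then b else if e = b then a else e) < N 0 := by
    intro e he
    split_ifs <;> assumption
  have hne : ∀ k ≤ K, ∀ e < N 0, la (anc par k e) ≠ e → nxt' e = nxt e := by
    intro k hk e he hl
    rw [h0 e he, if_neg, if_neg]
    · rintro rfl
      exact hl (hlb k hk)
    · rintro rfl
      exact hl (hla k hk)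
  refine
    { disj := h.disj, base_zero := h.base_zero, nxt_lt := ?_, nxt_inj := ?_, par_mem := h.par_mem,
      la_mem := h.la_mem, fa_mem := h.fa_mem, la_down := h.la_down, step := ?_, last := ?_,
      inj := h.inj, fa_le := h.fa_le }
  · intro e he
    rw [h0 e he]
    exact h.nxt_lt _ (hlt e he)
  · intro e he e' he' hee
    rw [h0 e he, h0 e' he'] at hee
    have := h.nxt_inj _ (hlt e he) _ (hlt e' he') hee
    split_ifs at this <;> simp_all
  · intro k hk e he hl
    rw [hne k hk e he hl]
    exact h.step k hk e he hl
  · intro k hk e he hl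
    have key : ∀ c < N 0, la (anc par k c) = c → anc par k e = anc par k c → e = c := by
      intro c hc hlc hec
      rw [← hl, hec, hlc]
    rw [hn k hk _ (h.anc_mem hk he), h0 e he]
    by_cases hea : e = a
    · subst hea
      rw [if_pos rfl, if_pos rfl]
      exact h.last k hk b hb (hlb k hk)
    · rw [if_neg fun hc => hea (key a ha (hla k hk) hc), if_neg hea]
      by_cases heb : e = b
      · subst heb
        rw [if_pos rfl, if_pos rfl]
        exact h.last k hk a ha (hla k hk)
      · rw [if_neg fun hc => heb (key b hb (hlb k hk) hc), if_neg heb]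
        exact h.last k hk e he hl

/-! ### Cycles -/

theorem nxt_mem (h : Inv K base N nxt par la fa rk) {k G : ℕ} (hk : k ≤ K)
    (hG : G ∈ Nd base N k) : nxt G ∈ Nd base N k := by
  obtain ⟨h1, h2⟩ := h.la_mem k hk G hG
  have := (h.last k hk _ h1 (by rw [h2])).1
  rw [h2] at this
  rw [this]
  exact h.anc_mem hk (h.nxt_lt _ h1)

theorem fa_nxt (h : Inv K base N nxt par la fa rk) {k G : ℕ} (hk : k ≤ K)
    (hG : G ∈ Nd base N k) : fa (nxt G) = nxt (la G) := by
  obtain ⟨h1, h2⟩ := h.la_mem k hk G hG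
  have := h.last k hk _ h1 (by rw [h2])
  rw [h2] at this
  rw [this.1, this.2]

theorem nxt_node_inj (h : Inv K base N nxt par la fa rk) {k G G' : ℕ} (hk : k ≤ K)
    (hG : G ∈ Nd base N k) (hG' : G' ∈ Nd base N k) (hn : nxt G = nxt G') : G = G' := by
  have h1 := h.fa_nxt hk hG
  have h2 := h.fa_nxt hk hG'
  rw [hn, h2] at h1
  obtain ⟨h3, h4⟩ := h.la_mem k hk G hG
  obtain ⟨h5, h6⟩ := h.la_mem k hk G' hG'
  rw [← h4, ← h6, h.nxt_inj _ h5 _ h3 h1]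

variable {M : ℕ} {T : Equiv.Perm (Fin M)}

theorem sameCycle_la (h : Inv K base N nxt par la fa rk) (hM : N 0 = M) (hT : ActsAs nxt T)
    {k : ℕ} (hk : k ≤ K) (e : Fin M) (z : Fin M) (hz : (z : ℕ) = la (anc par k e)) :
    T.SameCycle e z := by
  have := h.walk (k := k) hk (p := fun e => ∀ e' z : Fin M, (e' : ℕ) = e →
    (z : ℕ) = la (anc par k e) → T.SameCycle e' z) ?_ ?_ e (by rw [hM]; exact e.2) e z rfl hz
  · exact this
  · intro e he hl e' z he' hz
    have : e' = z := Fin.ext (by rw [he', hz, hl])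
    rw [this]
  · intro e he hl ih e' z he' hz
    have hs := h.step k hk e he hl
    have := ih (T e') z (by rw [← hT e', he']) (by rw [hs.1, hz])
    exact Equiv.Perm.sameCycle_apply_left.mp this

theorem sameCycle_of_anc_eq (h : Inv K base N nxt par la fa rk) (hM : N 0 = M)
    (hT : ActsAs nxt T) {k : ℕ} (hk : k ≤ K) {e e' : Fin M} (he : anc par k e = anc par k e') :
    T.SameCycle e e' := by
  have hl := h.la_lt (k := k) hk (e := e) (by rw [hM]; exact e.2)
  have hlt : la (anc par k e) < M := by omega
  exact (h.sameCycle_la hM hT hk e ⟨_, hlt⟩ rfl).trans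
    (h.sameCycle_la hM hT hk e' ⟨_, hlt⟩ (by simp [he])).symm

theorem iterate_mem (h : Inv K base N nxt par la fa rk) {k G : ℕ} (hk : k ≤ K)
    (hG : G ∈ Nd base N k) (j : ℕ) : nxt^[j] G ∈ Nd base N k := by
  induction j with
  | zero => exact hG
  | succ j ih =>
    rw [Function.iterate_succ_apply']
    exact h.nxt_mem hk ih

theorem exists_arc_iterate (h : Inv K base N nxt par la fa rk) (hM : N 0 = M) (hT : ActsAs nxt T)
    {k : ℕ} (hk : k ≤ K) (a : Fin M) (j : ℕ) :
    ∃ e : Fin M, T.SameCycle a e ∧ anc par k e = nxt^[j] (anc par k a) := by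
  induction j with
  | zero => exact ⟨a, Equiv.Perm.SameCycle.refl _ _, rfl⟩
  | succ j ih =>
    obtain ⟨e, he, hj⟩ := ih
    have heM : (e : ℕ) < N 0 := by rw [hM]; exact e.2
    have hl := h.la_lt hk heM
    have hlt : la (anc par k e) < M := by omega
    refine ⟨T ⟨_, hlt⟩, ?_, ?_⟩
    · exact Equiv.Perm.sameCycle_apply_right.mpr (he.trans (h.sameCycle_la hM hT hk e _ rfl))
    · have h1 := h.anc_la hk heM
      have h2 := (h.last k hk _ hl (by rw [h1])).1
      rw [Function.iterate_succ_apply', ← hj, ← hT ⟨_, hlt⟩]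
      simp only
      rw [← h2, h1]

/-- The groups of the arcs in the cycle of `a` are the ones in the cycle of the group of `a`. -/
theorem sameCycle_iff (h : Inv K base N nxt par la fa rk) (hM : N 0 = M) (hT : ActsAs nxt T)
    {k : ℕ} (hk : k ≤ K) (a e : Fin M) :
    T.SameCycle a e ↔ ∃ j, nxt^[j] (anc par k a) = anc par k e := by
  constructor
  · intro hs
    obtain ⟨i, rfl⟩ := hs.exists_nat_pow_eq
    induction i with
    | zero => exact ⟨0, rfl⟩
    | succ i ih =>
      obtain ⟨j, hj⟩ := ih ⟨i, rfl⟩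
      have heM : (((T ^ i) a : Fin M) : ℕ) < N 0 := by rw [hM]; exact Fin.isLt _
      have e1 : (((T ^ (i + 1)) a : Fin M) : ℕ) = nxt ((T ^ i) a : Fin M) := by
        rw [pow_succ', Equiv.Perm.mul_apply, hT]
      rw [e1]
      by_cases hl : la (anc par k ((T ^ i) a : Fin M)) = ((T ^ i) a : Fin M)
      · refine ⟨j + 1, ?_⟩
        rw [Function.iterate_succ_apply', hj]
        exact (h.last k hk _ heM hl).1
      · exact ⟨j, by rw [hj, (h.step k hk _ heM hl).1]⟩
  · rintro ⟨j, hj⟩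
    obtain ⟨e', he', hj'⟩ := h.exists_arc_iterate hM hT hk a j
    exact he'.trans (h.sameCycle_of_anc_eq hM hT hk (hj'.trans hj))

theorem isPeriodic (h : Inv K base N nxt par la fa rk) {k G : ℕ} (hk : k ≤ K)
    (hG : G ∈ Nd base N k) : ∃ n, 0 < n ∧ n ≤ N k ∧ nxt^[n] G = G := by
  have hcard : (Nd base N k).card < (Finset.range (N k + 1)).card := by simp [Nd]
  obtain ⟨i, hi, j, hj, hij, heq⟩ := Finset.exists_ne_map_eq_of_card_lt_of_maps_to hcard
    (f := fun j => nxt^[j] G) (fun j _ => h.iterate_mem hk hG j)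
  wlog hlt : i < j generalizing i j
  · exact this j hj i hi hij.symm heq.symm (by omega)
  have key : ∀ i d, nxt^[i] G = nxt^[i + d] G → nxt^[d] G = G := by
    intro i
    induction i with
    | zero => intro d hd; simpa using hd.symm
    | succ i ih =>
      intro d hd
      refine ih d (h.nxt_node_inj hk (h.iterate_mem hk hG _) (h.iterate_mem hk hG _) ?_)
      rw [← Function.iterate_succ_apply' nxt, ← Function.iterate_succ_apply' nxt, hd]
      congr 1
      omega
  simp only [Finset.mem_range] at hi hj
  refine ⟨j - i, by omega, by omega, key i (j - i) ?_⟩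
  have : i + (j - i) = j := by omega
  rw [this]
  exact heq

theorem minimalPeriod_pos (h : Inv K base N nxt par la fa rk) {k G : ℕ} (hk : k ≤ K)
    (hG : G ∈ Nd base N k) : 0 < Function.minimalPeriod nxt G := by
  obtain ⟨n, hn, -, hp⟩ := h.isPeriodic hk hG
  exact Function.IsPeriodicPt.minimalPeriod_pos hn hp

theorem minimalPeriod_le (h : Inv K base N nxt par la fa rk) {k G : ℕ} (hk : k ≤ K)
    (hG : G ∈ Nd base N k) : Function.minimalPeriod nxt G ≤ N k := by
  obtain ⟨n, hn, hle, hp⟩ := h.isPeriodic hk hG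
  exact (Function.IsPeriodicPt.minimalPeriod_le hn hp).trans hle

/-- If `nxt` is a tour then the nodes of each level form one cycle. -/
theorem tour_enum (h : Inv K base N nxt par la fa rk) (hM : N 0 = M) (hT : ActsAs nxt T)
    (htour : T.IsCycleOn Set.univ) {k G : ℕ} (hk : k ≤ K) (hG : G ∈ Nd base N k) :
    (∀ c ∈ Nd base N k, ∃ i < N k, nxt^[i] G = c) ∧
    (∀ i < N k, ∀ j < N k, nxt^[i] G = nxt^[j] G → i = j) ∧ nxt^[N k] G = G := by
  have hpos := h.minimalPeriod_pos hk hG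
  have hle := h.minimalPeriod_le hk hG
  have hsurj : ∀ c ∈ Nd base N k, ∃ i < Function.minimalPeriod nxt G, nxt^[i] G = c := by
    intro c hc
    obtain ⟨h1, h2⟩ := h.la_mem k hk G hG
    obtain ⟨h3, h4⟩ := h.la_mem k hk c hc
    have hs : T.SameCycle ⟨la G, by omega⟩ ⟨la c, by omega⟩ :=
      htour.2 (Set.mem_univ _) (Set.mem_univ _)
    obtain ⟨j, hj⟩ := (h.sameCycle_iff hM hT hk _ _).mp hs
    simp only [h2, h4] at hj
    refine ⟨j % Function.minimalPeriod nxt G, Nat.mod_lt _ hpos, ?_⟩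
    rw [Function.iterate_mod_minimalPeriod_eq, hj]
  have hge : N k ≤ Function.minimalPeriod nxt G := by
    have hsub : Nd base N k ⊆
        (Finset.range (Function.minimalPeriod nxt G)).image fun i => nxt^[i] G := by
      intro c hc
      obtain ⟨i, hi, rfl⟩ := hsurj c hc
      exact Finset.mem_image_of_mem _ (Finset.mem_range.mpr hi)
    have := (Finset.card_le_card hsub).trans Finset.card_image_le
    simpa [Nd] using this
  have heq : Function.minimalPeriod nxt G = N k := le_antisymm hle hge
  rw [heq] at hsurj
  refine ⟨hsurj, ?_, ?_⟩
  · intro i hi j hj hij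
    exact Function.iterate_injOn_Iio_minimalPeriod (f := nxt) (x := G) (by simpa [heq] using hi)
      (by simpa [heq] using hj) hij
  · rw [← heq]
    exact Function.iterate_minimalPeriod

/-! ### Building a level from the level below -/

theorem extend (h : Inv K base N nxt par la fa rk) {f : ℕ → ℕ} {ch : ℕ} (hch : 1 ≤ ch)
    (hNpos : 0 < N K)
    (hf : ∀ i < N K, f i ∈ Nd base N K)
    (hinj : ∀ i < N K, ∀ j < N K, f i = f j → i = j)
    (hsurj : ∀ c ∈ Nd base N K, ∃ i < N K, f i = c)
    (hnf : ∀ i < N K, nxt (f i) = f (if i + 1 < N K then i + 1 else 0))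
    (hbase : base K + N K ≤ base (K + 1))
    {N' nxt' par' la' fa' : ℕ → ℕ}
    (hN : ∀ k ≤ K, N' k = N k)
    (hN' : ∀ q, q < N' (K + 1) ↔ q * ch < N K)
    (hpar : ∀ i < N K, par' (f i) = base (K + 1) + i / ch)
    (hpar' : ∀ k < K, ∀ c ∈ Nd base N k, par' c = par c)
    (hla : ∀ q < N' (K + 1), la' (base (K + 1) + q) = la (f (min (q * ch + ch - 1) (N K - 1))))
    (hfa : ∀ q < N' (K + 1), fa' (base (K + 1) + q) = fa (f (q * ch)))
    (hnxt : ∀ q < N' (K + 1), nxt' (base (K + 1) + q) =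
      base (K + 1) + if q + 1 < N' (K + 1) then q + 1 else 0)
    (hold : ∀ k ≤ K, ∀ G ∈ Nd base N k, la' G = la G ∧ fa' G = fa G ∧ nxt' G = nxt G) :
    ∃ rk', Inv (K + 1) base N' nxt' par' la' fa' rk' := by
  choose! ix hix hfix using hsurj
  have hixf : ∀ i < N K, ix (f i) = i := fun i hi =>
    hinj _ (hix _ (hf i hi)) _ hi (hfix _ (hf i hi))
  have hN0 : N' 0 = N 0 := hN 0 (Nat.zero_le _)
  have hNd : ∀ k ≤ K, ∀ G, G ∈ Nd base N' k ↔ G ∈ Nd base N k := by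
    intro k hk G
    rw [mem_Nd, mem_Nd, hN k hk]
  have hA : ∀ k ≤ K, ∀ e < N 0, anc par' k e = anc par k e := by
    intro k hk e he
    induction k with
    | zero => rfl
    | succ k ih =>
      rw [anc_succ, anc_succ, ih (by omega), hpar' k (by omega) _ (h.anc_mem (by omega) he)]
  have hA1 : ∀ e < N 0, anc par' (K + 1) e = base (K + 1) + ix (anc par K e) / ch := by
    intro e he
    have hm := h.anc_mem le_rfl he
    have := hpar _ (hix _ hm)
    rw [hfix _ hm] at this
    rw [anc_succ, hA K le_rfl e he, this]
  have hdiv : ∀ i < N K, i / ch < N' (K + 1) := by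
    intro i hi
    rw [hN']
    exact (Nat.div_mul_le_self i ch).trans_lt hi
  set sz : ℕ → ℕ := fun i => rk K (la (f i)) - rk K (fa (f i)) + 1 with hsz
  set r : ℕ → ℕ := fun e => ∑ i ∈ Finset.range (ix (anc par K e)), sz i +
    (rk K e - rk K (fa (anc par K e))) with hr
  have hlaf : ∀ i < N K, la (f i) < N 0 ∧ anc par K (la (f i)) = f i := fun i hi =>
    h.la_mem K le_rfl _ (hf i hi)
  have hfaf : ∀ i < N K, fa (f i) < N 0 ∧ anc par K (fa (f i)) = f i := fun i hi =>
    h.fa_mem K le_rfl _ (hf i hi)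
  -- the position within a group is less than its size
  have hlt : ∀ e < N 0, rk K e - rk K (fa (anc par K e)) < sz (ix (anc par K e)) := by
    intro e he
    have hm := h.anc_mem le_rfl he
    have h1 := h.rk_le_la le_rfl le_rfl he
    simp only [hsz, hfix _ hm]
    omega
  have hmono : ∀ e < N 0, ∀ i, i ≤ ix (anc par K e) → ∑ j ∈ Finset.range i, sz j ≤ r e := by
    intro e he i hi
    exact (Finset.sum_le_sum_of_subset (Finset.range_mono hi)).trans (Nat.le_add_right _ _)
  have hlt' : ∀ e < N 0, ∀ i, ix (anc par K e) < i → r e < ∑ j ∈ Finset.range i, sz j := by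
    intro e he i hi
    calc r e < ∑ j ∈ Finset.range (ix (anc par K e) + 1), sz j := by
          rw [Finset.sum_range_succ]
          exact Nat.add_lt_add_left (hlt e he) _
      _ ≤ _ := Finset.sum_le_sum_of_subset (Finset.range_mono hi)
  have hgrp : ∀ G ∈ Nd base N' (K + 1), ∃ q < N' (K + 1), G = base (K + 1) + q := by
    intro G hG
    rw [mem_Nd] at hG
    exact ⟨G - base (K + 1), by omega, by omega⟩
  have hidx : ∀ q < N' (K + 1), min (q * ch + ch - 1) (N K - 1) < N K ∧
      min (q * ch + ch - 1) (N K - 1) / ch = q := by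
    intro q hq
    have := (hN' q).mp hq
    refine ⟨by omega, ?_⟩
    rw [Nat.div_eq_iff (by omega)]
    omega
  -- the end of a group of the new level
  have hend : ∀ e < N 0, la' (anc par' (K + 1) e) = e →
      e = la (f (ix (anc par K e))) ∧
      (ix (anc par K e) + 1 < N K → (ix (anc par K e) + 1) = (ix (anc par K e) / ch + 1) * ch) := by
    intro e he hl
    have hm := h.anc_mem le_rfl he
    have hi := hix _ hm
    have hq := hdiv _ hi
    rw [hA1 e he, hla _ hq] at hl
    obtain ⟨h1, h2⟩ := hidx _ hq
    have h3 := hlaf _ h1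
    rw [hl] at h3
    have h4 : ix (anc par K e) = min (ix (anc par K e) / ch * ch + ch - 1) (N K - 1) := by
      conv_lhs => rw [h3.2]
      rw [hixf _ h1]
    refine ⟨?_, fun h5 => ?_⟩
    · rw [hfix _ hm]
      rw [← h3.2] at hl
      exact hl.symm
    · rw [add_mul, one_mul]
      omega
  have hnotend : ∀ e < N 0, la (anc par K e) = e → la' (anc par' (K + 1) e) ≠ e →
      ix (anc par K e) + 1 < N K ∧ (ix (anc par K e) + 1) / ch = ix (anc par K e) / ch := by
    intro e he hl hl'
    have hm := h.anc_mem le_rfl he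
    have hi := hix _ hm
    have hq := hdiv _ hi
    rw [hA1 e he, hla _ hq] at hl'
    have hmod := Nat.mod_lt (ix (anc par K e)) (show 0 < ch by omega)
    have hdm := Nat.div_add_mod' (ix (anc par K e)) ch
    have h4 : ix (anc par K e) ≠ min (ix (anc par K e) / ch * ch + ch - 1) (N K - 1) := by
      intro hc
      rw [← hc, hfix _ hm] at hl'
      exact hl' hl
    refine ⟨by omega, ?_⟩
    rw [Nat.div_eq_iff (by omega)]
    omega
  refine ⟨Function.update rk (K + 1) r, ?_⟩
  have hrk : ∀ k ≤ K, Function.update rk (K + 1) r k = rk k := fun k hk =>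
    Function.update_of_ne (by omega) _ _
  have hrkK : Function.update rk (K + 1) r (K + 1) = r := Function.update_self _ _ _
  have hnx : ∀ e < N 0, nxt' e = nxt e := fun e he =>
    (hold 0 (Nat.zero_le _) e (h.mem_zero.mpr he)).2.2
  refine
    { disj := ?_, base_zero := h.base_zero, nxt_lt := ?_, nxt_inj := ?_, par_mem := ?_,
      la_mem := ?_, fa_mem := ?_, la_down := ?_, step := ?_, last := ?_, inj := ?_, fa_le := ?_ }
  · intro k hk
    rw [hN k (by omega)]
    rcases Nat.lt_or_ge k K with h1 | h1
    · exact h.disj k h1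
    · obtain rfl : k = K := by omega
      exact hbase
  · rw [hN0]
    intro e he
    rw [hnx e he]
    exact h.nxt_lt e he
  · rw [hN0]
    intro e he e' he'
    rw [hnx e he, hnx e' he']
    exact h.nxt_inj e he e' he'
  · intro k hk c hc
    rw [hNd k (by omega)] at hc
    rcases Nat.lt_or_ge k K with h1 | h1
    · rw [hNd (k + 1) (by omega), hpar' k h1 c hc]
      exact h.par_mem k h1 c hc
    · obtain rfl : k = K := by omega
      rw [← hfix c hc, hpar _ (hix c hc), mem_Nd]
      have := hdiv _ (hix c hc)
      generalize ix c / ch = q at this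
      omega
  · rw [hN0]
    intro k hk G hG
    rcases Nat.lt_or_ge K k with h1 | h1
    · obtain rfl : k = K + 1 := by omega
      obtain ⟨q, hq, rfl⟩ := hgrp G hG
      obtain ⟨h2, h3⟩ := hidx q hq
      obtain ⟨h4, h5⟩ := hlaf _ h2
      rw [hla q hq]
      refine ⟨h4, ?_⟩
      rw [hA1 _ h4, h5, hixf _ h2, h3]
    · rw [hNd k h1] at hG
      rw [(hold k h1 G hG).1]
      obtain ⟨h2, h3⟩ := h.la_mem k h1 G hG
      exact ⟨h2, by rw [hA k h1 _ h2, h3]⟩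
  · rw [hN0]
    intro k hk G hG
    rcases Nat.lt_or_ge K k with h1 | h1
    · obtain rfl : k = K + 1 := by omega
      obtain ⟨q, hq, rfl⟩ := hgrp G hG
      have h2 := (hN' q).mp hq
      obtain ⟨h4, h5⟩ := hfaf _ h2
      rw [hfa q hq]
      refine ⟨h4, ?_⟩
      rw [hA1 _ h4, h5, hixf _ h2, Nat.mul_div_cancel _ (by omega)]
    · rw [hNd k h1] at hG
      rw [(hold k h1 G hG).2.1]
      obtain ⟨h2, h3⟩ := h.fa_mem k h1 G hG
      exact ⟨h2, by rw [hA k h1 _ h2, h3]⟩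
  · rw [hN0]
    intro k hk e he hl
    rw [hA k (by omega) e he, (hold k (by omega) _ (h.anc_mem (by omega) he)).1]
    rcases Nat.lt_or_ge k K with h1 | h1
    · rw [hA (k + 1) (by omega) e he, (hold (k + 1) (by omega) _ (h.anc_mem (by omega) he)).1] at hl
      exact h.la_down k h1 e he hl
    · obtain rfl : k = K := by omega
      have := (hend e he hl).1
      rw [hfix _ (h.anc_mem le_rfl he)] at this
      exact this.symm
  · rw [hN0]
    intro k hk e he hl
    rw [hnx e he]
    have hne := h.nxt_lt e he
    rcases Nat.lt_or_ge K k with h1 | h1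
    · obtain rfl : k = K + 1 := by omega
      rw [hrkK, hA1 _ hne, hA1 _ he]
      have hm := h.anc_mem le_rfl he
      by_cases hle : la (anc par K e) = e
      · obtain ⟨h2, h3⟩ := hnotend e he hle hl
        obtain ⟨h4, h5⟩ := h.last K le_rfl e he hle
        have h6 : anc par K (nxt e) = f (ix (anc par K e) + 1) := by
          rw [← h4]
          have := hnf _ (hix _ hm)
          rwa [hfix _ hm, if_pos h2] at this
        have h7 : ix (anc par K (nxt e)) = ix (anc par K e) + 1 := by rw [h6, hixf _ h2]
        refine ⟨by rw [h7, h3], ?_⟩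
        simp only [hr]
        rw [h7, Finset.sum_range_succ, h5, Nat.sub_self, add_zero]
        simp only [hsz]
        rw [hfix _ hm, hle, add_assoc]
      · obtain ⟨h2, h3⟩ := h.step K le_rfl e he hle
        refine ⟨by rw [h2], ?_⟩
        simp only [hr]
        have := h.fa_le K le_rfl e he
        rw [h2, h3]
        omega
    · rw [hA k h1 e he, (hold k h1 _ (h.anc_mem h1 he)).1] at hl
      rw [hA k h1 e he, hA k h1 _ hne, hrk k h1]
      exact h.step k h1 e he hl
  · rw [hN0]
    intro k hk e he hl
    rw [hnx e he]
    have hne := h.nxt_lt e he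
    rcases Nat.lt_or_ge K k with h1 | h1
    · obtain rfl : k = K + 1 := by omega
      have hm := h.anc_mem le_rfl he
      have hi := hix _ hm
      obtain ⟨h2, h3⟩ := hend e he hl
      have hle : la (anc par K e) = e := by
        rw [hfix _ hm] at h2
        exact h2.symm
      obtain ⟨h4, h5⟩ := h.last K le_rfl e he hle
      have h6 : anc par K (nxt e) =
          f (if ix (anc par K e) + 1 < N K then ix (anc par K e) + 1 else 0) := by
        rw [← h4]
        have := hnf _ hi
        rwa [hfix _ hm] at this
      rw [hA1 e he, hA1 _ hne, hnxt _ (hdiv _ hi), h6]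
      by_cases hc : ix (anc par K e) + 1 < N K
      · have h7 := h3 hc
        have h8 : ix (anc par K e) / ch + 1 < N' (K + 1) := by
          rw [hN', ← h7]
          exact hc
        rw [if_pos hc] at h6 ⊢
        rw [if_pos h8, hixf _ hc]
        have h9 : (ix (anc par K e) + 1) / ch = ix (anc par K e) / ch + 1 := by
          conv_lhs => rw [h7]
          exact Nat.mul_div_cancel _ (by omega)
        refine ⟨by rw [h9], ?_⟩
        rw [h9, hfa _ h8, ← h7, ← h6, h5]
      · have h8 : ¬ ix (anc par K e) / ch + 1 < N' (K + 1) := by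
          rw [hN']
          have := Nat.lt_div_mul_add (a := ix (anc par K e)) (show 0 < ch by omega)
          rw [add_mul, one_mul]
          omega
        rw [if_neg hc] at h6 ⊢
        rw [if_neg h8, hixf _ hNpos, Nat.zero_div]
        refine ⟨rfl, ?_⟩
        rw [hfa 0 (by rw [hN']; omega), zero_mul, ← h6, h5]
    · rw [hA k h1 e he, (hold k h1 _ (h.anc_mem h1 he)).1] at hl
      rw [hA k h1 e he, hA k h1 _ hne, (hold k h1 _ (h.anc_mem h1 he)).2.2,
        (hold k h1 _ (h.anc_mem h1 hne)).2.1]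
      exact h.last k h1 e he hl
  · rw [hN0]
    intro k hk e he e' he' hAe hre
    rcases Nat.lt_or_ge K k with h1 | h1
    · obtain rfl : k = K + 1 := by omega
      rw [hrkK] at hre
      have h2 : ix (anc par K e) = ix (anc par K e') := by
        rcases lt_trichotomy (ix (anc par K e)) (ix (anc par K e')) with h2 | h2 | h2
        · have := hlt' e he _ h2
          have := hmono e' he' _ le_rfl
          omega
        · exact h2
        · have := hlt' e' he' _ h2
          have := hmono e he _ le_rfl
          omega
      have h3 : anc par K e = anc par K e' := by
        rw [← hfix _ (h.anc_mem le_rfl he), h2, hfix _ (h.anc_mem le_rfl he')]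
      refine h.inj K le_rfl e he e' he' h3 ?_
      have h4 := h.fa_le K le_rfl e he
      have h5 := h.fa_le K le_rfl e' he'
      simp only [hr] at hre
      rw [h3] at hre h4
      omega
    · rw [hA k h1 e he, hA k h1 e' he'] at hAe
      rw [hrk k h1] at hre
      exact h.inj k h1 e he e' he' hAe hre
  · rw [hN0]
    intro k hk e he
    rcases Nat.lt_or_ge K k with h1 | h1
    · obtain rfl : k = K + 1 := by omega
      have hm := h.anc_mem le_rfl he
      have hi := hix _ hm
      have hq := hdiv _ hi
      have hq' := (hN' _).mp hq
      rw [hrkK, hA1 e he, hfa _ hq]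
      have h2 := hfaf _ hq'
      have h3 : r (fa (f (ix (anc par K e) / ch * ch))) =
          ∑ i ∈ Finset.range (ix (anc par K e) / ch * ch), sz i := by
        simp only [hr]
        rw [h2.2, hixf _ hq', Nat.sub_self, add_zero]
      rw [h3]
      exact hmono e he _ (Nat.div_mul_le_self _ _)
    · rw [hA k h1 e he, hrk k h1, (hold k h1 _ (h.anc_mem h1 he)).2.1]
      exact h.fa_le k h1 e he

end Inv

end FlipRepair

namespace FlipRepair

/-! ### Counting pairs of mates -/

/-- The number of arcs `e` of the level-`k` group `G` whose mate is in the block `M + j`. -/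
def cnt (M : ℕ) (mate par : ℕ → ℕ) (k G j : ℕ) : ℕ :=
  ((Finset.range M).filter fun e => anc par k e = G ∧ par (mate e) = M + j).card

/-- The number of children of `G` at level `k`. -/
def kids (base N par : ℕ → ℕ) (k G : ℕ) : ℕ := ((Nd base N k).filter fun c => par c = G).card

/-- `mate` is a fixed-point-free involution of the arcs. -/
structure IsMate (M : ℕ) (mate : ℕ → ℕ) : Prop where
  lt : ∀ e < M, mate e < M
  invol : ∀ e < M, mate (mate e) = e
  ne : ∀ e < M, mate e ≠ e

theorem cnt_le (M : ℕ) (mate par : ℕ → ℕ) (k G j : ℕ) : cnt M mate par k G j ≤ M :=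
  (Finset.card_filter_le _ _).trans (by simp)

namespace Lev

variable {K : ℕ} {base N par : ℕ → ℕ}

theorem update_anc (h : Lev K base N par) {k f hn : ℕ} (hk : k < K) (hf : f ∈ Nd base N k)
    (hh : hn ∈ Nd base N (k + 1)) (hpar : k + 1 < K → par hn = par (par f)) {i e : ℕ}
    (hi : i ≤ K) (he : e < N 0) :
    anc (Function.update par f hn) i e =
      if i = k + 1 ∧ anc par k e = f then hn else anc par i e := by
  induction i with
  | zero => simp
  | succ i ih =>
    rw [anc_succ, ih (by omega)]
    have hm := h.anc_mem (k := i) (by omega) he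
    by_cases hik : i = k
    · subst hik
      rw [if_neg (by omega)]
      by_cases hc : anc par i e = f
      · simp [hc]
      · rw [Function.update_of_ne hc, if_neg (fun h => hc h.2), anc_succ]
    · rw [if_neg (by omega : ¬ (i + 1 = k + 1 ∧ _))]
      by_cases hc : i = k + 1 ∧ anc par k e = f
      · rw [if_pos hc, Function.update_of_ne]
        · rw [hc.1, hpar (by omega), anc_succ, anc_succ, hc.2]
        · rintro rfl
          have := h.lvl_unique (by omega) (by omega) hf hh
          omega
      · rw [if_neg hc, Function.update_of_ne, anc_succ]
        rintro hcc
        rw [hcc] at hm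
        exact hik (h.lvl_unique (by omega) (by omega) hm hf)

theorem update (h : Lev K base N par) {k f hn : ℕ} (hk : k < K) (hf : f ∈ Nd base N k)
    (hh : hn ∈ Nd base N (k + 1)) : Lev K base N (Function.update par f hn) where
  disj := h.disj
  base_zero := h.base_zero
  par_mem i hi c hc := by
    rw [Function.update_apply]
    split_ifs with hcf
    · subst hcf
      obtain rfl := h.lvl_unique (by omega) (by omega) hc hf
      exact hh
    · exact h.par_mem i hi c hc

variable {mate : ℕ → ℕ}

/-- Moving a group `f` of level `k ≥ 1` from its parent to `hn`. -/
theorem cnt_update (h : Lev K base N par) (hm : IsMate (N 0) mate) {k f hn : ℕ} (hk : k < K)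
    (hk1 : 1 ≤ k) (hf : f ∈ Nd base N k) (hh : hn ∈ Nd base N (k + 1)) (hne : hn ≠ par f)
    (hpar : k + 1 < K → par hn = par (par f)) {i : ℕ} (hi : i ≤ K) (G j : ℕ) :
    cnt (N 0) mate (Function.update par f hn) i G j =
      if i = k + 1 ∧ G = par f then cnt (N 0) mate par i G j - cnt (N 0) mate par k f j
      else if i = k + 1 ∧ G = hn then cnt (N 0) mate par i G j + cnt (N 0) mate par k f j
      else cnt (N 0) mate par i G j := by
  have hp : ∀ e < N 0, Function.update par f hn (mate e) = par (mate e) := by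
    intro e he
    rw [Function.update_of_ne]
    rintro rfl
    have := h.lvl_unique (by omega) (by omega) hf (h.mem_zero.mpr (hm.lt e he))
    omega
  have hA : ∀ e < N 0, anc (Function.update par f hn) i e =
      if i = k + 1 ∧ anc par k e = f then hn else anc par i e := fun e he =>
    h.update_anc hk hf hh hpar hi he
  unfold cnt
  split_ifs with h1 h2
  · obtain ⟨rfl, rfl⟩ := h1
    rw [← Finset.card_sdiff_of_subset]
    · congr 1
      ext e
      simp only [Finset.mem_filter, Finset.mem_range, Finset.mem_sdiff]
      constructor
      · rintro ⟨he, hg, hj⟩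
        rw [hA e he] at hg
        rw [hp e he] at hj
        split_ifs at hg with hc
        · exact absurd hg hne
        · exact ⟨⟨he, hg, hj⟩, fun hcc => hc ⟨rfl, hcc.2.1⟩⟩
      · rintro ⟨⟨he, hg, hj⟩, hnot⟩
        rw [hA e he, hp e he, if_neg]
        · exact ⟨he, hg, hj⟩
        · exact fun hc => hnot ⟨he, hc.2, hj⟩
    · intro e
      simp only [Finset.mem_filter, Finset.mem_range]
      rintro ⟨he, hg, hj⟩
      exact ⟨he, by rw [anc_succ, hg], hj⟩
  · obtain ⟨rfl, rfl⟩ := h2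
    rw [← Finset.card_union_of_disjoint]
    · congr 1
      ext e
      simp only [Finset.mem_filter, Finset.mem_range, Finset.mem_union]
      constructor
      · rintro ⟨he, hg, hj⟩
        rw [hA e he] at hg
        rw [hp e he] at hj
        split_ifs at hg with hc
        · exact Or.inr ⟨he, hc.2, hj⟩
        · exact Or.inl ⟨he, hg, hj⟩
      · rintro (⟨he, hg, hj⟩ | ⟨he, hg, hj⟩)
        · rw [hA e he, hp e he]
          refine ⟨he, ?_, hj⟩
          split_ifs
          · rfl
          · exact hg
        · rw [hA e he, hp e he]
          exact ⟨he, if_pos ⟨rfl, hg⟩, hj⟩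
    · rw [Finset.disjoint_left]
      intro e
      simp only [Finset.mem_filter, Finset.mem_range]
      rintro ⟨he, hg, hj⟩ ⟨-, hg', -⟩
      rw [anc_succ, hg'] at hg
      exact hne hg.symm
  · congr 1
    refine Finset.filter_congr fun e he => ?_
    rw [Finset.mem_range] at he
    rw [hA e he, hp e he]
    by_cases hc : i = k + 1 ∧ anc par k e = f
    · rw [if_pos hc]
      have h3 : hn ≠ G := fun h => h2 ⟨hc.1, h.symm⟩
      have h4 : anc par i e ≠ G := by
        intro h
        rw [hc.1, anc_succ, hc.2] at h
        exact h1 ⟨hc.1, h.symm⟩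
      simp [h3, h4]
    · rw [if_neg hc]

/-- Moving an arc `f` from its block to the block `hn`. -/
theorem cnt_update_arc (h : Lev K base N par) (hm : IsMate (N 0) mate) {f hn : ℕ} (hK : 1 ≤ K)
    (hf : f < N 0) (hh : hn ∈ Nd base N 1)
    (hpar : 1 < K → par hn = par (par f)) {i : ℕ} (hi1 : 1 ≤ i) (hi : i ≤ K) (G j : ℕ) :
    cnt (N 0) mate (Function.update par f hn) i G j +
        (if i = 1 ∧ G = par f ∧ N 0 + j = par (mate f) then 1 else 0) +
        (if G = anc par i (mate f) ∧ N 0 + j = par f then 1 else 0) =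
      cnt (N 0) mate par i G j +
        (if i = 1 ∧ G = hn ∧ N 0 + j = par (mate f) then 1 else 0) +
        (if G = anc par i (mate f) ∧ N 0 + j = hn then 1 else 0) := by
  have hfm : f ∈ Nd base N 0 := h.mem_zero.mpr hf
  have hmf := hm.lt f hf
  have hmne := hm.ne f hf
  have hA : ∀ e < N 0, anc (Function.update par f hn) i e =
      if i = 1 ∧ e = f then hn else anc par i e := fun e he =>
    h.update_anc (by omega) hfm hh hpar hi he
  have hsum : ∀ q : ℕ → ℕ, cnt (N 0) mate q i G j =
      (if anc q i f = G ∧ q (mate f) = N 0 + j then 1 else 0) +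
      ((if anc q i (mate f) = G ∧ q f = N 0 + j then 1 else 0) +
      ∑ e ∈ ((Finset.range (N 0)).erase f).erase (mate f),
        if anc q i e = G ∧ q (mate e) = N 0 + j then 1 else 0) := by
    intro q
    unfold cnt
    rw [Finset.card_filter, ← Finset.add_sum_erase _ _ (Finset.mem_range.mpr hf),
      ← Finset.add_sum_erase _ _ (Finset.mem_erase.mpr ⟨hmne, Finset.mem_range.mpr hmf⟩),
      hm.invol f hf]
  rw [hsum, hsum]
  have hrest : ∑ e ∈ ((Finset.range (N 0)).erase f).erase (mate f),
        (if anc (Function.update par f hn) i e = G ∧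
          Function.update par f hn (mate e) = N 0 + j then 1 else 0) =
      ∑ e ∈ ((Finset.range (N 0)).erase f).erase (mate f),
        if anc par i e = G ∧ par (mate e) = N 0 + j then 1 else 0 := by
    refine Finset.sum_congr rfl fun e he => ?_
    simp only [Finset.mem_erase, Finset.mem_range] at he
    rw [hA e he.2.2, if_neg (fun hc : i = 1 ∧ e = f => he.2.1 hc.2), Function.update_of_ne]
    rintro hc
    exact he.1 (by rw [← hc, hm.invol e he.2.2])
  rw [hrest, hA f hf, hA _ hmf, Function.update_self, Function.update_of_ne hmne,
    if_neg (fun hc : i = 1 ∧ mate f = f => hmne hc.2)]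
  have h1 : (if i = 1 ∧ f = f then hn else anc par i f) = if i = 1 then hn else anc par i f := by
    simp
  rw [h1]
  have e1 : (if anc par i (mate f) = G ∧ hn = N 0 + j then 1 else 0) =
      if G = anc par i (mate f) ∧ N 0 + j = hn then 1 else 0 := by
    simp only [eq_comm]
  have e2 : (if anc par i (mate f) = G ∧ par f = N 0 + j then 1 else 0) =
      if G = anc par i (mate f) ∧ N 0 + j = par f then 1 else 0 := by
    simp only [eq_comm]
  rw [e1, e2]
  have e3 : (if (if i = 1 then hn else anc par i f) = G ∧ par (mate f) = N 0 + j then 1 else 0) +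
        (if i = 1 ∧ G = par f ∧ N 0 + j = par (mate f) then 1 else 0) =
      (if anc par i f = G ∧ par (mate f) = N 0 + j then 1 else 0) +
        (if i = 1 ∧ G = hn ∧ N 0 + j = par (mate f) then 1 else 0) := by
    by_cases hi' : i = 1
    · subst hi'
      have : anc par 1 f = par f := rfl
      rw [this]
      simp only [if_true, true_and]
      by_cases hj : par (mate f) = N 0 + j
      · simp only [hj, and_true, eq_comm]
        split_ifs <;> omega
      · have hj' : N 0 + j ≠ par (mate f) := fun h => hj h.symm
        simp [hj, hj']
    · simp [hi']
  omega

theorem cnt_eq_sum (h : Lev K base N par) {k : ℕ} (hk : k < K) (G j : ℕ) :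
    cnt (N 0) mate par (k + 1) G j =
      ∑ c ∈ (Nd base N k).filter fun c => par c = G, cnt (N 0) mate par k c j := by
  unfold cnt
  rw [← Finset.card_biUnion]
  · congr 1
    ext e
    simp only [Finset.mem_filter, Finset.mem_range, Finset.mem_biUnion]
    constructor
    · rintro ⟨he, hg, hj⟩
      exact ⟨anc par k e, ⟨h.anc_mem hk.le he, by rw [← anc_succ par, hg]⟩, he, rfl, hj⟩
    · rintro ⟨c, ⟨-, hc⟩, he, hg, hj⟩
      exact ⟨he, by rw [anc_succ, hg, hc], hj⟩
  · intro c _ c' _ hne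
    rw [Function.onFun, Finset.disjoint_left]
    intro e
    simp only [Finset.mem_filter, Finset.mem_range]
    rintro ⟨-, h1, -⟩ ⟨-, h2, -⟩
    exact hne (h1.symm.trans h2)

end Lev

namespace Inv

variable {K : ℕ} {base N nxt par la fa : ℕ → ℕ} {rk : ℕ → ℕ → ℕ}
variable {M : ℕ} {T : Equiv.Perm (Fin M)}

/-- Adding up the rows of the groups in the cycle of the arc `a`. -/
theorem sum_cnt_cycle (h : Inv K base N nxt par la fa rk) (hM : N 0 = M) (hT : ActsAs nxt T)
    {k : ℕ} (hk : k ≤ K) (a : Fin M) (mate : ℕ → ℕ) (j : ℕ) :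
    ∑ t ∈ Finset.range (Function.minimalPeriod nxt (anc par k a)),
      cnt M mate par k (nxt^[t] (anc par k a)) j =
    ((Finset.univ : Finset (Fin M)).filter fun e : Fin M =>
      T.SameCycle a e ∧ par (mate e) = M + j).card := by
  classical
  have haM : (a : ℕ) < N 0 := by rw [hM]; exact a.2
  have hpos := h.minimalPeriod_pos hk (h.anc_mem hk haM)
  have hc : ∀ G, cnt M mate par k G j = ((Finset.univ : Finset (Fin M)).filter fun e : Fin M =>
      anc par k e = G ∧ par (mate e) = M + j).card := by
    intro G
    unfold cnt
    rw [← Finset.card_map Fin.valEmbedding]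
    congr 1
    ext e
    simp only [Finset.mem_filter, Finset.mem_range, Finset.mem_map, Finset.mem_univ, true_and,
      Fin.valEmbedding_apply]
    constructor
    · rintro ⟨he, h2⟩
      exact ⟨⟨e, he⟩, h2, rfl⟩
    · rintro ⟨e', h2, rfl⟩
      exact ⟨e'.2, h2⟩
  simp only [hc]
  rw [← Finset.card_biUnion]
  · congr 1
    ext e
    simp only [Finset.mem_biUnion, Finset.mem_range, Finset.mem_filter, Finset.mem_univ, true_and,
      h.sameCycle_iff hM hT hk a e]
    constructor
    · rintro ⟨t, -, he, hj⟩
      exact ⟨⟨t, he.symm⟩, hj⟩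
    · rintro ⟨⟨t, he⟩, hj⟩
      refine ⟨t % Function.minimalPeriod nxt (anc par k a), Nat.mod_lt _ hpos, ?_, hj⟩
      rw [Function.iterate_mod_minimalPeriod_eq, he]
  · intro t ht t' ht' hne
    rw [Function.onFun, Finset.disjoint_left]
    intro e
    simp only [Finset.mem_filter, Finset.mem_univ, true_and]
    rintro ⟨h1, -⟩ ⟨h2, -⟩
    exact hne (Function.iterate_injOn_Iio_minimalPeriod (f := nxt) (x := anc par k a)
      (by simpa using ht) (by simpa using ht') (h1.symm.trans h2))

end Inv

end FlipRepair

namespace FlipRepair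

/-! ### Parameters of the data structure -/

/-- The number of arcs, the block size, and the number of levels above the blocks. -/
structure Ctx where
  M : ℕ
  B : ℕ
  L : ℕ

namespace Ctx

variable (x : Ctx)

/-- The number of blocks after a rebuild is at most `P`. -/
def P : ℕ := 2 ^ x.L

/-- The top level. -/
def K : ℕ := x.L + 1

/-- The first node of level `k`. -/
def base (k : ℕ) : ℕ := if k = 0 then 0 else x.M + 20 * (2 ^ x.L - 2 ^ (x.K - k))

/-- The bounds of the machine fit the parameters. -/
structure Ok (l : Lim) : Prop where
  M_two : 2 ≤ x.M
  B_pos : 1 ≤ x.B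
  M_le : x.M ≤ x.P * x.B
  P_le : x.P ≤ 2 * x.M
  D_eq : l.D = 50 * x.M
  Z_eq : l.Z = x.M + 200 * (x.P * x.P)
  W_le : l.D + 16 * l.Z + 10 * x.B ≤ l.W

theorem P_pos : 0 < x.P := Nat.two_pow_pos _

theorem base_zero : x.base 0 = 0 := rfl

theorem base_one : x.base 1 = x.M := by simp [base, K]

theorem base_ge {k : ℕ} (hk : 1 ≤ k) : x.M ≤ x.base k := by
  rw [base, if_neg (by omega)]
  omega

theorem base_succ {k : ℕ} (hk : 1 ≤ k) (hK : k < x.K) :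
    x.base (k + 1) = x.base k + 10 * 2 ^ (x.K - k) := by
  unfold K at *
  rw [base, base, if_neg (by omega), if_neg (by omega)]
  unfold K at *
  have h1 : 2 ^ (x.L + 1 - k) = 2 * 2 ^ (x.L + 1 - (k + 1)) := by
    rw [← pow_succ']
    congr 1
    omega
  have h2 : 2 ^ (x.L + 1 - k) ≤ 2 ^ x.L := Nat.pow_le_pow_right (by omega) (by omega)
  omega

theorem base_add_le {k : ℕ} (hk : 1 ≤ k) :
    x.base k + 10 * 2 ^ (x.K - k) ≤ x.M + 20 * x.P := by
  rw [base, if_neg (by omega), P]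
  have h2 : 2 ^ (x.K - k) ≤ 2 ^ x.L := Nat.pow_le_pow_right (by omega) (by simp only [K]; omega)
  omega

theorem two_pow_le {k : ℕ} (hk : 1 ≤ k) : 2 ^ (x.K - k) ≤ x.P :=
  Nat.pow_le_pow_right (by omega) (by simp only [K]; omega)

/-- Index of the entry in row `G` and column `j` of the matrix. -/
def ix (G j : ℕ) : ℕ := (G - x.M) * (10 * x.P) + j

variable {x}

theorem ix_lt {l : Lim} (hx : x.Ok l) {G j : ℕ} (hG : G < x.M + 20 * x.P) (hj : j < 10 * x.P) :
    x.ix G j < l.Z := by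
  have hP := x.P_pos
  have h1 : (G - x.M + 1) * (10 * x.P) ≤ 20 * x.P * (10 * x.P) :=
    Nat.mul_le_mul_right _ (by omega)
  rw [hx.Z_eq, ix]
  have h2 : 20 * x.P * (10 * x.P) = 200 * (x.P * x.P) := by ring
  have h3 : (G - x.M + 1) * (10 * x.P) = (G - x.M) * (10 * x.P) + 10 * x.P := by ring
  omega

theorem ix_inj {G G' j j' : ℕ} (hG : x.M ≤ G) (hG' : x.M ≤ G') (hj : j < 10 * x.P)
    (hj' : j' < 10 * x.P) (h : x.ix G j = x.ix G' j') : G = G' ∧ j = j' := by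
  unfold ix at h
  have h1 : G - x.M = G' - x.M := by
    have e1 : ((G - x.M) * (10 * x.P) + j) / (10 * x.P) = G - x.M := by
      rw [Nat.div_eq_iff (by omega)]
      constructor <;> omega
    have e2 : ((G' - x.M) * (10 * x.P) + j') / (10 * x.P) = G' - x.M := by
      rw [Nat.div_eq_iff (by omega)]
      constructor <;> omega
    rw [← e1, ← e2, h]
  rw [h1] at h
  exact ⟨by omega, by omega⟩

theorem Ok.Z_ge {l : Lim} (hx : x.Ok l) : x.M + 20 * x.P ≤ l.Z := by
  have := x.P_pos
  have : x.P * 1 ≤ x.P * x.P := Nat.mul_le_mul_left _ this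
  rw [hx.Z_eq]
  omega

theorem Ok.node_lt {l : Lim} (hx : x.Ok l) {G : ℕ} (hG : G < x.M + 20 * x.P) :
    G < l.D ∧ G < l.Z := by
  have := hx.Z_ge
  have := hx.P_le
  rw [hx.D_eq]
  omega

theorem Ok.W_ge {l : Lim} (hx : x.Ok l) :
    50 * x.M + 16 * (x.M + 200 * (x.P * x.P)) + 10 * x.B ≤ l.W := by
  have := hx.W_le
  rwa [hx.D_eq, hx.Z_eq] at this

end Ctx

/-- The variables that hold the parameters. -/
structure Cst (x : Ctx) (h : HS) : Prop where
  M : h.v 1 = x.M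
  B : h.v 2 = x.B
  P : h.v 3 = x.P
  Kc : h.v 4 = 10 * x.P

theorem Cst.of_fr {x : Ctx} {c : HC} {h h' : HS} (hc : Cst x h) (hf : Fr c h h')
    (hw : 1 ∉ c.wv ∧ 2 ∉ c.wv ∧ 3 ∉ c.wv ∧ 4 ∉ c.wv) : Cst x h' :=
  ⟨(hf.v 1 hw.1).trans hc.M, (hf.v 2 hw.2.1).trans hc.B, (hf.v 3 hw.2.2.1).trans hc.P,
    (hf.v 4 hw.2.2.2).trans hc.Kc⟩

attribute [simp] wp_seq wp_asg wp_put wp_ite wp_skip Exp.eval Exp.ok Exp.cost Op.eval adrCost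
  Lim.bd

/-! ### Operations on the rows of the matrix -/

/-- Index of the matrix entry in the row and column given by two variables. -/
def eix (g j : ℕ) : Exp := (.v g -~ .v 1) *~ .v 4 +~ .v j

theorem eix_eval {x : Ctx} {h : HS} (hc : Cst x h) (g j : ℕ) :
    (eix g j).eval h = x.ix (h.v g) (h.v j) := by
  simp [eix, Ctx.ix, hc.M, hc.Kc]

theorem eix_ok {x : Ctx} {l : Lim} (hx : x.Ok l) {h : HS} (hc : Cst x h) {g j : ℕ} (hg : g < 50)
    (hj : j < 50) (hG : h.v g < x.M + 20 * x.P) (hJ : h.v j < 10 * x.P) : (eix g j).ok l h := by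
  have h1 := Ctx.ix_lt hx hG hJ
  have h2 := hx.W_le
  unfold Ctx.ix at h1
  have h3 := hx.Z_ge
  have := hx.D_eq
  simp only [eix, Exp.ok, Exp.eval, Op.eval, hc.M, hc.Kc]
  refine ⟨⟨⟨hg, by norm_num, ?_⟩, by norm_num, ?_⟩, hj, ?_⟩ <;> omega

@[simp] theorem eix_cost (g j : ℕ) : (eix g j).cost = 13 := by simp [eix]

/-- Set the entries of row `g` to zero. -/
def rowZero (g : ℕ) : HC := .for 18 19 (.put 4 (eix g 18) (.c 0))

/-- Move the entries of row `f` from row `g` to row `h`. -/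
def rowMove (f g h : ℕ) : HC :=
  .for 18 19 (.put 4 (eix g 18) (.get 4 (eix g 18) -~ .get 4 (eix f 18)) ;;
    .put 4 (eix h 18) (.get 4 (eix h 18) +~ .get 4 (eix f 18)))

variable {x : Ctx} {l : Lim}

theorem rowZero_spec (hx : x.Ok l) {h : HS} (hc : Cst x h) {g : ℕ} (hg : g < 50)
    (hg1 : g ≠ 18) (hG : x.M ≤ h.v g) (hG' : h.v g < x.M + 20 * x.P)
    (hnb : h.v 19 ≤ 10 * x.P) :
    wp l (rowZero g) h fun h' k => k ≤ 500 * x.P ∧ Fr (rowZero g) h h' ∧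
      ∀ G j, x.M ≤ G → j < 10 * x.P → h'.a 4 (x.ix G j) =
        if G = h.v g ∧ j < h.v 19 then 0 else h.a 4 (x.ix G j) := by
  have hW := hx.W_ge
  have hP := x.P_pos
  have hPM := hx.P_le
  have := wp_for (l := l) (i := 18) (b := 19) (c := .put 4 (eix g 18) (.c 0)) (h := h)
    (I := fun i h' => ∀ G j, x.M ≤ G → j < 10 * x.P → h'.a 4 (x.ix G j) =
        if G = h.v g ∧ j < i then 0 else h.a 4 (x.ix G j)) (C := 27) (n := h.v 19)
    (by norm_num) (by norm_num) (by norm_num) (by simp [HC.wv]) (by simp [HC.wv]) rfl (by omega)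
    (by simp) ?_
  · refine this.frame fun h' k ⟨hk, _, hI⟩ hF => ⟨?_, hF, hI⟩
    have : h.v 19 * (27 + 15) ≤ 10 * x.P * (27 + 15) := Nat.mul_le_mul_right _ hnb
    omega
  · intro j h' hj hv hI hF
    have hc' := hc.of_fr hF (by simp [HC.for, HC.wv])
    have hvg : h'.v g = h.v g := hF.v g (by simp [HC.for, HC.wv, hg1])
    have hi : x.ix (h'.v g) j < l.Z := Ctx.ix_lt hx (by omega) (by omega)
    refine ⟨by norm_num, eix_ok hx hc' hg (by norm_num) (by omega) (by omega), ?_, ?_, ?_, ?_⟩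
    · rw [eix_eval hc', hv]
      exact hi
    · simp
    · simp
    · intro G j' hG hj'
      rw [eix_eval hc', hv, hvg]
      simp only [HS.set_a, HS.put_a_same, Exp.eval, Function.update_apply]
      rw [hI G j' hG hj']
      by_cases h1 : x.ix G j' = x.ix (h.v g) j
      · obtain ⟨h2, h3⟩ := Ctx.ix_inj hG (by omega) hj' (by omega) h1
        simp [h2, h3]
      · rw [if_neg h1]
        by_cases h2 : G = h.v g
        · have : j' ≠ j := fun hc => h1 (by rw [h2, hc])
          simp only [h2, true_and]
          congr 1
          simp only [eq_iff_iff]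
          omega
        · simp [h2]

theorem rowMove_spec (hx : x.Ok l) {h : HS} (hc : Cst x h) {f g hn : ℕ} (hf : f < 50)
    (hg : g < 50) (hh : hn < 50) (hf1 : f ≠ 18) (hg1 : g ≠ 18) (hh1 : hn ≠ 18)
    (hF : x.M ≤ h.v f) (hF' : h.v f < x.M + 20 * x.P)
    (hG : x.M ≤ h.v g) (hG' : h.v g < x.M + 20 * x.P)
    (hH : x.M ≤ h.v hn) (hH' : h.v hn < x.M + 20 * x.P)
    (hfg : h.v f ≠ h.v g) (hgh : h.v g ≠ h.v hn)
    (hnb : h.v 19 ≤ 10 * x.P)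
    (hV : ∀ j < h.v 19, h.a 4 (x.ix (h.v hn) j) + h.a 4 (x.ix (h.v f) j) ≤ 2 * x.M ∧
      h.a 4 (x.ix (h.v g) j) ≤ 2 * x.M) :
    wp l (rowMove f g hn) h fun h' k => k ≤ 2000 * x.P ∧ Fr (rowMove f g hn) h h' ∧
      ∀ G j, x.M ≤ G → j < 10 * x.P → h'.a 4 (x.ix G j) =
        if G = h.v g ∧ j < h.v 19 then h.a 4 (x.ix G j) - h.a 4 (x.ix (h.v f) j)
        else if G = h.v hn ∧ j < h.v 19 then h.a 4 (x.ix G j) + h.a 4 (x.ix (h.v f) j)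
        else h.a 4 (x.ix G j) := by
  have hW := hx.W_ge
  have hP := x.P_pos
  have hPM := hx.P_le
  have := wp_for (l := l) (i := 18) (b := 19) (c := (.put 4 (eix g 18)
    (.get 4 (eix g 18) -~ .get 4 (eix f 18)) ;;
    .put 4 (eix hn 18) (.get 4 (eix hn 18) +~ .get 4 (eix f 18)))) (h := h)
    (I := fun i h' => ∀ G j, x.M ≤ G → j < 10 * x.P → h'.a 4 (x.ix G j) =
        if G = h.v g ∧ j < i then h.a 4 (x.ix G j) - h.a 4 (x.ix (h.v f) j)
        else if G = h.v hn ∧ j < i then h.a 4 (x.ix G j) + h.a 4 (x.ix (h.v f) j)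
        else h.a 4 (x.ix G j)) (C := 160) (n := h.v 19)
    (by norm_num) (by norm_num) (by norm_num) (by simp [HC.wv]) (by simp [HC.wv]) rfl (by omega)
    (by simp) ?_
  · refine this.frame fun h' k ⟨hk, _, hI⟩ hF => ⟨?_, hF, hI⟩
    have : h.v 19 * (160 + 15) ≤ 10 * x.P * (160 + 15) := Nat.mul_le_mul_right _ hnb
    omega
  · intro j h' hj hv hI hFr
    have hc' := hc.of_fr hFr (by simp [HC.for, HC.wv])
    have hvg : h'.v g = h.v g := hFr.v g (by simp [HC.for, HC.wv, hg1])
    have hvf : h'.v f = h.v f := hFr.v f (by simp [HC.for, HC.wv, hf1])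
    have hvh : h'.v hn = h.v hn := hFr.v hn (by simp [HC.for, HC.wv, hh1])
    have hj' : j < 10 * x.P := by omega
    have ig : x.ix (h.v g) j < l.Z := Ctx.ix_lt hx (by omega) (by omega)
    have iff' : x.ix (h.v f) j < l.Z := Ctx.ix_lt hx (by omega) (by omega)
    have ih : x.ix (h.v hn) j < l.Z := Ctx.ix_lt hx (by omega) (by omega)
    have og : (eix g 18).ok l h' := eix_ok hx hc' hg (by norm_num) (by omega) (by omega)
    have of : (eix f 18).ok l h' := eix_ok hx hc' hf (by norm_num) (by omega) (by omega)
    have oh : (eix hn 18).ok l h' := eix_ok hx hc' hh (by norm_num) (by omega) (by omega)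
    have Ig := hI (h.v g) j hG hj'
    have If := hI (h.v f) j hF hj'
    have Ih := hI (h.v hn) j hH hj'
    simp only [lt_irrefl, and_false, if_false] at Ig If Ih
    obtain ⟨V1, V2⟩ := hV j hj
    have eg : (eix g 18).eval h' = x.ix (h.v g) j := by rw [eix_eval hc', hv, hvg]
    have ef : (eix f 18).eval h' = x.ix (h.v f) j := by rw [eix_eval hc', hv, hvf]
    set y := h'.put 4 (x.ix (h.v g) j) (h.a 4 (x.ix (h.v g) j) - h.a 4 (x.ix (h.v f) j)) with hy
    have hcy : Cst x y := ⟨hc'.M, hc'.B, hc'.P, hc'.Kc⟩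
    have ef' : (eix f 18).eval y = x.ix (h.v f) j := by
      rw [eix_eval hcy]; simp only [hy, HS.put_v]; rw [hv, hvf]
    have eh' : (eix hn 18).eval y = x.ix (h.v hn) j := by
      rw [eix_eval hcy]; simp only [hy, HS.put_v]; rw [hv, hvh]
    have of' : (eix f 18).ok l y := eix_ok hx hcy hf (by norm_num)
      (by simp only [hy, HS.put_v]; omega) (by simp only [hy, HS.put_v]; omega)
    have oh' : (eix hn 18).ok l y := eix_ok hx hcy hh (by norm_num)
      (by simp only [hy, HS.put_v]; omega) (by simp only [hy, HS.put_v]; omega)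
    have nfg : x.ix (h.v f) j ≠ x.ix (h.v g) j := fun h1 => hfg (Ctx.ix_inj hF hG hj' hj' h1).1
    have nhg : x.ix (h.v hn) j ≠ x.ix (h.v g) j := fun h1 =>
      hgh (Ctx.ix_inj hH hG hj' hj' h1).1.symm
    have yf : y.a 4 (x.ix (h.v f) j) = h.a 4 (x.ix (h.v f) j) := by
      simp only [hy, HS.put_a_same, Function.update_of_ne nfg]; exact If
    have yh : y.a 4 (x.ix (h.v hn) j) = h.a 4 (x.ix (h.v hn) j) := by
      simp only [hy, HS.put_a_same, Function.update_of_ne nhg]; exact Ih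
    simp only [wp_seq, wp_put, Exp.ok, Exp.eval, Op.eval, eg, ef, Ig, If, ← hy, eh', ef', yf, yh,
      Lim.bd_pos l 4 (by norm_num)]
    refine ⟨by norm_num, og, ig, ⟨⟨by norm_num, og, ig⟩, ⟨by norm_num, of, iff'⟩, by omega⟩,
      by norm_num, oh', ih, ⟨⟨by norm_num, oh', ih⟩, ⟨by norm_num, of', iff'⟩, by omega⟩, ?_, ?_⟩
    · simp
    · intro G j' hG2 hj2
      simp only [HS.set_a, HS.put_a_same, Function.update_apply]
      by_cases h1 : x.ix G j' = x.ix (h.v hn) j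
      · obtain ⟨h2, h3⟩ := Ctx.ix_inj hG2 hH hj2 hj' h1
        subst h2 h3
        simp [hgh.symm]
      · rw [if_neg h1]
        simp only [hy, HS.put_a_same, Function.update_apply]
        by_cases h4 : x.ix G j' = x.ix (h.v g) j
        · obtain ⟨h2, h3⟩ := Ctx.ix_inj hG2 hG hj2 hj' h4
          subst h2 h3
          simp
        · rw [if_neg h4, hI G j' hG2 hj2]
          have e1 : (G = h.v g ∧ j' < j + 1) ↔ (G = h.v g ∧ j' < j) := by
            constructor
            · rintro ⟨h5, h6⟩
              exact ⟨h5, lt_of_le_of_ne (by omega) fun hc => h4 (by rw [h5, hc])⟩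
            · rintro ⟨h5, h6⟩
              exact ⟨h5, by omega⟩
          have e2 : (G = h.v hn ∧ j' < j + 1) ↔ (G = h.v hn ∧ j' < j) := by
            constructor
            · rintro ⟨h5, h6⟩
              exact ⟨h5, lt_of_le_of_ne (by omega) fun hc => h1 (by rw [h5, hc])⟩
            · rintro ⟨h5, h6⟩
              exact ⟨h5, by omega⟩
          simp only [e1, e2]

end FlipRepair

namespace FlipRepair

variable {x : Ctx} {l : Lim}

/-- Sizes of the levels. -/
structure Sizes (x : Ctx) (N : ℕ → ℕ) : Prop where
  zero : N 0 = x.M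
  cap : ∀ k, 1 ≤ k → k ≤ x.K → N k ≤ 10 * 2 ^ (x.K - k)

theorem Sizes.node {N : ℕ → ℕ} (hN : Sizes x N) {k G : ℕ} (hk : 1 ≤ k) (hK : k ≤ x.K)
    (hG : G ∈ Nd x.base N k) : x.M ≤ G ∧ G < x.M + 20 * x.P := by
  rw [mem_Nd] at hG
  have h1 := x.base_ge hk
  have h2 := hN.cap k hk hK
  have h3 := x.base_add_le hk
  omega

theorem Sizes.one {N : ℕ → ℕ} (hN : Sizes x N) : N 1 ≤ 10 * x.P := by
  have := hN.cap 1 le_rfl (by simp [Ctx.K])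
  simpa [Ctx.K, Ctx.P] using this

theorem Sizes.block {N : ℕ → ℕ} (_hN : Sizes x N) {G : ℕ} (hG : G ∈ Nd x.base N 1) :
    x.M ≤ G ∧ G - x.M < N 1 := by
  rw [mem_Nd, x.base_one] at hG
  omega

/-- The matrix counts, for every group and every block, the arcs of the group with mates in the
block. -/
def VOk (x : Ctx) (N par mate Va : ℕ → ℕ) : Prop :=
  ∀ k, 1 ≤ k → k ≤ x.K → ∀ G ∈ Nd x.base N k, ∀ j < N 1,
    Va (x.ix G j) = cnt x.M mate par k G j

/-- Move the child `13` (a group) of the group `11` to the group `12`. -/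
def moveRow : HC := .put 1 (.v 13) (.v 12) ;; rowMove 13 11 12

theorem moveRow_spec (hx : x.Ok l) {h : HS} (hc : Cst x h) {N : ℕ → ℕ} (hN : Sizes x N)
    (hlev : Lev x.K x.base N (h.a 1)) (hm : IsMate x.M (h.a 7))
    (hV : VOk x N (h.a 1) (h.a 7) (h.a 4)) {k : ℕ} (hk1 : 1 ≤ k) (hk : k < x.K)
    (hf : h.v 13 ∈ Nd x.base N k) (hg : h.a 1 (h.v 13) = h.v 11)
    (hh : h.v 12 ∈ Nd x.base N (k + 1)) (hne : h.v 12 ≠ h.v 11)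
    (hpar : k + 1 < x.K → h.a 1 (h.v 12) = h.a 1 (h.v 11)) (hnb : h.v 19 = N 1) :
    wp l moveRow h fun h' t => t ≤ 2020 * x.P ∧ Fr moveRow h h' ∧
      h'.a 1 = Function.update (h.a 1) (h.v 13) (h.v 12) ∧
      VOk x N (h'.a 1) (h.a 7) (h'.a 4) := by
  have hP := x.P_pos
  have hgm := hlev.par_mem k hk _ hf
  rw [hg] at hgm
  obtain ⟨f1, f2⟩ := hN.node hk1 (by omega) hf
  obtain ⟨g1, g2⟩ := hN.node (by omega) (by omega) hgm
  obtain ⟨n1, n2⟩ := hN.node (by omega) (by omega) hh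
  have hone := hN.one
  have hnz := hx.node_lt f2
  have hfl : ∀ {y}, y ∈ Nd x.base N (k + 1) → h.v 13 ≠ y := by
    rintro y hy rfl
    have := hlev.lvl_unique (by omega) (by omega) hf hy
    omega
  have hcnt : ∀ k, 1 ≤ k → k ≤ x.K → ∀ G ∈ Nd x.base N k, ∀ j < N 1,
      h.a 4 (x.ix G j) ≤ x.M := by
    intro k h1 h2 G hG j hj
    rw [hV k h1 h2 G hG j hj]
    exact cnt_le _ _ _ _ _ _
  set y := h.put 1 (h.v 13) (h.v 12) with hy
  have hcy : Cst x y := ⟨hc.M, hc.B, hc.P, hc.Kc⟩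
  have ya : y.a 4 = h.a 4 := by simp [hy]
  have key := rowMove_spec hx hcy (f := 13) (g := 11) (hn := 12) (by norm_num) (by norm_num)
    (by norm_num) (by norm_num) (by norm_num) (by norm_num) f1 f2 g1 g2 n1 n2 (hfl hgm)
    hne.symm (by simp only [hy, HS.put_v]; omega) (by
      intro j hj
      simp only [hy, HS.put_v] at hj
      rw [hnb] at hj
      rw [ya]
      have a1 := hcnt (k + 1) (by omega) (by omega) _ hh j hj
      have a2 := hcnt (k + 1) (by omega) (by omega) _ hgm j hj
      have a3 := hcnt k (by omega) (by omega) _ hf j hj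
      simp only [hy, HS.put_v]
      omega)
  unfold moveRow
  rw [wp_seq, wp_put]
  simp only [Exp.ok, Exp.eval, Lim.bd_pos l 1 (by norm_num)]
  refine ⟨by norm_num, by norm_num, hnz.2, by norm_num, ?_⟩
  refine key.mono fun h' t ⟨ht, hF, hV'⟩ => ⟨?_, ?_, ?_, ?_⟩
  · simp
    omega
  · refine Fr.trans (h₂ := y) ⟨fun _ _ => rfl, fun k hk => ?_⟩
      (hF.sub (by simp +contextual [HC.wv]) (by simp +contextual [HC.wa]))
    simp only [HC.wa, List.mem_append, List.mem_singleton, not_or] at hk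
    simp [hy, hk.1]
  · rw [hF.a 1 (by simp [rowMove, HC.for, HC.wa])]
    simp [hy]
  · have e1 : h'.a 1 = Function.update (h.a 1) (h.v 13) (h.v 12) := by
      rw [hF.a 1 (by simp [rowMove, HC.for, HC.wa])]
      simp [hy]
    rw [e1]
    intro i hi hiK G hG j hj
    have hGn := hN.node hi hiK hG
    have hu := hlev.cnt_update (mate := h.a 7) (by rw [hN.zero]; exact hm) hk hk1 hf hh
      (by rw [hg]; exact hne) (by rw [hg]; exact hpar) hiK G j
    rw [hN.zero, hg] at hu
    rw [hu, hV' G j hGn.1 (by omega), ya]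
    simp only [hy, HS.put_v]
    have c1 : (G = h.v 11 ∧ j < h.v 19) ↔ (i = k + 1 ∧ G = h.v 11) := by
      constructor
      · rintro ⟨rfl, -⟩
        exact ⟨hlev.lvl_unique (by omega) (by omega) hG hgm, rfl⟩
      · rintro ⟨-, rfl⟩
        exact ⟨rfl, by omega⟩
    have c2 : (G = h.v 12 ∧ j < h.v 19) ↔ (i = k + 1 ∧ G = h.v 12) := by
      constructor
      · rintro ⟨rfl, -⟩
        exact ⟨hlev.lvl_unique (by omega) (by omega) hG hh, rfl⟩
      · rintro ⟨-, rfl⟩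
        exact ⟨rfl, by omega⟩
    simp only [c1, c2]
    rw [hV i hi hiK G hG j hj, hV k hk1 hk.le _ hf j hj]

/-- Add one to the entry in column `31` and subtract one from the entry in column `30`, in the
rows of all ancestors of the node `16`. -/
def climb : HC :=
  .asg 15 (.v 3) ;;
  .loop (.v 15) (
    .put 4 (eix 16 30) (.get 4 (eix 16 30) -~ .c 1) ;;
    .put 4 (eix 16 31) (.get 4 (eix 16 31) +~ .c 1) ;;
    .asg 16 (.get 1 (.v 16)) ;;
    .asg 15 (.v 15 /~ .c 2))

theorem two_pow_sub_div {K s : ℕ} (hs : s < K) : 2 ^ (K - s) / 2 = 2 ^ (K - (s + 1)) := by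
  have : 2 ^ (K - s) = 2 ^ (K - (s + 1)) * 2 := by
    rw [← pow_succ]
    congr 1
    omega
  rw [this, Nat.mul_div_cancel _ (by norm_num)]

/-- The counter of a loop over the levels, after `s` rounds. -/
def lvlCtr (K s : ℕ) : ℕ := if s < K then 2 ^ (K - (s + 1)) else 0

theorem lvlCtr_zero : lvlCtr x.K 0 = x.P := by simp [lvlCtr, Ctx.K, Ctx.P]

theorem lvlCtr_div {K s : ℕ} (hs : s < K) : lvlCtr K s / 2 = lvlCtr K (s + 1) := by
  unfold lvlCtr
  rw [if_pos hs]
  split_ifs with h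
  · exact two_pow_sub_div h
  · have : K - (s + 1) = 0 := by omega
    simp [this]

theorem lvlCtr_ne {K s : ℕ} : lvlCtr K s ≠ 0 ↔ s < K := by
  unfold lvlCtr
  split_ifs with h
  · have := Nat.two_pow_pos (K - (s + 1))
    simp [h]
  · simp [h]

theorem lvlCtr_le (s : ℕ) : lvlCtr x.K s ≤ x.P := by
  unfold lvlCtr
  split_ifs with h
  · exact x.two_pow_le (by omega)
  · omega

theorem climb_spec (hx : x.Ok l) {h : HS} (hc : Cst x h) {N : ℕ → ℕ} (hN : Sizes x N)
    (hlev : Lev x.K x.base N (h.a 1)) {m : ℕ} (hm : m < x.M) (h16 : h.v 16 = h.a 1 m)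
    {jg jh : ℕ} (h30 : h.v 30 = jg) (h31 : h.v 31 = jh) (hjg : jg < N 1) (hjh : jh < N 1)
    (hj : jg ≠ jh)
    (hV : ∀ k, 1 ≤ k → k ≤ x.K → 1 ≤ h.a 4 (x.ix (anc (h.a 1) k m) jg) ∧
      h.a 4 (x.ix (anc (h.a 1) k m) jg) ≤ 2 * x.M ∧
      h.a 4 (x.ix (anc (h.a 1) k m) jh) ≤ 2 * x.M) :
    wp l climb h fun h' t => t ≤ 140 * x.K + 20 ∧ Fr climb h h' ∧
      ∀ k, 1 ≤ k → k ≤ x.K → ∀ G ∈ Nd x.base N k, ∀ j < N 1,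
        h'.a 4 (x.ix G j) + (if G = anc (h.a 1) k m ∧ j = jg then 1 else 0) =
          h.a 4 (x.ix G j) + (if G = anc (h.a 1) k m ∧ j = jh then 1 else 0) := by
  have hW := hx.W_ge
  have hP := x.P_pos
  have hPM := hx.P_le
  have hone := hN.one
  have hmN : m < N 0 := by rw [hN.zero]; exact hm
  have hanc : ∀ k, k ≤ x.K → anc (h.a 1) k m ∈ Nd x.base N k := fun k hk => hlev.anc_mem hk hmN
  unfold climb
  rw [wp_seq, wp_asg]
  refine ⟨by norm_num, by simp, ?_⟩
  have := wp_loop (l := l) (e := .v 15) (c :=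
    .put 4 (eix 16 30) (.get 4 (eix 16 30) -~ .c 1) ;;
    .put 4 (eix 16 31) (.get 4 (eix 16 31) +~ .c 1) ;;
    .asg 16 (.get 1 (.v 16)) ;; .asg 15 (.v 15 /~ .c 2)) (h := h.set 15 (h.v 3)) (C := 135)
    (m := x.K)
    (I := fun r h' => ∃ s, s + r = x.K ∧ h'.v 15 = lvlCtr x.K s ∧
      (s < x.K → h'.v 16 = anc (h.a 1) (s + 1) m) ∧
      ∀ k, 1 ≤ k → k ≤ x.K → ∀ G ∈ Nd x.base N k, ∀ j < N 1,
        h'.a 4 (x.ix G j) + (if k ≤ s ∧ G = anc (h.a 1) k m ∧ j = jg then 1 else 0) =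
          h.a 4 (x.ix G j) + (if k ≤ s ∧ G = anc (h.a 1) k m ∧ j = jh then 1 else 0)) ?_ ?_
  · refine this.mono fun h' t ⟨ht, hF, r, ⟨s, hs, h15, _, hI⟩, hz⟩ => ⟨?_, ?_, ?_⟩
    · simp only [Exp.cost] at *
      have : x.K * (135 + 1 + 2) = 138 * x.K := by ring
      omega
    · refine Fr.trans (h₂ := h.set 15 (h.v 3)) ⟨fun y hy => ?_, fun _ _ => rfl⟩
        (hF.sub (by simp +contextual [HC.wv]) (by simp +contextual [HC.wa]))
      simp only [HC.wv, List.mem_append, List.mem_singleton, not_or] at hy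
      simp [hy.1]
    · intro k hk hkK G hG j hj
      have hsK : ¬ s < x.K := by
        rw [← lvlCtr_ne, ← h15]
        simpa using hz
      have := hI k hk hkK G hG j hj
      simpa [show k ≤ s by omega] using this
  · refine ⟨0, by omega, ?_, ?_, ?_⟩
    · simp [hc.P, lvlCtr_zero]
    · intro _
      simp [h16, anc]
    · intro k hk _ G _ j _
      simp [show ¬ k ≤ 0 by omega]
  · intro r h' ⟨s, hs, h15, h16', hI⟩ hF
    refine ⟨by simp, fun hz => ?_⟩
    have hsK : s < x.K := by
      rw [← lvlCtr_ne, ← h15]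
      simpa using hz
    refine ⟨r - 1, by omega, ?_⟩
    have hc0 : Cst x (h.set 15 (h.v 3)) := ⟨by simp [hc.M], by simp [hc.B], by simp [hc.P],
      by simp [hc.Kc]⟩
    have hc' := hc0.of_fr hF (by simp [HC.wv])
    have v30 : h'.v 30 = jg := by rw [hF.v 30 (by simp [HC.wv])]; simp [h30]
    have v31 : h'.v 31 = jh := by rw [hF.v 31 (by simp [HC.wv])]; simp [h31]
    have a1 : h'.a 1 = h.a 1 := by rw [hF.a 1 (by simp [HC.wa])]; simp
    have hA := hanc (s + 1) (by omega)
    obtain ⟨b1, b2⟩ := hN.node (by omega) (by omega) hA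
    have v16 := h16' hsK
    set A := anc (h.a 1) (s + 1) m with hAdef
    have i30 : x.ix A jg < l.Z := Ctx.ix_lt hx b2 (by omega)
    have i31 : x.ix A jh < l.Z := Ctx.ix_lt hx b2 (by omega)
    have o30 : (eix 16 30).ok l h' :=
      eix_ok hx hc' (by norm_num) (by norm_num) (by omega) (by omega)
    have e30 : (eix 16 30).eval h' = x.ix A jg := by rw [eix_eval hc', v16, v30]
    have Ig := hI (s + 1) (by omega) (by omega) A hA jg hjg
    have Ih := hI (s + 1) (by omega) (by omega) A hA jh hjh
    simp only [show ¬ s + 1 ≤ s by omega, false_and, if_false, add_zero] at Ig Ih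
    obtain ⟨V1, V3, V2⟩ := hV (s + 1) (by omega) (by omega)
    rw [← hAdef] at V1 V2 V3
    set y := h'.put 4 (x.ix A jg) (h.a 4 (x.ix A jg) - 1) with hy
    have hcy : Cst x y := ⟨hc'.M, hc'.B, hc'.P, hc'.Kc⟩
    have o31 : (eix 16 31).ok l y :=
      eix_ok hx hcy (by norm_num) (by norm_num) (by simp only [hy, HS.put_v]; omega)
        (by simp only [hy, HS.put_v]; omega)
    have e31 : (eix 16 31).eval y = x.ix A jh := by
      rw [eix_eval hcy]; simp only [hy, HS.put_v]; rw [v16, v31]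
    have nij : x.ix A jh ≠ x.ix A jg := fun hc =>
      hj (Ctx.ix_inj b1 b1 (by omega) (by omega) hc).2.symm
    have y31 : y.a 4 (x.ix A jh) = h.a 4 (x.ix A jh) := by
      simp only [hy, HS.put_a_same, Function.update_of_ne nij]; exact Ih
    have hnl := hx.node_lt b2
    have hK1 : lvlCtr x.K s ≤ x.P := lvlCtr_le s
    simp only [wp_seq, wp_put, wp_asg, Exp.ok, Exp.eval, Op.eval, e30, Ig, ← hy, e31, y31,
      Lim.bd_pos l 4 (by norm_num), Lim.bd_pos l 1 (by norm_num)]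
    refine ⟨by norm_num, o30, i30, ⟨⟨by norm_num, o30, i30⟩, by omega, by omega⟩, by norm_num,
      o31, i31, ⟨⟨by norm_num, o31, i31⟩, by omega, by omega⟩, by norm_num, ⟨by norm_num,
      by norm_num, ?_⟩, by norm_num, ⟨by norm_num, by omega, ?_⟩, ?_, s + 1, by omega, ?_, ?_, ?_⟩
    · simp only [HS.put_v, hy, v16]
      exact hnl.2
    · simp only [HS.set_v, HS.put_v, hy, h15, show (15 : ℕ) ≠ 16 by norm_num, if_false]
      have := Nat.div_le_self (lvlCtr x.K s) 2
      omega
    · simp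
    · simp [hy, h15, lvlCtr_div hsK]
    · intro h1
      simp [hy, a1, v16, hAdef, anc_succ]
    · intro k hk hkK G hG j hj'
      obtain ⟨G1, G2⟩ := hN.node hk hkK hG
      have hII := hI k hk hkK G hG j hj'
      simp only [HS.set_a, HS.put_a_same, hy, Function.update_apply]
      by_cases hGA : G = A
      · have hks : k = s + 1 := by
          rw [hGA] at hG
          exact hlev.lvl_unique (by omega) (by omega) hG hA
        subst hks
        rw [hGA] at hII ⊢
        simp only [← hAdef, show ¬ s + 1 ≤ s by omega, false_and, if_false, add_zero] at hII
        simp only [← hAdef, le_refl, true_and]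
        by_cases h1 : j = jg
        · subst h1
          rw [if_neg nij.symm]
          simp [hj]
          omega
        · by_cases h2 : j = jh
          · subst h2
            simp [h1]
          · rw [if_neg fun hc => h2 (Ctx.ix_inj b1 b1 (by omega) (by omega) hc).2,
              if_neg fun hc => h1 (Ctx.ix_inj b1 b1 (by omega) (by omega) hc).2]
            simp [h1, h2, hII]
      · rw [if_neg fun hc => hGA (Ctx.ix_inj G1 b1 (by omega) (by omega) hc).1,
              if_neg fun hc => hGA (Ctx.ix_inj G1 b1 (by omega) (by omega) hc).1]
        have e1 : ∀ q : Prop, (k ≤ s + 1 ∧ G = anc (h.a 1) k m ∧ q) ↔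
            (k ≤ s ∧ G = anc (h.a 1) k m ∧ q) := by
          intro q
          constructor
          · rintro ⟨h1, h2, h3⟩
            refine ⟨?_, h2, h3⟩
            by_contra hc
            have : k = s + 1 := by omega
            subst this
            exact hGA h2
          · rintro ⟨h1, h2⟩
            exact ⟨by omega, h2⟩
        simp only [e1]
        exact hII

end FlipRepair

namespace FlipRepair

variable {x : Ctx} {l : Lim}

/-- Move the child `13` (an arc) of the group `11` to the group `12`. -/
def moveArc : HC :=
  .put 1 (.v 13) (.v 12) ;;
  .asg 16 (.get 1 (.get 7 (.v 13))) ;;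
  .asg 20 (.v 16 -~ .v 1) ;;
  .put 4 (eix 11 20) (.get 4 (eix 11 20) -~ .c 1) ;;
  .put 4 (eix 12 20) (.get 4 (eix 12 20) +~ .c 1) ;;
  .asg 30 (.v 11 -~ .v 1) ;;
  .asg 31 (.v 12 -~ .v 1) ;;
  climb

theorem Ctx.K_pos : 1 ≤ x.K := by simp [Ctx.K]

theorem moveArc_spec (hx : x.Ok l) {h : HS} (hc : Cst x h) {N : ℕ → ℕ} (hN : Sizes x N)
    (hlev : Lev x.K x.base N (h.a 1)) (hm : IsMate x.M (h.a 7))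
    (hV : VOk x N (h.a 1) (h.a 7) (h.a 4))
    (hf : h.v 13 < x.M) (hg : h.a 1 (h.v 13) = h.v 11)
    (hh : h.v 12 ∈ Nd x.base N 1) (hne : h.v 12 ≠ h.v 11)
    (hpar : 1 < x.K → h.a 1 (h.v 12) = h.a 1 (h.v 11)) :
    wp l moveArc h fun h' t => t ≤ 140 * x.K + 250 ∧ Fr moveArc h h' ∧
      h'.a 1 = Function.update (h.a 1) (h.v 13) (h.v 12) ∧
      VOk x N (h'.a 1) (h.a 7) (h'.a 4) := by
  have hP := x.P_pos
  have hPM := hx.P_le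
  have hW := hx.W_ge
  have hM2 := hx.M_two
  have hK1 : 1 ≤ x.K := Ctx.K_pos
  set f := h.v 13 with hfdef
  set g := h.v 11 with hgdef
  set hn := h.v 12 with hhdef
  have hf0 : f < N 0 := by rw [hN.zero]; exact hf
  have hfm : f ∈ Nd x.base N 0 := hlev.mem_zero.mpr hf0
  have hgm := hlev.par_mem 0 (by omega) _ hfm
  rw [hg] at hgm
  obtain ⟨g1, g2⟩ := hN.node le_rfl hK1 hgm
  obtain ⟨n1, n2⟩ := hN.node le_rfl hK1 hh
  have gb := hN.block hgm
  have nb := hN.block hh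
  have hone := hN.one
  have hnz := hx.node_lt g2
  set m := h.a 7 f with hmdef
  have hmM : m < x.M := hm.lt f hf
  have hm0 : m < N 0 := by rw [hN.zero]; exact hmM
  have hmf : m ≠ f := hm.ne f hf
  have hj0m := hlev.par_mem 0 (by omega) _ (hlev.mem_zero.mpr hm0)
  obtain ⟨p1, p2⟩ := hN.node le_rfl hK1 hj0m
  have pb := hN.block hj0m
  set j0 := h.a 1 m - x.M with hj0
  have hMZ : x.M ≤ l.Z := by have := hx.Z_ge; omega
  -- the counts before and after
  have hu : ∀ i, 1 ≤ i → i ≤ x.K → ∀ G ∈ Nd x.base N i, ∀ j < N 1,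
      cnt x.M (h.a 7) (Function.update (h.a 1) f hn) i G j +
        (if i = 1 ∧ G = g ∧ j = j0 then 1 else 0) +
        (if G = anc (h.a 1) i m ∧ j = g - x.M then 1 else 0) =
      h.a 4 (x.ix G j) + (if i = 1 ∧ G = hn ∧ j = j0 then 1 else 0) +
        (if G = anc (h.a 1) i m ∧ j = hn - x.M then 1 else 0) := by
    intro i hi hiK G hG j hj
    have := hlev.cnt_update_arc (mate := h.a 7) (by rw [hN.zero]; exact hm) hK1 hf0 hh
      (by rw [hg]; exact hpar) hi hiK G j
    rw [hN.zero, hg] at this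
    rw [hV i hi hiK G hG j hj]
    simpa only [show x.M + j = h.a 1 m ↔ j = j0 by omega, show x.M + j = g ↔ j = g - x.M by omega,
      show x.M + j = hn ↔ j = hn - x.M by omega, ← hmdef] using this
  have hA : ∀ k ≤ x.K, anc (Function.update (h.a 1) f hn) k m = anc (h.a 1) k m := by
    intro k hk
    rw [hlev.update_anc (k := 0) (by omega) hfm hh (by rw [hg]; exact hpar) hk hm0, if_neg]
    rintro ⟨-, hc⟩
    exact hmf hc
  have hge : 1 ≤ h.a 4 (x.ix g j0) := by
    rw [hV 1 le_rfl hK1 g hgm j0 (by omega)]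
    refine Finset.card_pos.mpr ⟨f, ?_⟩
    simp only [Finset.mem_filter, Finset.mem_range]
    exact ⟨hf, hg, by rw [← hmdef]; omega⟩
  have hle : ∀ i, 1 ≤ i → i ≤ x.K → ∀ G ∈ Nd x.base N i, ∀ j < N 1, h.a 4 (x.ix G j) ≤ x.M := by
    intro i hi hiK G hG j hj
    rw [hV i hi hiK G hG j hj]
    exact cnt_le _ _ _ _ _ _
  have hg4 := hle 1 le_rfl hK1 g hgm j0 (by omega)
  have hh4 := hle 1 le_rfl hK1 hn hh j0 (by omega)
  have ngh : x.ix hn j0 ≠ x.ix g j0 := fun h1 =>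
    hne (Ctx.ix_inj n1 g1 (by omega) (by omega) h1).1
  have ig : x.ix g j0 < l.Z := Ctx.ix_lt hx g2 (by omega)
  have ih : x.ix hn j0 < l.Z := Ctx.ix_lt hx n2 (by omega)
  set y := ((h.put 1 f hn).set 16 (h.a 1 m)).set 20 j0 with hy
  have hcy : Cst x y := ⟨hc.M, hc.B, hc.P, hc.Kc⟩
  have y11 : y.v 11 = g := by simp [hy, hgdef]
  have y12 : y.v 12 = hn := by simp [hy, hhdef]
  have y20 : y.v 20 = j0 := by simp [hy]
  have y4 : y.a 4 = h.a 4 := by simp [hy]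
  have og : (eix 11 20).ok l y :=
    eix_ok hx hcy (by norm_num) (by norm_num) (by omega) (by omega)
  have eg : (eix 11 20).eval y = x.ix g j0 := by rw [eix_eval hcy, y11, y20]
  set z := y.put 4 (x.ix g j0) (h.a 4 (x.ix g j0) - 1) with hz
  have hcz : Cst x z := ⟨hcy.M, hcy.B, hcy.P, hcy.Kc⟩
  have oh : (eix 12 20).ok l z :=
    eix_ok hx hcz (by norm_num) (by norm_num) (by simp only [hz, HS.put_v]; omega)
      (by simp only [hz, HS.put_v]; omega)
  have eh : (eix 12 20).eval z = x.ix hn j0 := by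
    rw [eix_eval hcz]; simp only [hz, HS.put_v]; rw [y12, y20]
  have z4 : z.a 4 (x.ix hn j0) = h.a 4 (x.ix hn j0) := by
    simp only [hz, HS.put_a_same, Function.update_of_ne ngh, y4]
  set w := (((z.put 4 (x.ix hn j0) (h.a 4 (x.ix hn j0) + 1)).set 30 (g - x.M)).set 31
    (hn - x.M)) with hw
  have w4 : ∀ i, 1 ≤ i → i ≤ x.K → ∀ G ∈ Nd x.base N i, ∀ j < N 1,
      w.a 4 (x.ix G j) + (if i = 1 ∧ G = g ∧ j = j0 then 1 else 0) =
      h.a 4 (x.ix G j) + (if i = 1 ∧ G = hn ∧ j = j0 then 1 else 0) := by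
    intro i hi hiK G hG j hj
    obtain ⟨G1, G2⟩ := hN.node hi hiK hG
    have c1 : (i = 1 ∧ G = g ∧ j = j0) ↔ x.ix G j = x.ix g j0 := by
      constructor
      · rintro ⟨-, rfl, rfl⟩
        rfl
      · intro hc
        obtain ⟨rfl, rfl⟩ := Ctx.ix_inj G1 g1 (by omega) (by omega) hc
        exact ⟨hlev.lvl_unique hiK hK1 hG hgm, rfl, rfl⟩
    have c2 : (i = 1 ∧ G = hn ∧ j = j0) ↔ x.ix G j = x.ix hn j0 := by
      constructor
      · rintro ⟨-, rfl, rfl⟩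
        rfl
      · intro hc
        obtain ⟨rfl, rfl⟩ := Ctx.ix_inj G1 n1 (by omega) (by omega) hc
        exact ⟨hlev.lvl_unique hiK hK1 hG hh, rfl, rfl⟩
    simp only [c1, c2, hw, HS.set_a, HS.put_a_same, hz, y4, Function.update_apply]
    by_cases h1 : x.ix G j = x.ix g j0
    · rw [h1]
      simp only [ngh.symm, if_true, if_false]
      omega
    · simp only [h1, if_false]
      by_cases h2 : x.ix G j = x.ix hn j0
      · rw [h2]
        simp
      · simp [h2]
  have w1 : w.a 1 = Function.update (h.a 1) f hn := by simp [hw, hz, hy]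
  have hcw : Cst x w := ⟨hc.M, hc.B, hc.P, hc.Kc⟩
  have key := climb_spec (m := m) (jg := g - x.M) (jh := hn - x.M) hx hcw hN (by
      rw [w1]; exact hlev.update (by omega) hfm hh) hmM (by
      rw [w1, Function.update_of_ne hmf]; simp [hw, hz, hy]) (by simp [hw]) (by simp [hw])
      gb.2 nb.2 (by omega) (by
      intro k hk hkK
      rw [w1, hA k hkK]
      have hAm := hlev.anc_mem hkK hm0
      have e1 := hu k hk hkK _ hAm (g - x.M) gb.2
      have e2 := w4 k hk hkK _ hAm (g - x.M) gb.2
      have e4 := w4 k hk hkK _ hAm (hn - x.M) nb.2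
      have e5 := hle k hk hkK _ hAm (hn - x.M) nb.2
      have e6 := hle k hk hkK _ hAm (g - x.M) gb.2
      rw [if_pos (show _ ∧ _ from ⟨rfl, rfl⟩), if_neg (show ¬ (_ ∧ g - x.M = hn - x.M) by
        rintro ⟨-, hc⟩; omega)] at e1
      split_ifs at * <;> omega)
  unfold moveArc
  simp only [wp_seq, wp_put, wp_asg, Exp.ok, Exp.eval, Op.eval, Lim.bd_pos l 4 (by norm_num),
    Lim.bd_pos l 1 (by norm_num), Lim.bd_pos l 7 (by norm_num)]
  have q1 : (h.put 1 f hn).a 7 = h.a 7 := by simp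
  have q2 : (h.put 1 f hn).v = h.v := rfl
  have q3 : (h.put 1 f hn).a 1 m = h.a 1 m := by simp [Function.update_of_ne hmf]
  have q4 : ((h.put 1 f hn).set 16 (h.a 1 m)).v 16 = h.a 1 m := by simp
  have q5 : ((h.put 1 f hn).set 16 (h.a 1 m)).v 1 = x.M := by simp [hc.M]
  have w11 : ((z.put 4 (x.ix hn j0) (h.a 4 (x.ix hn j0) + 1))).v 11 = g := y11
  have w1' : ((z.put 4 (x.ix hn j0) (h.a 4 (x.ix hn j0) + 1))).v 1 = x.M := hcz.M
  have w12 : (((z.put 4 (x.ix hn j0) (h.a 4 (x.ix hn j0) + 1))).set 30 (g - x.M)).v 12 = hn := y12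
  have w2' : (((z.put 4 (x.ix hn j0) (h.a 4 (x.ix hn j0) + 1))).set 30 (g - x.M)).v 1 = x.M :=
    hcz.M
  rw [← hfdef, ← hhdef, q1, q2, ← hfdef, ← hmdef, q3, q4, q5, ← hj0, ← hy, eg, y4, ← hz, eh, z4,
    w11, w1', w12, w2', ← hw]
  refine ⟨by norm_num, by norm_num, by omega, by norm_num, by norm_num, ⟨by norm_num,
    ⟨by norm_num, by norm_num, by omega⟩, by omega⟩, by norm_num, ⟨by norm_num, by norm_num,
    by omega⟩, by norm_num, og, ig, ⟨⟨by norm_num, og, ig⟩, by omega, by omega⟩, by norm_num,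
    oh, ih, ⟨⟨by norm_num, oh, ih⟩, by omega, by omega⟩, by norm_num, ⟨by norm_num, by norm_num,
    by omega⟩, by norm_num, ⟨by norm_num, by norm_num, by omega⟩, ?_⟩
  refine key.mono fun h' t ⟨ht, hF, hI⟩ => ⟨?_, ?_, ?_, ?_⟩
  · simp
    omega
  · refine Fr.trans (h₂ := w) ⟨fun k hk => ?_, fun k hk => ?_⟩
      (hF.sub (by simp +contextual [HC.wv]) (by simp +contextual [HC.wa]))
    · simp only [HC.wv, List.mem_append, List.mem_singleton, not_or] at hk
      simp [hw, hz, hy, hk]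
    · simp only [HC.wa, List.mem_append, List.mem_singleton, not_or] at hk
      simp [hw, hz, hy, hk]
  · rw [hF.a 1 (by simp [climb, HC.wa]), w1]
  · rw [hF.a 1 (by simp [climb, HC.wa]), w1]
    intro i hi hiK G hG j hj
    have e1 := hu i hi hiK G hG j hj
    have e2 := w4 i hi hiK G hG j hj
    have e3 := hI i hi hiK G hG j hj
    rw [w1, hA i hiK] at e3
    omega

end FlipRepair

namespace FlipRepair

variable {x : Ctx} {l : Lim}

/-- Move the child `13` of the group `11` to the group `12`. -/
def move : HC := .ite (.v 14 =~ .v 3) moveArc moveRow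

/-- Time to move a child of level `k`. -/
def moveTime (x : Ctx) (k : ℕ) : ℕ := if k = 0 then 140 * x.K + 300 else 2100 * x.P

theorem two_pow_eq_P {k : ℕ} (hk : k < x.K) : 2 ^ (x.K - (k + 1)) = x.P ↔ k = 0 := by
  unfold Ctx.P Ctx.K at *
  rw [Nat.pow_right_injective le_rfl |>.eq_iff]
  omega

theorem move_spec (hx : x.Ok l) {h : HS} (hc : Cst x h) {N : ℕ → ℕ} (hN : Sizes x N)
    (hlev : Lev x.K x.base N (h.a 1)) (hm : IsMate x.M (h.a 7))
    (hV : VOk x N (h.a 1) (h.a 7) (h.a 4)) {k : ℕ} (hk : k < x.K)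
    (h14 : h.v 14 = 2 ^ (x.K - (k + 1)))
    (hf : h.v 13 ∈ Nd x.base N k) (hg : h.a 1 (h.v 13) = h.v 11)
    (hh : h.v 12 ∈ Nd x.base N (k + 1)) (hne : h.v 12 ≠ h.v 11)
    (hpar : k + 1 < x.K → h.a 1 (h.v 12) = h.a 1 (h.v 11)) (hnb : h.v 19 = N 1) :
    wp l move h fun h' t => t ≤ moveTime x k ∧ Fr move h h' ∧
      h'.a 1 = Function.update (h.a 1) (h.v 13) (h.v 12) ∧
      VOk x N (h'.a 1) (h.a 7) (h'.a 4) := by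
  have hW := hx.W_ge
  have hM := hx.M_two
  have hP := x.P_pos
  have e : (Exp.v 14 =~ Exp.v 3).eval h = if k = 0 then 1 else 0 := by
    simp [h14, hc.P, two_pow_eq_P hk]
  unfold move
  rw [wp_ite, e]
  refine ⟨⟨by norm_num, by norm_num, (Op.eval_eq_le _ _).trans (by omega)⟩, ?_, ?_⟩
  · intro h0
    obtain rfl : k = 0 := by
      by_contra hc
      simp [hc] at h0
    have := moveArc_spec hx hc hN hlev hm hV (by
      rw [hlev.mem_zero, hN.zero] at hf
      exact hf) hg hh hne hpar
    refine this.mono fun h' t ⟨ht, hF, h1, h2⟩ => ⟨?_, ?_, h1, h2⟩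
    · simp [moveTime]
      omega
    · exact hF.sub (by simp +contextual [HC.wv]) (by simp +contextual [HC.wa])
  · intro h0
    have hk0 : k ≠ 0 := by
      rintro rfl
      simp at h0
    have := moveRow_spec hx hc hN hlev hm hV (by omega) hk hf hg hh hne hpar hnb
    refine this.mono fun h' t ⟨ht, hF, h1, h2⟩ => ⟨?_, ?_, h1, h2⟩
    · simp [moveTime, hk0]
      omega
    · exact hF.sub (by simp +contextual [HC.wv]) (by simp +contextual [HC.wa])

/-- Move the children of the group `11` that come after the child `10` to the group `12`. -/
def moveRest : HC :=
  .asg 13 (.v 10) ;;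
  .loop (.c 1 -~ (.get 2 (.v 13) =~ .get 2 (.v 12))) (.asg 13 (.get 0 (.v 13)) ;; move)

section moveRest

variable {N nxt par la fa : ℕ → ℕ} {rk : ℕ → ℕ → ℕ}

open Classical in
theorem moveRest_spec (hx : x.Ok l) {h : HS} (hc : Cst x h)
    (hI : Inv x.K x.base N nxt par la fa rk) {N' : ℕ → ℕ} (hN : Sizes x N') {k e₀ : ℕ}
    (hk : k < x.K) (he₀ : e₀ < N 0) (hl₀ : la (anc par k e₀) = e₀)
    (hroom : k + 1 < x.K → x.base (k + 1) + N (k + 1) < x.base (k + 2))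
    (hN' : N' = Function.update N (k + 1) (N (k + 1) + 1))
    (hm : IsMate x.M (h.a 7)) (h10 : h.v 10 = anc par k e₀) (h11 : h.v 11 = anc par (k + 1) e₀)
    (h12 : h.v 12 = x.base (k + 1) + N (k + 1)) (h14 : h.v 14 = 2 ^ (x.K - (k + 1)))
    (h19 : h.v 19 = N' 1)
    (h0 : ∀ G, G ≠ h.v 11 → G ≠ h.v 12 → h.a 0 G = nxt G)
    (h1 : h.a 1 = Function.update par (h.v 12) (par (h.v 11)))
    (h2 : ∀ G, G ≠ h.v 11 → G ≠ h.v 12 → h.a 2 G = la G) (h2' : h.a 2 (h.v 12) = la (h.v 11))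
    (hlev : Lev x.K x.base N' (h.a 1)) (hV : VOk x N' (h.a 1) (h.a 7) (h.a 4)) :
    wp l moveRest h fun h' t => t ≤ kids x.base N par k (h.v 11) * (moveTime x k + 50) + 50 ∧
      Inv.SplitPar x.base N par la rk k e₀ (h'.a 1) ∧ VOk x N' (h'.a 1) (h.a 7) (h'.a 4) := by
  have hW := hx.W_ge
  have hM2 := hx.M_two
  have hD := hx.D_eq
  set g := h.v 11 with hg
  set hn := h.v 12 with hhn
  have hnew : ∀ i ≤ x.K, hn ∉ Nd x.base N i := fun i hi => h12 ▸ hI.new_not_mem hk hroom hi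
  have hgm : g ∈ Nd x.base N (k + 1) := by rw [h11]; exact hI.anc_mem hk he₀
  have hgn : hn ≠ g := fun hc => hnew (k + 1) hk (hc ▸ hgm)
  have hhm : hn ∈ Nd x.base N' (k + 1) := by
    rw [hN']
    exact Inv.mem_Nd_update.mpr (Or.inr ⟨rfl, h12⟩)
  have hsub : ∀ i G, G ∈ Nd x.base N i → G ∈ Nd x.base N' i := fun i G hG => by
    rw [hN']
    exact Inv.mem_Nd_update.mpr (Or.inl hG)
  have hkm : ∀ c ∈ Nd x.base N k, c ≠ g ∧ c ≠ hn := fun c hc =>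
    ⟨fun h => by have := hI.lvl_unique hk.le hk (h ▸ hc) hgm; omega,
      fun h => hnew k hk.le (h ▸ hc)⟩
  have hgk : g ∉ Nd x.base N k := fun hc => (hkm g hc).1 rfl
  have hN1 : x.M ≤ hn ∧ hn < x.M + 20 * x.P := hN.node (by omega) (by omega) hhm
  have hnlt := hx.node_lt hN1.2
  have hnode : ∀ c ∈ Nd x.base N k, c < l.D ∧ c < l.Z := by
    intro c hc
    rcases Nat.eq_zero_or_pos k with rfl | hk1
    · rw [hI.mem_zero] at hc
      have : N 0 = x.M := by rw [← hN.zero, hN']; simp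
      have := hx.Z_ge
      have := x.P_pos
      omega
    · exact hx.node_lt (hN.node hk1 (by omega) (hsub _ _ hc)).2
  set c₀ := anc par k e₀ with hc₀
  have hc₀m : c₀ ∈ Nd x.base N k := hI.anc_mem hk.le he₀
  have hpc₀ : par c₀ = g := by rw [h11, anc_succ]
  -- the parents in the course of the loop
  set pc : ℕ → ℕ → ℕ := fun f c => if c ∈ Nd x.base N k ∧ par c = g ∧
    rk (k + 1) e₀ < rk (k + 1) (la c) ∧ rk (k + 1) (la c) ≤ rk (k + 1) (la f) then hn
    else if c = hn then par g else par c with hpcdef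
  set F : ℕ → Finset ℕ := fun f => (Nd x.base N k).filter fun c => par c = g ∧
    rk (k + 1) (la f) < rk (k + 1) (la c) with hFdef
  unfold moveRest
  rw [wp_seq, wp_asg]
  refine ⟨by norm_num, by norm_num, ?_⟩
  have := wp_loop (l := l) (e := .c 1 -~ (.get 2 (.v 13) =~ .get 2 (.v 12)))
    (c := .asg 13 (.get 0 (.v 13)) ;; move)
    (h := h.set 13 (h.v 10)) (C := moveTime x k + 10) (m := (F c₀).card)
    (I := fun m h' => (F (h'.v 13)).card ≤ m ∧ h'.v 13 ∈ Nd x.base N k ∧ par (h'.v 13) = g ∧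
      rk (k + 1) e₀ ≤ rk (k + 1) (la (h'.v 13)) ∧ h'.a 1 = pc (h'.v 13) ∧
      Lev x.K x.base N' (h'.a 1) ∧ VOk x N' (h'.a 1) (h.a 7) (h'.a 4)) ?_ ?_
  · refine this.mono fun h' t ⟨ht, hF, m', ⟨_, hI1, hI2, hI3, hI4, _, hI5⟩, hz⟩ => ⟨?_, ?_, hI5⟩
    · have hle : (F c₀).card ≤ kids x.base N par k g :=
        Finset.card_le_card (Finset.monotone_filter_right _ fun c _ hc => hc.1)
      simp only [Exp.cost, adrCost] at *
      have : (F c₀).card * (moveTime x k + 10 + (1 + (1 + 10 + 2 + (1 + 10 + 2) + 3) + 3) + 2) ≤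
        kids x.base N par k g * (moveTime x k + 50) := Nat.mul_le_mul hle (by omega)
      omega
    · have a2 : h'.a 2 = h.a 2 := by
        rw [hF.a 2 (by simp [HC.wa, move, moveArc, moveRow, climb, rowMove, HC.for])]; rfl
      have v12 : h'.v 12 = hn := by
        rw [hF.v 12 (by simp [HC.wv, move, moveArc, moveRow, climb, rowMove, HC.for])]; simp [hhn]
      have hlf : la (h'.v 13) = la g := by
        simp only [Exp.eval, Op.eval, a2, v12, h2'] at hz
        obtain ⟨u1, u2⟩ := hkm _ hI1
        rw [h2 _ u1 u2] at hz
        by_contra hc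
        simp [hc] at hz
      intro c
      rw [hI4, ← h11, ← h12]
      simp only [hpcdef]
      congr 1
      simp only [eq_iff_iff]
      constructor
      · rintro ⟨u1, u2, u3, -⟩
        exact ⟨u1, u2, u3⟩
      · rintro ⟨u1, u2, u3⟩
        refine ⟨u1, u2, u3, ?_⟩
        rw [hlf]
        obtain ⟨u4, u5⟩ := hI.la_mem k hk.le c u1
        have := hI.rk_le_la (k := k + 1) le_rfl hk u4
        rwa [anc_succ, u5, u2] at this
  · refine ⟨by simp [h10], by simp [h10, hc₀m], by simp [h10, hpc₀],
      by simp [h10, hl₀], ?_, hlev, hV⟩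
    funext c
    simp only [HS.set_a, HS.set_v, if_true, h10, h1, hpcdef, Function.update_apply]
    rw [if_neg (show ¬ (_ ∧ _ ∧ rk (k + 1) e₀ < _ ∧ _) by
      rintro ⟨-, -, u1, u2⟩
      rw [hl₀] at u2
      omega)]
  · intro m h' ⟨hm', hI1, hI2, hI3, hI4, hI6, hI5⟩ hF
    have a0 : h'.a 0 = h.a 0 := by
      rw [hF.a 0 (by simp [HC.wa, move, moveArc, moveRow, climb, rowMove, HC.for])]; rfl
    have a2 : h'.a 2 = h.a 2 := by
      rw [hF.a 2 (by simp [HC.wa, move, moveArc, moveRow, climb, rowMove, HC.for])]; rfl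
    have a7 : h'.a 7 = h.a 7 := by
      rw [hF.a 7 (by simp [HC.wa, move, moveArc, moveRow, climb, rowMove, HC.for])]; rfl
    have v11 : h'.v 11 = g := by
      rw [hF.v 11 (by simp [HC.wv, move, moveArc, moveRow, climb, rowMove, HC.for])]; simp [hg]
    have v12 : h'.v 12 = hn := by
      rw [hF.v 12 (by simp [HC.wv, move, moveArc, moveRow, climb, rowMove, HC.for])]; simp [hhn]
    have v14 : h'.v 14 = 2 ^ (x.K - (k + 1)) := by
      rw [hF.v 14 (by simp [HC.wv, move, moveArc, moveRow, climb, rowMove, HC.for])]; simp [h14]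
    have v19 : h'.v 19 = N' 1 := by
      rw [hF.v 19 (by simp [HC.wv, move, moveArc, moveRow, climb, rowMove, HC.for])]; simp [h19]
    have hc0 : Cst x (h.set 13 (h.v 10)) := ⟨by simp [hc.M], by simp [hc.B], by simp [hc.P],
      by simp [hc.Kc]⟩
    have hc' : Cst x h' := hc0.of_fr hF
      (by simp [HC.wv, move, moveArc, moveRow, climb, rowMove, HC.for])
    obtain ⟨u1, u2⟩ := hkm _ hI1
    obtain ⟨n1, n2⟩ := hnode _ hI1
    refine ⟨?_, fun hz => ?_⟩
    · simp only [Exp.ok, Exp.eval, v12, Lim.bd_pos l 2 (by norm_num)]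
      refine ⟨by omega, ⟨⟨by norm_num, by norm_num, n2⟩, ⟨by norm_num, by norm_num, hnlt.2⟩,
        (Op.eval_eq_le _ _).trans (by omega)⟩, ?_⟩
      simp only [Op.eval]
      omega
    have hlf : la g ≠ la (h'.v 13) := by
      simp only [Exp.eval, Op.eval, a2, v12, h2'] at hz
      rw [h2 _ u1 u2] at hz
      intro hc
      simp [hc] at hz
    set f := h'.v 13 with hf
    obtain ⟨f1, f2, f3, f4⟩ := hI.next_child hk hI1 (by rw [hI2]; exact hlf)
    rw [hI2] at f2 f4
    have hf0 : h'.a 0 f = nxt f := by rw [a0]; exact h0 _ u1 u2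
    obtain ⟨w1, w2⟩ := hkm _ f1
    have hmem : nxt f ∈ F f := by simp [hFdef, f1, f2, f3]
    have hcard : 0 < (F f).card := Finset.card_pos.mpr ⟨_, hmem⟩
    refine ⟨m - 1, by omega, ?_⟩
    rw [wp_seq, wp_asg]
    simp only [Exp.eval, Exp.ok, ← hf, hf0, Lim.bd_zero]
    refine ⟨by norm_num, ⟨by norm_num, by norm_num, n1⟩, ?_⟩
    have hpf : pc f (nxt f) = g := by
      simp only [hpcdef]
      rw [if_neg (by rintro ⟨-, -, -, q⟩; omega), if_neg w2, f2]
    have hpn : pc f hn = par g := by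
      simp only [hpcdef]
      rw [if_neg (fun q => hnew k hk.le q.1)]
      simp
    have hpg : pc f g = par g := by
      simp only [hpcdef]
      rw [if_neg (fun q => hgk q.1), if_neg hgn.symm]
    have hcy : Cst x (h'.set 13 (nxt f)) := ⟨by simp [hc'.M], by simp [hc'.B], by simp [hc'.P],
      by simp [hc'.Kc]⟩
    have key := move_spec hx hcy hN hI6 (by simpa [a7] using hm) (by simpa [a7] using hI5) hk
      (by simp [v14]) (by simpa using hsub _ _ f1) (by simp [v11, hI4, hpf]) (by simpa [v12] using hhm)
      (by simpa [v12, v11] using hgn) (by simp [v12, v11, hI4, hpn, hpg]) (by simp [v19])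
    refine key.mono fun h'' t ⟨ht, hF', p1, p2⟩ => ?_
    have v13 : h''.v 13 = nxt f := by
      rw [hF'.v 13 (by simp [HC.wv, move, moveArc, moveRow, climb, rowMove, HC.for])]; simp
    simp only [HS.set_a, HS.set_v, if_true, v12, hI4, show (12 : ℕ) ≠ 13 by norm_num, if_false]
      at p1
    have hup : pc (nxt f) = Function.update (pc f) (nxt f) hn := by
      funext c
      rw [Function.update_apply]
      by_cases hcf : c = nxt f
      · rw [if_pos hcf, hcf]
        simp only [hpcdef]
        rw [if_pos ⟨f1, f2, by omega, le_rfl⟩]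
      · rw [if_neg hcf]
        simp only [hpcdef]
        congr 1
        simp only [eq_iff_iff]
        constructor
        · rintro ⟨q1, q2, q3, q4⟩
          refine ⟨q1, q2, q3, ?_⟩
          by_contra q5
          exact hcf (f4 c q1 q2 (by omega) q4)
        · rintro ⟨q1, q2, q3, q4⟩
          exact ⟨q1, q2, q3, by omega⟩
    rw [v13]
    refine ⟨by simp; omega, ?_, f1, f2, by omega, by rw [p1, hup], ?_, ?_⟩
    · have : F (nxt f) ⊆ (F f).erase (nxt f) := by
        intro c
        simp only [hFdef, Finset.mem_filter, Finset.mem_erase]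
        rintro ⟨q1, q2, q3⟩
        refine ⟨?_, q1, q2, by omega⟩
        rintro rfl
        omega
      have := Finset.card_le_card this
      rw [Finset.card_erase_of_mem hmem] at this
      omega
    · rw [p1]
      have := hI6.update hk (hsub _ _ f1) hhm
      rwa [hI4] at this
    · have : (h'.set 13 (nxt f)).a 7 = h.a 7 := a7
      rwa [this] at p2

end moveRest

end FlipRepair

namespace FlipRepair

variable {x : Ctx} {l : Lim}

/-- Set the entries in the column of the group `12` to zero. -/
def colZero : HC :=
  .asg 28 (.c 20 *~ .v 3) ;;
  .for 17 28 (.put 4 (.v 17 *~ .v 4 +~ (.v 12 -~ .v 1)) (.c 0))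

theorem colZero_spec (hx : x.Ok l) {h : HS} (hc : Cst x h) {j₀ : ℕ} (hj₀ : h.v 12 - x.M = j₀)
    (hj : j₀ < 10 * x.P) :
    wp l colZero h fun h' t => t ≤ 1000 * x.P ∧ Fr colZero h h' ∧
      ∀ G j, x.M ≤ G → G < x.M + 20 * x.P → j < 10 * x.P → h'.a 4 (x.ix G j) =
        if j = j₀ then 0 else h.a 4 (x.ix G j) := by
  have hW := hx.W_ge
  have hP := x.P_pos
  have hPM := hx.P_le
  have hix : ∀ i, x.ix (x.M + i) j₀ = i * (10 * x.P) + j₀ := fun i => by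
    simp [Ctx.ix]
  unfold colZero
  rw [wp_seq, wp_asg]
  refine ⟨by norm_num, ⟨by simp; omega, by norm_num, by simp [hc.P]; omega⟩, ?_⟩
  have h28 : (Exp.c 20 *~ Exp.v 3).eval h = 20 * x.P := by simp [hc.P]
  rw [h28]
  have := wp_for (l := l) (i := 17) (b := 28)
    (c := .put 4 (.v 17 *~ .v 4 +~ (.v 12 -~ .v 1)) (.c 0)) (h := h.set 28 (20 * x.P))
    (I := fun i h' => ∀ G j, x.M ≤ G → j < 10 * x.P → h'.a 4 (x.ix G j) =
        if G < x.M + i ∧ j = j₀ then 0 else h.a 4 (x.ix G j)) (C := 27) (n := 20 * x.P)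
    (by norm_num) (by norm_num) (by norm_num) (by simp [HC.wv]) (by simp [HC.wv]) (by simp)
    (by omega) (by
      intro G j hG _
      simp [show ¬ G < x.M by omega]) ?_
  · refine this.frame fun h' t ⟨ht, _, hI⟩ hF => ⟨?_, ?_, ?_⟩
    · simp only [Exp.cost] at *
      omega
    · refine Fr.trans (h₂ := h.set 28 (20 * x.P)) ⟨fun k hk => ?_, fun _ _ => rfl⟩
        (hF.sub (by simp +contextual [HC.wv]) (by simp +contextual [HC.wa]))
      simp only [HC.wv, List.mem_append, List.mem_singleton, not_or] at hk
      simp [hk.1]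
    · intro G j hG hG' hj
      rw [hI G j hG hj]
      simp [hG']
  · intro i h' hi hv hI hF
    have hc0 : Cst x (h.set 28 (20 * x.P)) := ⟨by simp [hc.M], by simp [hc.B], by simp [hc.P],
      by simp [hc.Kc]⟩
    have hc' : Cst x h' := hc0.of_fr hF (by simp [HC.for, HC.wv])
    have v12 : h'.v 12 = h.v 12 := by rw [hF.v 12 (by simp [HC.for, HC.wv])]; simp
    have hlt := Ctx.ix_lt (G := x.M + i) hx (by omega) hj
    have hZ := hx.W_le
    rw [hix] at hlt
    have hev : (Exp.v 17 *~ Exp.v 4 +~ (Exp.v 12 -~ Exp.v 1)).eval h' = x.ix (x.M + i) j₀ := by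
      rw [hix]
      simp [hv, hc'.Kc, v12, hc'.M, hj₀]
    rw [wp_put, hev, hix]
    refine ⟨by norm_num, ⟨⟨by norm_num, by norm_num, ?_⟩, ⟨by norm_num, by norm_num, ?_⟩, ?_⟩, hlt,
      ?_, by simp, ?_⟩
    · simp only [Exp.eval, Op.eval, hv, hc'.Kc]
      omega
    · simp only [Exp.eval, Op.eval, v12, hc'.M]
      omega
    · simp only [Exp.eval, Op.eval, hv, hc'.Kc, v12, hc'.M, hj₀]
      omega
    · simp
    · intro G j hG hj'
      rw [← hix]
      simp only [HS.set_a, HS.put_a_same, Exp.eval, Function.update_apply]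
      rw [hI G j hG hj']
      by_cases h1 : x.ix G j = x.ix (x.M + i) j₀
      · obtain ⟨h2, h3⟩ := Ctx.ix_inj hG (by omega) hj' hj h1
        simp [h2, h3]
      · rw [if_neg h1]
        congr 1
        simp only [eq_iff_iff]
        constructor
        · rintro ⟨h2, h3⟩
          exact ⟨by omega, h3⟩
        · rintro ⟨h2, h3⟩
          refine ⟨?_, h3⟩
          have : G ≠ x.M + i := fun hc => h1 (by rw [hc, h3])
          omega

/-- The data structure in memory. -/
structure DS (x : Ctx) (N : ℕ → ℕ) (rk : ℕ → ℕ → ℕ) (h : HS) : Prop where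
  inv : Inv x.K x.base N (h.a 0) (h.a 1) (h.a 2) (h.a 3) rk
  sz : Sizes x N
  mate : IsMate x.M (h.a 7)
  nf : ∀ k, 1 ≤ k → k ≤ x.K → h.a 9 (2 ^ (x.K - k)) = x.base k + N k
  V : VOk x N (h.a 1) (h.a 7) (h.a 4)
  nb : h.v 19 = N 1

theorem Lev.anc_update_new {K : ℕ} {base N par : ℕ → ℕ} (h : Lev K base N par) {hn q : ℕ}
    (hnew : ∀ i ≤ K, hn ∉ Nd base N i) {i e : ℕ} (hi : i ≤ K + 1) (he : e < N 0) :
    anc (Function.update par hn q) i e = anc par i e := by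
  induction i with
  | zero => rfl
  | succ i ih =>
    have hm := h.anc_mem (k := i) (by omega) he
    rw [anc_succ, anc_succ, ih (by omega), Function.update_of_ne]
    rintro hc
    exact hnew i (by omega) (hc ▸ hm)

/-- Make a new group `12` after the group `11`, which now ends with the arc `9`. -/
def newGroup : HC :=
  .asg 12 (.get 9 (.v 14)) ;;
  .put 9 (.v 14) (.v 12 +~ .c 1) ;;
  .put 2 (.v 12) (.get 2 (.v 11)) ;;
  .put 2 (.v 11) (.v 9) ;;
  .put 0 (.v 12) (.get 0 (.v 11)) ;;
  .put 0 (.v 11) (.v 12) ;;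
  .put 3 (.v 12) (.get 0 (.v 9)) ;;
  .put 1 (.v 12) (.get 1 (.v 11)) ;;
  .asg 19 (.get 9 (.v 3) -~ .v 1) ;;
  rowZero 12 ;;
  .ite (.v 14 =~ .v 3) colZero .skip

section newGroup

variable {N : ℕ → ℕ} {rk : ℕ → ℕ → ℕ}

theorem Sizes.update (hN : Sizes x N) {k : ℕ}
    (hcap : N (k + 1) < 10 * 2 ^ (x.K - (k + 1))) :
    Sizes x (Function.update N (k + 1) (N (k + 1) + 1)) where
  zero := by simp [hN.zero]
  cap i hi hiK := by
    rw [Function.update_apply]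
    split_ifs with h
    · subst h
      omega
    · exact hN.cap i hi hiK

theorem newGroup_spec (hx : x.Ok l) {h : HS} (hc : Cst x h) (hd : DS x N rk h) {k e₀ : ℕ}
    (hk : k < x.K) (he₀ : e₀ < x.M) (h9 : h.v 9 = e₀) (h11 : h.v 11 = anc (h.a 1) (k + 1) e₀)
    (h14 : h.v 14 = 2 ^ (x.K - (k + 1))) (hcap : N (k + 1) < 10 * 2 ^ (x.K - (k + 1)))
    (hroom : k + 1 < x.K → x.base (k + 1) + N (k + 1) < x.base (k + 2))
    {N' : ℕ → ℕ} (hN' : N' = Function.update N (k + 1) (N (k + 1) + 1)) :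
    wp l newGroup h fun h' t => t ≤ 1800 * x.P ∧ Fr newGroup h h' ∧
      h'.v 12 = x.base (k + 1) + N (k + 1) ∧ h'.v 19 = N' 1 ∧
      h'.a 0 = Function.update (Function.update (h.a 0) (x.base (k + 1) + N (k + 1))
        (h.a 0 (h.v 11))) (h.v 11) (x.base (k + 1) + N (k + 1)) ∧
      h'.a 2 = Function.update (Function.update (h.a 2) (x.base (k + 1) + N (k + 1))
        (h.a 2 (h.v 11))) (h.v 11) e₀ ∧
      h'.a 3 = Function.update (h.a 3) (x.base (k + 1) + N (k + 1)) (h.a 0 e₀) ∧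
      h'.a 1 = Function.update (h.a 1) (x.base (k + 1) + N (k + 1)) (h.a 1 (h.v 11)) ∧
      (∀ i, 1 ≤ i → i ≤ x.K → h'.a 9 (2 ^ (x.K - i)) = x.base i + N' i) ∧
      Lev x.K x.base N' (h'.a 1) ∧
      VOk x N' (h'.a 1) (h.a 7) (h'.a 4) := by
  have hW := hx.W_ge
  have hP := x.P_pos
  have hPM := hx.P_le
  have hM2 := hx.M_two
  have hD := hx.D_eq
  have hK1 : 1 ≤ x.K := Ctx.K_pos
  have hMZ := hx.Z_ge
  have he0 : e₀ < N 0 := by rw [hd.sz.zero]; exact he₀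
  set hn := x.base (k + 1) + N (k + 1) with hhn
  have hsz' : Sizes x N' := hN' ▸ hd.sz.update hcap
  have hhm : hn ∈ Nd x.base N' (k + 1) := by
    rw [hN']
    exact Inv.mem_Nd_update.mpr (Or.inr ⟨rfl, hhn⟩)
  have hnew : ∀ i ≤ x.K, hn ∉ Nd x.base N i := fun i hi => hd.inv.new_not_mem hk hroom hi
  have hgm : h.v 11 ∈ Nd x.base N (k + 1) := by rw [h11]; exact hd.inv.anc_mem hk he0
  set g := h.v 11 with hg
  have hgn : g ≠ hn := fun hc => hnew (k + 1) hk (hc ▸ hgm)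
  obtain ⟨n1, n2⟩ := hsz'.node (by omega) (by omega) hhm
  obtain ⟨g1, g2⟩ := hd.sz.node (by omega) (by omega) hgm
  have nl := hx.node_lt n2
  have gl := hx.node_lt g2
  have hone := hsz'.one
  have hp2 : 2 ^ (x.K - (k + 1)) ≤ x.P := x.two_pow_le (by omega)
  have hnf := hd.nf (k + 1) (by omega) (by omega)
  have hnf' : ∀ i, 1 ≤ i → i ≤ x.K → Function.update (h.a 9) (2 ^ (x.K - (k + 1))) (hn + 1)
      (2 ^ (x.K - i)) = x.base i + N' i := by
    intro i hi hiK
    rw [Function.update_apply, hN', Function.update_apply]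
    by_cases hik : i = k + 1
    · subst hik
      simp [hhn]
      omega
    · rw [if_neg hik, if_neg, hd.nf i hi hiK]
      intro hc
      have := Nat.pow_right_injective (le_refl 2) hc
      omega
  have hP9 : Function.update (h.a 9) (2 ^ (x.K - (k + 1))) (hn + 1) x.P = x.M + N' 1 := by
    have := hnf' 1 le_rfl hK1
    rwa [x.base_one, show x.K - 1 = x.L by simp [Ctx.K]] at this
  set par' := Function.update (h.a 1) hn (h.a 1 g) with hpar'
  have hlev' : Lev x.K x.base N' par' := by
    refine ⟨?_, hd.inv.base_zero, ?_⟩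
    · intro i hi
      have := hd.inv.disj i hi
      rw [hN', Function.update_apply]
      split_ifs with hc
      · subst hc
        have : hn < x.base (k + 1 + 1) := hroom hi
        omega
      · exact this
    · intro i hi c hcm
      rw [hN'] at hcm
      rw [hpar', hN', Function.update_apply]
      rcases Inv.mem_Nd_update.mp hcm with h3 | ⟨rfl, h3⟩
      · rw [if_neg (fun q : c = hn => hnew i (by omega) (q ▸ h3))]
        exact Inv.mem_Nd_update.mpr (Or.inl (hd.inv.par_mem i hi c h3))
      · rw [if_pos h3]
        exact Inv.mem_Nd_update.mpr (Or.inl (hd.inv.par_mem _ hi g hgm))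
  set y : HS := ((((((((h.set 12 hn).put 9 (2 ^ (x.K - (k + 1))) (hn + 1)).put 2 hn (h.a 2 g)).put 2
    g e₀).put 0 hn (h.a 0 g)).put 0 g hn).put 3 hn (h.a 0 e₀)).put 1 hn (h.a 1 g)).set 19 (N' 1)
    with hy
  have hcy : Cst x y := ⟨hc.M, hc.B, hc.P, hc.Kc⟩
  have y12 : y.v 12 = hn := by simp [hy]
  have y19 : y.v 19 = N' 1 := by simp [hy]
  have y4 : y.a 4 = h.a 4 := by simp [hy]
  have e0n : e₀ ≠ hn := by omega
  have e0g : e₀ ≠ g := by omega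
  unfold newGroup
  simp only [wp_seq, wp_put, wp_asg, Exp.ok, Exp.eval, Op.eval, Lim.bd_zero,
    Lim.bd_pos l 1 (by norm_num), Lim.bd_pos l 2 (by norm_num), Lim.bd_pos l 3 (by norm_num),
    Lim.bd_pos l 9 (by norm_num)]
  simp only [HS.set_v, HS.put_v, if_true, h14, hnf, ← hhn,
    show (14 : ℕ) ≠ 12 by norm_num, show (11 : ℕ) ≠ 12 by norm_num, show (9 : ℕ) ≠ 12 by norm_num,
    show (3 : ℕ) ≠ 12 by norm_num, show (1 : ℕ) ≠ 12 by norm_num, if_false, ← hg, h9, hc.P, hc.M]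
  have q1 : ((h.set 12 hn).put 9 (2 ^ (x.K - (k + 1))) (hn + 1)).a 2 g = h.a 2 g := by simp
  simp only [q1]
  have q2 : ((((h.set 12 hn).put 9 (2 ^ (x.K - (k + 1))) (hn + 1)).put 2 hn (h.a 2 g)).put 2
    g e₀).a 0 g = h.a 0 g := by simp
  simp only [q2]
  have q3 : ((((((h.set 12 hn).put 9 (2 ^ (x.K - (k + 1))) (hn + 1)).put 2 hn (h.a 2 g)).put 2
    g e₀).put 0 hn (h.a 0 g)).put 0 g hn).a 0 e₀ = h.a 0 e₀ := by
    simp [Function.update_of_ne e0n, Function.update_of_ne e0g]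
  simp only [q3]
  have q4 : (((((((h.set 12 hn).put 9 (2 ^ (x.K - (k + 1))) (hn + 1)).put 2 hn (h.a 2 g)).put 2
    g e₀).put 0 hn (h.a 0 g)).put 0 g hn).put 3 hn (h.a 0 e₀)).a 1 g = h.a 1 g := by simp
  simp only [q4]
  have q5 : ((((((((h.set 12 hn).put 9 (2 ^ (x.K - (k + 1))) (hn + 1)).put 2 hn (h.a 2 g)).put 2
    g e₀).put 0 hn (h.a 0 g)).put 0 g hn).put 3 hn (h.a 0 e₀)).put 1 hn (h.a 1 g)).a 9 x.P =
      x.M + N' 1 := by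
    simpa using hP9
  simp only [q5, show x.M + N' 1 - x.M = N' 1 by omega, ← hy]
  refine ⟨by norm_num, ⟨by norm_num, by norm_num, by omega⟩, by norm_num, by norm_num, by omega,
    ⟨by norm_num, by omega, by omega⟩, by norm_num, by norm_num, by omega,
    ⟨by norm_num, by norm_num, by omega⟩, by norm_num, by norm_num, by omega, by norm_num,
    by norm_num, by norm_num, by omega, ⟨by norm_num, by norm_num, by omega⟩,
    by norm_num, by norm_num, by omega, by norm_num, by norm_num, by norm_num, by omega,
    ⟨by norm_num, by norm_num, by omega⟩, by norm_num, by norm_num, by omega,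
    ⟨by norm_num, by norm_num, by omega⟩, by norm_num,
    ⟨⟨by norm_num, by norm_num, by omega⟩, by norm_num, by omega⟩, ?_⟩
  have hrow := rowZero_spec hx hcy (g := 12) (by norm_num) (by norm_num) (by omega) (by omega)
    (by omega)
  refine hrow.mono fun h₁ t₁ ⟨ht₁, hF₁, hV₁⟩ => ?_
  have hc₁ : Cst x h₁ := hcy.of_fr hF₁ (by simp [rowZero, HC.for, HC.wv])
  have v12 : h₁.v 12 = hn := by rw [hF₁.v 12 (by simp [rowZero, HC.for, HC.wv]), y12]
  have v19 : h₁.v 19 = N' 1 := by rw [hF₁.v 19 (by simp [rowZero, HC.for, HC.wv]), y19]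
  have v14 : h₁.v 14 = 2 ^ (x.K - (k + 1)) := by
    rw [hF₁.v 14 (by simp [rowZero, HC.for, HC.wv])]; simp [hy, h14]
  have A₁ : ∀ i, i ≠ 4 → h₁.a i = y.a i := fun i hi => hF₁.a i (by simp [rowZero, HC.for, HC.wa, hi])
  have V₁ : ∀ v, v ≠ 18 → h₁.v v = y.v v := fun i hi => hF₁.v i (by simp [rowZero, HC.for, HC.wv, hi])
  have Y : ∀ v, v ∉ newGroup.wv → y.v v = h.v v := by
    intro v hv
    simp only [newGroup, HC.wv, List.mem_append, List.mem_singleton, not_or] at hv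
    simp [hy, hv]
  have Ya : ∀ v, v ∉ newGroup.wa → y.a v = h.a v := by
    intro v hv
    simp only [newGroup, HC.wa, List.mem_append, List.mem_singleton, not_or] at hv
    simp [hy, hv]
  -- the counts of the new group are zero
  have hanc : ∀ i ≤ x.K, ∀ e < x.M, anc par' i e = anc (h.a 1) i e := fun i hi e he =>
    hd.inv.lev.anc_update_new hnew (by omega) (by rw [hd.sz.zero]; exact he)
  have hpmate : ∀ e < x.M, par' (h.a 7 e) = h.a 1 (h.a 7 e) := fun e he =>
    hanc 1 hK1 _ (hd.mate.lt e he)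
  have hcnt : ∀ i, 1 ≤ i → i ≤ x.K → ∀ G ∈ Nd x.base N' i, ∀ j < N' 1,
      cnt x.M (h.a 7) par' i G j = if G = hn ∨ (k = 0 ∧ j = hn - x.M) then 0
        else h.a 4 (x.ix G j) := by
    intro i hi hiK G hG j hj
    have e1 : cnt x.M (h.a 7) par' i G j = cnt x.M (h.a 7) (h.a 1) i G j := by
      unfold cnt
      congr 1
      refine Finset.filter_congr fun e he => ?_
      have he := Finset.mem_range.mp he
      rw [hanc i hiK e he, hpmate e he]
    rw [e1]
    split_ifs with h1
    · unfold cnt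
      rw [Finset.card_eq_zero, Finset.filter_eq_empty_iff]
      intro e he
      have he := Finset.mem_range.mp he
      rcases h1 with rfl | ⟨rfl, h2⟩
      · rintro ⟨h2, -⟩
        exact hnew i hiK (h2 ▸ hd.inv.anc_mem hiK (by rw [hd.sz.zero]; exact he))
      · rintro ⟨-, h3⟩
        refine hnew 1 hK1 ?_
        rw [show hn = h.a 1 (h.a 7 e) by omega]
        exact hd.inv.par_mem 0 (by omega) _ (hd.inv.mem_zero.mpr (by
          rw [hd.sz.zero]; exact hd.mate.lt e he))
    · rw [not_or] at h1
      have hGN : G ∈ Nd x.base N i := by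
        rw [hN'] at hG
        rcases Inv.mem_Nd_update.mp hG with h3 | ⟨-, h3⟩
        · exact h3
        · exact absurd h3 h1.1
      refine (hd.V i hi hiK G hGN j ?_).symm
      rw [hN', Function.update_apply] at hj
      split_ifs at hj with h3
      · have : k = 0 := by omega
        subst this
        have h4 : ¬ j = hn - x.M := fun h5 => h1.2 ⟨rfl, h5⟩
        have hb := x.base_one
        have h5 : hn = x.base 1 + N 1 := hhn
        have h6 : j < N 1 + 1 := hj
        omega
      · exact hj
  have fin : ∀ h₂ : HS, h₂.v 12 = hn → h₂.v 19 = N' 1 → (∀ i, i ≠ 4 → h₂.a i = h₁.a i) →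
      (∀ G j, x.M ≤ G → G < x.M + 20 * x.P → j < 10 * x.P →
        h₂.a 4 (x.ix G j) = if k = 0 ∧ j = hn - x.M then 0 else h₁.a 4 (x.ix G j)) →
      h₂.v 12 = hn ∧ h₂.v 19 = N' 1 ∧
      h₂.a 0 = Function.update (Function.update (h.a 0) hn (h.a 0 g)) g hn ∧
      h₂.a 2 = Function.update (Function.update (h.a 2) hn (h.a 2 g)) g e₀ ∧
      h₂.a 3 = Function.update (h.a 3) hn (h.a 0 e₀) ∧
      h₂.a 1 = par' ∧
      (∀ i, 1 ≤ i → i ≤ x.K → h₂.a 9 (2 ^ (x.K - i)) = x.base i + N' i) ∧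
      Lev x.K x.base N' (h₂.a 1) ∧ VOk x N' (h₂.a 1) (h.a 7) (h₂.a 4) := by
      intro h₂ w12 w19 hA hV₂
      have e1' : h₂.a 1 = par' := by
        rw [hA 1 (by norm_num), A₁ 1 (by norm_num)]; simp [hy, hpar']
      refine ⟨w12, w19, ?_, ?_, ?_, e1', ?_, e1' ▸ hlev', ?_⟩
      · rw [hA 0 (by norm_num), A₁ 0 (by norm_num)]; simp [hy]
      · rw [hA 2 (by norm_num), A₁ 2 (by norm_num)]; simp [hy]
      · rw [hA 3 (by norm_num), A₁ 3 (by norm_num)]; simp [hy]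
      · rw [hA 9 (by norm_num), A₁ 9 (by norm_num)]; simpa [hy] using hnf'
      · rw [e1']
        intro i hi hiK G hG j hj
        obtain ⟨G1, G2⟩ := hsz'.node hi hiK hG
        rw [hcnt i hi hiK G hG j hj, hV₂ G j G1 G2 (by omega), hV₁ G j G1 (by omega), y12, y19, y4]
        by_cases p1 : G = hn <;> by_cases p2 : k = 0 ∧ j = hn - x.M <;> simp [p1, p2, hj]
  have hQ : (Exp.v 14 =~ Exp.v 3).eval h₁ = if k = 0 then 1 else 0 := by
    simp [v14, hc₁.P, two_pow_eq_P hk]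
  rw [wp_ite, hQ]
  refine ⟨⟨by norm_num, by norm_num, (Op.eval_eq_le _ _).trans (by omega)⟩, ?_, ?_⟩
  · intro h0
    have hk0 : k = 0 := by
      by_contra hc
      simp [hc] at h0
    have hnb : hn - x.M < 10 * x.P := by
      subst hk0
      have := hsz'.block hhm
      omega
    refine (colZero_spec hx hc₁ (by rw [v12]) hnb).mono fun h₂ t₂ ⟨ht₂, hF₂, hV₂⟩ => ?_
    have A₂ : ∀ i, i ≠ 4 → h₂.a i = h₁.a i := fun i hi =>
      hF₂.a i (by simp [colZero, HC.for, HC.wa, hi])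
    refine ⟨?_, ?_, ?_⟩
    · simp
      omega
    · exact Fr.trans ⟨Y, Ya⟩ (Fr.trans (hF₁.sub (by simp +contextual [HC.wv])
        (by simp +contextual [HC.wa])) (hF₂.sub (by simp +contextual [HC.wv])
        (by simp +contextual [HC.wa])))
    · refine fin h₂ (by rw [hF₂.v 12 (by simp [colZero, HC.for, HC.wv]), v12])
        (by rw [hF₂.v 19 (by simp [colZero, HC.for, HC.wv]), v19]) A₂ ?_
      intro G j hG hG' hj
      rw [hV₂ G j hG hG' hj]
      simp [hk0]
  · intro h0
    have hk0 : k ≠ 0 := by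
      rintro rfl
      simp at h0
    rw [wp_skip]
    refine ⟨?_, ?_, ?_⟩
    · simp
      omega
    · exact Fr.trans ⟨Y, Ya⟩ (hF₁.sub (by simp +contextual [HC.wv])
        (by simp +contextual [HC.wa]))
    · refine fin h₁ v12 v19 (fun _ _ => rfl) ?_
      intro G j hG hG' hj
      simp [hk0]

end newGroup

end FlipRepair

namespace FlipRepair

namespace Inv

variable {K : ℕ} {base N nxt par la fa par' la' : ℕ → ℕ} {rk : ℕ → ℕ → ℕ} {k e₀ : ℕ}

/-- Ends of groups remain ends of groups. -/
theorem split_la (h : Inv K base N nxt par la fa rk) (hk : k < K)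
    (hroom : k + 1 < K → base (k + 1) + N (k + 1) < base (k + 2))
    (he₀ : e₀ < N 0) (hl₀ : la (anc par k e₀) = e₀) (hl₁ : la (anc par (k + 1) e₀) ≠ e₀)
    (hp : SplitPar base N par la rk k e₀ par')
    (hla : la' = Function.update (Function.update la (base (k + 1) + N (k + 1))
      (la (anc par (k + 1) e₀))) (anc par (k + 1) e₀) e₀) {i e : ℕ} (hi : i ≤ K) (he : e < N 0)
    (hl : la (anc par i e) = e) : la' (anc par' i e) = e := by
  have hnew : ∀ i ≤ K, base (k + 1) + N (k + 1) ∉ Nd base N i := fun i hi =>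
    h.new_not_mem hk hroom hi
  have hgm := h.anc_mem (k := k + 1) hk he₀
  have hm := h.anc_mem hi he
  have hrz := h.rk_lt_la hk he₀ hl₁
  have hgn : base (k + 1) + N (k + 1) ≠ anc par (k + 1) e₀ := fun hc =>
    hnew (k + 1) hk (hc ▸ hgm)
  have hin : anc par i e ≠ base (k + 1) + N (k + 1) := fun hc => hnew i hi (hc ▸ hm)
  by_cases hik : i = k + 1
  · subst hik
    rw [h.split_anc_eq hk hroom he₀ hl₀ hp he]
    by_cases hg : anc par (k + 1) e = anc par (k + 1) e₀
    · rw [hg] at hl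
      rw [if_pos ⟨hg, by rw [← hl]; exact hrz⟩, hla, Function.update_of_ne hgn,
        Function.update_self, hl]
    · rw [if_neg fun hc => hg hc.1, hla, Function.update_of_ne hg, Function.update_of_ne hin, hl]
  · have hA : anc par' i e = anc par i e := by
      rcases Nat.lt_or_ge i (k + 1) with h1 | h1
      · exact h.split_anc_le hk hroom hp (by omega) he
      · exact h.split_anc_gt hk hroom he₀ hl₀ hp (by omega) hi he
    rw [hA, hla, Function.update_of_ne, Function.update_of_ne hin, hl]
    intro hc
    exact hik (h.lvl_unique hi hk (hc ▸ hm) hgm)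

theorem split_la_self (h : Inv K base N nxt par la fa rk) (hk : k < K)
    (hroom : k + 1 < K → base (k + 1) + N (k + 1) < base (k + 2))
    (he₀ : e₀ < N 0) (hl₀ : la (anc par k e₀) = e₀)
    (hp : SplitPar base N par la rk k e₀ par')
    (hla : la' = Function.update (Function.update la (base (k + 1) + N (k + 1))
      (la (anc par (k + 1) e₀))) (anc par (k + 1) e₀) e₀) :
    anc par' (k + 1) e₀ = anc par (k + 1) e₀ ∧ la' (anc par' (k + 1) e₀) = e₀ := by
  have : anc par' (k + 1) e₀ = anc par (k + 1) e₀ := by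
    rw [h.split_anc_eq hk hroom he₀ hl₀ hp he₀, if_neg (by omega)]
  rw [this, hla, Function.update_self]
  exact ⟨rfl, rfl⟩

theorem split_kids (h : Inv K base N nxt par la fa rk) (hk : k < K)
    (hroom : k + 1 < K → base (k + 1) + N (k + 1) < base (k + 2))
    (he₀ : e₀ < N 0) (hl₀ : la (anc par k e₀) = e₀) (hl₁ : la (anc par (k + 1) e₀) ≠ e₀)
    (hp : SplitPar base N par la rk k e₀ par') {N' : ℕ → ℕ}
    (hN' : N' = Function.update N (k + 1) (N (k + 1) + 1)) {i G : ℕ} (hi : i < K)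
    (hG : G ∈ Nd base N' (i + 1)) :
    (i = k → (G = anc par (k + 1) e₀ ∨ G = base (k + 1) + N (k + 1)) →
      kids base N' par' i G + 1 ≤ kids base N par k (anc par (k + 1) e₀)) ∧
    (i = k → ¬ (G = anc par (k + 1) e₀ ∨ G = base (k + 1) + N (k + 1)) →
      G ∈ Nd base N (i + 1) ∧ kids base N' par' i G ≤ kids base N par i G) ∧
    (i ≠ k → G ∈ Nd base N (i + 1) ∧ kids base N' par' i G ≤ kids base N par i G +
      if i = k + 1 ∧ G = anc par (k + 2) e₀ then 1 else 0) := by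
  set g := anc par (k + 1) e₀ with hg
  set hn := base (k + 1) + N (k + 1) with hhn
  have hnew : ∀ i ≤ K, hn ∉ Nd base N i := fun i hi => h.new_not_mem hk hroom hi
  have hgm : g ∈ Nd base N (k + 1) := h.anc_mem hk he₀
  have hrz := h.rk_lt_la hk he₀ hl₁
  rw [← hg] at hrz
  have hNk : Nd base N' k = Nd base N k := by
    ext c
    rw [hN', mem_Nd_update]
    constructor
    · rintro (h1 | ⟨h1, -⟩)
      · exact h1
      · omega
    · exact Or.inl
  refine ⟨?_, ?_, ?_⟩
  · rintro rfl hGG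
    -- the children on both sides
    have hc₀ := h.anc_mem hk.le he₀
    have hz := h.la_lt hk he₀
    rw [← hg] at hz
    have hlz := h.la_down i hk _ hz (by rw [h.anc_la hk he₀])
    have hc₁ := h.anc_mem hk.le hz
    have hpz : par (anc par i (la g)) = g := by rw [← anc_succ par]; exact h.anc_la hk he₀
    have hp₀ : par (anc par i e₀) = g := by rw [hg, anc_succ par]
    rw [kids, hNk]
    have key : ∀ c₂ ∈ Nd base N i, par c₂ = g → par' c₂ ≠ G →
        (∀ c ∈ Nd base N i, par' c = G → par c = g) →
        ((Nd base N i).filter fun c => par' c = G).card + 1 ≤ kids base N par i g := by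
      intro c₂ h1 h2 h3 h4
      have : insert c₂ ((Nd base N i).filter fun c => par' c = G) ⊆
          (Nd base N i).filter fun c => par c = g := by
        intro c
        simp only [Finset.mem_insert, Finset.mem_filter]
        rintro (rfl | ⟨h5, h6⟩)
        · exact ⟨h1, h2⟩
        · exact ⟨h5, h4 c h5 h6⟩
      have := Finset.card_le_card this
      rwa [Finset.card_insert_of_notMem (by simp [h3])] at this
    have hpv : ∀ c ∈ Nd base N i, par' c = if par c = g ∧ rk (i + 1) e₀ < rk (i + 1) (la c)
        then hn else par c := by
      intro c hc
      rw [hp, if_neg (fun q : c = hn => hnew i hk.le (q ▸ hc))]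
      simp [hc, ← hg, ← hhn]
    have hgn : g ≠ hn := fun hc => hnew (i + 1) hk (hc ▸ hgm)
    rcases hGG with rfl | rfl
    · refine key _ hc₁ hpz ?_ ?_
      · rw [hpv _ hc₁, if_pos ⟨hpz, by rw [hlz]; exact hrz⟩]
        exact hgn.symm
      · intro c hc hpc
        rw [hpv c hc] at hpc
        split_ifs at hpc with h1
        · exact h1.1
        · exact hpc
    · refine key _ hc₀ hp₀ ?_ ?_
      · rw [hpv _ hc₀, if_neg (by rw [hl₀]; omega), hp₀]
        exact hgn
      · intro c hc hpc
        rw [hpv c hc] at hpc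
        split_ifs at hpc with h1
        · exact h1.1
        · exact absurd (h.par_mem i hk c hc) (hpc ▸ hnew (i + 1) hk)
  · rintro rfl hGG
    rw [not_or] at hGG
    have hGN : G ∈ Nd base N (i + 1) := by
      rw [hN'] at hG
      rcases mem_Nd_update.mp hG with h3 | ⟨-, h3⟩
      · exact h3
      · exact absurd h3 hGG.2
    refine ⟨hGN, ?_⟩
    rw [kids, hNk]
    refine Finset.card_le_card fun c => ?_
    simp only [Finset.mem_filter]
    rintro ⟨hc, hpc⟩
    rw [hp, if_neg (fun q : c = hn => hnew i hk.le (q ▸ hc))] at hpc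
    split_ifs at hpc with h1
    · exact absurd hpc.symm hGG.2
    · exact ⟨hc, hpc⟩
  · intro hik
    have hGN : G ∈ Nd base N (i + 1) := by
      rw [hN'] at hG
      rcases mem_Nd_update.mp hG with h3 | ⟨h3, -⟩
      · exact h3
      · omega
    refine ⟨hGN, ?_⟩
    have hsub : ((Nd base N' i).filter fun c => par' c = G) ⊆
        ((Nd base N i).filter fun c => par c = G) ∪
          if i = k + 1 ∧ G = anc par (k + 2) e₀ then {hn} else ∅ := by
      intro c
      simp only [Finset.mem_filter, Finset.mem_union]
      rintro ⟨hc, hpc⟩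
      rw [hN'] at hc
      rw [hp] at hpc
      rcases mem_Nd_update.mp hc with h3 | ⟨h3, h4⟩
      · rw [if_neg (fun q => hik (h.lvl_unique hi.le hk.le h3 q.1)),
          if_neg (fun q : c = hn => hnew i hi.le (q ▸ h3))] at hpc
        exact Or.inl ⟨h3, hpc⟩
      · right
        change c = hn at h4
        rw [if_neg (fun q => hnew k hk.le (h4 ▸ q.1)), if_pos h4] at hpc
        rw [if_pos ⟨h3, by rw [← hpc, anc_succ par (k + 1)]⟩, Finset.mem_singleton]
        exact h4
    refine (Finset.card_le_card hsub).trans ((Finset.card_union_le _ _).trans ?_)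
    refine Nat.add_le_add_left ?_ _
    split_ifs <;> simp

end Inv

variable {x : Ctx} {l : Lim} {N : ℕ → ℕ} {rk : ℕ → ℕ → ℕ}

/-- Split the group `11` after its child `10`, which ends with the arc `9`. -/
def split : HC := newGroup ;; moveRest

theorem Ctx.room {k : ℕ} (hcap : N (k + 1) < 10 * 2 ^ (x.K - (k + 1))) :
    k + 1 < x.K → x.base (k + 1) + N (k + 1) < x.base (k + 2) := by
  intro h
  rw [x.base_succ (by omega) h]
  omega

theorem split_spec (hx : x.Ok l) {h : HS} (hc : Cst x h) (hd : DS x N rk h) {k e₀ : ℕ}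
    (hk : k < x.K) (he₀ : e₀ < x.M) (h9 : h.v 9 = e₀) (h10 : h.v 10 = anc (h.a 1) k e₀)
    (h11 : h.v 11 = anc (h.a 1) (k + 1) e₀)
    (h14 : h.v 14 = 2 ^ (x.K - (k + 1))) (hcap : N (k + 1) < 10 * 2 ^ (x.K - (k + 1)))
    (hl₀ : h.a 2 (anc (h.a 1) k e₀) = e₀) (hl₁ : h.a 2 (anc (h.a 1) (k + 1) e₀) ≠ e₀)
    {N' : ℕ → ℕ} (hN' : N' = Function.update N (k + 1) (N (k + 1) + 1)) :
    wp l split h fun h' t => t ≤ kids x.base N (h.a 1) k (h.v 11) * (moveTime x k + 50) +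
      1900 * x.P ∧ DS x N' rk h' ∧ (∀ e < x.M, h'.a 0 e = h.a 0 e) ∧
      Inv.SplitPar x.base N (h.a 1) (h.a 2) rk k e₀ (h'.a 1) ∧
      h'.a 2 = Function.update (Function.update (h.a 2) (x.base (k + 1) + N (k + 1))
        (h.a 2 (anc (h.a 1) (k + 1) e₀))) (anc (h.a 1) (k + 1) e₀) e₀ := by
  have hroom := x.room hcap
  have hP := x.P_pos
  have he0 : e₀ < N 0 := by rw [hd.sz.zero]; exact he₀
  have hsz' : Sizes x N' := hN' ▸ hd.sz.update hcap
  have hgm := hd.inv.anc_mem (k := k + 1) hk he0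
  have hgM := (hd.sz.node (by omega) (by omega) hgm).1
  have hnM := x.base_ge (k := k + 1) (by omega)
  unfold split
  rw [wp_seq]
  refine (newGroup_spec hx hc hd hk he₀ h9 h11 h14 hcap hroom hN').mono fun h₁ t₁
    ⟨ht₁, hF₁, w12, w19, b0, b2, b3, b1, b9, blev, bV⟩ => ?_
  have wv : ∀ v, v ∉ newGroup.wv → h₁.v v = h.v v := hF₁.v
  have v10 : h₁.v 10 = h.v 10 := hF₁.v 10 (by simp [newGroup, HC.wv, rowZero, colZero, HC.for])
  have v11 : h₁.v 11 = h.v 11 := hF₁.v 11 (by simp [newGroup, HC.wv, rowZero, colZero, HC.for])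
  have v14 : h₁.v 14 = h.v 14 := hF₁.v 14 (by simp [newGroup, HC.wv, rowZero, colZero, HC.for])
  have a7 : h₁.a 7 = h.a 7 := hF₁.a 7 (by simp [newGroup, HC.wa, rowZero, colZero, HC.for])
  have hc₁ : Cst x h₁ := hc.of_fr hF₁ (by simp [newGroup, HC.wv, rowZero, colZero, HC.for])
  have hgn : x.base (k + 1) + N (k + 1) ≠ h.v 11 := by
    rw [h11]
    exact fun hc => hd.inv.new_not_mem hk hroom (i := k + 1) hk (hc ▸ hgm)
  have key := moveRest_spec hx hc₁ hd.inv hsz' hk he0 hl₀ hroom hN' (by rw [a7]; exact hd.mate)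
    (by rw [v10, h10]) (by rw [v11, h11]) w12 (by rw [v14, h14]) w19 (by
      intro G h1 h2
      rw [b0, Function.update_of_ne (v11 ▸ h1), Function.update_of_ne (w12 ▸ h2)])
    (by rw [w12, v11]; exact b1) (by
      intro G h1 h2
      rw [b2, Function.update_of_ne (v11 ▸ h1), Function.update_of_ne (w12 ▸ h2)])
    (by rw [b2, w12, v11, Function.update_of_ne hgn, Function.update_self]) blev
    (by rw [a7]; exact bV)
  refine key.frame fun h₂ t₂ ⟨ht₂, c1, c4⟩ hF₂ => ?_
  have a : ∀ k, k ≠ 1 → k ≠ 4 → h₂.a k = h₁.a k := fun k hk1 hk4 => hF₂.a k (by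
    simp [moveRest, move, moveArc, moveRow, climb, rowMove, HC.wa, HC.for, hk1, hk4])
  have e2 : h₂.a 2 = Function.update (Function.update (h.a 2) (x.base (k + 1) + N (k + 1))
      (h.a 2 (anc (h.a 1) (k + 1) e₀))) (anc (h.a 1) (k + 1) e₀) e₀ := by
    rw [a 2 (by norm_num) (by norm_num), b2, h11]
  have e0 : h₂.a 0 = Function.update (Function.update (h.a 0) (x.base (k + 1) + N (k + 1))
      (h.a 0 (anc (h.a 1) (k + 1) e₀))) (anc (h.a 1) (k + 1) e₀) (x.base (k + 1) + N (k + 1)) := by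
    rw [a 0 (by norm_num) (by norm_num), b0, h11]
  refine ⟨?_, ⟨?_, hsz', ?_, ?_, ?_, ?_⟩, ?_, c1, e2⟩
  · rw [v11] at ht₂
    omega
  · have := hd.inv.split hk hroom he0 hl₀ hl₁ c1 e0 e2 (fa' := h₂.a 3) (by
      rw [a 3 (by norm_num) (by norm_num), b3])
    rwa [← hN'] at this
  · rw [a 7 (by norm_num) (by norm_num), a7]
    exact hd.mate
  · rw [a 9 (by norm_num) (by norm_num)]
    exact b9
  · rw [a 7 (by norm_num) (by norm_num), a7]
    rwa [a7] at c4
  · rw [hF₂.v 19 (by simp [moveRest, move, moveArc, moveRow, climb, rowMove, HC.wv, HC.for]), w19]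
  · intro e he
    rw [e0, Function.update_of_ne (by omega), Function.update_of_ne (by omega)]

end FlipRepair

namespace FlipRepair

variable {x : Ctx} {l : Lim} {N : ℕ → ℕ} {rk : ℕ → ℕ → ℕ}

theorem DS.of_eq {h h' : HS} (hd : DS x N rk h) (ha : h'.a = h.a) (hv : h'.v 19 = h.v 19) :
    DS x N rk h' := by
  obtain ⟨h1, h2, h3, h4, h5, h6⟩ := hd
  rw [← ha] at h1 h3 h4 h5
  exact ⟨h1, h2, h3, h4, h5, by rw [hv, h6]⟩

/-- The bound for the number of children of level `k` of a group. -/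
def kb (x : Ctx) (k : ℕ) : ℕ := if k = 0 then x.B else 4

/-- The groups have few children. -/
def Cards (x : Ctx) (N par : ℕ → ℕ) : Prop :=
  ∀ k < x.K, ∀ G ∈ Nd x.base N (k + 1), kids x.base N par k G ≤ kb x k

/-- Make the arc `9` the end of its groups of all levels. -/
def cut : HC :=
  .asg 10 (.v 9) ;;
  .asg 14 (.v 3) ;;
  .loop (.v 14) (
    .asg 11 (.get 1 (.v 10)) ;;
    .ite (.get 2 (.v 11) =~ .v 9) .skip split ;;
    .asg 10 (.v 11) ;;
    .asg 14 (.v 14 /~ .c 2))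

def cutTime (x : Ctx) : ℕ := x.K * (13000 * x.P) + x.B * (140 * x.K + 350) + 20

/-- A bound for the running time of the last `m` rounds of `cut`. -/
def cutRank (x : Ctx) (m : ℕ) : ℕ :=
  m * (13000 * x.P) + if m = x.K then x.B * (140 * x.K + 350) else 0

/-- After `s` rounds of `cut`, starting from `h` with the sizes `N`. -/
structure CutInv (x : Ctx) (N : ℕ → ℕ) (rk : ℕ → ℕ → ℕ) (h : HS) (e₀ s : ℕ) (N' : ℕ → ℕ)
    (h' : HS) : Prop where
  ds : DS x N' rk h'
  la : h'.a 2 (anc (h'.a 1) s e₀) = e₀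
  kids : ∀ k < x.K, ∀ G ∈ Nd x.base N' (k + 1), kids x.base N' (h'.a 1) k G ≤ kb x k +
    if 1 ≤ k ∧ k = s ∧ G = anc (h'.a 1) (s + 1) e₀ ∧ h'.a 2 G ≠ e₀ then 1 else 0
  size : ∀ k, N' k ≤ N k + if 1 ≤ k ∧ k ≤ s then 1 else 0
  nxt : ∀ e < x.M, h'.a 0 e = h.a 0 e
  ends : ∀ k ≤ x.K, ∀ e < x.M, h.a 2 (anc (h.a 1) k e) = e → h'.a 2 (anc (h'.a 1) k e) = e

theorem CutInv.of_eq {h h' h'' : HS} {e₀ s : ℕ} {N' : ℕ → ℕ}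
    (hi : CutInv x N rk h e₀ s N' h') (ha : h''.a = h'.a) (hv : h''.v 19 = h'.v 19) :
    CutInv x N rk h e₀ s N' h'' := by
  obtain ⟨h1, h2, h3, h4, h5, h6⟩ := hi
  refine ⟨h1.of_eq ha hv, ?_, ?_, h4, ?_, ?_⟩ <;> rw [ha] <;> assumption

theorem CutInv.skip {h h' : HS} {e₀ s : ℕ} {N' : ℕ → ℕ}
    (hi : CutInv x N rk h e₀ s N' h') (hl : h'.a 2 (anc (h'.a 1) (s + 1) e₀) = e₀) :
    CutInv x N rk h e₀ (s + 1) N' h' := by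
  obtain ⟨h1, h2, h3, h4, h5, h6⟩ := hi
  refine ⟨h1, hl, ?_, ?_, h5, h6⟩
  · intro k hk G hG
    refine (h3 k hk G hG).trans (Nat.add_le_add_left ?_ _)
    rw [if_neg]
    · exact Nat.zero_le _
    · rintro ⟨-, rfl, rfl, h8⟩
      exact h8 hl
  · intro k
    refine (h4 k).trans (Nat.add_le_add_left ?_ _)
    split_ifs <;> omega

theorem CutInv.split {h h' h'' : HS} {e₀ s : ℕ} {N' : ℕ → ℕ}
    (hi : CutInv x N rk h e₀ s N' h') (hs : s < x.K) (he₀ : e₀ < x.M)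
    (hl : h'.a 2 (anc (h'.a 1) (s + 1) e₀) ≠ e₀)
    (hcap : N' (s + 1) < 10 * 2 ^ (x.K - (s + 1))) (hsz : N' (s + 1) ≤ N (s + 1))
    {N'' : ℕ → ℕ} (hN'' : N'' = Function.update N' (s + 1) (N' (s + 1) + 1))
    (hd : DS x N'' rk h'') (h0 : ∀ e < x.M, h''.a 0 e = h'.a 0 e)
    (hp : Inv.SplitPar x.base N' (h'.a 1) (h'.a 2) rk s e₀ (h''.a 1))
    (h2 : h''.a 2 = Function.update (Function.update (h'.a 2) (x.base (s + 1) + N' (s + 1))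
        (h'.a 2 (anc (h'.a 1) (s + 1) e₀))) (anc (h'.a 1) (s + 1) e₀) e₀) :
    CutInv x N rk h e₀ (s + 1) N'' h'' := by
  have hroom := x.room hcap
  have he0 : e₀ < N' 0 := by rw [hi.ds.sz.zero]; exact he₀
  have hinv := hi.ds.inv
  obtain ⟨s1, s2⟩ := hinv.split_la_self hs hroom he0 hi.la hp h2
  refine ⟨hd, s2, ?_, ?_, ?_, ?_⟩
  · intro k hk G hG
    obtain ⟨k1, k2, k3⟩ := hinv.split_kids hs hroom he0 hi.la hl hp hN'' hk hG
    by_cases hks : k = s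
    · by_cases hGG : G = anc (h'.a 1) (s + 1) e₀ ∨ G = x.base (s + 1) + N' (s + 1)
      · have h3 := k1 hks hGG
        have h4 := hi.kids s hs _ (hinv.anc_mem (k := s + 1) hs he0)
        subst hks
        split_ifs at h4 <;> omega
      · obtain ⟨h3, h4⟩ := k2 hks hGG
        have h5 := hi.kids k hk G h3
        rw [not_or] at hGG
        subst hks
        rw [if_neg (fun q => hGG.1 q.2.2.1)] at h5
        omega
    · obtain ⟨h3, h4⟩ := k3 hks
      have h5 := hi.kids k hk G h3
      rw [if_neg (fun q => hks q.2.1)] at h5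
      refine h4.trans (Nat.add_le_add h5 ?_)
      split_ifs with h6 h7 h7
      · exact le_rfl
      · exfalso
        refine h7 ⟨by omega, h6.1, ?_, ?_⟩
        · rw [h6.2, hinv.split_anc_gt hs hroom he0 hi.la hp (by omega) (by omega) he0]
        · obtain ⟨rfl, rfl⟩ := h6
          have hm := hinv.anc_mem (k := s + 2) (by omega) he0
          rw [h2, Function.update_of_ne, Function.update_of_ne]
          · intro hc
            exact hl (hinv.la_down (s + 1) (by omega) e₀ he0 hc)
          · intro hc
            exact hinv.new_not_mem hs hroom (i := s + 2) (by omega) (hc ▸ hm)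
          · intro hc
            have := hinv.lvl_unique (i := s + 2) (j := s + 1) (by omega) (by omega) hm
              (hc ▸ hinv.anc_mem (k := s + 1) (by omega) he0)
            omega
      · omega
      · exact le_rfl
  · intro k
    have h3 := hi.size k
    rw [hN'', Function.update_apply]
    split_ifs at * <;> first | omega | (subst_vars; omega)
  · intro e he
    rw [h0 e he, hi.nxt e he]
  · intro k hk e he h3
    have h4 := hi.ends k hk e he h3
    exact hinv.split_la hs hroom he0 hi.la hl hp h2 hk (by rw [hi.ds.sz.zero]; exact he) h4

theorem cut_spec (hx : x.Ok l) {h : HS} (hc : Cst x h) (hd : DS x N rk h)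
    (hk : Cards x N (h.a 1)) (hcap : ∀ k, 1 ≤ k → k ≤ x.K → N k < 10 * 2 ^ (x.K - k)) {e₀ : ℕ}
    (he₀ : e₀ < x.M) (h9 : h.v 9 = e₀) :
    wp l cut h fun h' t => t ≤ cutTime x ∧ ∃ N', CutInv x N rk h e₀ x.K N' h' ∧
      Cards x N' (h'.a 1) := by
  have hW := hx.W_ge
  have hP := x.P_pos
  have hPM := hx.P_le
  have hM2 := hx.M_two
  have he0 : e₀ < N 0 := by rw [hd.sz.zero]; exact he₀
  unfold cut
  rw [wp_seq, wp_asg]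
  refine ⟨by norm_num, by simp, ?_⟩
  rw [wp_seq, wp_asg]
  refine ⟨by norm_num, by simp, ?_⟩
  set y := (h.set 10 ((Exp.v 9).eval h)).set 14 ((Exp.v 3).eval (h.set 10 ((Exp.v 9).eval h)))
    with hy
  have hcy : Cst x y := ⟨by simp [hy, hc.M], by simp [hy, hc.B], by simp [hy, hc.P],
      by simp [hy, hc.Kc]⟩
  have := wp_loop_rank (l := l) (e := .v 14) (c :=
    .asg 11 (.get 1 (.v 10)) ;;
    .ite (.get 2 (.v 11) =~ .v 9) .skip split ;;
    .asg 10 (.v 11) ;;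
    .asg 14 (.v 14 /~ .c 2)) (h := y) (m := x.K)
    (R := cutRank x)
    (I := fun m h' => ∃ s N', s + m = x.K ∧ h'.v 10 = anc (h'.a 1) s e₀ ∧
      h'.v 14 = lvlCtr x.K s ∧ CutInv x N rk h e₀ s N' h') ?_ ?_
  · refine this.mono fun h' t ⟨ht, hF, m, ⟨s, N', hs, h10, h14, hI⟩, hz⟩ => ⟨?_, ?_⟩
    · simp only [Exp.cost, cutRank, if_true] at *
      unfold cutTime
      omega
    · have hsK : ¬ s < x.K := by
        rw [← lvlCtr_ne, ← h14]
        simpa using hz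
      obtain rfl : s = x.K := by omega
      refine ⟨N', hI, fun k hk G hG => ?_⟩
      have := hI.kids k hk G hG
      rwa [if_neg (by omega), add_zero] at this
  · refine ⟨0, N, by omega, by simp [hy, h9], by simp [hy, hc.P, lvlCtr_zero], ?_⟩
    refine ⟨hd.of_eq rfl (by simp [hy]), ?_, ?_, ?_, fun _ _ => rfl, fun _ _ _ _ h => h⟩
    · exact hd.inv.la_arc he0
    · intro k hkK G hG
      exact (hk k hkK G hG).trans (by omega)
    · intro k
      omega
  · intro m h' ⟨s, N', hs, h10, h14, hI⟩ hF
    refine ⟨by simp, fun hz => ?_⟩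
    have hsK : s < x.K := by
      rw [← lvlCtr_ne, ← h14]
      simpa using hz
    have h9' : h'.v 9 = e₀ := by
      rw [hF.v 9 (by simp [HC.wv, split, newGroup, moveRest, move, moveArc, moveRow, climb,
        rowMove, rowZero, colZero, HC.for])]
      simp [hy, h9]
    have hc' : Cst x h' := hcy.of_fr hF (by simp [HC.wv, split, newGroup, moveRest, move, moveArc,
        moveRow, climb, rowMove, rowZero, colZero, HC.for])
    have he0' : e₀ < N' 0 := by rw [hI.ds.sz.zero]; exact he₀
    have hinv := hI.ds.inv
    have hcm := hinv.anc_mem (k := s) hsK.le he0'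
    have hgm := hinv.anc_mem (k := s + 1) hsK he0'
    obtain ⟨g1, g2⟩ := hI.ds.sz.node (by omega) (by omega) hgm
    have gl := hx.node_lt g2
    have hcz : anc (h'.a 1) s e₀ < l.Z := by
      rcases Nat.eq_zero_or_pos s with rfl | hs1
      · have := hx.Z_ge
        simp
        omega
      · exact (hx.node_lt (hI.ds.sz.node hs1 (by omega) hcm).2).2
    have hctr := lvlCtr_le (x := x) s
    refine ⟨m - 1, by omega, ?_⟩
    -- the running time of a split
    have hR : kids x.base N' (h'.a 1) s (anc (h'.a 1) (s + 1) e₀) * (moveTime x s + 50) +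
        1900 * x.P + 60 + cutRank x (m - 1) ≤ cutRank x m := by
      have hk := hI.kids s hsK _ hgm
      have hm : m * (13000 * x.P) = (m - 1) * (13000 * x.P) + 13000 * x.P := by
        rw [← Nat.succ_mul]
        congr 1
        omega
      have e1 : cutRank x (m - 1) = (m - 1) * (13000 * x.P) := by
        unfold cutRank
        rw [if_neg (show ¬ m - 1 = x.K by omega), add_zero]
      have e2 : cutRank x m = m * (13000 * x.P) + if s = 0 then x.B * (140 * x.K + 350) else 0 := by
        unfold cutRank
        congr 2
        simp only [eq_iff_iff]
        omega
      rw [e1, e2]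
      rcases Nat.eq_zero_or_pos s with rfl | hs1
      · rw [if_neg (by omega)] at hk
        rw [if_pos rfl]
        have := Nat.mul_le_mul_right (moveTime x 0 + 50) hk
        simp only [kb, moveTime, if_true, add_zero] at this
        simp only [moveTime, if_true]
        have e : x.B * (140 * x.K + 300 + 50) = x.B * (140 * x.K + 350) := by ring
        rw [e] at this
        refine (Nat.add_le_add_right (Nat.add_le_add_right (Nat.add_le_add_right this _) _) _).trans
          ?_
        have aux : ∀ a b p : ℕ, 0 < p → a + 1900 * p + 60 + b ≤ b + 13000 * p + a := by
          intro a b p hp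
          omega
        rw [hm]
        exact aux _ _ _ hP
      · have hs0 : ¬ s = 0 := by omega
        have hk5 : kids x.base N' (h'.a 1) s (anc (h'.a 1) (s + 1) e₀) ≤ 5 := by
          refine hk.trans ?_
          rw [kb, if_neg (by omega)]
          split_ifs <;> omega
        have := Nat.mul_le_mul_right (moveTime x s + 50) hk5
        have e : moveTime x s = 2100 * x.P := by rw [moveTime, if_neg hs0]
        rw [e] at this ⊢
        rw [if_neg hs0]
        omega
    have hg : h'.a 1 (anc (h'.a 1) s e₀) = anc (h'.a 1) (s + 1) e₀ := (anc_succ _ _ _).symm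
    set g := anc (h'.a 1) (s + 1) e₀ with hgdef
    rw [wp_seq, wp_asg]
    simp only [Exp.ok, Exp.eval, h10, hg, Lim.bd_pos l 1 (by norm_num)]
    refine ⟨by norm_num, ⟨by norm_num, by norm_num, hcz⟩, ?_⟩
    set z := h'.set 11 g with hzdef
    have hcz : Cst x z := ⟨by simp [hzdef, hc'.M], by simp [hzdef, hc'.B], by simp [hzdef, hc'.P],
      by simp [hzdef, hc'.Kc]⟩
    have hIz : CutInv x N rk h e₀ s N' z := hI.of_eq rfl (by simp [hzdef])
    have z11 : z.v 11 = g := by simp [hzdef]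
    have z9 : z.v 9 = e₀ := by simp [hzdef, h9']
    have z14 : z.v 14 = lvlCtr x.K s := by simp [hzdef, h14]
    have za : z.a = h'.a := rfl
    rw [wp_seq, wp_ite]
    simp only [Exp.ok, Exp.eval, z11, z9, Lim.bd_pos l 2 (by norm_num), za]
    refine ⟨⟨⟨by norm_num, by norm_num, gl.2⟩, by norm_num, (Op.eval_eq_le _ _).trans (by omega)⟩,
      ?_, ?_⟩
    · intro h0
      have hla : h'.a 2 g = e₀ := by
        by_contra hc
        simp [Op.eval, hc] at h0
      rw [wp_skip, wp_seq, wp_asg, wp_asg]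
      simp only [Exp.ok, Exp.eval, HS.set_v, z11, z14, show (14 : ℕ) ≠ 10 by norm_num, if_false,
        Op.eval]
      have := Nat.div_le_self (lvlCtr x.K s) 2
      refine ⟨by norm_num, by norm_num, by norm_num, ⟨by norm_num, by omega, by omega⟩, ?_, s + 1,
        N', by omega, ?_, ?_, ?_⟩
      · simp
        omega
      · simp [hzdef, hgdef]
      · simp [lvlCtr_div hsK]
      · exact (hIz.skip hla).of_eq rfl (by simp)
    · intro h0
      have hla : h'.a 2 g ≠ e₀ := by
        intro hc
        simp [Op.eval, hc] at h0
      have hsz : N' (s + 1) ≤ N (s + 1) := by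
        have := hI.size (s + 1)
        rwa [if_neg (by omega), add_zero] at this
      have hcap' : N' (s + 1) < 10 * 2 ^ (x.K - (s + 1)) :=
        hsz.trans_lt (hcap (s + 1) (by omega) (by omega))
      refine (split_spec hx hcz hIz.ds hsK he₀ z9 (by simp [hzdef, h10]) z11
        (by rw [z14, lvlCtr, if_pos hsK]) hcap' hI.la hla rfl).frame
        fun h'' t ⟨ht, c1, c2, c3, c4⟩ hF' => ?_
      have v11 : h''.v 11 = g := by
        rw [hF'.v 11 (by simp [HC.wv, split, newGroup, moveRest, move, moveArc, moveRow, climb,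
        rowMove, rowZero, colZero, HC.for]), z11]
      have v14 : h''.v 14 = lvlCtr x.K s := by
        rw [hF'.v 14 (by simp [HC.wv, split, newGroup, moveRest, move, moveArc, moveRow, climb,
        rowMove, rowZero, colZero, HC.for]), z14]
      rw [wp_seq, wp_asg, wp_asg]
      simp only [Exp.ok, Exp.eval, HS.set_v, v11, v14, show (14 : ℕ) ≠ 10 by norm_num, if_false,
        Op.eval]
      have := Nat.div_le_self (lvlCtr x.K s) 2
      have hnew := hIz.split hsK he₀ hla hcap' hsz rfl c1 c2 c3 c4
      have hs2 := hinv.split_la_self hsK (x.room hcap') he0' hI.la c3 c4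
      refine ⟨by norm_num, by norm_num, by norm_num, ⟨by norm_num, by omega, by omega⟩, ?_, s + 1,
        _, by omega, ?_, ?_, hnew.of_eq rfl (by simp)⟩
      · rw [z11] at ht
        change t ≤ kids x.base N' (h'.a 1) s g * _ + _ at ht
        simp
        omega
      · simp only [HS.set_a]
        rw [if_neg (by norm_num), if_true, hs2.1]
      · simp [lvlCtr_div hsK]

end FlipRepair

namespace FlipRepair

variable {x : Ctx} {l : Lim} {N : ℕ → ℕ} {rk : ℕ → ℕ → ℕ}

/-- Exchange the successors of the arcs `7` and `8` and those of their groups. -/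
def swapNext : HC :=
  .asg 10 (.v 7) ;;
  .asg 11 (.v 8) ;;
  .asg 14 (.c 2 *~ .v 3) ;;
  .loop (.v 14) (
    .asg 28 (.get 0 (.v 10)) ;;
    .put 0 (.v 10) (.get 0 (.v 11)) ;;
    .put 0 (.v 11) (.v 28) ;;
    .asg 10 (.get 1 (.v 10)) ;;
    .asg 11 (.get 1 (.v 11)) ;;
    .asg 14 (.v 14 /~ .c 2))

theorem lvlCtr_le_two (s : ℕ) : lvlCtr (x.K + 1) s ≤ 2 * x.P := by
  unfold lvlCtr
  split_ifs with h
  · unfold Ctx.P Ctx.K at *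
    rw [← pow_succ']
    exact Nat.pow_le_pow_right (by omega) (by omega)
  · omega

theorem swapNext_spec (hx : x.Ok l) {h : HS} (hc : Cst x h) (hd : DS x N rk h) {a b : ℕ}
    (ha : a < x.M) (hb : b < x.M) (h7 : h.v 7 = a) (h8 : h.v 8 = b) :
    wp l swapNext h fun h' t => t ≤ 80 * x.K + 200 ∧
      ∀ k ≤ x.K, ∀ G ∈ Nd x.base N k, h'.a 0 G =
        if G = anc (h.a 1) k a then h.a 0 (anc (h.a 1) k b)
        else if G = anc (h.a 1) k b then h.a 0 (anc (h.a 1) k a) else h.a 0 G := by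
  have hW := hx.W_ge
  have hP := x.P_pos
  have hPM := hx.P_le
  have hM2 := hx.M_two
  have hD := hx.D_eq
  have ha0 : a < N 0 := by rw [hd.sz.zero]; exact ha
  have hb0 : b < N 0 := by rw [hd.sz.zero]; exact hb
  unfold swapNext
  simp only [wp_seq, wp_asg]
  refine ⟨by norm_num, by simp, by norm_num, by simp, by norm_num, ?_, ?_⟩
  · simp [hc.P]
    omega
  set y := ((h.set 10 ((Exp.v 7).eval h)).set 11 ((Exp.v 8).eval (h.set 10 ((Exp.v 7).eval h)))).set
    14 ((Exp.c 2 *~ Exp.v 3).eval ((h.set 10 ((Exp.v 7).eval h)).set 11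
      ((Exp.v 8).eval (h.set 10 ((Exp.v 7).eval h))))) with hy
  have := wp_loop (l := l) (e := .v 14) (c :=
    .asg 28 (.get 0 (.v 10)) ;;
    .put 0 (.v 10) (.get 0 (.v 11)) ;;
    .put 0 (.v 11) (.v 28) ;;
    .asg 10 (.get 1 (.v 10)) ;;
    .asg 11 (.get 1 (.v 11)) ;;
    .asg 14 (.v 14 /~ .c 2)) (h := y) (m := x.K + 1) (C := 70)
    (I := fun m h' => ∃ s, s + m = x.K + 1 ∧ h'.v 10 = anc (h.a 1) s a ∧
      h'.v 11 = anc (h.a 1) s b ∧ h'.v 14 = lvlCtr (x.K + 1) s ∧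
      ∀ k ≤ x.K, ∀ G ∈ Nd x.base N k, h'.a 0 G = if k < s then
        if G = anc (h.a 1) k a then h.a 0 (anc (h.a 1) k b)
        else if G = anc (h.a 1) k b then h.a 0 (anc (h.a 1) k a) else h.a 0 G
        else h.a 0 G) ?_ ?_
  · refine this.mono fun h' t ⟨ht, hF, m, ⟨s, hs, h10, h11, h14, hI⟩, hz⟩ => ⟨?_, ?_⟩
    · simp only [Exp.cost] at *
      omega
    · have hsK : ¬ s < x.K + 1 := by
        rw [← lvlCtr_ne, ← h14]
        simpa using hz
      intro k hk G hG
      rw [hI k hk G hG, if_pos (by omega)]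
  · refine ⟨0, by omega, by simp [hy, h7], by simp [hy, h8], ?_, ?_⟩
    · simp [hy, hc.P, lvlCtr, Ctx.K, Ctx.P, pow_succ, mul_comm]
    · intro k _ G _
      simp [hy]
  · intro m h' ⟨s, hs, h10, h11, h14, hI⟩ hF
    refine ⟨by simp, fun hz => ?_⟩
    have hsK : s < x.K + 1 := by
      rw [← lvlCtr_ne, ← h14]
      simpa using hz
    have a1 : h'.a 1 = h.a 1 := by rw [hF.a 1 (by simp [HC.wa])]; rfl
    have ham := hd.inv.anc_mem (k := s) (by omega) ha0
    have hbm := hd.inv.anc_mem (k := s) (by omega) hb0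
    have hlt : ∀ {G}, G ∈ Nd x.base N s → G < l.D ∧ G < l.Z := by
      intro G hG
      rcases Nat.eq_zero_or_pos s with rfl | hs1
      · rw [hd.inv.mem_zero, hd.sz.zero] at hG
        have := hx.Z_ge
        omega
      · exact hx.node_lt (hd.sz.node hs1 (by omega) hG).2
    have al := hlt ham
    have bl := hlt hbm
    have ea := hI s (by omega) _ ham
    have eb := hI s (by omega) _ hbm
    rw [if_neg (by omega)] at ea eb
    have hctr := lvlCtr_le_two (x := x) s
    have hctr' := Nat.div_le_self (lvlCtr (x.K + 1) s) 2
    refine ⟨m - 1, by omega, ?_⟩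
    set A := anc (h.a 1) s a with hA
    set B := anc (h.a 1) s b with hB
    simp only [wp_seq, wp_asg, wp_put, Exp.ok, Exp.eval, HS.set_v, HS.put_v, HS.set_a, h10, h11,
      h14, Lim.bd_zero, if_true, if_false, show (10 : ℕ) ≠ 28 by norm_num,
      show (11 : ℕ) ≠ 28 by norm_num, show (11 : ℕ) ≠ 10 by norm_num, show (14 : ℕ) ≠ 28 by norm_num,
      show (14 : ℕ) ≠ 10 by norm_num, show (14 : ℕ) ≠ 11 by norm_num, Op.eval,
      Lim.bd_pos l 1 (by norm_num), ea, eb]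
    refine ⟨by norm_num, ⟨by norm_num, by norm_num, al.1⟩, by norm_num, by norm_num, al.1,
      ⟨by norm_num, by norm_num, bl.1⟩, by norm_num, by norm_num, bl.1, by norm_num, by norm_num,
      ⟨by norm_num, by norm_num, al.2⟩, by norm_num, ⟨by norm_num, by norm_num, bl.2⟩, by norm_num,
      ⟨by norm_num, by omega, by omega⟩, ?_, s + 1, by omega, ?_, ?_, ?_, ?_⟩
    · simp
    · simp [a1, hA, anc_succ]
    · simp [a1, hB, anc_succ]
    · simp [lvlCtr_div hsK]
    · intro k hk G hG
      simp only [HS.put_a_same, HS.set_a, Function.update_apply]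
      by_cases hks : k = s
      · subst hks
        rw [if_pos (show k < k + 1 by omega), ← hA, ← hB]
        have := hI k hk G hG
        rw [if_neg (lt_irrefl k)] at this
        by_cases h1 : G = B
        · by_cases h2 : G = A
          · rw [if_pos h1, if_pos h2, ← h1, ← h2]
          · rw [if_pos h1, if_neg h2, if_pos h1]
        · by_cases h2 : G = A
          · rw [if_neg h1, if_pos h2, if_pos h2]
          · rw [if_neg h1, if_neg h2, if_neg h2, if_neg h1, this]
      · have hGA : G ≠ A := fun hc => hks (hd.inv.lvl_unique hk (by omega) (hc ▸ hG) ham)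
        have hGB : G ≠ B := fun hc => hks (hd.inv.lvl_unique hk (by omega) (hc ▸ hG) hbm)
        rw [if_neg hGB, if_neg hGA, hI k hk G hG]
        congr 1
        simp only [eq_iff_iff]
        omega

/-- Exchange the successors of the arcs `7` and `8`. -/
def flipArcs : HC := .asg 9 (.v 7) ;; cut ;; .asg 9 (.v 8) ;; cut ;; swapNext

def flipTime (x : Ctx) : ℕ := 2 * cutTime x + 80 * x.K + 220

theorem not_mem_cut (k : ℕ) (hk : k ∉ [10, 11, 14, 12, 18, 13, 16, 20, 30, 31, 15, 17, 28, 19]) :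
    k ∉ cut.wv := by
  simp only [List.mem_cons, not_or] at hk
  simp [HC.wv, cut, split, newGroup, moveRest, move, moveArc, moveRow, climb, rowMove, rowZero,
    colZero, HC.for, hk]

theorem flipArcs_spec (hx : x.Ok l) {h : HS} (hc : Cst x h) (hd : DS x N rk h)
    (hk : Cards x N (h.a 1)) (hcap : ∀ k, 1 ≤ k → k ≤ x.K → N k + 1 < 10 * 2 ^ (x.K - k))
    {a b : ℕ} (ha : a < x.M) (hb : b < x.M) (h7 : h.v 7 = a) (h8 : h.v 8 = b) :
    wp l flipArcs h fun h' t => t ≤ flipTime x ∧ ∃ N', DS x N' rk h' ∧ Cards x N' (h'.a 1) ∧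
      (∀ k, N' k ≤ N k + 2) ∧
      ∀ e < x.M, h'.a 0 e = h.a 0 (if e = a then b else if e = b then a else e) := by
  unfold flipArcs
  rw [wp_seq, wp_asg]
  refine ⟨by norm_num, by norm_num, ?_⟩
  rw [wp_seq]
  have hc1 : Cst x (h.set 9 ((Exp.v 7).eval h)) := ⟨hc.M, hc.B, hc.P, hc.Kc⟩
  refine (cut_spec hx hc1 (hd.of_eq rfl (by simp)) hk (fun k h1 h2 => by
    have := hcap k h1 h2; omega) ha (by simp [h7])).frame fun h₁ t₁ ⟨ht₁, N₁, hI₁, hk₁⟩ hF₁ => ?_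
  have hc₁ : Cst x h₁ := hc1.of_fr hF₁ ⟨not_mem_cut _ (by decide), not_mem_cut _ (by decide),
    not_mem_cut _ (by decide), not_mem_cut _ (by decide)⟩
  have v7 : h₁.v 7 = a := by rw [hF₁.v 7 (not_mem_cut _ (by decide))]; simp [h7]
  have v8 : h₁.v 8 = b := by rw [hF₁.v 8 (not_mem_cut _ (by decide))]; simp [h8]
  rw [wp_seq, wp_asg]
  refine ⟨by norm_num, by norm_num, ?_⟩
  rw [wp_seq]
  have hc2 : Cst x (h₁.set 9 ((Exp.v 8).eval h₁)) := ⟨hc₁.M, hc₁.B, hc₁.P, hc₁.Kc⟩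
  have hsz1 : ∀ k, N₁ k ≤ N k + 1 := fun k => (hI₁.size k).trans (by split_ifs <;> omega)
  refine (cut_spec hx hc2 (hI₁.ds.of_eq rfl (by simp)) hk₁ (fun k h1 h2 => by
    have := hcap k h1 h2; have := hsz1 k; omega) hb (by simp [v8])).frame
    fun h₂ t₂ ⟨ht₂, N₂, hI₂, hk₂⟩ hF₂ => ?_
  have hc₂ : Cst x h₂ := hc2.of_fr hF₂ ⟨not_mem_cut _ (by decide), not_mem_cut _ (by decide),
    not_mem_cut _ (by decide), not_mem_cut _ (by decide)⟩
  have w7 : h₂.v 7 = a := by rw [hF₂.v 7 (not_mem_cut _ (by decide))]; simp [v7]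
  have w8 : h₂.v 8 = b := by rw [hF₂.v 8 (not_mem_cut _ (by decide))]; simp [v8]
  have hsz2 : ∀ k, N₂ k ≤ N₁ k + 1 := fun k => (hI₂.size k).trans (by split_ifs <;> omega)
  have e2 : N₂ 0 = x.M := hI₂.ds.sz.zero
  have hb0 : b < N₂ 0 := by omega
  have ha0 : a < N₂ 0 := by omega
  have hlb : ∀ k ≤ x.K, h₂.a 2 (anc (h₂.a 1) k b) = b := fun k hk =>
    hI₂.ds.inv.la_down' hk le_rfl hb0 hI₂.la
  have hla : ∀ k ≤ x.K, h₂.a 2 (anc (h₂.a 1) k a) = a := fun k hk =>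
    hI₂.ends k hk a ha (hI₁.ds.inv.la_down' hk le_rfl (by rw [hI₁.ds.sz.zero]; exact ha) hI₁.la)
  refine (swapNext_spec hx hc₂ hI₂.ds ha hb w7 w8).frame fun h₃ t₃ ⟨ht₃, hn⟩ hF₃ => ?_
  have w : ∀ v, v ∉ [0] → h₃.a v = h₂.a v := fun v hv => hF₃.a v (by
    simp only [List.mem_cons, not_or] at hv
    simp [HC.wa, swapNext, hv])
  refine ⟨?_, N₂, ⟨?_, hI₂.ds.sz, ?_, ?_, ?_, ?_⟩, ?_, ?_, ?_⟩
  · simp only [Exp.cost, flipTime]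
    omega
  · rw [w 1 (by decide), w 2 (by decide), w 3 (by decide)]
    exact hI₂.ds.inv.flip ha0 hb0 hla hlb hn
  · rw [w 7 (by decide)]
    exact hI₂.ds.mate
  · rw [w 9 (by decide)]
    exact hI₂.ds.nf
  · rw [w 1 (by decide), w 7 (by decide), w 4 (by decide)]
    exact hI₂.ds.V
  · rw [hF₃.v 19 (by simp [HC.wv, swapNext])]
    exact hI₂.ds.nb
  · rw [w 1 (by decide)]
    exact hk₂
  · intro k
    have := hsz1 k
    have := hsz2 k
    omega
  · intro e he
    have h1 := hn 0 (by omega) e (by rw [hI₂.ds.inv.mem_zero]; omega)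
    simp only [anc_zero] at h1
    have q1 : ∀ e < x.M, h₂.a 0 e = h.a 0 e := fun e he => by
      rw [hI₂.nxt e he, HS.set_a, hI₁.nxt e he, HS.set_a]
    rw [h1, q1 e he, q1 a ha, q1 b hb]
    by_cases h2 : e = a
    · simp [h2]
    · by_cases h3 : e = b
      · subst h3
        simp [h2]
      · simp [h2, h3]

end FlipRepair

namespace FlipRepair

variable {x : Ctx} {l : Lim} {N : ℕ → ℕ} {rk : ℕ → ℕ → ℕ}

/-- Run `c` for all nodes `16` of a cycle. -/
def cyc (c : HC) : HC :=
  .asg 24 (.v 16) ;;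
  .asg 23 (.c 1) ;;
  .loop (.v 23) (c ;; .asg 16 (.get 0 (.v 16)) ;; .asg 23 (.c 1 -~ (.v 16 =~ .v 24)))

theorem wp_cyc (hW : 1 ≤ l.W) {c : HC} {h : HS} {per G₀ C : ℕ} {J : ℕ → (ℕ → ℕ → ℕ) → Prop}
    (hv : 16 ∉ c.wv ∧ 23 ∉ c.wv ∧ 24 ∉ c.wv) (ha : 0 ∉ c.wa) (h16 : h.v 16 = G₀)
    (hper : per = Function.minimalPeriod (h.a 0) G₀) (hpos : 0 < per)
    (hD : ∀ t, (h.a 0)^[t] G₀ < l.D) (h0 : J 0 h.a)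
    (hJ : ∀ t h', t < per → h'.v 16 = (h.a 0)^[t] G₀ → J t h'.a → Fr (cyc c) h h' →
      wp l c h' fun h'' k => k ≤ C ∧ J (t + 1) h''.a) :
    wp l (cyc c) h fun h' k => k ≤ per * (C + 25) + 20 ∧ J per h'.a := by
  unfold cyc
  rw [wp_seq, wp_asg]
  refine ⟨by norm_num, by norm_num, ?_⟩
  rw [wp_seq, wp_asg]
  refine ⟨by norm_num, hW, ?_⟩
  set y := (h.set 24 ((Exp.v 16).eval h)).set 23 ((Exp.c 1).eval (h.set 24 ((Exp.v 16).eval h)))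
    with hy
  have := wp_loop (l := l) (e := .v 23) (c := c ;; .asg 16 (.get 0 (.v 16)) ;;
    .asg 23 (.c 1 -~ (.v 16 =~ .v 24))) (h := y) (C := C + 20) (m := per)
    (I := fun m h' => ∃ t, t + m = per ∧ h'.v 16 = (h.a 0)^[t] G₀ ∧
      h'.v 23 = (if t < per then 1 else 0) ∧ h'.v 24 = G₀ ∧ J t h'.a) ?_ ?_
  · refine this.mono fun h' k ⟨hk, hF, m, ⟨t, ht, u1, u2, u3, u4⟩, hz⟩ => ⟨?_, ?_⟩
    · simp only [Exp.cost] at *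
      rw [show C + 20 + 1 + 2 = C + 23 by ring] at hk
      have : per * (C + 23) ≤ per * (C + 25) := Nat.mul_le_mul_left _ (by omega)
      omega
    · have : ¬ t < per := by
        intro hc
        rw [if_pos hc] at u2
        simp [u2] at hz
      obtain rfl : t = per := by omega
      exact u4
  · exact ⟨0, by omega, by simp [hy, h16], by simp [hy, hpos], by simp [hy, h16], h0⟩
  · intro m h' ⟨t, ht, u1, u2, u3, u4⟩ hF
    refine ⟨by norm_num, fun hz => ?_⟩
    have htp : t < per := by
      by_contra hc
      rw [if_neg hc] at u2
      exact hz u2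
    refine ⟨m - 1, by omega, ?_⟩
    have hFr : Fr (cyc c) h h' := by
      refine Fr.trans (h₂ := y) ⟨fun v hv' => ?_, fun _ _ => rfl⟩
        (hF.sub (by simp +contextual [cyc, HC.wv]) (by simp +contextual [cyc, HC.wa]))
      simp only [cyc, HC.wv, List.mem_append, List.mem_singleton, not_or] at hv'
      simp [hy, hv']
    have a0 : h'.a 0 = h.a 0 := by
      rw [hF.a 0 (by simp [HC.wa, ha])]
      rfl
    rw [wp_seq]
    refine (hJ t h' htp u1 u4 hFr).frame fun h'' k ⟨hk, hJ'⟩ hF' => ?_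
    have w16 : h''.v 16 = (h.a 0)^[t] G₀ := by rw [hF'.v 16 hv.1, u1]
    have w24 : h''.v 24 = G₀ := by rw [hF'.v 24 hv.2.2, u3]
    have w0 : h''.a 0 = h.a 0 := by rw [hF'.a 0 ha, a0]
    have e1 : h''.a 0 (h''.v 16) = (h.a 0)^[t + 1] G₀ := by
      rw [w16, w0, Function.iterate_succ_apply']
    simp only [wp_seq, wp_asg, Exp.ok, Exp.eval, HS.set_v, Lim.bd_zero, if_true, w24,
      show (24 : ℕ) ≠ 16 by norm_num, if_false, e1]
    have hper' : (h.a 0)^[t + 1] G₀ = G₀ ↔ ¬ t + 1 < per := by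
      constructor
      · intro hc hlt
        have := Function.IsPeriodicPt.minimalPeriod_le (n := t + 1) (by omega) hc
        omega
      · intro hc
        obtain rfl : t + 1 = per := by omega
        rw [hper]
        exact Function.iterate_minimalPeriod
    refine ⟨by norm_num, ⟨by norm_num, by norm_num, w16 ▸ hD t⟩, by norm_num, ⟨hW, ⟨by norm_num,
      by norm_num, (Op.eval_eq_le _ _).trans hW⟩, ?_⟩, ?_, t + 1, by omega, ?_, ?_, ?_, hJ'⟩
    · simp only [Op.eval]
      omega
    · simp
      omega
    · simp
    · simp only [Op.eval, hper']
      by_cases h1 : t + 1 < per <;> simp [h1]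
    · simp

/-- Find the top group `16` of the arc `7`. -/
def findTop : HC :=
  .asg 16 (.v 7) ;;
  .asg 15 (.v 3) ;;
  .loop (.v 15) (.asg 16 (.get 1 (.v 16)) ;; .asg 15 (.v 15 /~ .c 2))

theorem DS.node_lt (hx : x.Ok l) {h : HS} (hd : DS x N rk h) {k G : ℕ} (hk : k ≤ x.K)
    (hG : G ∈ Nd x.base N k) : G < l.D ∧ G < l.Z := by
  rcases Nat.eq_zero_or_pos k with rfl | hs1
  · rw [hd.inv.mem_zero, hd.sz.zero] at hG
    have := hx.Z_ge
    have := hx.D_eq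
    omega
  · exact hx.node_lt (hd.sz.node hs1 hk hG).2

theorem findTop_spec (hx : x.Ok l) {h : HS} (hc : Cst x h) (hd : DS x N rk h) {a : ℕ}
    (ha : a < x.M) (h7 : h.v 7 = a) :
    wp l findTop h fun h' t => t ≤ 40 * x.K + 20 ∧ h'.v 16 = anc (h.a 1) x.K a := by
  have hW := hx.W_ge
  have hP := x.P_pos
  have hPM := hx.P_le
  have hM2 := hx.M_two
  have ha0 : a < N 0 := by rw [hd.sz.zero]; exact ha
  unfold findTop
  simp only [wp_seq, wp_asg]
  refine ⟨by norm_num, by simp, by norm_num, by simp, ?_⟩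
  have := wp_loop (l := l) (e := .v 15) (c := .asg 16 (.get 1 (.v 16)) ;; .asg 15 (.v 15 /~ .c 2))
    (h := (h.set 16 ((Exp.v 7).eval h)).set 15 ((Exp.v 3).eval (h.set 16 ((Exp.v 7).eval h))))
    (C := 25) (m := x.K)
    (I := fun m h' => ∃ s, s + m = x.K ∧ h'.v 16 = anc (h.a 1) s a ∧ h'.v 15 = lvlCtr x.K s) ?_ ?_
  · refine this.mono fun h' t ⟨ht, hF, m, ⟨s, hs, h16, h15⟩, hz⟩ => ⟨?_, ?_⟩
    · simp only [Exp.cost] at *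
      omega
    · have hsK : ¬ s < x.K := by
        rw [← lvlCtr_ne, ← h15]
        simpa using hz
      obtain rfl : s = x.K := by omega
      exact h16
  · exact ⟨0, by omega, by simp [h7], by simp [hc.P, lvlCtr_zero]⟩
  · intro m h' ⟨s, hs, h16, h15⟩ hF
    refine ⟨by simp, fun hz => ?_⟩
    have hsK : s < x.K := by
      rw [← lvlCtr_ne, ← h15]
      simpa using hz
    have a1 : h'.a 1 = h.a 1 := by rw [hF.a 1 (by simp [HC.wa])]; rfl
    have al := hd.node_lt hx hsK.le (hd.inv.anc_mem (k := s) hsK.le ha0)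
    have hctr := lvlCtr_le (x := x) s
    have hctr' := Nat.div_le_self (lvlCtr x.K s) 2
    refine ⟨m - 1, by omega, ?_⟩
    simp only [wp_seq, wp_asg, Exp.ok, Exp.eval, HS.set_v, h16, h15, if_false,
      show (15 : ℕ) ≠ 16 by norm_num, Op.eval, Lim.bd_pos l 1 (by norm_num)]
    refine ⟨by norm_num, ⟨by norm_num, by norm_num, al.2⟩, by norm_num,
      ⟨by norm_num, by omega, by omega⟩, ?_, s + 1, by omega, ?_, ?_⟩
    · simp
    · simp [a1, anc_succ]
    · simp [lvlCtr_div hsK]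

/-- Count the repairs by the blocks of their arcs outside of the cycle of the arc `7`. -/
def query : HC :=
  .for 17 19 (.put 5 (.v 17) (.c 0) ;; .put 6 (.v 17) (.c 0)) ;;
  findTop ;;
  cyc (.for 17 19 (.put 5 (.v 17) (.get 5 (.v 17) +~ .get 4 (eix 16 17)))) ;;
  .asg 16 (.get 1 (.v 7)) ;;
  cyc (.put 6 (.v 16 -~ .v 1) (.c 1)) ;;
  .asg 22 (.c 0) ;;
  .for 17 19 (.asg 22 (.v 22 +~ (.c 1 -~ .get 6 (.v 17)) *~ .get 5 (.v 17)))

/-- The number of arcs in the cycle of `a` with mates in block `j`. -/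
def accCount (M : ℕ) (T : Equiv.Perm (Fin M)) (par mate : ℕ → ℕ) (a : Fin M) (j : ℕ) : ℕ :=
  open Classical in
  ((Finset.univ : Finset (Fin M)).filter fun e : Fin M =>
    T.SameCycle a e ∧ par (mate e) = M + j).card

open Classical in
/-- One if block `j` is in the cycle of `a`. -/
noncomputable def markVal (M : ℕ) (T : Equiv.Perm (Fin M)) (par : ℕ → ℕ) (a : Fin M) (j : ℕ) : ℕ :=
  if ∃ e : Fin M, T.SameCycle a e ∧ par e = M + j then 1 else 0

end FlipRepair

namespace FlipRepair

variable {x : Ctx} {l : Lim} {N : ℕ → ℕ} {rk : ℕ → ℕ → ℕ}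

section counts

variable {M : ℕ} {T : Equiv.Perm (Fin M)} {par mate : ℕ → ℕ} {a : Fin M}

theorem accCount_le (j : ℕ) : accCount M T par mate a j ≤ M :=
  (Finset.card_filter_le _ _).trans (by simp)

open Classical in
theorem sum_accCount (n : ℕ) :
    ∑ j ∈ Finset.range n, (1 - markVal M T par a j) * accCount M T par mate a j =
      ((Finset.univ : Finset (Fin M)).filter fun e : Fin M => T.SameCycle a e ∧
        ∃ j < n, par (mate e) = M + j ∧ markVal M T par a j = 0).card := by
  rw [Finset.card_eq_sum_card_fiberwise (f := fun e : Fin M => par (mate e) - M)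
    (t := Finset.range n)]
  · refine Finset.sum_congr rfl fun j hj => ?_
    have hj := Finset.mem_range.mp hj
    by_cases hm : markVal M T par a j = 0
    · rw [hm, Nat.sub_zero, one_mul, accCount]
      congr 1
      ext e
      simp only [Finset.mem_filter, Finset.mem_univ, true_and]
      constructor
      · rintro ⟨h1, h2⟩
        exact ⟨⟨h1, j, hj, h2, hm⟩, by omega⟩
      · rintro ⟨⟨h1, j', _, h2, _⟩, h3⟩
        exact ⟨h1, by omega⟩
    · have : markVal M T par a j = 1 := by
        unfold markVal at hm ⊢
        split_ifs at hm ⊢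
        · rfl
        · exact absurd rfl hm
      rw [this, Nat.sub_self, zero_mul, eq_comm, Finset.card_eq_zero, Finset.filter_eq_empty_iff]
      simp only [Finset.mem_filter, Finset.mem_univ, true_and]
      rintro e ⟨_, j', _, h2, h3⟩ h4
      obtain rfl : j' = j := by omega
      exact hm h3
  · intro e he
    simp only [Finset.coe_filter, Finset.mem_univ, true_and, Set.mem_ofPred_eq] at he
    obtain ⟨_, j', h1, h2, _⟩ := he
    simp only [Finset.coe_range, Set.mem_Iio]
    omega

theorem sum_accCount_le (n : ℕ) :
    ∑ j ∈ Finset.range n, (1 - markVal M T par a j) * accCount M T par mate a j ≤ M := by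
  rw [sum_accCount]
  exact (Finset.card_filter_le _ _).trans (by simp)

end counts

/-- The results of `query`. -/
structure QueryOk (x : Ctx) (N : ℕ → ℕ) (T : Equiv.Perm (Fin x.M)) (a : Fin x.M) (h : HS) :
    Prop where
  acc : ∀ j < N 1, h.a 5 j = accCount x.M T (h.a 1) (h.a 7) a j
  mark : ∀ j < N 1, h.a 6 j = markVal x.M T (h.a 1) a j
  tot : h.v 22 = ∑ j ∈ Finset.range (N 1),
    (1 - markVal x.M T (h.a 1) a j) * accCount x.M T (h.a 1) (h.a 7) a j

def queryTime (x : Ctx) : ℕ := 15000 * x.P + 40 * x.K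

theorem query_spec (hx : x.Ok l) {h : HS} (hc : Cst x h) (hd : DS x N rk h)
    {T : Equiv.Perm (Fin x.M)} (hT : ActsAs (h.a 0) T) {a : Fin x.M} (h7 : h.v 7 = a) :
    wp l query h fun h' t => t ≤ queryTime x ∧ QueryOk x N T a h' := by
  have hW := hx.W_ge
  have hP := x.P_pos
  have hPM := hx.P_le
  have hM2 := hx.M_two
  have hD := hx.D_eq
  have hZ := hx.Z_ge
  have hone := hd.sz.one
  have hK1 : 1 ≤ x.K := Ctx.K_pos
  have hM0 := hd.sz.zero
  have ha0 : (a : ℕ) < N 0 := by rw [hM0]; exact a.2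
  have hinv := hd.inv
  unfold query
  rw [wp_seq]
  -- the initialization
  refine (wp_for (l := l) (i := 17) (b := 19)
    (c := .put 5 (.v 17) (.c 0) ;; .put 6 (.v 17) (.c 0)) (h := h) (C := 40) (n := N 1)
    (I := fun i h' => ∀ j < i, h'.a 5 j = 0 ∧ h'.a 6 j = 0) (by norm_num) (by norm_num)
    (by norm_num) (by simp [HC.wv]) (by simp [HC.wv]) hd.nb (by omega) (by simp) ?_).frame
    fun h₁ t₁ ⟨ht₁, _, hz₁⟩ hF₁ => ?_
  · intro j h' hj hv hI _
    simp only [wp_seq, wp_put, Exp.ok, Exp.eval, HS.put_v, hv, Lim.bd_pos l 5 (by norm_num),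
      Lim.bd_pos l 6 (by norm_num)]
    refine ⟨by norm_num, by norm_num, by omega, by omega, by norm_num, by norm_num, by omega,
      by omega, by simp, ?_⟩
    intro j' hj'
    by_cases hjj : j' = j
    · simp [hjj]
    · simpa [hjj] using hI j' (by omega)
  have A₁ : ∀ k, k ∉ [5, 6] → h₁.a k = h.a k := fun k hk => hF₁.a k (by
    simp only [List.mem_cons, not_or] at hk
    simp [HC.wa, HC.for, hk])
  have V₁ : ∀ k, k ≠ 17 → h₁.v k = h.v k := fun k hk => hF₁.v k (by simp [HC.wv, HC.for, hk])
  have hd₁ : DS x N rk h₁ := by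
    obtain ⟨h1, h2, h3, h4, h5, h6⟩ := hd
    refine ⟨?_, h2, ?_, ?_, ?_, ?_⟩
    · rwa [A₁ 0 (by decide), A₁ 1 (by decide), A₁ 2 (by decide), A₁ 3 (by decide)]
    · rwa [A₁ 7 (by decide)]
    · rwa [A₁ 9 (by decide)]
    · rwa [A₁ 1 (by decide), A₁ 7 (by decide), A₁ 4 (by decide)]
    · rwa [V₁ 19 (by norm_num)]
  have hc₁ : Cst x h₁ := hc.of_fr hF₁ (by simp [HC.for, HC.wv])
  rw [wp_seq]
  refine (findTop_spec hx hc₁ hd₁ a.2 (by rw [V₁ 7 (by norm_num), h7])).frame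
    fun h₂ t₂ ⟨ht₂, w16⟩ hF₂ => ?_
  have A₂ : h₂.a = h₁.a := by
    funext k
    exact hF₂.a k (by simp [findTop, HC.wa])
  have V₂ : ∀ k, k ∉ [17, 16, 15] → h₂.v k = h.v k := fun k hk => by
    simp only [List.mem_cons, not_or] at hk
    rw [hF₂.v k (by simp [findTop, HC.wv, hk]), V₁ k hk.1]
  have hc₂ : Cst x h₂ := hc₁.of_fr hF₂ (by simp [findTop, HC.wv])
  have E : ∀ k, k ∉ [5, 6] → h₂.a k = h.a k := fun k hk => by rw [A₂, A₁ k hk]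
  rw [A₁ 1 (by decide)] at w16
  -- the sum of the rows
  have hGm := hinv.anc_mem (k := x.K) le_rfl ha0
  set G₀ := anc (h.a 1) x.K a with hG₀
  have hit : ∀ t, (h.a 0)^[t] G₀ ∈ Nd x.base N x.K := hinv.iterate_mem le_rfl hGm
  set S : ℕ → ℕ → ℕ := fun t j => ∑ i ∈ Finset.range t,
    cnt x.M (h.a 7) (h.a 1) x.K ((h.a 0)^[i] G₀) j with hS
  have hSle : ∀ t j, S t j ≤ t * x.M := fun t j =>
    (Finset.sum_le_card_nsmul _ _ _ fun i _ => cnt_le _ _ _ _ _ _).trans (by simp)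
  have hperle := hinv.minimalPeriod_le le_rfl hGm
  have hNK : N x.K ≤ 10 := by simpa using hd.sz.cap x.K hK1 le_rfl
  have a20 : h₂.a 0 = h.a 0 := E 0 (by decide)
  set per := Function.minimalPeriod (h.a 0) G₀ with hper
  rw [wp_seq]
  refine (wp_cyc (l := l) (h := h₂) (G₀ := G₀) (per := per) (C := 700 * x.P + 12)
    (c := .for 17 19 (.put 5 (.v 17) (.get 5 (.v 17) +~ .get 4 (eix 16 17))))
    (J := fun t A => ∀ j < N 1, A 5 j = S t j) (by omega) (by simp [HC.for, HC.wv])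
    (by simp [HC.for, HC.wa]) w16 (by rw [a20]) (hinv.minimalPeriod_pos le_rfl hGm)
    (fun t => by rw [a20]; exact (hd.node_lt hx le_rfl (hit t)).1) ?_ ?_).frame
    fun h₃ t₃ ⟨ht₃, hacc⟩ hF₃ => ?_
  · intro j hj
    rw [A₂]
    simpa [hS] using (hz₁ j hj).1
  · intro t h' ht hv16 hJ hF
    rw [a20] at hv16
    have b4 : h'.a 4 = h.a 4 := by rw [hF.a 4 (by simp [cyc, HC.for, HC.wa]), E 4 (by decide)]
    have b19 : h'.v 19 = N 1 := by
      rw [hF.v 19 (by simp [cyc, HC.for, HC.wv]), V₂ 19 (by decide), hd.nb]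
    have hc' : Cst x h' := hc₂.of_fr hF (by simp [cyc, HC.for, HC.wv])
    obtain ⟨g1, g2⟩ := hd.sz.node hK1 le_rfl (hit t)
    have hS1 : ∀ j, S (t + 1) j = S t j + cnt x.M (h.a 7) (h.a 1) x.K ((h.a 0)^[t] G₀) j :=
      fun j => Finset.sum_range_succ _ _
    refine (wp_for (l := l) (i := 17) (b := 19)
      (c := .put 5 (.v 17) (.get 5 (.v 17) +~ .get 4 (eix 16 17))) (h := h') (C := 55) (n := N 1)
      (I := fun i h'' => ∀ j < N 1, h''.a 5 j = if j < i then S (t + 1) j else S t j)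
      (by norm_num) (by norm_num) (by norm_num) (by simp [HC.wv]) (by simp [HC.wv]) b19 (by omega)
      (by simpa using hJ) ?_).mono fun h'' k ⟨hk, _, hI⟩ => ⟨by omega, ?_⟩
    · intro j h'' hj hv hI hF''
      have d4 : h''.a 4 = h.a 4 := by rw [hF''.a 4 (by simp [HC.for, HC.wa]), b4]
      have d16 : h''.v 16 = (h.a 0)^[t] G₀ := by rw [hF''.v 16 (by simp [HC.for, HC.wv]), hv16]
      have hc'' : Cst x h'' := hc'.of_fr hF'' (by simp [HC.for, HC.wv])
      have hi : x.ix ((h.a 0)^[t] G₀) j < l.Z := Ctx.ix_lt hx g2 (by omega)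
      have e1 : (eix 16 17).eval h'' = x.ix ((h.a 0)^[t] G₀) j := by rw [eix_eval hc'', hv, d16]
      have o1 : (eix 16 17).ok l h'' :=
        eix_ok hx hc'' (by norm_num) (by norm_num) (by omega) (by omega)
      have e2 := hI j hj
      rw [if_neg (lt_irrefl j)] at e2
      have e3 := hd.V x.K hK1 le_rfl _ (hit t) j hj
      have e4 := hS1 j
      have e5 := hSle (t + 1) j
      have e6 : (t + 1) * x.M ≤ 10 * x.M := Nat.mul_le_mul_right _ (by omega)
      simp only [wp_put, Exp.ok, Exp.eval, hv, e1, d4, e2, e3, Lim.bd_pos l 5 (by norm_num),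
        Lim.bd_pos l 4 (by norm_num), Op.eval, ← e4]
      refine ⟨by norm_num, by norm_num, by omega, ⟨⟨by norm_num, by norm_num, by omega⟩,
        ⟨by norm_num, o1, hi⟩, by omega⟩, by simp, ?_⟩
      intro j' hj'
      simp only [HS.set_a, HS.put_a_same, Function.update_apply]
      by_cases hjj : j' = j
      · simp [hjj]
      · rw [if_neg hjj, hI j' hj']
        congr 1
        simp only [eq_iff_iff]
        omega
    · intro j hj
      rw [hI j hj, if_pos hj]
  have A₃ : ∀ k, k ∉ [5, 6] → h₃.a k = h.a k := fun k hk => by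
    have hk' := hk
    simp only [List.mem_cons, not_or] at hk
    rw [hF₃.a k (by simp [cyc, HC.for, HC.wa, hk]), E k hk']
  have V₃ : ∀ k, k ∉ [17, 16, 15, 24, 23] → h₃.v k = h.v k := fun k hk => by
    simp only [List.mem_cons, not_or] at hk
    rw [hF₃.v k (by simp [cyc, HC.for, HC.wv, hk]), V₂ k (by simp [hk])]
  have a36 : h₃.a 6 = h₁.a 6 := by rw [hF₃.a 6 (by simp [cyc, HC.for, HC.wa]), A₂]
  have hc₃ : Cst x h₃ := hc₂.of_fr hF₃ (by simp [cyc, HC.for, HC.wv])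
  -- the blocks of the cycle
  have hgm := hinv.par_mem 0 (by omega) a (hinv.mem_zero.mpr ha0)
  set g := h.a 1 a with hg
  have hit1 : ∀ t, (h.a 0)^[t] g ∈ Nd x.base N 1 := hinv.iterate_mem hK1 hgm
  have hper1 := hinv.minimalPeriod_le hK1 hgm
  set per1 := Function.minimalPeriod (h.a 0) g with hper1'
  have a30 : h₃.a 0 = h.a 0 := A₃ 0 (by decide)
  rw [wp_seq, wp_asg]
  simp only [Exp.ok, Exp.eval, V₃ 7 (by decide), h7, A₃ 1 (by decide), ← hg,
    Lim.bd_pos l 1 (by norm_num)]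
  refine ⟨by norm_num, ⟨by norm_num, by norm_num, by omega⟩, ?_⟩
  rw [wp_seq]
  refine (wp_cyc (l := l) (h := h₃.set 16 g) (G₀ := g) (per := per1) (C := 19)
    (c := .put 6 (.v 16 -~ .v 1) (.c 1))
    (J := fun t A => ∀ j < N 1, A 6 j = if ∃ i < t, (h.a 0)^[i] g = x.M + j then 1 else 0)
    (by omega) (by simp [HC.wv])
    (by simp [HC.wa]) (by simp) (by rw [HS.set_a, a30]) (hinv.minimalPeriod_pos hK1 hgm)
    (fun t => by rw [HS.set_a, a30]; exact (hd.node_lt hx hK1 (hit1 t)).1) ?_ ?_).frame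
    fun h₄ t₄ ⟨ht₄, hmark⟩ hF₄ => ?_
  · intro j hj
    rw [HS.set_a, a36]
    simpa using (hz₁ j hj).2
  · intro t h' ht hv16 hJ hF
    rw [HS.set_a, a30] at hv16
    have hb := hd.sz.block (hit1 t)
    have hl := hd.node_lt hx hK1 (hit1 t)
    have hc' : Cst x (h₃.set 16 g) := ⟨hc₃.M, hc₃.B, hc₃.P, hc₃.Kc⟩
    have e1 : h'.v 1 = x.M := (hc'.of_fr hF (by simp [cyc, HC.wv])).M
    simp only [wp_put, Exp.ok, Exp.eval, hv16, e1, Op.eval, Lim.bd_pos l 6 (by norm_num)]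
    refine ⟨by norm_num, ⟨by norm_num, by norm_num, by omega⟩, by omega, by omega, by simp, ?_⟩
    intro j hj
    simp only [HS.put_a_same, Function.update_apply]
    rw [hJ j hj]
    by_cases h1 : j = (h.a 0)^[t] g - x.M
    · rw [if_pos h1, if_pos ⟨t, by omega, by omega⟩]
    · rw [if_neg h1]
      congr 1
      simp only [eq_iff_iff]
      constructor
      · rintro ⟨i, h2, h3⟩
        exact ⟨i, by omega, h3⟩
      · rintro ⟨i, h2, h3⟩
        refine ⟨i, lt_of_le_of_ne (by omega) ?_, h3⟩
        rintro rfl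
        omega
  have A₄ : ∀ k, k ∉ [5, 6] → h₄.a k = h.a k := fun k hk => by
    have hk' := hk
    simp only [List.mem_cons, not_or] at hk
    rw [hF₄.a k (by simp [cyc, HC.wa, hk]), HS.set_a, A₃ k hk']
  have a45 : h₄.a 5 = h₃.a 5 := by rw [hF₄.a 5 (by simp [cyc, HC.wa]), HS.set_a]
  have v19 : h₄.v 19 = N 1 := by
    rw [hF₄.v 19 (by simp [cyc, HC.wv]), HS.set_v, if_neg (by norm_num), V₃ 19 (by decide), hd.nb]
  have hacc' : ∀ j < N 1, h₄.a 5 j = accCount x.M T (h.a 1) (h.a 7) a j := by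
    intro j hj
    rw [a45, hacc j hj]
    exact hinv.sum_cnt_cycle hM0 hT le_rfl a (h.a 7) j
  have hmark' : ∀ j < N 1, h₄.a 6 j = markVal x.M T (h.a 1) a j := by
    intro j hj
    rw [hmark j hj, markVal]
    congr 1
    simp only [eq_iff_iff]
    constructor
    · rintro ⟨i, _, h2⟩
      obtain ⟨e, h3, h4⟩ := hinv.exists_arc_iterate hM0 hT hK1 a i
      exact ⟨e, h3, by rw [← h2]; exact h4⟩
    · rintro ⟨e, h1, h2⟩
      obtain ⟨i, hi⟩ := (hinv.sameCycle_iff hM0 hT hK1 a e).mp h1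
      refine ⟨i % per1, Nat.mod_lt _ (hinv.minimalPeriod_pos hK1 hgm), ?_⟩
      rw [hper1', Function.iterate_mod_minimalPeriod_eq, ← h2]
      exact hi
  -- the total
  rw [wp_seq, wp_asg]
  refine ⟨by norm_num, by simp, ?_⟩
  refine (wp_for (l := l) (i := 17) (b := 19)
    (c := .asg 22 (.v 22 +~ (.c 1 -~ .get 6 (.v 17)) *~ .get 5 (.v 17)))
    (h := h₄.set 22 ((Exp.c 0).eval h₄)) (C := 60) (n := N 1)
    (I := fun i h' => h'.v 22 = ∑ j ∈ Finset.range i, (1 - markVal x.M T (h.a 1) a j) *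
      accCount x.M T (h.a 1) (h.a 7) a j) (by norm_num) (by norm_num)
    (by norm_num) (by simp [HC.wv]) (by simp [HC.wv]) (by simpa using v19) (by omega) (by simp)
    ?_).frame fun h₅ t₅ ⟨ht₅, _, htot⟩ hF₅ => ?_
  · intro j h' hj hv hI hF
    have e5 : h'.a 5 j = accCount x.M T (h.a 1) (h.a 7) a j := by
      rw [hF.a 5 (by simp [HC.wa, HC.for]), HS.set_a, hacc' j hj]
    have e6 : h'.a 6 j = markVal x.M T (h.a 1) a j := by
      rw [hF.a 6 (by simp [HC.wa, HC.for]), HS.set_a, hmark' j hj]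
    have s1 := Finset.sum_range_succ (fun j => (1 - markVal x.M T (h.a 1) a j) *
      accCount x.M T (h.a 1) (h.a 7) a j) j
    have s2 := sum_accCount_le (T := T) (par := h.a 1) (mate := h.a 7) (a := a) (j + 1)
    simp only [wp_asg, Exp.ok, Exp.eval, hv, hI, e5, e6, Op.eval, Lim.bd_pos l 5 (by norm_num),
      Lim.bd_pos l 6 (by norm_num), ← s1]
    refine ⟨by norm_num, ⟨by norm_num, ⟨⟨by omega, ⟨by norm_num, by norm_num, by omega⟩, by omega⟩,
      ⟨by norm_num, by norm_num, by omega⟩, by omega⟩, by omega⟩, by simp, by simp⟩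
  have A₅ : ∀ k, h₅.a k = h₄.a k := fun k => by
    rw [hF₅.a k (by simp [HC.wa, HC.for]), HS.set_a]
  refine ⟨?_, ?_, ?_, ?_⟩
  · have q1 : per * (700 * x.P + 12 + 25) ≤ 10 * (700 * x.P + 12 + 25) :=
      Nat.mul_le_mul_right _ (by omega)
    simp only [Exp.cost, adrCost, queryTime]
    omega
  · intro j hj
    rw [A₅, A₅, A₅, A₄ 1 (by decide), A₄ 7 (by decide), hacc' j hj]
  · intro j hj
    rw [A₅, A₅, A₄ 1 (by decide), hmark' j hj]
  · rw [A₅, A₅, A₄ 1 (by decide), A₄ 7 (by decide), htot]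

end FlipRepair

namespace FlipRepair

variable {x : Ctx} {l : Lim} {N : ℕ → ℕ} {rk : ℕ → ℕ → ℕ}

section counts

variable {M : ℕ} {T : Equiv.Perm (Fin M)} {par mate : ℕ → ℕ} {a : Fin M}

theorem markVal_zero_or_one (j : ℕ) : markVal M T par a j = 0 ∨ markVal M T par a j = 1 := by
  unfold markVal
  split_ifs <;> simp

theorem Inv.markVal_eq_one {K : ℕ} {base nxt la fa : ℕ → ℕ}
    (h : Inv K base N nxt par la fa rk) (hM : N 0 = M) (hT : ActsAs nxt T) (hK : 1 ≤ K)
    (hb : base 1 = M) (e : Fin M) : markVal M T par a (par e - M) = 1 ↔ T.SameCycle a e := by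
  have hm := h.par_mem 0 (by omega) e (h.mem_zero.mpr (by rw [hM]; exact e.2))
  rw [mem_Nd] at hm
  have hpe : par e = M + (par e - M) := by
    have := hm.1
    rw [zero_add, hb] at this
    omega
  unfold markVal
  constructor
  · intro h1
    split_ifs at h1 with h2
    · obtain ⟨e', h3, h4⟩ := h2
      refine h3.trans (h.sameCycle_of_anc_eq hM hT hK ?_)
      change par e' = par e
      rw [h4, ← hpe]
  · intro h1
    rw [if_pos ⟨e, h1, hpe⟩]

/-- The position of the arc `f` in the list of the arcs outside of the cycle of `a` that have
their mates in this cycle. -/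
noncomputable def arcRank (M : ℕ) (T : Equiv.Perm (Fin M)) (par mate : ℕ → ℕ)
    (rk : ℕ → ℕ → ℕ) (a : Fin M) (f : ℕ) : ℕ :=
  ∑ j ∈ Finset.range (par f - M), (1 - markVal M T par a j) * accCount M T par mate a j +
    ((Finset.range M).filter fun e => par e = par f ∧ markVal M T par a (par (mate e) - M) = 1 ∧
      rk 1 e < rk 1 f).card

theorem Inv.accCount_eq {K : ℕ} {base nxt la fa : ℕ → ℕ}
    (h : Inv K base N nxt par la fa rk) (hM : N 0 = M) (hT : ActsAs nxt T) (hK : 1 ≤ K)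
    (hb : base 1 = M) (hm : IsMate M mate) (j : ℕ) : accCount M T par mate a j =
      ((Finset.range M).filter fun e => par e = M + j ∧
        markVal M T par a (par (mate e) - M) = 1).card := by
  unfold accCount
  refine Finset.card_bij' (fun e _ => mate e) (fun f hf => ⟨mate f, hm.lt f (by
    simp only [Finset.mem_filter, Finset.mem_range] at hf
    exact hf.1)⟩) ?_ ?_ ?_ ?_
  · intro e he
    simp only [Finset.mem_filter, Finset.mem_univ, true_and] at he
    simp only [Finset.mem_filter, Finset.mem_range]
    refine ⟨hm.lt e e.2, he.2, ?_⟩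
    rw [hm.invol e e.2]
    exact (h.markVal_eq_one hM hT hK hb e).mpr he.1
  · intro f hf
    simp only [Finset.mem_filter, Finset.mem_range] at hf
    simp only [Finset.mem_filter, Finset.mem_univ, true_and]
    refine ⟨?_, by rw [hm.invol f hf.1]; exact hf.2.1⟩
    rw [← h.markVal_eq_one hM hT hK hb]
    exact hf.2.2
  · intro e he
    exact Fin.ext (hm.invol e e.2)
  · intro f hf
    simp only [Finset.mem_filter, Finset.mem_range] at hf
    exact hm.invol f hf.1

end counts

/-- The number of arcs of the unmarked block `17` with mates in the cycle. -/
def blockExp : Exp := (.c 1 -~ .get 6 (.v 17)) *~ .get 5 (.v 17)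

/-- One if the mate of the arc `13` is in the cycle. -/
def crossExp : Exp := .get 6 (.get 1 (.get 7 (.v 13)) -~ .v 1)

/-- Find the arc `13` outside of the cycle with mate in the cycle that has position `21`. -/
def select : HC :=
  .asg 17 (.c 0) ;;
  .loop (.c 1 -~ (.v 21 <~ blockExp)) (.asg 21 (.v 21 -~ blockExp) ;; .asg 17 (.v 17 +~ .c 1)) ;;
  .asg 13 (.get 3 (.v 17 +~ .v 1)) ;;
  .loop (.c 1 -~ crossExp *~ (.v 21 =~ .c 0)) (.asg 21 (.v 21 -~ crossExp) ;;
    .asg 13 (.get 0 (.v 13)))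

def selectTime (x : Ctx) : ℕ := 1000 * x.P + 120 * x.B + 200

theorem select_spec (hx : x.Ok l) {h : HS} (hc : Cst x h) (hd : DS x N rk h)
    (hk : Cards x N (h.a 1)) {T : Equiv.Perm (Fin x.M)} (hT : ActsAs (h.a 0) T) {a : Fin x.M}
    (hq : QueryOk x N T a h) {r : ℕ} (hr : h.v 21 = r) (hlt : r < h.v 22) :
    wp l select h fun h' t => t ≤ selectTime x ∧ ∃ d : Fin x.M, h'.v 13 = d ∧ ¬ T.SameCycle a d ∧
      (∀ e : Fin x.M, (e : ℕ) = h.a 7 d → T.SameCycle a e) ∧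
      arcRank x.M T (h.a 1) (h.a 7) rk a d = r := by
  have hW := hx.W_ge
  have hP := x.P_pos
  have hPM := hx.P_le
  have hM2 := hx.M_two
  have hD := hx.D_eq
  have hZ := hx.Z_ge
  have hone := hd.sz.one
  have hK1 : 1 ≤ x.K := Ctx.K_pos
  have hM0 := hd.sz.zero
  have hinv := hd.inv
  have htot := hq.tot
  set w : ℕ → ℕ := fun j => (1 - markVal x.M T (h.a 1) a j) * accCount x.M T (h.a 1) (h.a 7) a j
    with hw
  have hwle : ∀ j, w j ≤ x.M := by
    intro j
    have h1 := accCount_le (T := T) (par := h.a 1) (mate := h.a 7) (a := a) j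
    rcases markVal_zero_or_one (T := T) (par := h.a 1) (a := a) j with h2 | h2 <;>
      simp only [hw, h2] <;> omega
  have htotM : h.v 22 ≤ x.M := by rw [htot]; exact sum_accCount_le _
  unfold select
  rw [wp_seq, wp_asg]
  refine ⟨by norm_num, by simp, ?_⟩
  rw [wp_seq]
  refine (wp_loop (l := l) (e := .c 1 -~ (.v 21 <~ blockExp))
    (c := .asg 21 (.v 21 -~ blockExp) ;; .asg 17 (.v 17 +~ .c 1)) (h := h.set 17 ((Exp.c 0).eval h))
    (C := 50) (m := N 1)
    (I := fun m h' => h'.v 17 + m = N 1 ∧ ∑ j ∈ Finset.range (h'.v 17), w j + h'.v 21 = r)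
    (by simp [hr]) ?_).mono fun h₁ t₁ ⟨ht₁, hF₁, m, ⟨hm₁, hs₁⟩, hz₁⟩ => ?_
  · intro m h' ⟨hm, hs⟩ hF
    have e5 : h'.a 5 = h.a 5 := by rw [hF.a 5 (by simp [HC.wa]), HS.set_a]
    have e6 : h'.a 6 = h.a 6 := by rw [hF.a 6 (by simp [HC.wa]), HS.set_a]
    have hjlt : h'.v 17 < N 1 := by
      by_contra hc
      have : h'.v 17 = N 1 := by omega
      rw [this, ← htot] at hs
      omega
    set j := h'.v 17 with hj
    have b1 : blockExp.eval h' = w j := by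
      simp only [blockExp, Exp.eval, Op.eval, e5, e6, ← hj, hq.acc j hjlt, hq.mark j hjlt, hw]
    have hwj := hwle j
    have b2 : blockExp.ok l h' := by
      have b3 := b1
      simp only [blockExp, Exp.eval, Op.eval] at b3
      simp only [blockExp, Exp.ok, Exp.eval, Op.eval, ← hj, Lim.bd_pos l 5 (by norm_num),
        Lim.bd_pos l 6 (by norm_num)] at b3 ⊢
      refine ⟨⟨by omega, ⟨by norm_num, by norm_num, by omega⟩, by omega⟩, ⟨by norm_num,
        by norm_num, by omega⟩, ?_⟩
      rw [b3]
      omega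
    refine ⟨⟨by simp; omega, ⟨by norm_num, b2, (Op.eval_lt_le _ _).trans (by omega)⟩, ?_⟩,
      fun hz => ?_⟩
    · simp only [Exp.eval, Op.eval]
      omega
    · simp only [Exp.eval, Op.eval, b1] at hz
      have hge : w j ≤ h'.v 21 := by
        by_contra hc
        rw [if_pos (by omega)] at hz
        omega
      refine ⟨m - 1, by omega, ?_⟩
      have s1 := Finset.sum_range_succ w j
      simp only [wp_seq, wp_asg, Exp.ok, Exp.eval, Op.eval, HS.set_v, b1, if_false, if_true,
        show (17 : ℕ) ≠ 21 by norm_num, show (21 : ℕ) ≠ 17 by norm_num, ← hj]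
      refine ⟨by norm_num, ⟨by norm_num, b2, by omega⟩, by norm_num, ⟨by norm_num, by omega,
        by omega⟩, by simp [blockExp], by omega, ?_⟩
      rw [s1]
      omega
  -- the block
  set j := h₁.v 17 with hj
  have hA₁ : h₁.a = h.a := by funext k; rw [hF₁.a k (by simp [HC.wa]), HS.set_a]
  have hjlt : j < N 1 := by
    by_contra hc
    have : j = N 1 := by omega
    rw [this, ← htot] at hs₁
    omega
  have b1 : blockExp.eval h₁ = w j := by
    simp only [blockExp, Exp.eval, Op.eval, hA₁, ← hj, hq.acc j hjlt, hq.mark j hjlt, hw]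
  have hlt1 : h₁.v 21 < w j := by
    simp only [Exp.eval, Op.eval, b1] at hz₁
    by_contra hc
    rw [if_neg hc] at hz₁
    omega
  have hmk : markVal x.M T (h.a 1) a j = 0 := by
    rcases markVal_zero_or_one (T := T) (par := h.a 1) (a := a) j with h2 | h2
    · exact h2
    · simp [hw, h2] at hlt1
  have hwj : w j = accCount x.M T (h.a 1) (h.a 7) a j := by simp [hw, hmk]
  set G := x.M + j with hG
  have hGm : G ∈ Nd x.base N 1 := by
    rw [mem_Nd, x.base_one]
    omega
  obtain ⟨hfa1, hfa2⟩ := hinv.fa_mem 1 hK1 G hGm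
  obtain ⟨hla1, hla2⟩ := hinv.la_mem 1 hK1 G hGm
  rw [hM0] at hfa1 hla1
  have hGl := hd.node_lt hx hK1 hGm
  have hv1 : h₁.v 1 = x.M := by rw [hF₁.v 1 (by simp [HC.wv])]; simp [hc.M]
  rw [wp_seq, wp_asg]
  simp only [Exp.ok, Exp.eval, Op.eval, ← hj, hv1, show j + x.M = G by omega, hA₁,
    Lim.bd_pos l 3 (by norm_num)]
  refine ⟨by norm_num, ⟨by norm_num, ⟨by norm_num, by norm_num, by omega⟩, by omega⟩, ?_⟩
  -- the arcs of the block
  set cr : ℕ → ℕ := fun f => markVal x.M T (h.a 1) a (h.a 1 (h.a 7 f) - x.M) with hcr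
  have hcr01 : ∀ f, cr f = 0 ∨ cr f = 1 := fun f => markVal_zero_or_one _
  set Q : ℕ → Finset ℕ := fun f => (Finset.range x.M).filter fun e => h.a 1 e = G ∧ cr e = 1 ∧
      rk 1 e < rk 1 f with hQ
  set F : ℕ → Finset ℕ := fun f => (Finset.range x.M).filter fun e => h.a 1 e = G ∧
      rk 1 f < rk 1 e with hF
  have hFB : (F (h.a 3 G)).card ≤ x.B := by
    have := hk 0 (by omega) G hGm
    refine le_trans (Finset.card_le_card ?_) this
    intro e
    simp only [hF, Finset.mem_filter, Finset.mem_range, hinv.mem_zero, hM0]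
    rintro ⟨h1, h2, _⟩
    exact ⟨h1, h2⟩
  have crOk : ∀ h' : HS, h'.a = h.a → h'.v 1 = x.M → h'.v 13 < x.M → crossExp.ok l h' ∧
      crossExp.eval h' = cr (h'.v 13) := by
    intro h' ha h1 hf
    have hm := hd.mate.lt _ hf
    have hp := hinv.par_mem 0 (by omega) _ (hinv.mem_zero.mpr (by rw [hM0]; exact hm))
    have hb := hd.sz.block hp
    have hpl := hd.node_lt hx hK1 hp
    simp only [crossExp, Exp.ok, Exp.eval, Op.eval, ha, h1, Lim.bd_pos l 6 (by norm_num),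
      Lim.bd_pos l 1 (by norm_num), Lim.bd_pos l 7 (by norm_num)]
    exact ⟨⟨by norm_num, ⟨⟨by norm_num, ⟨by norm_num, by norm_num, by omega⟩, by omega⟩,
      by norm_num, by omega⟩, by omega⟩, hq.mark _ hb.2⟩
  refine (wp_loop (l := l) (e := .c 1 -~ crossExp *~ (.v 21 =~ .c 0))
    (c := .asg 21 (.v 21 -~ crossExp) ;; .asg 13 (.get 0 (.v 13))) (h := h₁.set 13 (h.a 3 G))
    (C := 55) (m := (F (h.a 3 G)).card)
    (I := fun m h' => h'.v 13 < x.M ∧ h.a 1 (h'.v 13) = G ∧ (F (h'.v 13)).card ≤ m ∧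
      (Q (h'.v 13)).card + h'.v 21 = h₁.v 21) ?_ ?_).mono
    fun h₂ t₂ ⟨ht₂, hF₂, m', ⟨i1, i2, i3, i4⟩, hz₂⟩ => ?_
  · simp only [HS.set_v, if_true, show (21 : ℕ) ≠ 13 by norm_num, if_false]
    refine ⟨hfa1, hfa2, le_rfl, ?_⟩
    have : Q (h.a 3 G) = ∅ := by
      rw [hQ, Finset.filter_eq_empty_iff]
      rintro e he ⟨h1, _, h2⟩
      have := hinv.fa_le 1 hK1 e (by rw [hM0]; exact Finset.mem_range.mp he)
      rw [show anc (h.a 1) 1 e = G from h1] at this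
      omega
    rw [this]
    simp
  · intro m h' ⟨i1, i2, i3, i4⟩ hF'
    have ha : h'.a = h.a := by funext k; rw [hF'.a k (by simp [HC.wa]), HS.set_a, hA₁]
    have h1 : h'.v 1 = x.M := by rw [hF'.v 1 (by simp [HC.wv])]; simp [hv1]
    obtain ⟨c1, c2⟩ := crOk h' ha h1 i1
    set f := h'.v 13 with hf
    have hcr1 : cr f ≤ 1 := by rcases hcr01 f with h | h <;> omega
    have he1 := Op.eval_eq_le (h'.v 21) 0
    have hmul : cr f * (if h'.v 21 = 0 then 1 else 0) ≤ 1 := by split_ifs <;> omega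
    refine ⟨⟨by simp; omega, ⟨c1, ⟨by norm_num, by simp, by simp only [Exp.eval]; omega⟩, ?_⟩, ?_⟩,
      fun hz => ?_⟩
    · simp only [Exp.eval, Op.eval, c2]
      exact hmul.trans (by omega)
    · simp only [Exp.eval, Op.eval, c2]
      exact (Nat.sub_le _ _).trans (by omega)
    simp only [Exp.eval, Op.eval, c2] at hz
    have hgo : ¬ (cr f = 1 ∧ h'.v 21 = 0) := by
      rintro ⟨q1, q2⟩
      simp [q1, q2] at hz
    have hla : h.a 2 (anc (h.a 1) 1 f) ≠ f := by
      intro hl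
      -- all arcs with mates in the cycle come before
      have hacc := hinv.accCount_eq (a := a) (mate := h.a 7) hM0 hT hK1 x.base_one hd.mate j
      have hsub : ((Finset.range x.M).filter fun e => h.a 1 e = x.M + j ∧ cr e = 1) ⊆
          Q f ∪ if cr f = 1 then {f} else ∅ := by
        intro e
        simp only [Finset.mem_filter, Finset.mem_range, Finset.mem_union, hQ]
        rintro ⟨q1, q2, q3⟩
        by_cases hef : e = f
        · right
          rw [if_pos (hef ▸ q3), Finset.mem_singleton]
          exact hef
        · left
          refine ⟨q1, q2, q3, ?_⟩
          have hae : anc (h.a 1) 1 e = anc (h.a 1) 1 f := q2.trans i2.symm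
          have := hinv.rk_lt_la hK1 (e := e) (by rw [hM0]; exact q1) (by
            rw [hae, hl]
            exact fun hc => hef hc.symm)
          rwa [hae, hl] at this
      have hle := (Finset.card_le_card hsub).trans (Finset.card_union_le _ _)
      have hcard : (if cr f = 1 then ({f} : Finset ℕ) else ∅).card = cr f := by
        rcases hcr01 f with q | q <;> simp [q]
      rw [hcard] at hle
      rw [hwj, hacc] at hlt1
      change h₁.v 21 < ((Finset.range x.M).filter fun e => h.a 1 e = x.M + j ∧ cr e = 1).card
        at hlt1
      rcases hcr01 f with q | q
      · omega
      · exact hgo ⟨q, by omega⟩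
    have hst := hinv.step 1 hK1 f (by rw [hM0]; exact i1) hla
    have hnl := hinv.nxt_lt f (by rw [hM0]; exact i1)
    rw [hM0] at hnl
    have hpn : h.a 1 (h.a 0 f) = G := hst.1.trans i2
    have hmem : h.a 0 f ∈ F f := by
      simp only [hF, Finset.mem_filter, Finset.mem_range]
      exact ⟨hnl, hpn, by omega⟩
    have hpos := Finset.card_pos.mpr ⟨_, hmem⟩
    refine ⟨m - 1, by omega, ?_⟩
    simp only [wp_seq, wp_asg, Exp.ok, Exp.eval, Op.eval, HS.set_v, HS.set_a, c2, if_false, if_true,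
      show (13 : ℕ) ≠ 21 by norm_num, show (21 : ℕ) ≠ 13 by norm_num, ← hf, ha, Lim.bd_zero]
    refine ⟨by norm_num, ⟨by norm_num, c1, by omega⟩, by norm_num, ⟨by norm_num, by norm_num,
      by omega⟩, by simp [crossExp], hnl, hpn, ?_, ?_⟩
    · have : F (h.a 0 f) ⊆ (F f).erase (h.a 0 f) := by
        intro c
        simp only [hF, Finset.mem_filter, Finset.mem_erase]
        rintro ⟨q1, q2, q3⟩
        refine ⟨?_, q1, q2, by omega⟩
        rintro rfl
        omega
      have := Finset.card_le_card this
      rw [Finset.card_erase_of_mem hmem] at this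
      omega
    · have hQs : Q (h.a 0 f) = Q f ∪ if cr f = 1 then {f} else ∅ := by
        ext e
        simp only [hQ, Finset.mem_filter, Finset.mem_range, Finset.mem_union]
        constructor
        · rintro ⟨q1, q2, q3, q4⟩
          by_cases hef : e = f
          · right
            rw [if_pos (hef ▸ q3), Finset.mem_singleton]
            exact hef
          · left
            refine ⟨q1, q2, q3, lt_of_le_of_ne (by omega) fun hc => hef ?_⟩
            exact hinv.inj 1 hK1 e (by rw [hM0]; exact q1) f (by rw [hM0]; exact i1)
              (q2.trans i2.symm) hc
        · rintro (⟨q1, q2, q3, q4⟩ | q)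
          · exact ⟨q1, q2, q3, by omega⟩
          · split_ifs at q with q1
            · rw [Finset.mem_singleton] at q
              subst q
              exact ⟨i1, i2, q1, by omega⟩
            · simp at q
      have hcard : (Q (h.a 0 f)).card = (Q f).card + cr f := by
        rw [hQs, Finset.card_union_of_disjoint]
        · rcases hcr01 f with q | q <;> simp [q]
        · rw [Finset.disjoint_left]
          intro e he
          simp only [hQ, Finset.mem_filter] at he
          split_ifs
          · rw [Finset.mem_singleton]
            rintro rfl
            omega
          · simp
      rw [hcard]
      rcases hcr01 f with q | q
      · omega
      · have : h'.v 21 ≠ 0 := fun hc => hgo ⟨q, hc⟩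
        omega
  · have ha : h₂.a = h.a := by funext k; rw [hF₂.a k (by simp [HC.wa]), HS.set_a, hA₁]
    have h1 : h₂.v 1 = x.M := by rw [hF₂.v 1 (by simp [HC.wv])]; simp [hv1]
    obtain ⟨c1, c2⟩ := crOk h₂ ha h1 i1
    simp only [Exp.eval, Op.eval, c2] at hz₂
    have hfin : cr (h₂.v 13) = 1 ∧ h₂.v 21 = 0 := by
      rcases hcr01 (h₂.v 13) with q | q
      · rw [q] at hz₂
        simp at hz₂
      · refine ⟨q, ?_⟩
        by_contra hc
        simp [hc] at hz₂
    refine ⟨?_, ⟨h₂.v 13, i1⟩, rfl, ?_, ?_, ?_⟩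
    · simp only [Exp.cost, adrCost, blockExp, crossExp] at *
      have q1 : N 1 * (50 + (1 + (1 + (1 + (1 + 10 + 2) + 3 + (1 + 10 + 2) + 3) + 3) + 3) + 2) ≤
        10 * x.P * 96 := Nat.mul_le_mul hone (by norm_num)
      have q2 : (F (h.a 3 G)).card * (55 + (1 + (1 + 10 + 2 + 10 + 2 + 1 + 3 + 10 + 2 +
        (1 + 1 + 3) + 3) + 3) + 2) ≤ x.B * 120 := Nat.mul_le_mul hFB (by norm_num)
      simp only [selectTime]
      omega
    · rw [← hinv.markVal_eq_one hM0 hT hK1 x.base_one, i2, hG]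
      simp [hmk]
    · intro e he
      rw [← hinv.markVal_eq_one hM0 hT hK1 x.base_one, he]
      exact hfin.1
    · unfold arcRank
      rw [i2, show G - x.M = j by omega]
      change ∑ i ∈ Finset.range j, w i + (Q (h₂.v 13)).card = r
      omega

end FlipRepair

namespace FlipRepair

variable {x : Ctx} {l : Lim}

/-! ### Building a level -/

/-- Make the nodes `12, …` of a new level: each gets `27` consecutive nodes of the cycle of the
node `13`, which has `26` nodes. -/
def links : HC :=
  .for 17 26 (
    .asg 28 (.v 12 +~ .v 17 /~ .v 27) ;;
    .ite (.v 17 %~ .v 27) .skip (.put 3 (.v 28) (.get 3 (.v 13))) ;;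
    .put 1 (.v 13) (.v 28) ;;
    .put 2 (.v 28) (.get 2 (.v 13)) ;;
    .put 0 (.v 28) (.v 28 +~ .c 1) ;;
    .asg 13 (.get 0 (.v 13))) ;;
  .put 0 (.v 28) (.v 12) ;;
  .put 9 (.v 14) (.v 28 +~ .c 1)

/-- The state after `i` rounds of `links`. -/
structure LinkInv (f : ℕ → ℕ) (b ch : ℕ) (a : ℕ → ℕ → ℕ) (i : ℕ) (a' : ℕ → ℕ → ℕ) : Prop where
  par : ∀ t < i, a' 1 (f t) = b + t / ch
  par_ne : ∀ c, (∀ t < i, f t ≠ c) → a' 1 c = a 1 c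
  la : ∀ q, q * ch < i → a' 2 (b + q) = a 2 (f (min (q * ch + ch - 1) (i - 1)))
  fa : ∀ q, q * ch < i → a' 3 (b + q) = a 3 (f (q * ch))
  nxt : ∀ q, q * ch < i → a' 0 (b + q) = b + q + 1
  old : ∀ G < b, a' 2 G = a 2 G ∧ a' 3 G = a 3 G ∧ a' 0 G = a 0 G

theorem LinkInv.step {f : ℕ → ℕ} {b ch i : ℕ} {a a' : ℕ → ℕ → ℕ} (h : LinkInv f b ch a i a')
    (hch : 1 ≤ ch) (hinj : ∀ t < i, f t ≠ f i) :
    LinkInv f b ch a (i + 1) fun k =>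
      if k = 1 then Function.update (a' 1) (f i) (b + i / ch)
      else if k = 2 then Function.update (a' 2) (b + i / ch) (a 2 (f i))
      else if k = 3 then
        if i % ch = 0 then Function.update (a' 3) (b + i / ch) (a 3 (f i)) else a' 3
      else if k = 0 then Function.update (a' 0) (b + i / ch) (b + i / ch + 1)
      else a' k := by
  have key : ∀ q, q * ch < i + 1 → q ≠ i / ch → q * ch + ch ≤ i := by
    intro q hq hne
    have h1 : q ≤ i / ch := (Nat.le_div_iff_mul_le hch).mpr (by omega)
    have h2 : q + 1 ≤ i / ch := by omega
    have := (Nat.le_div_iff_mul_le hch).mp h2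
    rwa [Nat.add_mul, one_mul] at this
  have hdm := Nat.div_add_mod' i ch
  have hlt := Nat.mod_lt i hch
  constructor
  · intro t ht
    simp only [if_true]
    by_cases hti : t = i
    · rw [hti, Function.update_self]
    · rw [Function.update_of_ne (hinj t (by omega)), h.par t (by omega)]
  · intro c hc
    simp only [if_true]
    rw [Function.update_of_ne (hc i (by omega)).symm, h.par_ne c fun t ht => hc t (by omega)]
  · intro q hq
    simp only [if_true, show (2 : ℕ) ≠ 1 by norm_num, if_false]
    by_cases hqi : q = i / ch
    · rw [hqi, Function.update_self, show min (i / ch * ch + ch - 1) (i + 1 - 1) = i by omega]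
    · have := key q hq hqi
      rw [Function.update_of_ne (by omega), h.la q (by omega),
        show min (q * ch + ch - 1) (i - 1) = min (q * ch + ch - 1) (i + 1 - 1) by omega]
  · intro q hq
    simp only [if_true, show (3 : ℕ) ≠ 1 by norm_num, show (3 : ℕ) ≠ 2 by norm_num, if_false]
    by_cases hqi : q = i / ch
    · by_cases hm : i % ch = 0
      · rw [if_pos hm, hqi, Function.update_self, show i / ch * ch = i by omega]
      · rw [if_neg hm, h.fa q (by rw [hqi]; omega)]
    · have := key q hq hqi
      split_ifs
      · rw [Function.update_of_ne (by omega), h.fa q (by omega)]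
      · rw [h.fa q (by omega)]
  · intro q hq
    simp only [if_true, show (0 : ℕ) ≠ 1 by norm_num, show (0 : ℕ) ≠ 2 by norm_num,
      show (0 : ℕ) ≠ 3 by norm_num, if_false]
    by_cases hqi : q = i / ch
    · rw [hqi, Function.update_self]
    · have := key q hq hqi
      rw [Function.update_of_ne (by omega), h.nxt q (by omega)]
  · intro G hG
    obtain ⟨h1, h2, h3⟩ := h.old G hG
    have := Nat.le_add_right b (i / ch)
    simp only [if_true, show (0 : ℕ) ≠ 1 by norm_num, show (0 : ℕ) ≠ 2 by norm_num,
      show (0 : ℕ) ≠ 3 by norm_num, show (2 : ℕ) ≠ 1 by norm_num, show (3 : ℕ) ≠ 1 by norm_num,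
      show (3 : ℕ) ≠ 2 by norm_num, if_false]
    refine ⟨?_, ?_, ?_⟩
    · rw [Function.update_of_ne (by omega), h1]
    · split_ifs
      · rw [Function.update_of_ne (by omega), h2]
      · exact h2
    · rw [Function.update_of_ne (by omega), h3]

theorem links_spec (hx : x.Ok l) {h : HS} {b n ch p G₀ : ℕ} (h12 : h.v 12 = b) (h13 : h.v 13 = G₀)
    (h14 : h.v 14 = p) (h26 : h.v 26 = n) (h27 : h.v 27 = ch) (hch : 1 ≤ ch) (hn : 0 < n)
    (hnM : n ≤ 20 * x.M) (hp : p ≤ x.P)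
    (hf : ∀ i, (h.a 0)^[i] G₀ < b) (hb : b + (n - 1) / ch < x.M + 20 * x.P)
    (hinj : ∀ i < n, ∀ j < n, (h.a 0)^[i] G₀ = (h.a 0)^[j] G₀ → i = j) :
    wp l links h fun h' t => t ≤ n * 260 + 100 ∧ Fr links h h' ∧ h'.v 28 = b + (n - 1) / ch ∧ ∃ a',
      LinkInv (fun i => (h.a 0)^[i] G₀) b ch h.a n a' ∧ (∀ k, k ≠ 0 → k ≠ 9 → h'.a k = a' k) ∧
      h'.a 0 = Function.update (a' 0) (b + (n - 1) / ch) b ∧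
      h'.a 9 = Function.update (h.a 9) p (b + (n - 1) / ch + 1) := by
  have hW := hx.W_ge
  have hP := x.P_pos
  have hPM := hx.P_le
  set f : ℕ → ℕ := fun i => (h.a 0)^[i] G₀ with hfdef
  have hfl : ∀ i, f i < b := hf
  have hfs : ∀ i, h.a 0 (f i) = f (i + 1) := fun i =>
    (Function.iterate_succ_apply' (h.a 0) i G₀).symm
  have hbl := hx.node_lt hb
  have hdiv : ∀ i < n, i / ch ≤ (n - 1) / ch := fun i hi => Nat.div_le_div_right (by omega)
  unfold links
  rw [wp_seq]
  have := wp_for (l := l) (i := 17) (b := 26) (c :=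
    .asg 28 (.v 12 +~ .v 17 /~ .v 27) ;;
    .ite (.v 17 %~ .v 27) .skip (.put 3 (.v 28) (.get 3 (.v 13))) ;;
    .put 1 (.v 13) (.v 28) ;;
    .put 2 (.v 28) (.get 2 (.v 13)) ;;
    .put 0 (.v 28) (.v 28 +~ .c 1) ;;
    .asg 13 (.get 0 (.v 13))) (h := h) (n := n) (C := 200)
    (I := fun i h' => h'.v 13 = f i ∧ (0 < i → h'.v 28 = b + (i - 1) / ch) ∧
      LinkInv f b ch h.a i h'.a)
    (by norm_num) (by norm_num) (by norm_num) (by simp [HC.wv]) (by simp [HC.wv]) h26 (by omega)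
    ⟨by simp [h13, hfdef], by simp, ⟨by simp, by simp, by simp, by simp, by simp, by simp⟩⟩ ?_
  · refine (this.frame fun h' t h1 hF => And.intro h1 hF).mono
      fun h₁ t₁ ⟨⟨ht, _, i1, i2, i3⟩, hF⟩ => ?_
    have v28 := i2 hn
    have v12 : h₁.v 12 = b := by rw [hF.v 12 (by simp [HC.for, HC.wv]), h12]
    have v14 : h₁.v 14 = p := by rw [hF.v 14 (by simp [HC.for, HC.wv]), h14]
    have a9 : h₁.a 9 = h.a 9 := hF.a 9 (by simp [HC.for, HC.wa])
    have hZ := hx.Z_ge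
    have hD := hx.D_eq
    simp only [wp_seq, wp_put, Exp.ok, Exp.eval, Op.eval, HS.put_v, v28, v12, v14,
      Lim.bd_zero, Lim.bd_pos l 9 (by norm_num), Exp.cost, adrCost]
    refine ⟨by norm_num, by norm_num, hbl.1, by norm_num, by norm_num, by norm_num, by omega,
      ⟨by norm_num, by omega, by omega⟩, by omega, ?_, by simp,
      h₁.a, i3, ?_, ?_, ?_⟩
    · refine ⟨fun y hy => ?_, fun k hk => ?_⟩
      · simp only [HS.put_v]
        refine hF.v y fun hc => hy ?_
        simp only [HC.wv, List.mem_append]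
        exact Or.inl hc
      · simp only [HC.wa, List.mem_append, List.mem_singleton, not_or] at hk
        rw [HS.put_a_ne _ _ _ _ _ hk.2.2, HS.put_a_ne _ _ _ _ _ hk.2.1]
        exact hF.a k fun hc => hk.1 (by simpa [HC.for, HC.wa] using hc)
    · intro k hk hk9
      rw [HS.put_a_ne _ _ _ _ _ hk9, HS.put_a_ne _ _ _ _ _ hk]
    · simp
    · simp [a9]
  · intro i h' hi hv ⟨i1, i2, i3⟩ hF
    have v12 : h'.v 12 = b := by rw [hF.v 12 (by simp [HC.for, HC.wv]), h12]
    have v27 : h'.v 27 = ch := by rw [hF.v 27 (by simp [HC.for, HC.wv]), h27]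
    have hd := hdiv i hi
    have hfi := hfl i
    have hZ := hx.Z_ge
    have hD := hx.D_eq
    have hml := Nat.mod_le i ch
    have hbq := Nat.le_add_right b (i / ch)
    have hst := i3.step hch fun t ht hc => absurd (hinj t (by omega) i hi hc) (by omega)
    have o3 := (i3.old (f i) hfi)
    have hmd : ∀ c d : HC, ∀ Q : HS → ℕ → Prop, wp l (.ite (.v 17 %~ .v 27) c d)
        (h'.set 28 (b + i / ch)) Q ↔ (i % ch ≠ 0 → wp l c (h'.set 28 (b + i / ch))
          fun h'' k => Q h'' (k + 7)) ∧ (i % ch = 0 → wp l d (h'.set 28 (b + i / ch))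
          fun h'' k => Q h'' (k + 7)) := by
      intro c d Q
      rw [wp_ite]
      simp only [Exp.ok, Exp.eval, Op.eval, HS.set_v, hv, v27, show (17 : ℕ) ≠ 28 by norm_num,
        show (27 : ℕ) ≠ 28 by norm_num, if_false, Exp.cost]
      exact ⟨fun q => ⟨q.2.1, q.2.2⟩, fun q => ⟨⟨by norm_num, by norm_num, by omega⟩, q⟩⟩
    rw [wp_seq, wp_asg]
    simp only [Exp.ok, Exp.eval, Op.eval, hv, v12, v27, Exp.cost]
    refine ⟨by norm_num, ⟨by norm_num, ⟨by norm_num, by norm_num, ?_⟩, ?_⟩, ?_⟩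
    · have := Nat.div_le_self i ch
      omega
    · omega
    rw [wp_seq, hmd]
    have rest : ∀ (y : HS) (k : ℕ), y.v 13 = f i → y.v 28 = b + i / ch → y.v 17 = i →
        y.a 0 (f i) = f (i + 1) → y.a 2 (f i) = h.a 2 (f i) → k ≤ 60 →
        (LinkInv f b ch h.a (i + 1) fun k =>
          if k = 1 then Function.update (y.a 1) (f i) (b + i / ch)
          else if k = 2 then Function.update (y.a 2) (b + i / ch) (h.a 2 (f i))
          else if k = 3 then y.a 3
          else if k = 0 then Function.update (y.a 0) (b + i / ch) (b + i / ch + 1)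
          else y.a k) →
        wp l (.put 1 (.v 13) (.v 28) ;; .put 2 (.v 28) (.get 2 (.v 13)) ;;
          .put 0 (.v 28) (.v 28 +~ .c 1) ;; .asg 13 (.get 0 (.v 13))) y fun h'' k' =>
          k + k' ≤ 190 ∧ (h''.set 17 (i + 1)).v 13 = f (i + 1) ∧
          (0 < i + 1 → (h''.set 17 (i + 1)).v 28 = b + (i + 1 - 1) / ch) ∧
          LinkInv f b ch h.a (i + 1) (h''.set 17 (i + 1)).a := by
      intro y k y13 y28 y17 y0 y2 hk hL
      have hne : f i ≠ b + i / ch := by omega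
      simp only [wp_seq, wp_put, wp_asg, Exp.ok, Exp.eval, Op.eval, HS.put_v, y13, y28,
        Lim.bd_zero, Lim.bd_pos l 1 (by norm_num), Lim.bd_pos l 2 (by norm_num), Exp.cost, adrCost]
      refine ⟨by norm_num, by norm_num, by omega, by norm_num, by norm_num, by norm_num, by omega,
        ⟨by norm_num, by norm_num, by omega⟩, by norm_num, by norm_num, by omega,
        ⟨by norm_num, by omega, by omega⟩, by norm_num, ⟨by norm_num, by norm_num, by omega⟩,
        by omega, ?_, ?_, ?_⟩
      · simp only [HS.set_v, show (13 : ℕ) ≠ 17 by norm_num, if_false, if_true, HS.put_a_same]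
        rw [Function.update_of_ne hne]
        simp [y0]
      · simp [y28]
      · convert hL using 1
        funext k
        by_cases k0 : k = 0
        · subst k0; simp
        by_cases k1 : k = 1
        · subst k1; simp
        by_cases k2 : k = 2
        · subst k2; simp [y2]
        · simp only [HS.set_a, k0, k1, k2, if_false, ne_eq, not_false_eq_true, HS.put_a_ne]
          split_ifs with k3
          · rw [k3]
          · rfl
    constructor
    · intro hm
      rw [wp_skip]
      refine (rest (h'.set 28 (b + i / ch)) 30 (by simp [i1]) (by simp) (by simp [hv])
        (by simp [o3.2.2, hfs]) (by simp [o3.1]) (by norm_num) ?_).mono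
        fun _ _ ⟨q1, q2⟩ => ⟨by omega, q2⟩
      simpa [hm] using hst
    · intro hm
      simp only [wp_put, Exp.ok, Exp.eval, HS.set_v, Lim.bd_pos l 3 (by norm_num), i1, if_true,
        show (13 : ℕ) ≠ 28 by norm_num, if_false, Exp.cost, adrCost, HS.set_a]
      refine ⟨by norm_num, by norm_num, by omega, ⟨by norm_num, by norm_num, by omega⟩, ?_⟩
      refine (rest _ 60 (by simp [i1]) (by simp) (by simp [hv])
        (by simp [o3.2.2, hfs]) (by simp [o3.1]) (by norm_num) ?_).mono
        fun _ _ ⟨q1, q2⟩ => ⟨by omega, q2⟩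
      convert hst using 1
      funext k
      by_cases k0 : k = 0
      · subst k0; simp
      by_cases k1 : k = 1
      · subst k1; simp
      by_cases k2 : k = 2
      · subst k2; simp
      by_cases k3 : k = 3
      · subst k3; simp [hm, o3.2.1]
      · simp [k0, k1, k2, k3]

end FlipRepair

namespace FlipRepair

variable {x : Ctx} {l : Lim}

/-! ### Filling the matrix -/

/-- Clear the rows of the nodes `12, …, 28`. -/
def zeroRows : HC :=
  .asg 16 (.v 12) ;;
  .loop (.v 16 <~ .v 28 +~ .c 1) (rowZero 16 ;; .asg 16 (.v 16 +~ .c 1))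

theorem zeroRows_spec (hx : x.Ok l) {h : HS} (hc : Cst x h) {b n : ℕ} (h12 : h.v 12 = b)
    (h28 : h.v 28 + 1 = b + n) (hb : x.M ≤ b) (hbn : b + n ≤ x.M + 20 * x.P)
    (hnb : h.v 19 ≤ 10 * x.P) :
    wp l zeroRows h fun h' t => t ≤ n * (500 * x.P + 20) + 20 ∧ Fr zeroRows h h' ∧
      ∀ G j, x.M ≤ G → j < 10 * x.P → h'.a 4 (x.ix G j) =
        if b ≤ G ∧ G < b + n ∧ j < h.v 19 then 0 else h.a 4 (x.ix G j) := by
  have hW := hx.W_ge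
  have hP := x.P_pos
  have hPM := hx.P_le
  unfold zeroRows
  rw [wp_seq, wp_asg]
  refine ⟨by norm_num, by simp, ?_⟩
  rw [show (Exp.v 12).eval h = b from h12]
  have := wp_loop (l := l) (e := .v 16 <~ .v 28 +~ .c 1) (c := rowZero 16 ;; .asg 16 (.v 16 +~ .c 1))
    (h := h.set 16 b) (C := 500 * x.P + 8) (m := n)
    (I := fun m h' => ∃ i, i + m = n ∧ h'.v 16 = b + i ∧
      ∀ G j, x.M ≤ G → j < 10 * x.P → h'.a 4 (x.ix G j) =
        if b ≤ G ∧ G < b + i ∧ j < h.v 19 then 0 else h.a 4 (x.ix G j)) ?_ ?_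
  · refine this.frame fun h' t ⟨ht, hF, m, ⟨i, hi, h16, hI⟩, hz⟩ _ => ⟨?_, ?_, ?_⟩
    · simp only [Exp.cost] at *
      rw [show 500 * x.P + 8 + (1 + (1 + 1 + 3) + 3) + 2 = 500 * x.P + 19 by ring] at ht
      have : n * (500 * x.P + 19) ≤ n * (500 * x.P + 20) := Nat.mul_le_mul_left _ (by omega)
      omega
    · refine Fr.trans (h₂ := h.set 16 b) ⟨fun y hy => ?_, fun _ _ => rfl⟩
        (hF.sub (by simp +contextual [HC.wv]) (by simp +contextual [HC.wa]))
      simp only [HC.wv, List.mem_append, List.mem_singleton, not_or] at hy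
      simp [hy.1]
    · have h28' : h'.v 28 = h.v 28 := by rw [hF.v 28 (by simp [HC.wv, rowZero, HC.for])]; simp
      have : i = n := by
        simp only [Exp.eval, Op.eval, h16, h28'] at hz
        split_ifs at hz
        omega
      subst this
      exact hI
  · exact ⟨0, by omega, by simp, fun G j _ _ => by
      rw [if_neg (by omega)]
      simp⟩
  · intro m h' ⟨i, hi, h16, hI⟩ hF
    have hc0 : Cst x (h.set 16 b) := ⟨by simp [hc.M], by simp [hc.B], by simp [hc.P],
      by simp [hc.Kc]⟩
    have hc' := hc0.of_fr hF (by simp [HC.wv, rowZero, HC.for])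
    have h28' : h'.v 28 = h.v 28 := by rw [hF.v 28 (by simp [HC.wv, rowZero, HC.for])]; simp
    have h19' : h'.v 19 = h.v 19 := by rw [hF.v 19 (by simp [HC.wv, rowZero, HC.for])]; simp
    refine ⟨⟨by norm_num, ⟨by norm_num, by simp; omega, ?_⟩, (Op.eval_lt_le _ _).trans (by omega)⟩,
      fun hz => ?_⟩
    · simp only [Exp.eval, Op.eval, h28']
      omega
    have hin : i < n := by
      simp only [Exp.eval, Op.eval, h16, h28'] at hz
      by_contra hc
      rw [if_neg (by omega)] at hz
      exact hz rfl
    refine ⟨m - 1, by omega, ?_⟩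
    rw [wp_seq]
    refine (rowZero_spec hx hc' (g := 16) (by norm_num) (by norm_num) (by omega) (by omega)
      (by omega)).mono fun h'' t ⟨ht, hF', hR⟩ => ?_
    have h16' : h''.v 16 = b + i := by
      rw [hF'.v 16 (by simp [HC.wv, rowZero, HC.for]), h16]
    simp only [wp_asg, Exp.ok, Exp.eval, Op.eval, h16', Exp.cost]
    refine ⟨by norm_num, ⟨by norm_num, by omega, by omega⟩, by omega, i + 1, by omega,
      by simp; omega, ?_⟩
    intro G j hG hj
    rw [HS.set_a, hR G j hG hj, hI G j hG hj, h16, h19']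
    by_cases h1 : G = b + i
    · subst h1
      by_cases h2 : j < h.v 19
      · simp [h2]
      · simp [h2]
    · have e : (b ≤ G ∧ G < b + (i + 1) ∧ j < h.v 19) ↔ (b ≤ G ∧ G < b + i ∧ j < h.v 19) := by
        constructor <;> rintro ⟨q1, q2, q3⟩ <;> exact ⟨q1, by omega, q3⟩
      simp only [h1, false_and, if_false, e]

/-- Add row `f` to row `g`. -/
def rowAdd (f g : ℕ) : HC :=
  .for 18 19 (.put 4 (eix g 18) (.get 4 (eix g 18) +~ .get 4 (eix f 18)))

theorem rowAdd_spec (hx : x.Ok l) {h : HS} (hc : Cst x h) {f g : ℕ} (hf : f < 50)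
    (hg : g < 50) (hf1 : f ≠ 18) (hg1 : g ≠ 18) (hF : x.M ≤ h.v f) (hF' : h.v f < x.M + 20 * x.P)
    (hG : x.M ≤ h.v g) (hG' : h.v g < x.M + 20 * x.P)
    (hnb : h.v 19 ≤ 10 * x.P)
    (hV : ∀ j < h.v 19, h.a 4 (x.ix (h.v g) j) + h.a 4 (x.ix (h.v f) j) ≤ 2 * x.M) :
    wp l (rowAdd f g) h fun h' k => k ≤ 2000 * x.P ∧ Fr (rowAdd f g) h h' ∧
      ∀ G j, x.M ≤ G → j < 10 * x.P → h'.a 4 (x.ix G j) =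
        if G = h.v g ∧ j < h.v 19 then h.a 4 (x.ix G j) + h.a 4 (x.ix (h.v f) j)
        else h.a 4 (x.ix G j) := by
  have hW := hx.W_ge
  have hP := x.P_pos
  have hPM := hx.P_le
  have := wp_for (l := l) (i := 18) (b := 19) (c := .put 4 (eix g 18)
    (.get 4 (eix g 18) +~ .get 4 (eix f 18))) (h := h)
    (I := fun i h' => ∀ G j, x.M ≤ G → j < 10 * x.P → h'.a 4 (x.ix G j) =
        if G = h.v g ∧ j < i then h.a 4 (x.ix G j) + h.a 4 (x.ix (h.v f) j)
        else h.a 4 (x.ix G j)) (C := 160) (n := h.v 19)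
    (by norm_num) (by norm_num) (by norm_num) (by simp [HC.wv]) (by simp [HC.wv]) rfl (by omega)
    (by simp) ?_
  · refine this.frame fun h' k ⟨hk, _, hI⟩ hF => ⟨?_, hF, hI⟩
    have : h.v 19 * (160 + 15) ≤ 10 * x.P * (160 + 15) := Nat.mul_le_mul_right _ hnb
    omega
  · intro j h' hj hv hI hFr
    have hc' := hc.of_fr hFr (by simp [HC.for, HC.wv])
    have hvg : h'.v g = h.v g := hFr.v g (by simp [HC.for, HC.wv, hg1])
    have hvf : h'.v f = h.v f := hFr.v f (by simp [HC.for, HC.wv, hf1])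
    have hj' : j < 10 * x.P := by omega
    have ig : x.ix (h.v g) j < l.Z := Ctx.ix_lt hx (by omega) (by omega)
    have iff' : x.ix (h.v f) j < l.Z := Ctx.ix_lt hx (by omega) (by omega)
    have og : (eix g 18).ok l h' := eix_ok hx hc' hg (by norm_num) (by omega) (by omega)
    have of : (eix f 18).ok l h' := eix_ok hx hc' hf (by norm_num) (by omega) (by omega)
    have Ig := hI (h.v g) j hG hj'
    have If := hI (h.v f) j hF hj'
    simp only [lt_irrefl, and_false, if_false] at Ig If
    have V1 := hV j hj
    have eg : (eix g 18).eval h' = x.ix (h.v g) j := by rw [eix_eval hc', hv, hvg]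
    have ef : (eix f 18).eval h' = x.ix (h.v f) j := by rw [eix_eval hc', hv, hvf]
    simp only [wp_put, Exp.ok, Exp.eval, Op.eval, eg, ef, Ig, If, Lim.bd_pos l 4 (by norm_num)]
    refine ⟨by norm_num, og, ig, ⟨⟨by norm_num, og, ig⟩, ⟨by norm_num, of, iff'⟩, by omega⟩,
      by simp, ?_⟩
    intro G j' hG2 hj2
    simp only [HS.set_a, HS.put_a_same, Function.update_apply]
    rw [hI G j' hG2 hj2]
    by_cases h1 : x.ix G j' = x.ix (h.v g) j
    · obtain ⟨rfl, rfl⟩ := Ctx.ix_inj hG2 hG hj2 hj' h1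
      simp
    · rw [if_neg h1]
      have e1 : (G = h.v g ∧ j' < j + 1) ↔ (G = h.v g ∧ j' < j) := by
        constructor
        · rintro ⟨h5, h6⟩
          exact ⟨h5, lt_of_le_of_ne (by omega) fun hc => h1 (by rw [h5, hc])⟩
        · rintro ⟨h5, h6⟩
          exact ⟨h5, by omega⟩
      simp only [e1]

/-- Add the rows of the nodes `20, …, 20 + 26 - 1` to the rows of their parents. -/
def addRows : HC :=
  .asg 13 (.v 20) ;;
  .loop (.v 13 <~ .v 20 +~ .v 26) (.asg 11 (.get 1 (.v 13)) ;; rowAdd 13 11 ;;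
    .asg 13 (.v 13 +~ .c 1))

theorem addRows_spec (hx : x.Ok l) {h : HS} (hc : Cst x h) {b n b' : ℕ} (h20 : h.v 20 = b)
    (h26 : h.v 26 = n) (hb : x.M ≤ b) (hbn : b + n ≤ b') (hb' : b' ≤ x.M + 20 * x.P)
    (hpar : ∀ c, b ≤ c → c < b + n → b' ≤ h.a 1 c ∧ h.a 1 c < x.M + 20 * x.P)
    (hnb : h.v 19 ≤ 10 * x.P)
    (h0 : ∀ c, b ≤ c → c < b + n → ∀ j < h.v 19, h.a 4 (x.ix (h.a 1 c) j) = 0)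
    (hV : ∀ G, ∀ j < h.v 19, ∑ c ∈ (Finset.Ico b (b + n)).filter fun c => h.a 1 c = G,
      h.a 4 (x.ix c j) ≤ 2 * x.M) :
    wp l addRows h fun h' t => t ≤ n * (2000 * x.P + 50) + 20 ∧ Fr addRows h h' ∧
      ∀ G j, x.M ≤ G → j < 10 * x.P → h'.a 4 (x.ix G j) = h.a 4 (x.ix G j) +
        if j < h.v 19 then ∑ c ∈ (Finset.Ico b (b + n)).filter fun c => h.a 1 c = G,
          h.a 4 (x.ix c j) else 0 := by
  have hW := hx.W_ge
  have hP := x.P_pos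
  have hPM := hx.P_le
  have hZ := hx.Z_ge
  unfold addRows
  rw [wp_seq, wp_asg]
  refine ⟨by norm_num, by simp, ?_⟩
  rw [show (Exp.v 20).eval h = b from h20]
  have := wp_loop (l := l) (e := .v 13 <~ .v 20 +~ .v 26) (c := .asg 11 (.get 1 (.v 13)) ;;
    rowAdd 13 11 ;; .asg 13 (.v 13 +~ .c 1))
    (h := h.set 13 b) (C := 2000 * x.P + 30) (m := n)
    (I := fun m h' => ∃ i, i + m = n ∧ h'.v 13 = b + i ∧
      ∀ G j, x.M ≤ G → j < 10 * x.P → h'.a 4 (x.ix G j) = h.a 4 (x.ix G j) +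
        if j < h.v 19 then ∑ c ∈ (Finset.Ico b (b + i)).filter fun c => h.a 1 c = G,
          h.a 4 (x.ix c j) else 0) ?_ ?_
  · refine this.frame fun h' t ⟨ht, hF, m, ⟨i, hi, h13, hI⟩, hz⟩ _ => ⟨?_, ?_, ?_⟩
    · simp only [Exp.cost] at *
      rw [show 2000 * x.P + 30 + (1 + (1 + 1 + 3) + 3) + 2 = 2000 * x.P + 41 by ring] at ht
      have : n * (2000 * x.P + 41) ≤ n * (2000 * x.P + 50) := Nat.mul_le_mul_left _ (by omega)
      omega
    · refine Fr.trans (h₂ := h.set 13 b) ⟨fun y hy => ?_, fun _ _ => rfl⟩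
        (hF.sub (by simp +contextual [HC.wv]) (by simp +contextual [HC.wa]))
      simp only [HC.wv, List.mem_append, List.mem_singleton, not_or] at hy
      simp [hy.1]
    · have h20' : h'.v 20 = b := by rw [hF.v 20 (by simp [HC.wv, rowAdd, HC.for])]; simp [h20]
      have h26' : h'.v 26 = n := by rw [hF.v 26 (by simp [HC.wv, rowAdd, HC.for])]; simp [h26]
      have : i = n := by
        simp only [Exp.eval, Op.eval, h13, h20', h26'] at hz
        split_ifs at hz
        omega
      subst this
      exact hI
  · exact ⟨0, by omega, by simp, fun G j _ _ => by simp⟩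
  · intro m h' ⟨i, hi, h13, hI⟩ hF
    have hc0 : Cst x (h.set 13 b) := ⟨by simp [hc.M], by simp [hc.B], by simp [hc.P],
      by simp [hc.Kc]⟩
    have hc' := hc0.of_fr hF (by simp [HC.wv, rowAdd, HC.for])
    have h20' : h'.v 20 = b := by rw [hF.v 20 (by simp [HC.wv, rowAdd, HC.for])]; simp [h20]
    have h26' : h'.v 26 = n := by rw [hF.v 26 (by simp [HC.wv, rowAdd, HC.for])]; simp [h26]
    have h19' : h'.v 19 = h.v 19 := by rw [hF.v 19 (by simp [HC.wv, rowAdd, HC.for])]; simp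
    have a1 : h'.a 1 = h.a 1 := by rw [hF.a 1 (by simp [HC.wa, rowAdd, HC.for])]; simp
    refine ⟨⟨by norm_num, ⟨by norm_num, by norm_num, ?_⟩, (Op.eval_lt_le _ _).trans (by omega)⟩,
      fun hz => ?_⟩
    · simp only [Exp.eval, Op.eval, h20', h26']
      omega
    have hin : i < n := by
      simp only [Exp.eval, Op.eval, h13, h20', h26'] at hz
      by_contra hc
      rw [if_neg (by omega)] at hz
      exact hz rfl
    refine ⟨m - 1, by omega, ?_⟩
    obtain ⟨p1, p2⟩ := hpar (b + i) (by omega) (by omega)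
    have hfil : ∀ G, (Finset.Ico b (b + (i + 1))).filter (fun c => h.a 1 c = G) =
        if h.a 1 (b + i) = G then insert (b + i) ((Finset.Ico b (b + i)).filter fun c => h.a 1 c = G)
        else (Finset.Ico b (b + i)).filter fun c => h.a 1 c = G := by
      intro G
      rw [← add_assoc, ← Finset.insert_Ico_right_eq_Ico_add_one (by omega), Finset.filter_insert]
    have hsum : ∀ G j, ∑ c ∈ (Finset.Ico b (b + (i + 1))).filter (fun c => h.a 1 c = G),
        h.a 4 (x.ix c j) = ∑ c ∈ (Finset.Ico b (b + i)).filter (fun c => h.a 1 c = G),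
        h.a 4 (x.ix c j) + if G = h.a 1 (b + i) then h.a 4 (x.ix (b + i) j) else 0 := by
      intro G j
      rw [hfil]
      by_cases hG : h.a 1 (b + i) = G
      · rw [if_pos hG, if_pos hG.symm, Finset.sum_insert (by simp)]
        ring
      · rw [if_neg hG, if_neg (Ne.symm hG), add_zero]
    have hzero : ∀ j, ∑ c ∈ (Finset.Ico b (b + i)).filter (fun c => h.a 1 c = b + i),
        h.a 4 (x.ix c j) = 0 := by
      intro j
      rw [Finset.filter_false_of_mem, Finset.sum_empty]
      intro c hc hcb
      rw [Finset.mem_Ico] at hc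
      have := hpar c hc.1 (by omega)
      omega
    rw [wp_seq, wp_asg]
    simp only [Exp.ok, Exp.eval, h13, Lim.bd_pos l 1 (by norm_num), a1]
    refine ⟨by norm_num, ⟨by norm_num, by norm_num, by omega⟩, ?_⟩
    rw [wp_seq]
    have hc'' : Cst x (h'.set 11 (h.a 1 (b + i))) := ⟨by simp [hc'.M], by simp [hc'.B],
      by simp [hc'.P], by simp [hc'.Kc]⟩
    refine (rowAdd_spec hx hc'' (f := 13) (g := 11) (by norm_num) (by norm_num) (by norm_num)
      (by norm_num) ?_ ?_ ?_ ?_ ?_ ?_).mono fun h'' t ⟨ht, hF', hR⟩ => ?_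
    · simp [h13]; omega
    · simp [h13]; omega
    · simp; omega
    · simp; omega
    · simp [h19', hnb]
    · intro j hj
      simp only [HS.set_v, show (19 : ℕ) ≠ 11 by norm_num, if_false, h19'] at hj
      simp only [HS.set_v, show (13 : ℕ) ≠ 11 by norm_num, if_false, if_true, h13, HS.set_a]
      rw [hI _ j (by omega) (by omega), hI _ j (by omega) (by omega), if_pos hj, if_pos hj, hzero,
        h0 (b + i) (by omega) (by omega) j hj, zero_add, add_zero]
      have h1 := hsum (h.a 1 (b + i)) j
      rw [if_pos rfl] at h1
      rw [← h1]
      refine le_trans (Finset.sum_le_sum_of_subset ?_) (hV (h.a 1 (b + i)) j hj)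
      exact Finset.filter_subset_filter _ (Finset.Ico_subset_Ico_right (by omega))
    have h13' : h''.v 13 = b + i := by
      rw [hF'.v 13 (by simp [HC.wv, rowAdd, HC.for])]
      simp [h13]
    simp only [wp_asg, Exp.ok, Exp.eval, Op.eval, h13', Exp.cost, adrCost]
    refine ⟨by norm_num, ⟨by norm_num, by omega, by omega⟩, by omega, i + 1, by omega,
      by simp; omega, ?_⟩
    intro G j hG hj
    have e1 := hR G j hG hj
    simp only [HS.set_v, show (13 : ℕ) ≠ 11 by norm_num, if_false, if_true, h13, HS.set_a,
      show (19 : ℕ) ≠ 11 by norm_num, h19'] at e1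
    rw [HS.set_a, e1, hsum, hI G j hG hj, hI (b + i) j (by omega) hj, hzero]
    by_cases h2 : j < h.v 19
    · by_cases h3 : G = h.a 1 (b + i)
      · simp [h2, h3]; omega
      · simp [h2, h3]
    · simp [h2]

/-- Count the arcs of all blocks with mates in all blocks. -/
def countArcs : HC :=
  .for 17 1 (
    .asg 11 (.get 1 (.v 17)) ;;
    .asg 30 (.get 1 (.get 7 (.v 17)) -~ .v 1) ;;
    .put 4 (eix 11 30) (.get 4 (eix 11 30) +~ .c 1))

theorem countArcs_spec (hx : x.Ok l) {h : HS} (hc : Cst x h) (hmate : IsMate x.M (h.a 7)) {n : ℕ}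
    (hn : n ≤ 10 * x.P) (hpar : ∀ e < x.M, x.M ≤ h.a 1 e ∧ h.a 1 e < x.M + n)
    (h0 : ∀ G j, x.M ≤ G → G < x.M + n → j < n → h.a 4 (x.ix G j) = 0) :
    wp l countArcs h fun h' t => t ≤ x.M * 170 + 20 ∧ Fr countArcs h h' ∧
      ∀ G j, x.M ≤ G → G < x.M + n → j < n →
        h'.a 4 (x.ix G j) = cnt x.M (h.a 7) (h.a 1) 1 G j := by
  have hW := hx.W_ge
  have hP := x.P_pos
  have hPM := hx.P_le
  have hZ := hx.Z_ge
  have hM2 := hx.M_two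
  have hcl : ∀ i ≤ x.M, ∀ G j, ((Finset.range i).filter fun e => h.a 1 e = G ∧
      h.a 1 (h.a 7 e) = x.M + j).card ≤ x.M := fun i hi G j =>
    (Finset.card_filter_le _ _).trans (by simpa)
  unfold countArcs
  have := wp_for (l := l) (i := 17) (b := 1) (c := .asg 11 (.get 1 (.v 17)) ;;
    .asg 30 (.get 1 (.get 7 (.v 17)) -~ .v 1) ;;
    .put 4 (eix 11 30) (.get 4 (eix 11 30) +~ .c 1)) (h := h)
    (I := fun i h' => ∀ G j, x.M ≤ G → G < x.M + n → j < n → h'.a 4 (x.ix G j) =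
      ((Finset.range i).filter fun e => h.a 1 e = G ∧ h.a 1 (h.a 7 e) = x.M + j).card)
    (C := 150) (n := x.M)
    (by norm_num) (by norm_num) (by norm_num) (by simp [HC.wv]) (by simp [HC.wv]) hc.M (by omega)
    ?_ ?_
  · refine this.frame fun h' k ⟨hk, _, hI⟩ hF => ⟨by omega, hF, fun G j h1 h2 h3 => ?_⟩
    rw [hI G j h1 h2 h3]
    rfl
  · intro G j h1 h2 h3
    simp [h0 G j h1 h2 h3]
  · intro i h' hi hv hI hF
    have hc' := hc.of_fr hF (by simp [HC.for, HC.wv])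
    have a1 : h'.a 1 = h.a 1 := hF.a 1 (by simp [HC.wa, HC.for])
    have a7 : h'.a 7 = h.a 7 := hF.a 7 (by simp [HC.wa, HC.for])
    have hm := hmate.lt i hi
    obtain ⟨p1, p2⟩ := hpar i hi
    obtain ⟨p3, p4⟩ := hpar _ hm
    rw [wp_seq, wp_asg]
    simp only [Exp.ok, Exp.eval, hv, Lim.bd_pos l 1 (by norm_num), a1]
    refine ⟨by norm_num, ⟨by norm_num, by norm_num, by omega⟩, ?_⟩
    rw [wp_seq, wp_asg]
    simp only [Exp.ok, Exp.eval, Op.eval, HS.set_v, HS.set_a, hv, a1, a7, hc'.M,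
      show (17 : ℕ) ≠ 11 by norm_num, show (1 : ℕ) ≠ 11 by norm_num, if_false,
      Lim.bd_pos l 1 (by norm_num), Lim.bd_pos l 7 (by norm_num)]
    refine ⟨by norm_num, ⟨⟨by norm_num, ⟨by norm_num, by norm_num, by omega⟩, by omega⟩,
      by norm_num, by omega⟩, ?_⟩
    set y := (h'.set 11 (h.a 1 i)).set 30 (h.a 1 (h.a 7 i) - x.M) with hy
    have hcy : Cst x y := ⟨by simp [hy, hc'.M], by simp [hy, hc'.B], by simp [hy, hc'.P],
      by simp [hy, hc'.Kc]⟩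
    have y11 : y.v 11 = h.a 1 i := by simp [hy]
    have y30 : y.v 30 = h.a 1 (h.a 7 i) - x.M := by simp [hy]
    have og : (eix 11 30).ok l y := eix_ok hx hcy (by norm_num) (by norm_num) (by omega) (by omega)
    have eg := eix_eval hcy 11 30
    rw [y11, y30] at eg
    have ig : x.ix (h.a 1 i) (h.a 1 (h.a 7 i) - x.M) < l.Z := Ctx.ix_lt hx (by omega) (by omega)
    have I1 := hI (h.a 1 i) (h.a 1 (h.a 7 i) - x.M) p1 p2 (by omega)
    have I2 := hcl i hi.le (h.a 1 i) (h.a 1 (h.a 7 i) - x.M)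
    rw [← I1] at I2
    simp only [wp_put, Exp.ok, Exp.eval, Op.eval, eg, Lim.bd_pos l 4 (by norm_num),
      show y.a = h'.a from rfl]
    refine ⟨by norm_num, og, ig, ⟨⟨by norm_num, og, ig⟩, by omega, by omega⟩, by simp, ?_⟩
    intro G j h1 h2 h3
    simp only [HS.put_a_same, Function.update_apply, show y.a = h'.a from rfl]
    rw [Finset.range_add_one, Finset.filter_insert]
    by_cases hq : x.ix G j = x.ix (h.a 1 i) (h.a 1 (h.a 7 i) - x.M)
    · obtain ⟨rfl, rfl⟩ := Ctx.ix_inj h1 p1 (by omega) (by omega) hq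
      rw [if_pos rfl, if_pos ⟨rfl, by omega⟩, Finset.card_insert_of_notMem (by simp), I1]
    · rw [if_neg hq, if_neg, hI G j h1 h2 h3]
      rintro ⟨rfl, h5⟩
      exact hq (by rw [h5, Nat.add_sub_cancel_left])

end FlipRepair

namespace FlipRepair

variable {x : Ctx} {l : Lim} {N : ℕ → ℕ} {rk : ℕ → ℕ → ℕ} {s tc : ℕ} {T : Equiv.Perm (Fin x.M)}

/-- The data structure is in order up to level `s`. -/
structure Part (x : Ctx) (s tc : ℕ) (T : Equiv.Perm (Fin x.M)) (N : ℕ → ℕ) (rk : ℕ → ℕ → ℕ)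
    (h : HS) : Prop where
  inv : Inv s x.base N (h.a 0) (h.a 1) (h.a 2) (h.a 3) rk
  zero : N 0 = x.M
  size : ∀ k, 1 ≤ k → k ≤ s → N k ≤ 6 * 2 ^ (x.K - k) + 4 * (tc % 2 ^ (x.K - k))
  mate : IsMate x.M (h.a 7)
  nf : ∀ k, 1 ≤ k → k ≤ s → h.a 9 (2 ^ (x.K - k)) = x.base k + N k
  V : ∀ k, 1 ≤ k → k ≤ s → ∀ G ∈ Nd x.base N k, ∀ j < N 1,
    h.a 4 (x.ix G j) = cnt x.M (h.a 7) (h.a 1) k G j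
  nb : 1 ≤ s → h.v 19 = N 1
  kids : ∀ k < s, ∀ G ∈ Nd x.base N (k + 1), kids x.base N (h.a 1) k G ≤ kb x k
  acts : ActsAs (h.a 0) T

namespace Part

theorem congr {h h' : HS} (hp : Part x s tc T N rk h) (ha : h'.a = h.a) (hv : h'.v 19 = h.v 19) :
    Part x s tc T N rk h' := by
  obtain ⟨h1, h2, h3, h4, h5, h6, h7, h8, h9⟩ := hp
  rw [← ha] at h1 h4 h5 h6 h8 h9
  exact ⟨h1, h2, h3, h4, h5, h6, by rwa [hv], h8, h9⟩

theorem cap {h : HS} (hp : Part x s tc T N rk h) {k : ℕ} (hk : 1 ≤ k) (hks : k ≤ s) :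
    N k ≤ 10 * 2 ^ (x.K - k) := by
  have h1 := hp.size k hk hks
  have h2 := Nat.mod_lt tc (Nat.two_pow_pos (x.K - k))
  omega

theorem ds {h : HS} (hp : Part x x.K tc T N rk h) : DS x N rk h :=
  ⟨hp.inv, ⟨hp.zero, fun _ hk hK => hp.cap hk hK⟩, hp.mate, hp.nf, hp.V, hp.nb (Ctx.K_pos)⟩

theorem cards {h : HS} (hp : Part x x.K tc T N rk h) : Cards x N (h.a 1) := hp.kids

theorem of_ds_le {h : HS} (hd : DS x N rk h) (hk' : Cards x N (h.a 1)) (ha : ActsAs (h.a 0) T)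
    (hsK : s ≤ x.K)
    (hs : ∀ k, 1 ≤ k → k ≤ s → N k ≤ 6 * 2 ^ (x.K - k) + 4 * (tc % 2 ^ (x.K - k))) :
    Part x s tc T N rk h := by
  obtain ⟨⟨b1, b2, b3, b4, b5, b6, b7, b8, b9, b10, b11, b12⟩, h2, h3, h4, h5, h6⟩ := hd
  exact ⟨⟨fun k hk => b1 k (by omega), b2, b3, b4, fun k hk => b5 k (by omega),
    fun k hk => b6 k (by omega), fun k hk => b7 k (by omega), fun k hk => b8 k (by omega),
    fun k hk => b9 k (by omega), fun k hk => b10 k (by omega), fun k hk => b11 k (by omega),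
    fun k hk => b12 k (by omega)⟩, h2.zero, hs, h3, fun k h1 hk => h4 k h1 (by omega),
    fun k h1 hk => h5 k h1 (by omega), fun _ => h6, fun k hk => hk' k (by omega), ha⟩

theorem base_le {h : HS} (hp : Part x s tc T N rk h) (hs : s < x.K) :
    x.base s + N s ≤ x.base (s + 1) := by
  rcases Nat.eq_zero_or_pos s with rfl | h0
  · rw [x.base_zero, x.base_one, hp.zero]
    omega
  · have := hp.cap h0 le_rfl
    rw [x.base_succ h0 hs]
    omega

theorem pos {h : HS} (hp : Part x s tc T N rk h) (hM : 2 ≤ x.M) : 0 < N s := by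
  have := hp.inv.anc_mem le_rfl (e := 0) (by rw [hp.zero]; omega)
  rw [mem_Nd] at this
  omega

theorem cycle {h : HS} (hp : Part x s tc T N rk h) (hM : 2 ≤ x.M)
    (htour : T.IsCycleOn Set.univ) : x.base s ∈ Nd x.base N s ∧
    (∀ c ∈ Nd x.base N s, ∃ i < N s, (h.a 0)^[i] (x.base s) = c) ∧
    (∀ i < N s, ∀ j < N s, (h.a 0)^[i] (x.base s) = (h.a 0)^[j] (x.base s) → i = j) ∧
    (h.a 0)^[N s] (x.base s) = x.base s ∧ ∀ i, (h.a 0)^[i] (x.base s) ∈ Nd x.base N s := by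
  have hG : x.base s ∈ Nd x.base N s := by
    rw [mem_Nd]
    have := hp.pos hM
    omega
  obtain ⟨h1, h2, h3⟩ := hp.inv.tour_enum hp.zero hp.acts htour le_rfl hG
  exact ⟨hG, h1, h2, h3, fun i => hp.inv.iterate_mem le_rfl hG i⟩

theorem link {h h' : HS} (hp : Part x s tc T N rk h) (hM : 2 ≤ x.M)
    (htour : T.IsCycleOn Set.univ) (hs : s < x.K) {ch : ℕ} (hch : 1 ≤ ch) (hkb : ch = kb x s)
    {a' : ℕ → ℕ → ℕ} (hL : LinkInv (fun i => (h.a 0)^[i] (x.base s)) (x.base (s + 1)) ch h.a (N s) a')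
    (h1 : h'.a 1 = a' 1) (h2 : h'.a 2 = a' 2) (h3 : h'.a 3 = a' 3) (h7 : h'.a 7 = h.a 7)
    (h0 : h'.a 0 = Function.update (a' 0) (x.base (s + 1) + (N s - 1) / ch) (x.base (s + 1)))
    (h9 : h'.a 9 = Function.update (h.a 9) (2 ^ (x.K - (s + 1)))
      (x.base (s + 1) + (N s - 1) / ch + 1))
    (hq : (N s - 1) / ch + 1 ≤ 6 * 2 ^ (x.K - (s + 1)))
    (hnb : h'.v 19 = Function.update N (s + 1) ((N s - 1) / ch + 1) 1)
    (hV : (∀ k ≤ s, ∀ e < x.M, anc (h'.a 1) k e = anc (h.a 1) k e) →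
      Lev (s + 1) x.base (Function.update N (s + 1) ((N s - 1) / ch + 1)) (h'.a 1) →
      ∀ k, 1 ≤ k → k ≤ s + 1 → ∀ G ∈ Nd x.base (Function.update N (s + 1) ((N s - 1) / ch + 1)) k,
      ∀ j < Function.update N (s + 1) ((N s - 1) / ch + 1) 1,
        h'.a 4 (x.ix G j) = cnt x.M (h'.a 7) (h'.a 1) k G j) :
    ∃ rk', Part x (s + 1) tc T (Function.update N (s + 1) ((N s - 1) / ch + 1)) rk' h' := by
  obtain ⟨c1, c2, c3, c4, c5⟩ := hp.cycle hM htour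
  have hpos := hp.pos hM
  have hbl := hp.base_le hs
  set N' := Function.update N (s + 1) ((N s - 1) / ch + 1) with hN'
  have hNk : ∀ k ≤ s, N' k = N k := fun k hk => Function.update_of_ne (by omega) _ _
  have hNs : N' (s + 1) = (N s - 1) / ch + 1 := Function.update_self _ _ _
  have hlt : ∀ q, q < N' (s + 1) ↔ q * ch < N s := by
    intro q
    rw [hNs, Nat.lt_succ_iff, Nat.le_div_iff_mul_le hch]
    omega
  have hnode : ∀ k ≤ s, ∀ G ∈ Nd x.base N k, G < x.base (s + 1) := by
    intro k hk G hG
    rw [mem_Nd] at hG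
    rcases Nat.lt_or_ge k s with h | h
    · have := hp.inv.base_le h le_rfl
      omega
    · obtain rfl : k = s := by omega
      omega
  have hparold : ∀ k < s, ∀ c ∈ Nd x.base N k, h'.a 1 c = h.a 1 c := by
    intro k hk c hc
    rw [h1, hL.par_ne c fun t _ hct => ?_]
    have := hp.inv.lvl_unique (i := k) (j := s) (by omega) le_rfl hc (hct ▸ c5 t)
    omega
  have hanc : ∀ k ≤ s, ∀ e < x.M, anc (h'.a 1) k e = anc (h.a 1) k e := by
    intro k hk e he
    induction k with
    | zero => rfl
    | succ k ih =>
      rw [anc_succ, anc_succ, ih (by omega),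
        hparold k (by omega) _ (hp.inv.anc_mem (by omega) (by rw [hp.zero]; exact he))]
  have hnold : ∀ G < x.base (s + 1), h'.a 0 G = h.a 0 G := by
    intro G hG
    have := Nat.le_add_right (x.base (s + 1)) ((N s - 1) / ch)
    rw [h0, Function.update_of_ne (by omega), (hL.old G hG).2.2]
  obtain ⟨rk', hI⟩ := hp.inv.extend (f := fun i => (h.a 0)^[i] (x.base s)) hch hpos
    (fun i _ => c5 i) c3 c2 (fun i hi => by
      rw [← Function.iterate_succ_apply' (h.a 0)]
      split_ifs with hc
      · rfl
      · rw [show i.succ = N s by omega, c4]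
        rfl) hbl (N' := N') (nxt' := h'.a 0) (par' := h'.a 1) (la' := h'.a 2) (fa' := h'.a 3) hNk hlt
    (fun i hi => by rw [h1]; exact hL.par i hi) hparold
    (fun q hq => by rw [h2]; exact hL.la q ((hlt q).mp hq))
    (fun q hq => by rw [h3]; exact hL.fa q ((hlt q).mp hq))
    (fun q hq => by
      rw [hNs] at hq ⊢
      rw [h0]
      by_cases hc : q = (N s - 1) / ch
      · rw [hc, Function.update_self, if_neg (by omega), add_zero]
      · rw [Function.update_of_ne (by omega), hL.nxt q ((hlt q).mp (by rw [hNs]; exact hq)),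
          if_pos (by omega)]
        ring)
    (fun k hk G hG => by
      have := hnode k hk G hG
      rw [h2, h3, hnold G this]
      exact ⟨(hL.old G this).1, (hL.old G this).2.1, rfl⟩)
  have hN0 : N' 0 = x.M := by rw [hNk 0 (by omega), hp.zero]
  refine ⟨rk', hI, hN0, ?_, by rw [h7]; exact hp.mate, ?_, hV hanc hI.lev, fun _ => hnb, ?_, ?_⟩
  · intro k hk hks
    rcases Nat.lt_or_ge k (s + 1) with h | h
    · rw [hNk k (by omega)]
      exact hp.size k hk (by omega)
    · obtain rfl : k = s + 1 := by omega
      rw [hNs]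
      omega
  · intro k hk hks
    rw [h9]
    rcases Nat.lt_or_ge k (s + 1) with h | h
    · have : x.K - (s + 1) < x.K - k := by omega
      have := Nat.pow_lt_pow_right (show 1 < 2 by norm_num) this
      rw [Function.update_of_ne (by omega), hNk k (by omega)]
      exact hp.nf k hk (by omega)
    · obtain rfl : k = s + 1 := by omega
      rw [hNs, Function.update_self]
      ring
  · intro k hk G hG
    rcases Nat.lt_or_ge k s with hks | hks
    · have hG' : G ∈ Nd x.base N (k + 1) := by
        rwa [mem_Nd, hNk (k + 1) (by omega), ← mem_Nd] at hG
      refine le_trans (le_of_eq ?_) (hp.kids k hks G hG')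
      unfold FlipRepair.kids
      congr 1
      ext c
      simp only [Finset.mem_filter, mem_Nd, hNk k (by omega)]
      refine and_congr_right fun hc => ?_
      rw [hparold k hks c (mem_Nd.mpr hc)]
    · obtain rfl : k = s := by omega
      rw [← hkb]
      unfold FlipRepair.kids
      set q := G - x.base (k + 1) with hqd
      have : (Nd x.base N' k).filter (fun c => h'.a 1 c = G) ⊆
          (Finset.Ico (q * ch) (q * ch + ch)).image fun i => (h.a 0)^[i] (x.base k) := by
        intro c
        simp only [Finset.mem_filter, Finset.mem_image, Finset.mem_Ico]
        rintro ⟨hc, hcG⟩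
        rw [mem_Nd, hNk k le_rfl, ← mem_Nd] at hc
        obtain ⟨i, hi, rfl⟩ := c2 c hc
        refine ⟨i, ?_, rfl⟩
        have e1 := hL.par i hi
        rw [← h1] at e1
        have e2 : i / ch = q := by
          have : x.base (k + 1) + i / ch = G := e1.symm.trans hcG
          rw [hqd, ← this, Nat.add_sub_cancel_left]
        have e3 := Nat.div_add_mod' i ch
        have e4 := Nat.mod_lt i hch
        rw [e2] at e3
        omega
      refine (Finset.card_le_card this).trans (Finset.card_image_le.trans ?_)
      simp
  · intro e
    rw [hnold e]
    · exact hp.acts e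
    · refine hnode 0 (by omega) e (hp.inv.mem_zero.mpr ?_)
      rw [hp.zero]
      exact e.2

end Part

/-- Build the blocks and their matrix. -/
def buildBlocks : HC :=
  .asg 13 (.c 0) ;; .asg 26 (.v 1) ;; .asg 27 (.v 2) ;; .asg 12 (.v 1) ;; .asg 14 (.v 3) ;;
  links ;; .asg 19 (.v 28 +~ .c 1 -~ .v 1) ;; zeroRows ;; countArcs

/-- Build the level with the number `14` from the level below. -/
def buildLevel : HC :=
  .asg 20 (.v 1 +~ .c 20 *~ (.v 3 -~ .c 2 *~ .v 14)) ;;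
  .asg 26 (.get 9 (.c 2 *~ .v 14) -~ .v 20) ;;
  .asg 13 (.v 20) ;;
  .asg 12 (.v 1 +~ .c 20 *~ (.v 3 -~ .v 14)) ;;
  .asg 27 (.c 4) ;;
  links ;; zeroRows ;; addRows

end FlipRepair

namespace FlipRepair

variable {x : Ctx} {l : Lim} {N : ℕ → ℕ} {rk : ℕ → ℕ → ℕ} {s tc : ℕ} {T : Equiv.Perm (Fin x.M)}

theorem buildBlocks_spec (hx : x.Ok l) {h : HS} (hc : Cst x h) (hp : Part x 0 tc T N rk h)
    (htour : T.IsCycleOn Set.univ) :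
    wp l buildBlocks h fun h' t => t ≤ 430 * x.M + 3200 * (x.P * x.P) + 300 ∧
      Fr buildBlocks h h' ∧ ∃ N' rk', Part x 1 tc T N' rk' h' := by
  have hW := hx.W_ge
  have hP := x.P_pos
  have hPM := hx.P_le
  have hM2 := hx.M_two
  have hB := hx.B_pos
  have hZ := hx.Z_ge
  have hD := hx.D_eq
  have hK1 : 0 < x.K := Ctx.K_pos
  obtain ⟨c1, c2, c3, c4, c5⟩ := hp.cycle hM2 htour
  have hb1 : x.base (0 + 1) = x.M := x.base_one
  have hb0 : x.base 0 = 0 := x.base_zero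
  have hpK : 2 ^ (x.K - (0 + 1)) = x.P := by simp [Ctx.K, Ctx.P]
  have hn0 := hp.zero
  have hq : (x.M - 1) / x.B + 1 ≤ x.P := by
    have : (x.M - 1) / x.B < x.P := by
      rw [Nat.div_lt_iff_lt_mul hB]
      have := hx.M_le
      omega
    omega
  set q := (x.M - 1) / x.B + 1 with hqd
  have := wp_frame_aux (l := l) (c := buildBlocks) (h := h) (Q := fun h' t =>
    t ≤ 430 * x.M + 3200 * (x.P * x.P) + 300 ∧ ∃ N' rk', Part x 1 tc T N' rk' h') ?_
  · exact this.mono fun h' t ⟨⟨q1, q2⟩, q3⟩ => ⟨q1, q3, q2⟩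
  unfold buildBlocks
  simp only [wp_seq, wp_asg, Exp.ok, Exp.eval, HS.set_v, hc.M, hc.B, hc.P, if_false,
    show (1 : ℕ) ≠ 13 by norm_num, show (1 : ℕ) ≠ 26 by norm_num, show (1 : ℕ) ≠ 27 by norm_num,
    show (2 : ℕ) ≠ 13 by norm_num, show (2 : ℕ) ≠ 26 by norm_num, show (3 : ℕ) ≠ 12 by norm_num,
    show (3 : ℕ) ≠ 13 by norm_num, show (3 : ℕ) ≠ 26 by norm_num, show (3 : ℕ) ≠ 27 by norm_num,
    Exp.cost]
  refine ⟨by norm_num, by norm_num, by norm_num, by norm_num, by norm_num, by norm_num,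
    by norm_num, by norm_num, by norm_num, by norm_num, ?_⟩
  set y := ((((h.set 13 0).set 26 x.M).set 27 x.B).set 12 x.M).set 14 x.P with hy
  have ya : y.a = h.a := rfl
  have hcy : Cst x y := ⟨by simp [hy, hc.M], by simp [hy, hc.B], by simp [hy, hc.P],
    by simp [hy, hc.Kc]⟩
  refine (links_spec hx (h := y) (b := x.M) (n := x.M) (ch := x.B) (p := x.P) (G₀ := 0)
    (by simp [hy]) (by simp [hy]) (by simp [hy]) (by simp [hy]) (by simp [hy]) hB (by omega)
    (by omega) le_rfl ?_ (by omega) ?_).mono fun h₁ t₁ ⟨ht₁, hF₁, v28, a', hL, e1, e2, e3⟩ => ?_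
  · intro i
    have := c5 i
    rw [hb0, mem_Nd, hb0, hn0] at this
    rw [ya]
    omega
  · rw [hb0, hn0] at c3
    exact c3
  have hc₁ := hcy.of_fr hF₁ (by decide)
  have a4₁ : h₁.a 4 = h.a 4 := by rw [hF₁.a 4 (by decide)]; rfl
  have a7₁ : h₁.a 7 = h.a 7 := by rw [hF₁.a 7 (by decide)]; rfl
  have v12₁ : h₁.v 12 = x.M := by rw [hF₁.v 12 (by decide)]; simp [hy]
  simp only [v28, hc₁.M, Op.eval]
  refine ⟨by norm_num, ⟨⟨by norm_num, by omega, by omega⟩, by norm_num, by omega⟩, ?_⟩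
  rw [show x.M + (x.M - 1) / x.B + 1 - x.M = q by
    rw [add_assoc, Nat.add_sub_cancel_left]]
  have hc₁' : Cst x (h₁.set 19 q) := ⟨by simp [hc₁.M], by simp [hc₁.B], by simp [hc₁.P],
    by simp [hc₁.Kc]⟩
  refine (zeroRows_spec hx hc₁' (b := x.M) (n := q) (by simp [v12₁])
    (by simp [v28]; omega) le_rfl (by omega) (by simp; omega)).mono
    fun h₂ t₂ ⟨ht₂, hF₂, hV₂⟩ => ?_
  have hc₂ := hc₁'.of_fr hF₂ (by decide)
  have a1₂ : h₂.a 1 = a' 1 := by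
    rw [hF₂.a 1 (by decide), HS.set_a, e1 1 (by norm_num) (by norm_num)]
  have a7₂ : h₂.a 7 = h.a 7 := by rw [hF₂.a 7 (by decide), HS.set_a, a7₁]
  have hN' : Function.update N (0 + 1) ((N 0 - 1) / x.B + 1) 1 = q := by simp [hn0, hqd]
  have hLpar : ∀ e < x.M, ∃ i < x.M, a' 1 e = x.M + i / x.B := by
    intro e he
    obtain ⟨i, hi, rfl⟩ := c2 e (hp.inv.mem_zero.mpr (by rw [hn0]; exact he))
    rw [hn0] at hi
    exact ⟨i, hi, by rw [hb0]; exact hL.par i hi⟩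
  refine (countArcs_spec hx hc₂ (by rw [a7₂]; exact hp.mate) (n := q) (by omega) ?_ ?_).mono
    fun h₃ t₃ ⟨ht₃, hF₃, hV₃⟩ => ⟨?_, ?_⟩
  · intro e he
    obtain ⟨i, hi, h1⟩ := hLpar e he
    have := Nat.div_le_div_right (c := x.B) (show i ≤ x.M - 1 by omega)
    rw [a1₂, h1]
    have := Nat.le_add_right x.M (i / x.B)
    omega
  · intro G j h1 h2 h3
    rw [hV₂ G j h1 (by omega), if_pos ⟨h1, h2, by simpa using h3⟩]
  · have : q * (500 * x.P + 20) ≤ x.P * (500 * x.P + 20) := Nat.mul_le_mul_right _ hq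
    have h2 : x.P * (500 * x.P + 20) = 500 * (x.P * x.P) + 20 * x.P := by ring
    have h3 : x.P * 1 ≤ x.P * x.P := Nat.mul_le_mul_left _ hP
    omega
  · have a1₃ : h₃.a 1 = a' 1 := by rw [hF₃.a 1 (by decide), a1₂]
    have a7₃ : h₃.a 7 = h.a 7 := by rw [hF₃.a 7 (by decide), a7₂]
    have hk : ∀ k, k ≠ 4 → k ≠ 0 → k ≠ 9 → h₃.a k = a' k := by
      intro k h4 h0 h9
      rw [hF₃.a k (by simp [countArcs, HC.for, HC.wa, h4]), hF₂.a k (by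
        simp [zeroRows, rowZero, HC.for, HC.wa, h4]), HS.set_a, e1 k h0 h9]
    have hk' : ∀ k, k ≠ 4 → h₃.a k = h₁.a k := by
      intro k h4
      rw [hF₃.a k (by simp [countArcs, HC.for, HC.wa, h4]), hF₂.a k (by
        simp [zeroRows, rowZero, HC.for, HC.wa, h4]), HS.set_a]
    refine ⟨_, hp.link (h' := h₃) hM2 htour hK1 (ch := x.B) hB (by simp [kb]) (a' := a') ?_
      (hk 1 (by norm_num) (by norm_num) (by norm_num))
      (hk 2 (by norm_num) (by norm_num) (by norm_num))
      (hk 3 (by norm_num) (by norm_num) (by norm_num)) a7₃ ?_ ?_ ?_ ?_ ?_⟩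
    · rw [hb0, hb1, hn0]
      exact hL
    · rw [hk' 0 (by norm_num), hb1, hn0, e2]
    · rw [hk' 9 (by norm_num), hb1, hn0, e3, hpK]
      rfl
    · rw [hn0, hpK]
      omega
    · rw [hF₃.v 19 (by decide), hF₂.v 19 (by decide), hN']
      simp
    · intro _ _ k hk hk1 G hG j hj
      obtain rfl : k = 1 := by omega
      rw [mem_Nd, hN', x.base_one] at hG
      rw [hN'] at hj
      rw [hV₃ G j (by omega) (by omega) hj, a1₃, a7₃, a1₂, a7₂]

theorem buildLevel_spec (hx : x.Ok l) {h : HS} (hc : Cst x h) (hs1 : 1 ≤ s) (hs : s < x.K)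
    (hp : Part x s tc T N rk h) (h14 : h.v 14 = 2 ^ (x.K - (s + 1)))
    (hdvd : 2 ^ (x.K - (s + 1)) ∣ tc) (htour : T.IsCycleOn Set.univ) :
    wp l buildLevel h fun h' t => t ≤ 41000 * (2 ^ (x.K - (s + 1)) * x.P) ∧
      Fr buildLevel h h' ∧ ∃ N' rk', Part x (s + 1) tc T N' rk' h' := by
  have hW := hx.W_ge
  have hP := x.P_pos
  have hPM := hx.P_le
  have hM2 := hx.M_two
  have hZ := hx.Z_ge
  have hD := hx.D_eq
  obtain ⟨c1, c2, c3, c4, c5⟩ := hp.cycle hM2 htour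
  have hp2 : 2 ^ (x.K - s) = 2 * 2 ^ (x.K - (s + 1)) := by
    rw [← pow_succ']
    congr 1
    omega
  have hsz : N s ≤ 8 * 2 ^ (x.K - s) := by
    have h1 := hp.size s hs1 le_rfl
    have h2 : tc % 2 ^ (x.K - s) ≤ 2 ^ (x.K - (s + 1)) := by
      obtain ⟨c, rfl⟩ := hdvd
      rw [hp2, mul_comm 2, Nat.mul_mod_mul_left]
      have := Nat.mod_lt c (show 0 < 2 by norm_num)
      calc _ ≤ 2 ^ (x.K - (s + 1)) * 1 := Nat.mul_le_mul_left _ (by omega)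
        _ = _ := mul_one _
    omega
  have hppos := Nat.two_pow_pos (x.K - (s + 1))
  have hpP : 2 * 2 ^ (x.K - (s + 1)) ≤ x.P := by rw [← hp2]; exact x.two_pow_le hs1
  have hnf := hp.nf s hs1 le_rfl
  have hbs := x.base_succ hs1 hs
  have hbadd := x.base_add_le (k := s + 1) (by omega)
  have hbge := x.base_ge hs1
  have hpos := hp.pos hM2
  have hnb := hp.nb hs1
  have hone : N 1 ≤ 10 * x.P := by
    have := hp.cap (k := 1) le_rfl hs1
    simpa [Ctx.K, Ctx.P] using this
  rw [hp2] at hnf hsz hbs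
  set p := 2 ^ (x.K - (s + 1)) with hpd
  have hb : x.base s = x.M + 20 * (x.P - 2 * p) := by
    rw [Ctx.base, if_neg (by omega), hp2, Ctx.P]
  have hb' : x.base (s + 1) = x.M + 20 * (x.P - p) := by
    rw [Ctx.base, if_neg (by omega), Ctx.P]
  have hq : (N s - 1) / 4 + 1 ≤ 6 * p := by omega
  set q := (N s - 1) / 4 + 1 with hqd
  have := wp_frame_aux (l := l) (c := buildLevel) (h := h) (Q := fun h' t =>
    t ≤ 41000 * (p * x.P) ∧ ∃ N' rk', Part x (s + 1) tc T N' rk' h') ?_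
  · exact this.mono fun h' t ⟨⟨q1, q2⟩, q3⟩ => ⟨q1, q3, q2⟩
  unfold buildLevel
  simp only [wp_seq, wp_asg, Exp.ok, Exp.eval, Op.eval, HS.set_v, HS.set_a, hc.M, hc.P, h14,
    if_false, if_true, show (1 : ℕ) ≠ 13 by norm_num, show (1 : ℕ) ≠ 26 by norm_num,
    show (1 : ℕ) ≠ 20 by norm_num, show (3 : ℕ) ≠ 20 by norm_num,
    show (3 : ℕ) ≠ 13 by norm_num, show (3 : ℕ) ≠ 26 by norm_num, show (14 : ℕ) ≠ 20 by norm_num,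
    show (14 : ℕ) ≠ 26 by norm_num, show (14 : ℕ) ≠ 13 by norm_num, show (20 : ℕ) ≠ 26 by norm_num,
    hnf, ← hb, ← hb', show x.base s + N s - x.base s = N s by omega, Exp.cost, adrCost,
    Lim.bd_pos l 9 (by norm_num)]
  refine ⟨by norm_num, ⟨by norm_num, ⟨by omega, ⟨by norm_num, ⟨by omega, by norm_num, by omega⟩,
    by omega⟩, by omega⟩, by omega⟩, by norm_num, ⟨⟨by norm_num, ⟨by omega, by norm_num, by omega⟩,
    by omega⟩, by norm_num, by omega⟩, by norm_num, by norm_num, by norm_num, ⟨by norm_num,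
    ⟨by omega, ⟨by norm_num, by norm_num, by omega⟩, by omega⟩, by omega⟩, by norm_num, by omega, ?_⟩
  set y := ((((h.set 20 (x.base s)).set 26 (N s)).set 13 (x.base s)).set 12 (x.base (s + 1))).set
    27 4 with hy
  have ya : y.a = h.a := rfl
  have hcy : Cst x y := ⟨by simp [hy, hc.M], by simp [hy, hc.B], by simp [hy, hc.P],
    by simp [hy, hc.Kc]⟩
  have hy14 : y.v 14 = p := by simp [hy, h14]
  have hblt := hp.base_le hs
  refine (links_spec hx (h := y) (b := x.base (s + 1)) (n := N s) (ch := 4) (p := p)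
    (G₀ := x.base s) (by simp [hy]) (by simp [hy]) hy14 (by simp [hy]) (by simp [hy])
    (by norm_num) hpos (by omega) (by omega) ?_ (by omega) ?_).mono
    fun h₁ t₁ ⟨ht₁, hF₁, v28, a', hL, e1, e2, e3⟩ => ?_
  · intro i
    have := c5 i
    rw [mem_Nd] at this
    rw [ya]
    omega
  · exact c3
  have hc₁ := hcy.of_fr hF₁ (by decide)
  have a4₁ : h₁.a 4 = h.a 4 := by rw [hF₁.a 4 (by decide)]; rfl
  have v12₁ : h₁.v 12 = x.base (s + 1) := by rw [hF₁.v 12 (by decide)]; simp [hy]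
  have v19₁ : h₁.v 19 = N 1 := by rw [hF₁.v 19 (by decide)]; simp [hy, hnb]
  refine (zeroRows_spec hx hc₁ (b := x.base (s + 1)) (n := q) v12₁
    (by omega) (by omega) (by omega) (by omega)).mono
    fun h₂ t₂ ⟨ht₂, hF₂, hV₂⟩ => ?_
  have hc₂ := hc₁.of_fr hF₂ (by decide)
  have a1₂ : h₂.a 1 = a' 1 := by
    rw [hF₂.a 1 (by decide), e1 1 (by norm_num) (by norm_num)]
  have v19₂ : h₂.v 19 = N 1 := by rw [hF₂.v 19 (by decide), v19₁]
  have v20₂ : h₂.v 20 = x.base s := by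
    rw [hF₂.v 20 (by decide), hF₁.v 20 (by decide)]; simp [hy]
  have v26₂ : h₂.v 26 = N s := by
    rw [hF₂.v 26 (by decide), hF₁.v 26 (by decide)]; simp [hy]
  have hLpar : ∀ c, x.base s ≤ c → c < x.base s + N s → ∃ i < N s,
      a' 1 c = x.base (s + 1) + i / 4 := by
    intro c h1 h2
    obtain ⟨i, hi, rfl⟩ := c2 c (mem_Nd.mpr ⟨h1, h2⟩)
    exact ⟨i, hi, hL.par i hi⟩
  have hpar2 : ∀ c, x.base s ≤ c → c < x.base s + N s → x.base (s + 1) ≤ a' 1 c ∧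
      a' 1 c < x.base (s + 1) + q := by
    intro c h1 h2
    obtain ⟨i, hi, h3⟩ := hLpar c h1 h2
    omega
  -- the rows of the level below
  have hold : ∀ k, 1 ≤ k → k ≤ s → ∀ G ∈ Nd x.base N k, ∀ j < N 1,
      h₂.a 4 (x.ix G j) = cnt x.M (h.a 7) (h.a 1) k G j ∧ x.M ≤ G ∧ G < x.base (s + 1) := by
    intro k hk hks G hG j hj
    have hV := hp.V k hk hks G hG j hj
    rw [mem_Nd] at hG
    have h1 := x.base_ge hk
    have h2 : G < x.base (s + 1) := by
      rcases Nat.lt_or_ge k s with h | h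
      · have := hp.inv.base_le h le_rfl
        omega
      · obtain rfl : k = s := by omega
        omega
    rw [hV₂ G j (by omega) (by omega), if_neg (by omega), a4₁, hV]
    exact ⟨rfl, by omega, h2⟩
  have hsum : ∀ G, ∀ j < N 1, ∑ c ∈ (Finset.Ico (x.base s) (x.base s + N s)).filter
      (fun c => h₂.a 1 c = G), h₂.a 4 (x.ix c j) =
      ∑ c ∈ (Finset.Ico (x.base s) (x.base s + N s)).filter (fun c => a' 1 c = G),
        cnt x.M (h.a 7) (h.a 1) s c j := by
    intro G j hj
    rw [a1₂]
    refine Finset.sum_congr rfl fun c hc => ?_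
    rw [Finset.mem_filter] at hc
    exact (hold s hs1 le_rfl c hc.1 j hj).1
  refine (addRows_spec hx hc₂ (b := x.base s) (n := N s) (b' := x.base (s + 1)) v20₂ v26₂
    (by omega) hblt (by omega) ?_ (by omega) ?_ ?_).mono
    fun h₃ t₃ ⟨ht₃, hF₃, hV₃⟩ => ⟨?_, ?_⟩
  · intro c h1 h2
    have := hpar2 c h1 h2
    rw [a1₂]
    omega
  · intro c h1 h2 j hj
    have := hpar2 c h1 h2
    rw [a1₂, hV₂ _ j (by omega) (by omega), if_pos ⟨by omega, by omega, by omega⟩]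
  · intro G j hj
    rw [v19₂] at hj
    rw [hsum G j hj]
    refine le_trans ?_ (show x.M ≤ 2 * x.M by omega)
    unfold cnt
    rw [← Finset.card_biUnion]
    · refine (Finset.card_le_card (Finset.biUnion_subset.mpr fun c _ =>
        Finset.filter_subset _ _)).trans (by simp)
    · intro c _ c' _ hcc
      rw [Function.onFun, Finset.disjoint_left]
      intro e he he'
      simp only [Finset.mem_filter] at he he'
      exact hcc (he.2.1.symm.trans he'.2.1)
  · have t1 : N s * (2000 * x.P + 50) ≤ 16 * p * (2000 * x.P + 50) :=
      Nat.mul_le_mul_right _ (by omega)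
    have t2 : q * (500 * x.P + 20) ≤ 6 * p * (500 * x.P + 20) := Nat.mul_le_mul_right _ hq
    have t3 : 16 * p * (2000 * x.P + 50) = 32000 * (p * x.P) + 800 * p := by ring
    have t4 : 6 * p * (500 * x.P + 20) = 3000 * (p * x.P) + 120 * p := by ring
    have t5 : p * 2 ≤ p * x.P := Nat.mul_le_mul_left _ (by omega)
    omega
  · have a1₃ : h₃.a 1 = a' 1 := by rw [hF₃.a 1 (by decide), a1₂]
    have a7₃ : h₃.a 7 = h.a 7 := by
      rw [hF₃.a 7 (by decide), hF₂.a 7 (by decide), hF₁.a 7 (by decide), ya]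
    have hk' : ∀ k, k ≠ 4 → h₃.a k = h₁.a k := by
      intro k h4
      rw [hF₃.a k (by simp [addRows, rowAdd, HC.for, HC.wa, h4]), hF₂.a k (by
        simp [zeroRows, rowZero, HC.for, HC.wa, h4])]
    have hk : ∀ k, k ≠ 4 → k ≠ 0 → k ≠ 9 → h₃.a k = a' k := by
      intro k h4 h0 h9
      rw [hk' k h4, e1 k h0 h9]
    have hN1 : Function.update N (s + 1) q 1 = N 1 := Function.update_of_ne (by omega) _ _
    have hNs : Function.update N (s + 1) q s = N s := Function.update_of_ne (by omega) _ _
    have hN0 : Function.update N (s + 1) q 0 = x.M := by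
      rw [Function.update_of_ne (by omega), hp.zero]
    refine ⟨_, hp.link (h' := h₃) hM2 htour hs (ch := 4) (by norm_num)
      (by simp [kb, show s ≠ 0 by omega]) (a' := a') hL
      (hk 1 (by norm_num) (by norm_num) (by norm_num))
      (hk 2 (by norm_num) (by norm_num) (by norm_num))
      (hk 3 (by norm_num) (by norm_num) (by norm_num)) a7₃ ?_ ?_ hq ?_ ?_⟩
    · rw [hk' 0 (by norm_num), e2]
    · rw [hk' 9 (by norm_num), e3]
      rfl
    · rw [hF₃.v 19 (by decide), v19₂, hN1]
    · rw [← hqd]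
      intro hanc hlev k hk hks G hG j hj
      rw [hN1] at hj
      have hcn : ∀ k, k ≤ s → ∀ G, cnt x.M (h₃.a 7) (h₃.a 1) k G j =
          cnt x.M (h.a 7) (h.a 1) k G j := by
        intro k hk G
        unfold cnt
        congr 1
        ext e
        simp only [Finset.mem_filter, Finset.mem_range]
        refine and_congr_right fun he => ?_
        rw [hanc k hk e he, a7₃]
        have := hanc 1 hs1 _ (hp.mate.lt e he)
        rw [show h₃.a 1 (h.a 7 e) = h.a 1 (h.a 7 e) from this]
      rcases Nat.lt_or_ge k (s + 1) with hlt | hge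
      · have hG' : G ∈ Nd x.base N k := by
          rwa [mem_Nd, Function.update_of_ne (by omega), ← mem_Nd] at hG
        obtain ⟨o1, o2, o3⟩ := hold k hk (by omega) G hG' j hj
        rw [hV₃ G j o2 (by omega), v19₂, if_pos hj, hsum G j hj, o1, hcn k (by omega),
          Finset.sum_eq_zero, add_zero]
        intro c hc
        rw [Finset.mem_filter, Finset.mem_Ico] at hc
        have := hpar2 c hc.1.1 hc.1.2
        omega
      · obtain rfl : k = s + 1 := by omega
        rw [mem_Nd, Function.update_self] at hG
        have e4 := hlev.cnt_eq_sum (mate := h₃.a 7) (k := s) (by omega) G j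
        rw [hN0] at e4
        rw [hV₃ G j (by omega) (by omega), v19₂, if_pos hj, hsum G j hj, e4,
          hV₂ G j (by omega) (by omega), if_pos ⟨by omega, by omega, by omega⟩, zero_add, a1₃]
        unfold Nd
        rw [hNs]
        refine Finset.sum_congr rfl fun c _ => ?_
        rw [← a1₃, hcn s le_rfl]

end FlipRepair

namespace FlipRepair

variable {x : Ctx} {l : Lim} {N : ℕ → ℕ} {rk : ℕ → ℕ → ℕ} {s tc : ℕ} {T : Equiv.Perm (Fin x.M)}

/-- Rebuild the levels whose numbers divide the counter `5`. -/
def maint : HC :=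
  .ite (.v 5) .skip buildBlocks ;;
  .asg 14 (.v 3 /~ .c 2) ;;
  .loop (.v 14) (.ite (.v 5 %~ .v 14) .skip buildLevel ;; .asg 14 (.v 14 /~ .c 2))

/-- A bound for the time that `maint` spends on the level `s + 1`. -/
def lvlTime (x : Ctx) (tc s : ℕ) : ℕ :=
  20 + if 2 ^ (x.K - (s + 1)) ∣ tc then 41000 * (2 ^ (x.K - (s + 1)) * (x.P + x.B)) else 0

/-- A bound for the running time of `maint`. -/
def maintTime (x : Ctx) (tc : ℕ) : ℕ := ∑ s ∈ Finset.range x.K, lvlTime x tc s + 20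

/-- The levels that need not be rebuilt are in order. -/
def Kept (x : Ctx) (tc : ℕ) (T : Equiv.Perm (Fin x.M)) (h : HS) : Prop :=
  ∀ s ≤ x.K, ¬ 2 ^ (x.K - s) ∣ tc → ∃ N rk, Part x s tc T N rk h

theorem Kept.congr {h h' : HS} (hk : Kept x tc T h) (ha : h'.a = h.a) (hv : h'.v 19 = h.v 19) :
    Kept x tc T h' := fun s hs hd =>
  let ⟨N, rk, q⟩ := hk s hs hd
  ⟨N, rk, q.congr ha hv⟩

theorem maint_spec (hx : x.Ok l) {h : HS} (hc : Cst x h) (h5 : h.v 5 = tc) (htc : tc < x.P)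
    (hp : Part x 0 tc T N rk h) (hfull : Kept x tc T h)
    (htour : T.IsCycleOn Set.univ) :
    wp l maint h fun h' t => t ≤ maintTime x tc ∧ Fr maint h h' ∧
      ∃ N' rk', Part x x.K tc T N' rk' h' := by
  have hW := hx.W_ge
  have hP := x.P_pos
  have hPM := hx.P_le
  have hMle := hx.M_le
  have hM2 := hx.M_two
  have hK1 : 1 ≤ x.K := Ctx.K_pos
  have hpK : 2 ^ (x.K - (0 + 1)) = x.P := by simp [Ctx.K, Ctx.P]
  have := wp_frame_aux (l := l) (c := maint) (h := h) (Q := fun h' t =>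
    t ≤ maintTime x tc ∧ ∃ N' rk', Part x x.K tc T N' rk' h') ?_
  · exact this.mono fun h' t ⟨⟨q1, q2⟩, q3⟩ => ⟨q1, q3, q2⟩
  have rest : ∀ (y : HS) (k : ℕ), Cst x y → y.v 5 = tc → (∃ N rk, Part x 1 tc T N rk y) →
      (tc ≠ 0 → Kept x tc T y) → k + 10 ≤ lvlTime x tc 0 →
      wp l (.asg 14 (.v 3 /~ .c 2) ;;
        .loop (.v 14) (.ite (.v 5 %~ .v 14) .skip buildLevel ;; .asg 14 (.v 14 /~ .c 2))) y
        fun h' t => k + t + 1 ≤ maintTime x tc ∧ ∃ N' rk', Part x x.K tc T N' rk' h' := by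
    intro y k hcy y5 hy1 hyK hk
    rw [wp_seq, wp_asg]
    simp only [Exp.ok, Exp.eval, Op.eval, hcy.P, Exp.cost]
    refine ⟨by norm_num, ⟨by norm_num, by omega, by omega⟩, ?_⟩
    have := wp_loop_rank (l := l) (e := .v 14) (c := .ite (.v 5 %~ .v 14) .skip buildLevel ;;
      .asg 14 (.v 14 /~ .c 2)) (h := y.set 14 (x.P / 2)) (m := x.K - 1)
      (R := fun m => ∑ s ∈ Finset.Ico (x.K - m) x.K, lvlTime x tc s)
      (I := fun m h' => ∃ s, 1 ≤ s ∧ s + m = x.K ∧ h'.v 14 = lvlCtr x.K s ∧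
        (∃ N rk, Part x s tc T N rk h') ∧
        (¬ 2 ^ (x.K - s) ∣ tc → Kept x tc T h')) ?_ ?_
    · refine this.mono fun h' t ⟨ht, hF, m, ⟨s, hs1, hsm, h14, hPs, _⟩, hz⟩ => ⟨?_, ?_⟩
      · simp only [Exp.cost] at ht
        rw [show x.K - (x.K - 1) = 1 by omega] at ht
        have e1 := Finset.sum_range_add_sum_Ico (lvlTime x tc) hK1
        rw [Finset.sum_range_one] at e1
        simp only [maintTime]
        omega
      · have hsK : ¬ s < x.K := by
          rw [← lvlCtr_ne, ← h14]
          simpa using hz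
        obtain rfl : s = x.K := by omega
        exact hPs
    · refine ⟨1, le_rfl, by omega, ?_, ?_, ?_⟩
      · rw [← lvlCtr_zero (x := x), lvlCtr_div (by omega)]
        simp
      · obtain ⟨N, rk, q⟩ := hy1
        exact ⟨N, rk, q.congr rfl (by simp)⟩
      · intro hnd
        exact (hyK fun hc => hnd (hc ▸ dvd_zero _)).congr rfl (by simp)
    · rintro m h' ⟨s, hs1, hsm, h14, ⟨Ns, rks, hPs⟩, hPK⟩ hF
      refine ⟨by norm_num, fun hz => ?_⟩
      have hsK : s < x.K := by
        rw [← lvlCtr_ne, ← h14]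
        simpa using hz
      obtain ⟨m', rfl⟩ : ∃ m', m = m' + 1 := ⟨m - 1, by omega⟩
      refine ⟨m', rfl, ?_⟩
      have hc0 : Cst x (y.set 14 (x.P / 2)) := ⟨by simp [hcy.M], by simp [hcy.B], by simp [hcy.P],
        by simp [hcy.Kc]⟩
      have hc' := hc0.of_fr hF (by decide)
      have v5 : h'.v 5 = tc := by rw [hF.v 5 (by decide)]; simp [y5]
      have h14' : h'.v 14 = 2 ^ (x.K - (s + 1)) := by rw [h14, lvlCtr, if_pos hsK]
      have hR : ∑ s ∈ Finset.Ico (x.K - (m' + 1)) x.K, lvlTime x tc s =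
          lvlTime x tc s + ∑ s ∈ Finset.Ico (x.K - m') x.K, lvlTime x tc s := by
        rw [show x.K - (m' + 1) = s by omega, show x.K - m' = s + 1 by omega,
          Finset.sum_eq_sum_Ico_succ_bot hsK]
      rw [hR]
      have hlc : lvlCtr x.K s ≤ x.P := lvlCtr_le s
      have hmod := Nat.mod_le tc (2 ^ (x.K - (s + 1)))
      have fin : ∀ (z : HS) (k : ℕ), z.v 14 = lvlCtr x.K s → (∃ N rk, Part x (s + 1) tc T N rk z) →
          (¬ 2 ^ (x.K - (s + 1)) ∣ tc → Kept x tc T z) →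
          k + 11 ≤ lvlTime x tc s →
          wp l (.asg 14 (.v 14 /~ .c 2)) z fun h'' t => k + t + 1 + 1 + 2 +
            ∑ s ∈ Finset.Ico (x.K - m') x.K, lvlTime x tc s ≤ lvlTime x tc s +
            ∑ s ∈ Finset.Ico (x.K - m') x.K, lvlTime x tc s ∧ ∃ s, 1 ≤ s ∧ s + m' = x.K ∧
            h''.v 14 = lvlCtr x.K s ∧ (∃ N rk, Part x s tc T N rk h'') ∧
            (¬ 2 ^ (x.K - s) ∣ tc → Kept x tc T h'') := by
        intro z k z14 hz1 hzK hk
        simp only [wp_asg, Exp.ok, Exp.eval, Op.eval, z14, Exp.cost]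
        refine ⟨by norm_num, ⟨by norm_num, by omega, by omega⟩, by omega, s + 1, by omega, by omega,
          by simp [lvlCtr_div hsK], ?_, ?_⟩
        · obtain ⟨N, rk, q⟩ := hz1
          exact ⟨N, rk, q.congr rfl (by simp)⟩
        · intro hnd
          exact (hzK hnd).congr rfl (by simp)
      rw [wp_seq, wp_ite]
      simp only [Exp.ok, Exp.eval, Op.eval, v5, h14', Exp.cost]
      refine ⟨⟨by norm_num, by norm_num, by omega⟩, fun hne => ?_, fun heq => ?_⟩
      · have hnd : ¬ 2 ^ (x.K - (s + 1)) ∣ tc := fun hc => hne (Nat.mod_eq_zero_of_dvd hc)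
        have hk := hPK fun hc => hnd ((Nat.pow_dvd_pow 2 (by omega)).trans hc)
        rw [wp_skip]
        refine (fin h' 8 h14 (hk (s + 1) hsK hnd) (fun _ => hk)
          (by simp only [lvlTime]; omega)).mono fun _ _ ⟨q1, q2⟩ => ⟨by omega, q2⟩
      · have hd := Nat.dvd_of_mod_eq_zero heq
        refine (buildLevel_spec hx hc' hs1 hsK hPs h14' hd htour).mono
          fun z t ⟨ht, hF', hz⟩ => ?_
        have : 2 ^ (x.K - (s + 1)) * x.P + 1 ≤ 2 ^ (x.K - (s + 1)) * (x.P + x.B) := by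
          have := Nat.mul_le_mul (Nat.two_pow_pos (x.K - (s + 1))) hx.B_pos
          rw [Nat.mul_add]
          omega
        refine (fin z (t + 7) ?_ hz (fun hc => absurd hd hc) ?_).mono
          fun _ _ ⟨q1, q2⟩ => ⟨by omega, q2⟩
        · rw [hF'.v 14 (by decide), h14]
        · have aux : ∀ a b : ℕ, t ≤ 41000 * a → a + 1 ≤ b → t + 7 + 11 ≤ 20 + 41000 * b := by
            intros
            omega
          rw [lvlTime, if_pos hd]
          exact aux _ _ ht this
  unfold maint
  rw [wp_seq, wp_ite]
  simp only [Exp.ok, Exp.eval, h5, Exp.cost]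
  refine ⟨by norm_num, fun hne => ?_, fun h0 => ?_⟩
  · rw [wp_skip]
    have hnd : ¬ 2 ^ (x.K - 1) ∣ tc := by
      rw [hpK]
      exact fun hc => hne (Nat.eq_zero_of_dvd_of_lt hc htc)
    refine (rest h 5 hc h5 (hfull 1 hK1 hnd) (fun _ => hfull)
      (by simp only [lvlTime]; omega)).mono fun _ _ ⟨q1, q2⟩ => ⟨by omega, q2⟩
  · refine (buildBlocks_spec hx hc hp htour).mono fun z t ⟨ht, hF, hz⟩ => ?_
    refine (rest z (t + 5) (hc.of_fr hF (by decide)) (by rw [hF.v 5 (by decide), h5]) hz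
      (fun hc => absurd h0 hc) ?_).mono fun _ _ ⟨q1, q2⟩ => ⟨by omega, q2⟩
    rw [lvlTime, hpK, if_pos (by rw [h0]; exact dvd_zero _), Nat.mul_add]
    have := Nat.mul_le_mul hP hP
    omega

/-- The credit of the counter `tc` for the next rebuilds. -/
def credit (x : Ctx) (tc : ℕ) : ℕ :=
  41000 * (x.P + x.B) * ∑ s ∈ Finset.range x.K, tc % 2 ^ (x.K - (s + 1))

theorem maintTime_zero_le : maintTime x 0 ≤ 82040 * (x.P * (x.P + x.B)) + 20 * x.K + 20 := by
  have h1 : ∀ k, ∑ s ∈ Finset.range k, 2 ^ (k - (s + 1)) = 2 ^ k - 1 := by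
    intro k
    have := Finset.sum_range_reflect (fun s => 2 ^ s) k
    simp only [Nat.sub_sub, add_comm 1] at this
    rw [this, Nat.geomSum_eq le_rfl]
    simp
  have h2 : 2 ^ x.K = 2 * x.P := by rw [Ctx.K, pow_succ, Ctx.P]; ring
  simp only [maintTime, lvlTime, dvd_zero, if_true, Finset.sum_add_distrib, Finset.sum_const,
    Finset.card_range, smul_eq_mul]
  rw [← Finset.mul_sum, ← Finset.sum_mul, h1, h2]
  have : (2 * x.P - 1) * (x.P + x.B) ≤ 2 * x.P * (x.P + x.B) := Nat.mul_le_mul_right _ (by omega)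
  rw [Nat.mul_assoc] at this
  omega

/-- The counter after one more step. -/
def nextCtr (x : Ctx) (tc : ℕ) : ℕ := if tc + 1 = x.P then 0 else tc + 1

theorem maintTime_credit (tc : ℕ) :
    maintTime x (nextCtr x tc) + credit x (nextCtr x tc) ≤
      credit x tc + 41000 * (x.P + x.B) * x.K + 20 * x.K + 20 := by
  have hmod : ∀ s < x.K, nextCtr x tc % 2 ^ (x.K - (s + 1)) = (tc + 1) % 2 ^ (x.K - (s + 1)) := by
    intro s _
    unfold nextCtr
    split_ifs with h
    · rw [h, Nat.zero_mod]
      symm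
      refine Nat.mod_eq_zero_of_dvd ?_
      rw [Ctx.P]
      exact Nat.pow_dvd_pow 2 (by simp only [Ctx.K]; omega)
    · rfl
  have key : ∀ s ∈ Finset.range x.K, lvlTime x (nextCtr x tc) s +
      41000 * (x.P + x.B) * (nextCtr x tc % 2 ^ (x.K - (s + 1))) ≤
      41000 * (x.P + x.B) * (tc % 2 ^ (x.K - (s + 1))) + (41000 * (x.P + x.B) + 20) := by
    intro s hs
    have hm := hmod s (Finset.mem_range.mp hs)
    set p := 2 ^ (x.K - (s + 1)) with hp
    have hpos : 0 < p := Nat.two_pow_pos _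
    have hlt := Nat.mod_lt tc hpos
    set q := x.P + x.B with hq
    rw [lvlTime, ← hp, if_congr (Nat.dvd_iff_mod_eq_zero.trans (by rw [hm])) rfl rfl, hm,
      Nat.add_mod_eq_ite, ← hq]
    clear_value p q
    by_cases h1 : p = 1
    · subst h1
      simp only [Nat.mod_one]
      simp
      omega
    · rw [Nat.mod_eq_of_lt (show 1 < p by omega)]
      by_cases h2 : p ≤ tc % p + 1
      · have : tc % p = p - 1 := by omega
        rw [if_pos h2, this, show p - 1 + 1 - p = 0 by omega, if_pos rfl]
        obtain ⟨r, rfl⟩ : ∃ r, p = r + 1 := ⟨p - 1, by omega⟩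
        rw [Nat.add_sub_cancel]
        have : 41000 * ((r + 1) * q) = 41000 * q * r + 41000 * q := by ring
        omega
      · rw [if_neg h2, if_neg (by omega), Nat.mul_add]
        omega
  have := Finset.sum_le_sum key
  rw [Finset.sum_add_distrib, Finset.sum_add_distrib, ← Finset.mul_sum, ← Finset.mul_sum,
    Finset.sum_const, Finset.card_range, smul_eq_mul] at this
  unfold maintTime credit
  have h3 : x.K * (41000 * (x.P + x.B) + 20) = 41000 * (x.P + x.B) * x.K + 20 * x.K := by ring
  omega

end FlipRepair

namespace FlipRepair

variable {x : Ctx} {l : Lim}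

/-! ### Preprocessing -/

/-- Every vertex `v < n` is the head of exactly two arcs. -/
structure TwoIn (n M : ℕ) (hd : ℕ → ℕ) : Prop where
  lt : ∀ e < M, hd e < n
  other : ∀ e < M, ∃ e' < M, e' ≠ e ∧ hd e' = hd e
  three : ∀ e < M, ∀ e' < M, ∀ e'' < M, hd e' = hd e → hd e'' = hd e → e' ≠ e → e'' ≠ e → e' = e''
  surj : ∀ v < n, ∃ e < M, hd e = v

/-- The arrays of the incoming arcs of the vertices and of the other arcs with the same heads. -/
structure Heads (x : Ctx) (n : ℕ) (hd : ℕ → ℕ) (h : HS) : Prop where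
  ia : ∀ v < n, h.a 8 v < x.M ∧ hd (h.a 8 v) = v
  mate : ∀ e < x.M, ∀ e' < x.M, e ≠ e' → hd e = hd e' → h.a 7 e = e'

theorem Heads.isMate {n : ℕ} {hd : ℕ → ℕ} (h2 : TwoIn n x.M hd) {h : HS} (hh : Heads x n hd h) :
    IsMate x.M (h.a 7) := by
  constructor
  · intro e he
    obtain ⟨e', h1, h3, h4⟩ := h2.other e he
    rw [hh.mate e he e' h1 h3.symm h4.symm]
    exact h1
  · intro e he
    obtain ⟨e', h1, h3, h4⟩ := h2.other e he
    rw [hh.mate e he e' h1 h3.symm h4.symm, hh.mate e' h1 e he h3 h4]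
  · intro e he
    obtain ⟨e', h1, h3, h4⟩ := h2.other e he
    rw [hh.mate e he e' h1 h3.symm h4.symm]
    exact h3

/-- Compute the smallest power of two `3` whose product with `2` is at least `1`. -/
def params : HC :=
  .asg 3 (.c 1) ;;
  .loop (.v 3 *~ .v 2 <~ .v 1) (.asg 3 (.v 3 +~ .v 3)) ;;
  .asg 4 (.c 10 *~ .v 3)

theorem params_spec (hx : x.Ok l) (hmin : ∀ i < x.L, 2 ^ i * x.B < x.M) {h : HS}
    (h1 : h.v 1 = x.M) (h2 : h.v 2 = x.B) :
    wp l params h fun h' t => t ≤ 20 * x.K + 40 ∧ Fr params h h' ∧ Cst x h' := by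
  have hW := hx.W_ge
  have hP := x.P_pos
  have hPM := hx.P_le
  have hM := hx.M_le
  have hmul : ∀ i ≤ x.L, 2 ^ i * x.B ≤ 2 * x.M + x.B ∧ 2 ^ i ≤ 2 * x.M := by
    intro i hi
    refine ⟨?_, (Nat.pow_le_pow_right (by norm_num) hi).trans hPM⟩
    rcases Nat.eq_zero_or_pos i with rfl | h0
    · omega
    · obtain ⟨j, rfl⟩ : ∃ j, i = j + 1 := ⟨i - 1, by omega⟩
      have := hmin j (by omega)
      rw [pow_succ', Nat.mul_assoc]
      omega
  have := wp_frame_aux (l := l) (c := params) (h := h) (Q := fun h' t =>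
    t ≤ 20 * x.K + 40 ∧ Cst x h') ?_
  · exact this.mono fun h' t ⟨⟨q1, q2⟩, q3⟩ => ⟨q1, q3, q2⟩
  unfold params
  rw [wp_seq, wp_asg]
  refine ⟨by norm_num, by simp only [Exp.ok]; omega, ?_⟩
  rw [wp_seq]
  refine (wp_loop (l := l) (e := .v 3 *~ .v 2 <~ .v 1) (c := .asg 3 (.v 3 +~ .v 3))
    (h := h.set 3 1) (C := 7) (m := x.L) (I := fun m h' => ∃ i, i + m = x.L ∧ h'.v 3 = 2 ^ i)
    ⟨0, by omega, by simp⟩ ?_).mono fun h' t ⟨ht, hF, m, ⟨i, hi, h3⟩, hz⟩ => ?_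
  · rintro m h' ⟨i, hi, h3⟩ hF
    have v1 : h'.v 1 = x.M := by rw [hF.v 1 (by decide)]; simp [h1]
    have v2 : h'.v 2 = x.B := by rw [hF.v 2 (by decide)]; simp [h2]
    have := hmul i (by omega)
    refine ⟨⟨⟨by norm_num, by norm_num, ?_⟩, by norm_num, (Op.eval_lt_le _ _).trans (by omega)⟩,
      fun hz => ?_⟩
    · simp only [Exp.eval, Op.eval, v2, h3]
      omega
    simp only [Exp.eval, Op.eval, v1, v2, h3] at hz
    have hiL : i < x.L := by
      by_contra hc
      obtain rfl : i = x.L := by omega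
      rw [if_neg (by rw [Ctx.P] at hM; omega)] at hz
      exact hz rfl
    refine ⟨m - 1, by omega, ?_⟩
    have h2i := hmul (i + 1) hiL
    simp only [wp_asg, Exp.ok, Exp.eval, Op.eval, h3, Exp.cost]
    have : 2 ^ (i + 1) = 2 ^ i + 2 ^ i := by ring
    exact ⟨by norm_num, ⟨by norm_num, by norm_num, by omega⟩, by norm_num, i + 1, by omega,
      by simp [this]⟩
  · have v1 : h'.v 1 = x.M := by rw [hF.v 1 (by decide)]; simp [h1]
    have v2 : h'.v 2 = x.B := by rw [hF.v 2 (by decide)]; simp [h2]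
    have hiL : i = x.L := by
      by_contra hc
      have := hmin i (by omega)
      simp only [Exp.eval, Op.eval, v1, v2, h3] at hz
      rw [if_pos this] at hz
      exact one_ne_zero hz
    subst hiL
    have h3' : h'.v 3 = x.P := h3
    simp only [wp_asg, Exp.ok, Exp.eval, Op.eval, h3', Exp.cost] at ht ⊢
    refine ⟨by norm_num, ⟨by omega, by norm_num, by omega⟩, ?_, by simp [v1], by simp [v2],
      by simp [h3'], by simp⟩
    simp only [Ctx.K]
    omega

/-- Compute the arrays of the incoming arcs and of the mates, and the first and last arcs of
the arcs. -/
def pairs : HC :=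
  .for 17 0 (.put 8 (.v 17) (.v 1)) ;;
  .for 17 1 (
    .asg 28 (.get 0 (.v 1 +~ .v 17)) ;;
    .put 2 (.v 17) (.v 17) ;;
    .put 3 (.v 17) (.v 17) ;;
    .ite (.get 8 (.v 28) <~ .v 1)
      (.asg 29 (.get 8 (.v 28)) ;; .put 7 (.v 17) (.v 29) ;; .put 7 (.v 29) (.v 17)) .skip ;;
    .put 8 (.v 28) (.v 17))

/-- The state after `i` rounds of the second loop of `pairs`. -/
structure PairInv (x : Ctx) (n : ℕ) (hd : ℕ → ℕ) (i : ℕ) (a : ℕ → ℕ → ℕ) : Prop where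
  ends : ∀ e < i, a 2 e = e ∧ a 3 e = e
  ia : ∀ v < n, (a 8 v = x.M ∧ ∀ e < i, hd e ≠ v) ∨ (a 8 v < i ∧ hd (a 8 v) = v)
  mate : ∀ e < i, ∀ e' < i, e ≠ e' → hd e = hd e' → a 7 e = e'

theorem pairs_spec (hx : x.Ok l) {n : ℕ} {hd : ℕ → ℕ} (h2 : TwoIn n x.M hd) (hn : n ≤ x.M)
    {h : HS} (h0 : h.v 0 = n) (hc : Cst x h) (hhd : ∀ e < x.M, h.a 0 (x.M + e) = hd e) :
    wp l pairs h fun h' t => t ≤ 200 * x.M + 40 ∧ Fr pairs h h' ∧ Heads x n hd h' ∧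
      ∀ e < x.M, h'.a 2 e = e ∧ h'.a 3 e = e := by
  have hW := hx.W_ge
  have hZ := hx.Z_ge
  have hD := hx.D_eq
  have hM2 := hx.M_two
  have := wp_frame_aux (l := l) (c := pairs) (h := h) (Q := fun h' t =>
    t ≤ 200 * x.M + 40 ∧ PairInv x n hd x.M h'.a) ?_
  · refine this.mono fun h' t ⟨⟨q1, q2⟩, q3⟩ => ⟨q1, q3, ⟨fun v hv => ?_, q2.mate⟩, q2.ends⟩
    rcases q2.ia v hv with ⟨h3, h4⟩ | h5
    · obtain ⟨e, he, hev⟩ := h2.surj v hv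
      exact absurd hev (h4 e he)
    · exact h5
  unfold pairs
  rw [wp_seq]
  have hl1 := wp_for (l := l) (i := 17) (b := 0) (c := .put 8 (.v 17) (.v 1)) (h := h)
    (I := fun i h' => ∀ v < i, h'.a 8 v = x.M) (C := 15) (n := n)
    (by norm_num) (by norm_num) (by norm_num) (by simp [HC.wv]) (by simp [HC.wv]) h0 (by omega)
    (by simp) ?_
  · refine (hl1.frame fun h' t q hF => And.intro q hF).mono fun h₁ t₁ ⟨⟨ht₁, _, hI₁⟩, hF₁⟩ => ?_
    have hc₁ := hc.of_fr hF₁ (by decide)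
    have hl2 := wp_for (l := l) (i := 17) (b := 1) (c := .asg 28 (.get 0 (.v 1 +~ .v 17)) ;;
      .put 2 (.v 17) (.v 17) ;;
      .put 3 (.v 17) (.v 17) ;;
      .ite (.get 8 (.v 28) <~ .v 1)
        (.asg 29 (.get 8 (.v 28)) ;; .put 7 (.v 17) (.v 29) ;; .put 7 (.v 29) (.v 17)) .skip ;;
      .put 8 (.v 28) (.v 17)) (h := h₁)
      (I := fun i h' => PairInv x n hd i h'.a) (C := 150) (n := x.M)
      (by norm_num) (by norm_num) (by norm_num) (by simp [HC.wv]) (by simp [HC.wv]) hc₁.M (by omega)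
      ⟨by simp, fun v hv => Or.inl ⟨hI₁ v hv, by simp⟩, by simp⟩ ?_
    · exact hl2.mono fun h₂ t₂ ⟨ht₂, _, hI₂⟩ => ⟨by omega, hI₂⟩
    intro i h' hi hv hI hF
    have v1 : h'.v 1 = x.M := by rw [hF.v 1 (by decide), hc₁.M]
    have a0 : h'.a 0 = h.a 0 := by rw [hF.a 0 (by decide), hF₁.a 0 (by decide)]
    have hvn := h2.lt i hi
    have hia := hI.ia (hd i) hvn
    have e8 : h'.a 0 (i + x.M) = hd i := by rw [a0, add_comm, hhd i hi]
    set v := hd i with hvd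
    simp only [wp_seq, wp_asg, wp_put, wp_ite, wp_skip, Exp.ok, Exp.eval, Op.eval, HS.set_v,
      HS.set_a, HS.put_v, v1, hv, Lim.bd_zero, Lim.bd_pos l 2 (by norm_num),
      Lim.bd_pos l 3 (by norm_num), Lim.bd_pos l 7 (by norm_num), Lim.bd_pos l 8 (by norm_num),
      show x.M + i = i + x.M by omega, e8, if_true, if_false, show (17 : ℕ) ≠ 28 by norm_num,
      show (1 : ℕ) ≠ 28 by norm_num, show (17 : ℕ) ≠ 29 by norm_num, show (28 : ℕ) ≠ 29 by norm_num,
      Exp.cost, adrCost, HS.put_a_ne _ _ _ _ _ (show (8 : ℕ) ≠ 3 by norm_num),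
      HS.put_a_ne _ _ _ _ _ (show (8 : ℕ) ≠ 2 by norm_num)]
    refine ⟨by norm_num, ⟨by norm_num, ⟨by norm_num, by norm_num, by omega⟩, by omega⟩, by norm_num,
      by norm_num, by omega, by norm_num, by norm_num, by norm_num, by omega, by norm_num,
      ⟨⟨by norm_num, by norm_num, by omega⟩, by norm_num, by split_ifs <;> omega⟩, ?_, ?_⟩
    · intro hlt
      have hlt : h'.a 8 v < x.M := by
        by_contra hc
        rw [if_neg hc] at hlt
        exact hlt rfl
      obtain ⟨hci, hcv⟩ : h'.a 8 v < i ∧ hd (h'.a 8 v) = v := by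
        rcases hia with h3 | h3
        · omega
        · exact h3
      set c := h'.a 8 v with hcd
      refine ⟨by norm_num, ⟨by norm_num, by norm_num, by omega⟩, by norm_num, by norm_num, by omega,
        by norm_num, by norm_num, by norm_num, by omega, by norm_num, by norm_num, by norm_num,
        by omega, by norm_num, by norm_num, ?_, ?_, ?_⟩
      · intro e he
        simp [Function.update_apply]
        constructor <;> split_ifs with hne
        · exact hne.symm
        · exact (hI.ends e (by omega)).1
        · exact hne.symm
        · exact (hI.ends e (by omega)).2
      · intro u hu
        simp [Function.update_apply]
        by_cases huv : u = v
        · right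
          rw [if_pos huv]
          exact ⟨by omega, huv.symm⟩
        · rw [if_neg huv]
          rcases hI.ia u hu with ⟨q1, q2⟩ | ⟨q1, q2⟩
          · left
            refine ⟨q1, fun e he heu => ?_⟩
            rcases Nat.lt_or_ge e i with h5 | h5
            · exact q2 e h5 heu
            · obtain rfl : e = i := by omega
              exact huv heu.symm
          · right
            exact ⟨by omega, q2⟩
      · intro e he e' he' hne hee
        simp [Function.update_apply]
        by_cases h5 : e = c
        · rw [if_pos h5]
          subst h5
          by_contra hc'
          have := h2.three c (by omega) i hi e' (by omega) (by rw [← hvd, hcv]) hee.symm (by omega)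
            (by omega)
          exact hc' this
        · rw [if_neg h5]
          by_cases h6 : e = i
          · rw [if_pos h6]
            subst h6
            refine h2.three e hi c (by omega) e' (by omega) (by rw [hcv]) hee.symm (by omega) ?_
            omega
          · rw [if_neg h6]
            by_cases h7 : e' = i
            · subst h7
              exact absurd (h2.three e' hi e (by omega) c (by omega) hee (by rw [hcv]) h6 (by omega)) h5
            · exact hI.mate e (by omega) e' (by omega) hne hee
    · intro hge
      have hge : ¬ h'.a 8 v < x.M := by
        intro hc
        rw [if_pos hc] at hge
        exact one_ne_zero hge
      have hnone : ∀ e < i, hd e ≠ v := by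
        rcases hia with h3 | h3
        · exact h3.2
        · omega
      refine ⟨by norm_num, by norm_num, by omega, by norm_num, by norm_num, ?_, ?_, ?_⟩
      · intro e he
        simp [Function.update_apply]
        constructor <;> split_ifs with hne
        · exact hne.symm
        · exact (hI.ends e (by omega)).1
        · exact hne.symm
        · exact (hI.ends e (by omega)).2
      · intro u hu
        simp [Function.update_apply]
        by_cases huv : u = v
        · right
          rw [if_pos huv]
          exact ⟨by omega, huv.symm⟩
        · rw [if_neg huv]
          rcases hI.ia u hu with ⟨q1, q2⟩ | ⟨q1, q2⟩
          · left
            refine ⟨q1, fun e he heu => ?_⟩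
            rcases Nat.lt_or_ge e i with h5 | h5
            · exact q2 e h5 heu
            · obtain rfl : e = i := by omega
              exact huv heu.symm
          · right
            exact ⟨by omega, q2⟩
      · intro e he e' he' hne hee
        have h6 : e ≠ i := by
          rintro rfl
          exact hnone e' (by omega) hee.symm
        have h7 : e' ≠ i := by
          rintro rfl
          exact hnone e (by omega) hee
        exact hI.mate e (by omega) e' (by omega) hne hee
  · intro i h' hi hv hI hF
    have v1 : h'.v 1 = x.M := by rw [hF.v 1 (by decide), hc.M]
    simp only [wp_put, Exp.ok, Exp.eval, hv, v1, Lim.bd_pos l 8 (by norm_num), Exp.cost, adrCost]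
    refine ⟨by norm_num, by norm_num, by omega, by norm_num, by norm_num, fun v hv' => ?_⟩
    simp only [HS.set_a, HS.put_a_same, Function.update_apply]
    split_ifs with h1
    · rfl
    · exact hI v (by omega)

/-- The preprocessing. -/
def prep : HC := params ;; pairs ;; .asg 5 (.c 0) ;; maint

theorem prep_spec (hx : x.Ok l) (hmin : ∀ i < x.L, 2 ^ i * x.B < x.M) {n : ℕ} {hd : ℕ → ℕ}
    (h2 : TwoIn n x.M hd) (hn : n ≤ x.M) {h : HS} (h0 : h.v 0 = n) (h1 : h.v 1 = x.M)
    (hB : h.v 2 = x.B) (hhd : ∀ e < x.M, h.a 0 (x.M + e) = hd e) {T : Equiv.Perm (Fin x.M)}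
    (hT : ActsAs (h.a 0) T) (htour : T.IsCycleOn Set.univ) :
    wp l prep h fun h' t => t ≤ 200 * x.M + 20 * x.K + 100 + maintTime x 0 ∧ h'.v 0 = n ∧
      h'.v 5 = 0 ∧ Cst x h' ∧ Heads x n hd h' ∧ ∃ N rk, Part x x.K 0 T N rk h' := by
  unfold prep
  rw [wp_seq]
  refine (params_spec hx hmin h1 hB).mono fun h₁ t₁ ⟨ht₁, hF₁, hc₁⟩ => ?_
  rw [wp_seq]
  have a0₁ : h₁.a 0 = h.a 0 := hF₁.a 0 (by decide)
  refine (pairs_spec hx h2 hn (by rw [hF₁.v 0 (by decide), h0]) hc₁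
    (by rw [a0₁]; exact hhd)).mono fun h₂ t₂ ⟨ht₂, hF₂, hh, hends⟩ => ?_
  have hc₂ := hc₁.of_fr hF₂ (by decide)
  have a0₂ : h₂.a 0 = h.a 0 := by rw [hF₂.a 0 (by decide), a0₁]
  rw [wp_seq, wp_asg]
  refine ⟨by norm_num, by simp, ?_⟩
  have hc₃ : Cst x (h₂.set 5 0) := ⟨by simp [hc₂.M], by simp [hc₂.B], by simp [hc₂.P],
    by simp [hc₂.Kc]⟩
  have hp0 : Part x 0 0 T (fun _ => x.M) (fun _ _ => 0) (h₂.set 5 0) := by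
    have hlt : ∀ e (he : e < x.M), h₂.a 0 e = T ⟨e, he⟩ := fun e he => by rw [a0₂]; exact hT ⟨e, he⟩
    have hnl : ∀ e < x.M, h₂.a 0 e < x.M := fun e he => by rw [hlt e he]; exact (T ⟨e, he⟩).2
    refine ⟨⟨by omega, x.base_zero, hnl, ?_, by omega, ?_, ?_, by omega, ?_, ?_, ?_, by simp⟩, rfl,
      by omega, hh.isMate h2, by omega, by omega, by omega, by omega, ?_⟩
    · intro e he e' he' hee
      simp only [HS.set_a] at hee
      rw [hlt e he, hlt e' he'] at hee
      exact congrArg Fin.val (T.injective (Fin.ext hee))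
    · intro k hk G hG
      obtain rfl : k = 0 := by omega
      have hG' : G < x.M := by simpa [mem_Nd, x.base_zero] using hG
      simp [(hends G hG').1, hG']
    · intro k hk G hG
      obtain rfl : k = 0 := by omega
      have hG' : G < x.M := by simpa [mem_Nd, x.base_zero] using hG
      simp [(hends G hG').2, hG']
    · intro k hk e he hne
      obtain rfl : k = 0 := by omega
      exact absurd (hends e he).1 hne
    · intro k hk e he _
      obtain rfl : k = 0 := by omega
      exact ⟨rfl, (hends _ (hnl e he)).2⟩
    · intro k hk e he e' he' hee _
      obtain rfl : k = 0 := by omega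
      exact hee
    · intro e
      rw [HS.set_a, a0₂]
      exact hT e
  refine (maint_spec hx hc₃ (tc := 0) (by simp) x.P_pos hp0 (fun _ _ hd => absurd (dvd_zero _) hd) htour).mono
    fun h₃ t₃ ⟨ht₃, hF₃, hP⟩ => ⟨?_, ?_, ?_, hc₃.of_fr hF₃ (by decide), ?_, hP⟩
  · simp only [Exp.cost]
    omega
  · rw [hF₃.v 0 (by decide)]
    simp only [HS.set_v, show (0 : ℕ) ≠ 5 by norm_num, if_false]
    rw [hF₂.v 0 (by decide), hF₁.v 0 (by decide), h0]
  · rw [hF₃.v 5 (by decide)]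
    simp
  · obtain ⟨q1, q2⟩ := hh
    refine ⟨?_, ?_⟩
    · rw [hF₃.a 8 (by decide)]
      exact q1
    · rw [hF₃.a 7 (by decide)]
      exact q2

end FlipRepair

namespace FlipRepair

open Equiv Equiv.Perm

/-! ### Multiplying a permutation by a transposition -/

section perm

variable {α : Type*} {T : Perm α} {a b : α}

theorem isCycleOn_univ (h : ∀ e, T.SameCycle a e) : T.IsCycleOn Set.univ :=
  ⟨Set.bijOn_univ.mpr T.bijective, fun e _ e' _ => (h e).symm.trans (h e')⟩

variable [Fintype α] [DecidableEq α]

theorem sign_of_isCycleOn (h : T.IsCycleOn Set.univ) (hab : a ≠ b) :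
    sign T = -(-1) ^ Fintype.card α := by
  have hn : (Set.univ : Set α).Nontrivial := ⟨a, trivial, b, trivial, hab⟩
  have hc : T.IsCycle := isCycle_iff_exists_isCycleOn.mpr ⟨_, hn, h, fun _ _ => trivial⟩
  have hs : T.support = Finset.univ := by
    ext e
    simpa using h.apply_ne hn (Set.mem_univ e)
  rw [hc.sign, hs, Finset.card_univ]

theorem sameCycle_or (h : T.IsCycleOn Set.univ) (e : α) :
    (T * swap a b).SameCycle a e ∨ (T * swap a b).SameCycle b e := by
  obtain ⟨k, rfl⟩ := (h.2 (Set.mem_univ a) (Set.mem_univ e)).exists_nat_pow_eq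
  induction k with
  | zero => exact Or.inl (SameCycle.refl _ _)
  | succ k ih =>
    rw [pow_succ', mul_apply]
    set c := (T ^ k) a
    by_cases ha : c = a
    · right
      have : T c = (T * swap a b) b := by simp [ha]
      rw [this, sameCycle_apply_right]
    · by_cases hb : c = b
      · left
        have : T c = (T * swap a b) a := by simp [hb]
        rw [this, sameCycle_apply_right]
      · have : T c = (T * swap a b) c := by simp [swap_apply_of_ne_of_ne ha hb]
        rwa [this, sameCycle_apply_right, sameCycle_apply_right]

/-- A transposition splits a single cycle. -/
theorem not_sameCycle_mul_swap (h : T.IsCycleOn Set.univ) (hab : a ≠ b) :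
    ¬ (T * swap a b).SameCycle a b := by
  intro hs
  have h' : (T * swap a b).IsCycleOn Set.univ := isCycleOn_univ (a := a) fun e =>
    (sameCycle_or (a := a) (b := b) h e).elim id hs.trans
  have h1 := sign_of_isCycleOn h' hab
  rw [Equiv.Perm.sign_mul, sign_swap hab, sign_of_isCycleOn h hab] at h1
  simp at h1

theorem sameCycle_mul_swap (h : ¬ T.SameCycle a b) :
    (∀ e, T.SameCycle b e → (T * swap a b).SameCycle b e) ∧ (T * swap a b).SameCycle a b := by
  have key : ∀ k : ℕ, (T * swap a b).SameCycle (T b) ((T ^ k) (T b)) := by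
    intro k
    induction k with
    | zero => exact SameCycle.refl _ _
    | succ k ih =>
      rw [pow_succ', mul_apply]
      set c := (T ^ k) (T b) with hc
      by_cases hb : c = b
      · rw [hb]
      · have ha : c ≠ a := by
          intro hca
          refine h (SameCycle.symm ?_)
          rw [← hca, hc, sameCycle_pow_right, sameCycle_apply_right]
        have : T c = (T * swap a b) c := by simp [swap_apply_of_ne_of_ne ha hb]
        rwa [this, sameCycle_apply_right]
  have hb : ∀ e, T.SameCycle b e → (T * swap a b).SameCycle (T b) e := by
    intro e he
    obtain ⟨k, rfl⟩ := (sameCycle_apply_left.mpr he).exists_nat_pow_eq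
    exact key k
  refine ⟨fun e he => (hb b (SameCycle.refl _ _)).symm.trans (hb e he), ?_⟩
  have : T b = (T * swap a b) a := by simp
  have h1 := hb b (SameCycle.refl _ _)
  rwa [this, sameCycle_apply_left] at h1

/-- A transposition joins two cycles. -/
theorem isCycleOn_mul_swap (h : ¬ T.SameCycle a b)
    (hor : ∀ e, T.SameCycle a e ∨ T.SameCycle b e) : (T * swap a b).IsCycleOn Set.univ := by
  obtain ⟨h1, h2⟩ := sameCycle_mul_swap h
  have h3 := (sameCycle_mul_swap (a := b) (b := a) fun hc => h hc.symm).1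
  rw [swap_comm] at h3
  exact isCycleOn_univ fun e => (hor e).elim (h3 e) fun he => h2.trans (h1 e he)

end perm

namespace Graph

variable {n M : ℕ} (H : Graph n M)

theorem inArcs_eq (v : Fin n) : H.inArcs v = {H.inArcA v, H.inArcB v} ∧
    H.inArcA v ≠ H.inArcB v := by
  have hne : H.inArcA v ≠ H.inArcB v := by
    refine (Finset.min'_lt_max'_of_card _ ?_).ne
    have := H.two_in v
    unfold inArcs
    omega
  refine ⟨(Finset.eq_of_subset_of_card_le ?_ ?_).symm, hne⟩
  · intro e he
    rw [Finset.mem_insert, Finset.mem_singleton] at he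
    rcases he with rfl | rfl <;> simp [inArcs, head_inArcA, head_inArcB]
  · rw [Finset.card_pair hne]
    exact (H.two_in v).le

theorem head_eq_iff {e : Fin M} {v : Fin n} :
    H.head e = v ↔ e = H.inArcA v ∨ e = H.inArcB v := by
  constructor
  · intro h
    have h1 : e ∈ H.inArcs v := by simp [inArcs, h]
    rw [(H.inArcs_eq v).1] at h1
    simpa using h1
  · rintro (rfl | rfl)
    · exact H.head_inArcA v
    · exact H.head_inArcB v

/-- The heads of the arcs as a function of the natural numbers. -/
def hd (e : ℕ) : ℕ := if h : e < M then H.head ⟨e, h⟩ else 0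

theorem hd_fin (e : Fin M) : H.hd e = H.head e := by simp [hd]

theorem twoIn : TwoIn n M H.hd := by
  refine ⟨fun e he => ?_, fun e he => ?_, ?_, fun v hv => ?_⟩
  · simp [hd, he]
  · obtain ⟨h1, h2⟩ := H.inArcs_eq (H.head ⟨e, he⟩)
    rcases H.head_eq_iff.mp (rfl : H.head ⟨e, he⟩ = _) with h3 | h3
    · refine ⟨H.inArcB (H.head ⟨e, he⟩), Fin.is_lt _, fun hc => h2 ?_, ?_⟩
      · rw [← h3]
        exact Fin.ext hc.symm
      · rw [hd_fin, H.head_inArcB]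
        simp [hd, he]
    · refine ⟨H.inArcA (H.head ⟨e, he⟩), Fin.is_lt _, fun hc => h2 ?_, ?_⟩
      · rw [← h3]
        exact Fin.ext hc
      · rw [hd_fin, H.head_inArcA]
        simp [hd, he]
  · intro e he e' he' e'' he'' h1 h2 h3 h4
    have w := H.head_eq_iff.mp (rfl : H.head ⟨e, he⟩ = _)
    have w' := (H.head_eq_iff (e := ⟨e', he'⟩) (v := H.head ⟨e, he⟩)).mp
      (Fin.ext (by simpa [hd, he, he'] using h1))
    have w'' := (H.head_eq_iff (e := ⟨e'', he''⟩) (v := H.head ⟨e, he⟩)).mp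
      (Fin.ext (by simpa [hd, he, he''] using h2))
    generalize H.inArcA (H.head ⟨e, he⟩) = A at w w' w''
    generalize H.inArcB (H.head ⟨e, he⟩) = B at w w' w''
    simp only [Fin.ext_iff] at w w' w''
    omega
  · exact ⟨H.inArcA ⟨v, hv⟩, Fin.is_lt _, by rw [hd_fin, H.head_inArcA]⟩

theorem two_mul_card (H : Graph n M) : 2 * n = M := by
  have h1 := Finset.card_eq_sum_card_fiberwise (f := fun e : Fin M => Graph.head H e)
    (s := Finset.univ) (t := Finset.univ)
    (fun _ _ => Finset.mem_coe.mpr (Finset.mem_univ _))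
  simp only [H.two_in] at h1
  simpa [mul_comm] using h1.symm

end Graph

variable {n M : ℕ} {H : Graph n M}

theorem TransitionSystem.flip_next (τ : TransitionSystem H) {v : Fin n} {a b : Fin M} (hab : a ≠ b)
    (ha : H.head a = v) (hb : H.head b = v) : (τ.flip v).next = τ.next * swap a b := by
  change τ.next * swap (H.inArcA v) (H.inArcB v) = _
  rcases H.head_eq_iff.mp ha with rfl | rfl <;> rcases H.head_eq_iff.mp hb with rfl | rfl
  · exact absurd rfl hab
  · rfl
  · rw [swap_comm]
  · exact absurd rfl hab

theorem Tour.mem_repairs_iff (τ : Tour H) (v : Fin n) {y : Fin n} {c d : Fin M} (hcd : c ≠ d)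
    (hc : H.head c = y) (hd : H.head d = y) :
    y ∈ τ.1.repairs v ↔ ¬ (τ.1.flip v).next.SameCycle c d := by
  have h0 : y ∈ τ.1.repairs v ↔ ((τ.1.flip v).flip y).next.IsCycleOn Set.univ := by
    simp only [TransitionSystem.repairs, Finset.mem_filter, Finset.mem_univ, true_and]
    rfl
  rw [h0, (τ.1.flip v).flip_next hcd hc hd]
  constructor
  · intro h
    have := not_sameCycle_mul_swap h hcd
    rwa [mul_assoc, swap_mul_self, mul_one] at this
  · intro h
    have hor : ∀ e, (τ.1.flip v).next.SameCycle (H.inArcA v) e ∨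
        (τ.1.flip v).next.SameCycle (H.inArcB v) e := fun e => sameCycle_or τ.2 e
    refine isCycleOn_mul_swap h fun e => ?_
    rcases hor c with h1 | h1 <;> rcases hor d with h2 | h2 <;> rcases hor e with h3 | h3
    · exact absurd (h1.symm.trans h2) h
    · exact absurd (h1.symm.trans h2) h
    · exact Or.inl (h1.symm.trans h3)
    · exact Or.inr (h2.symm.trans h3)
    · exact Or.inr (h2.symm.trans h3)
    · exact Or.inl (h1.symm.trans h3)
    · exact absurd (h1.symm.trans h2) h
    · exact absurd (h1.symm.trans h2) h

end FlipRepair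

namespace FlipRepair

open Equiv Equiv.Perm

variable {x : Ctx} {l : Lim} {N : ℕ → ℕ} {rk : ℕ → ℕ → ℕ} {n tc : ℕ} {H : Graph n x.M}
  {T : Perm (Fin x.M)}

theorem DS.of_eq_on {h h' : HS} (hd : DS x N rk h)
    (ha : ∀ k ∈ [0, 1, 2, 3, 4, 7, 9], h'.a k = h.a k) (hv : h'.v 19 = h.v 19) :
    DS x N rk h' := by
  obtain ⟨h1, h2, h3, h4, h5, h6⟩ := hd
  simp only [List.mem_cons, List.not_mem_nil, or_false, forall_eq_or_imp, forall_eq] at ha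
  obtain ⟨a0, a1, a2, a3, a4, a7, a9⟩ := ha
  refine ⟨?_, h2, ?_, ?_, ?_, by rw [hv, h6]⟩
  · rwa [a0, a1, a2, a3]
  · rwa [a7]
  · rwa [a9]
  · rwa [a1, a7, a4]

/-- What stays the same during a step. -/
structure Fixed (x : Ctx) {n : ℕ} (H : Graph n x.M) (tc : ℕ) (h : HS) : Prop where
  v_n : h.v 0 = n
  ctr : h.v 5 = tc
  lt : tc < x.P
  cst : Cst x h
  heads : Heads x n H.hd h

theorem Fixed.of_fr {c : HC} {h h' : HS} (hf : Fixed x H tc h) (hF : Fr c h h')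
    (hv : ∀ k ∈ [0, 1, 2, 3, 4, 5], k ∉ c.wv) (ha : 7 ∉ c.wa ∧ 8 ∉ c.wa) : Fixed x H tc h' := by
  simp only [List.mem_cons, List.not_mem_nil, or_false, forall_eq_or_imp, forall_eq] at hv
  obtain ⟨v0, v1, v2, v3, v4, v5⟩ := hv
  exact ⟨(hF.v 0 v0).trans hf.v_n, (hF.v 5 v5).trans hf.ctr, hf.lt, hf.cst.of_fr hF ⟨v1, v2, v3, v4⟩,
    ⟨by rw [hF.a 8 ha.2]; exact hf.heads.ia, by rw [hF.a 7 ha.1]; exact hf.heads.mate⟩⟩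

/-- The memory represents the tour `T` between two steps. -/
def Rep (x : Ctx) {n : ℕ} (H : Graph n x.M) (tc : ℕ) (T : Perm (Fin x.M)) (h : HS) : Prop :=
  Fixed x H tc h ∧ ∃ N rk, Part x x.K tc T N rk h

/-- The memory represents `T`, with `q` new groups on each level in this step. -/
structure Mid (x : Ctx) (q tc : ℕ) (T : Perm (Fin x.M)) (N : ℕ → ℕ) (rk : ℕ → ℕ → ℕ)
    (h : HS) : Prop where
  ds : DS x N rk h
  cards : Cards x N (h.a 1)
  size : ∀ k, 1 ≤ k → k ≤ x.K → N k ≤ 6 * 2 ^ (x.K - k) + 4 * (tc % 2 ^ (x.K - k)) + q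
  acts : ActsAs (h.a 0) T

theorem Mid.of_eq_on {q : ℕ} {h h' : HS} (hm : Mid x q tc T N rk h)
    (ha : ∀ k ∈ [0, 1, 2, 3, 4, 7, 9], h'.a k = h.a k) (hv : h'.v 19 = h.v 19) :
    Mid x q tc T N rk h' :=
  ⟨hm.ds.of_eq_on ha hv, by rw [ha 1 (by simp)]; exact hm.cards, hm.size,
    by rw [ha 0 (by simp)]; exact hm.acts⟩

theorem not_mem_flipArcs {k : ℕ} (hk : k < 6) : k ∉ flipArcs.wv := by
  interval_cases k <;> decide

theorem flip_spec (hx : x.Ok l) {h : HS} (hf : Fixed x H tc h) {q : ℕ} (hq : q ≤ 2)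
    (hm : Mid x q tc T N rk h) {a b : Fin x.M} (h7 : h.v 7 = a) (h8 : h.v 8 = b) :
    wp l flipArcs h fun h' t => t ≤ flipTime x ∧ Fixed x H tc h' ∧
      ∃ N', Mid x (q + 2) tc (T * swap a b) N' rk h' := by
  refine (flipArcs_spec hx hf.cst hm.ds hm.cards (fun k h1 hk => ?_) a.2 b.2 h7 h8).frame
    fun h' t ⟨ht, N', d1, d2, d3, d4⟩ hF => ⟨ht, hf.of_fr hF ?_ (by decide), N', d1, d2, ?_, ?_⟩
  · have h2 := hm.size k h1 hk
    have h3 := Nat.mod_lt tc (Nat.two_pow_pos (x.K - k))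
    omega
  · intro k hk
    refine not_mem_flipArcs ?_
    simp only [List.mem_cons, List.not_mem_nil, or_false] at hk
    omega
  · intro k h1 hk
    have h2 := hm.size k h1 hk
    have h3 := d3 k
    omega
  · intro e
    have h1 := d4 e e.2
    rw [h1, mul_apply, ← hm.acts, swap_apply_def]
    simp only [Fin.ext_iff]
    split_ifs <;> rfl

/-- Flip the random vertex `6` and count the repairs. -/
def openFlip : HC := .asg 7 (.get 8 (.v 6)) ;; .asg 8 (.get 7 (.v 7)) ;; flipArcs ;; query

theorem openFlip_spec (hx : x.Ok l) {h : HS} (hn : n ≤ x.M) (hr : Rep x H tc T h) {v : Fin n}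
    (h6 : h.v 6 = v) :
    wp l openFlip h fun h' t => t ≤ flipTime x + queryTime x + 40 ∧ Fixed x H tc h' ∧
      ∃ (a b : Fin x.M) (N' : ℕ → ℕ) (rk : ℕ → ℕ → ℕ), a ≠ b ∧ H.head a = v ∧ H.head b = v ∧
        Mid x 2 tc (T * swap a b) N' rk h' ∧ QueryOk x N' (T * swap a b) a h' := by
  obtain ⟨hf, N, rk, hp⟩ := hr
  have hZ := hx.Z_ge
  obtain ⟨i1, i2⟩ := hf.heads.ia v v.2
  obtain ⟨a, ha⟩ : ∃ a : Fin x.M, h.a 8 v = a := ⟨⟨_, i1⟩, rfl⟩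
  obtain ⟨e', e1, e2, e3⟩ := H.twoIn.other a a.2
  obtain ⟨b, rfl⟩ : ∃ b : Fin x.M, e' = b := ⟨⟨_, e1⟩, rfl⟩
  have hb : h.a 7 a = b := hf.heads.mate a a.2 b b.2 e2.symm e3.symm
  have hav : H.head a = v := by
    rw [ha, H.hd_fin] at i2
    exact Fin.ext i2
  have hbv : H.head b = v := by
    rw [H.hd_fin, H.hd_fin, hav] at e3
    exact Fin.ext e3
  have hvZ : (v : ℕ) < l.Z := by have := v.2; omega
  have haZ : (a : ℕ) < l.Z := by have := a.2; omega
  unfold openFlip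
  simp only [wp_seq, wp_asg, Exp.ok, Exp.eval, HS.set_v, HS.set_a, h6, ha, hb, if_true, Exp.cost,
    adrCost, Lim.bd_pos l 8 (by norm_num), Lim.bd_pos l 7 (by norm_num)]
  refine ⟨by norm_num, ⟨by norm_num, by norm_num, hvZ⟩, by norm_num, ⟨by norm_num, by norm_num,
    haZ⟩, ?_⟩
  set y := (h.set 7 (a : ℕ)).set 8 (b : ℕ) with hy
  have hfy : Fixed x H tc y := ⟨by simp [hy, hf.v_n], by simp [hy, hf.ctr], hf.lt,
    ⟨by simp [hy, hf.cst.M], by simp [hy, hf.cst.B], by simp [hy, hf.cst.P],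
    by simp [hy, hf.cst.Kc]⟩, hf.heads.1, hf.heads.2⟩
  have hmy : Mid x 0 tc T N rk y := Mid.of_eq_on (h := h) ⟨hp.ds, hp.cards, hp.size, hp.acts⟩
    (fun _ _ => rfl) (by simp [hy])
  refine (flip_spec hx hfy (by norm_num) hmy (a := a) (b := b) (by simp [hy])
    (by simp [hy])).frame fun h₁ t₁ ⟨ht₁, hf₁, N₁, hm₁⟩ hF₁ => ?_
  refine (query_spec hx hf₁.cst hm₁.ds hm₁.acts (a := a) ?_).frame fun h₂ t₂ ⟨ht₂, hq₂⟩ hF₂ =>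
    ⟨by omega, hf₁.of_fr hF₂ (by decide) (by decide), a, b, N₁, rk,
      fun hc => e2 (by rw [hc]), hav, hbv, hm₁.of_eq_on (fun k hk => hF₂.a k ?_)
        (hF₂.v 19 (by decide)), hq₂⟩
  · rw [hF₁.v 7 (by decide)]
    simp [hy]
  · revert k
    decide

/-- The number of the repairs is at most the number that `query` computes. -/
theorem card_repairs_le {τ : Tour H} {v : Fin n} {a b : Fin x.M} (hab : a ≠ b)
    (ha : H.head a = v) (hb : H.head b = v) {h : HS} (hf : Fixed x H tc h)
    (hm : Mid x 2 tc (τ.1.next * swap a b) N rk h)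
    (hq : QueryOk x N (τ.1.next * swap a b) a h) : (τ.1.repairs v).card ≤ h.v 22 := by
  classical
  have hK1 : 1 ≤ x.K := Ctx.K_pos
  have hinv := hm.ds.inv
  have hM0 := hm.ds.sz.zero
  set T' := τ.1.next * swap a b with hT'
  have hor : ∀ e, T'.SameCycle a e ∨ T'.SameCycle b e := fun e => sameCycle_or τ.2 e
  rw [hq.tot, sum_accCount]
  refine le_trans (Finset.card_le_card (fun y hy => ?_)) (Finset.card_image_le (f := H.head))
  obtain ⟨hne, -⟩ := (H.inArcs_eq y).symm
  have hns := (τ.mem_repairs_iff v hne (H.head_inArcA y) (H.head_inArcB y)).mp hy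
  rw [τ.1.flip_next hab ha hb] at hns
  have key : ∀ c d : Fin x.M, c ≠ d → H.head c = y → H.head d = y → T'.SameCycle a c →
      ¬ T'.SameCycle a d → y ∈ Finset.image H.head (Finset.univ.filter fun e : Fin x.M =>
        T'.SameCycle a e ∧ ∃ j < N 1, h.a 1 (h.a 7 e) = x.M + j ∧ markVal x.M T' (h.a 1) a j = 0) := by
    intro c d hcd hc hd h1 h2
    refine Finset.mem_image.mpr ⟨c, ?_, hc⟩
    have hmt : h.a 7 c = d := hf.heads.mate c c.2 d d.2 (fun h => hcd (Fin.ext h))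
      (by rw [H.hd_fin, H.hd_fin, hc, hd])
    have hp := hinv.par_mem 0 (by omega) d (hinv.mem_zero.mpr (by rw [hM0]; exact d.2))
    have hbl := hm.ds.sz.block hp
    simp only [Finset.mem_filter, Finset.mem_univ, true_and, hmt]
    refine ⟨h1, h.a 1 d - x.M, hbl.2, by omega, ?_⟩
    rcases markVal_zero_or_one (T := T') (par := h.a 1) (a := a) (h.a 1 d - x.M) with h3 | h3
    · exact h3
    · exact absurd ((hinv.markVal_eq_one hM0 hm.acts hK1 x.base_one d).mp h3) h2
  rcases hor (H.inArcA y) with h1 | h1 <;> rcases hor (H.inArcB y) with h2 | h2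
  · exact absurd (h1.symm.trans h2) hns
  · refine key _ _ hne (H.head_inArcA y) (H.head_inArcB y) h1 fun h3 => hns (h1.symm.trans h3)
  · exact key _ _ hne.symm (H.head_inArcB y) (H.head_inArcA y) h2 fun h3 => hns (h3.symm.trans h2)
  · exact absurd (h1.symm.trans h2) hns

/-- Flip the repair with number `21` and rebuild. -/
def closeFlip : HC :=
  select ;; .asg 7 (.v 13) ;; .asg 8 (.get 7 (.v 7)) ;; flipArcs ;;
  .asg 5 (.v 5 +~ .c 1) ;; .ite (.v 5 =~ .v 3) (.asg 5 (.c 0)) .skip ;; maint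

theorem closeFlip_spec (hx : x.Ok l) {τ : Tour H} {v : Fin n} {a b : Fin x.M} (hab : a ≠ b)
    (ha : H.head a = v) (hb : H.head b = v) {h : HS} (hf : Fixed x H tc h)
    (hm : Mid x 2 tc (τ.1.next * swap a b) N rk h)
    (hq : QueryOk x N (τ.1.next * swap a b) a h) {r : ℕ} (hr : r < h.v 22) :
    wp l closeFlip (h.set 21 r) fun h' t =>
      t ≤ selectTime x + flipTime x + maintTime x (nextCtr x tc) + 80 ∧
      ∃ (c d : Fin x.M) (hy : H.head c ∈ τ.1.repairs v), c ≠ d ∧ H.head d = H.head c ∧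
        ¬ (τ.1.next * swap a b).SameCycle a c ∧ (τ.1.next * swap a b).SameCycle a d ∧
        arcRank x.M (τ.1.next * swap a b) (h.a 1) (h.a 7) rk a c = r ∧
        Rep x H (nextCtr x tc) (τ.move v ⟨H.head c, hy⟩).1.next h' := by
  have hW := hx.W_ge
  have hZ := hx.Z_ge
  have hPM := hx.P_le
  set T' := τ.1.next * swap a b with hT'
  have hf' : Fixed x H tc (h.set 21 r) := ⟨by simp [hf.v_n], by simp [hf.ctr], hf.lt,
    ⟨by simp [hf.cst.M], by simp [hf.cst.B], by simp [hf.cst.P],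
    by simp [hf.cst.Kc]⟩, hf.heads.1, hf.heads.2⟩
  have hm' : Mid x 2 tc T' N rk (h.set 21 r) := hm.of_eq_on (fun _ _ => rfl) (by simp)
  have hq' : QueryOk x N T' a (h.set 21 r) := ⟨hq.acc, hq.mark, by simpa using hq.tot⟩
  unfold closeFlip
  rw [wp_seq]
  refine (select_spec hx hf'.cst hm'.ds hm'.cards hm'.acts hq' (r := r) (by simp)
    (by simpa using hr)).frame fun h₁ t₁ ⟨ht₁, c, h13, hc1, hc2, hc3⟩ hF₁ => ?_
  have hA₁ : h₁.a = h.a := by funext k; rw [hF₁.a k (by simp [select, HC.wa])]; rfl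
  obtain ⟨e', e1, e2, e3⟩ := H.twoIn.other c c.2
  obtain ⟨d, rfl⟩ : ∃ d : Fin x.M, e' = d := ⟨⟨_, e1⟩, rfl⟩
  have hd : h.a 7 c = d := hf.heads.mate c c.2 d d.2 e2.symm e3.symm
  have hdc : H.head d = H.head c := by
    rw [H.hd_fin, H.hd_fin] at e3
    exact Fin.ext e3
  have hcd : c ≠ d := fun hc => e2 (by rw [hc])
  have hda : T'.SameCycle a d := hc2 d hd.symm
  have hns : ¬ T'.SameCycle c d := fun hc => hc1 (hda.trans hc.symm)
  have hy : H.head c ∈ τ.1.repairs v := by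
    rw [τ.mem_repairs_iff v hcd rfl hdc, τ.1.flip_next hab ha hb]
    exact hns
  have hnext : (τ.move v ⟨H.head c, hy⟩).1.next = T' * swap c d := by
    change ((τ.1.flip v).flip (H.head c)).next = _
    rw [(τ.1.flip v).flip_next hcd rfl hdc, τ.1.flip_next hab ha hb]
  have htour : (T' * swap c d).IsCycleOn Set.univ := by
    rw [← hnext]
    exact (τ.move v ⟨H.head c, hy⟩).2
  have hcZ : (c : ℕ) < l.Z := by have := c.2; omega
  simp only [wp_seq, wp_asg, Exp.ok, Exp.eval, HS.set_v, HS.set_a, h13, hA₁, hd, if_true, Exp.cost,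
    adrCost, Lim.bd_pos l 7 (by norm_num)]
  refine ⟨by norm_num, by norm_num, by norm_num, ⟨by norm_num, by norm_num, hcZ⟩, ?_⟩
  set y := (h₁.set 7 (c : ℕ)).set 8 (d : ℕ) with hyd
  have hf₁ : Fixed x H tc h₁ := hf'.of_fr hF₁ (by decide) (by decide)
  have hfy : Fixed x H tc y := ⟨by simp [hyd, hf₁.v_n], by simp [hyd, hf₁.ctr], hf.lt,
    ⟨by simp [hyd, hf₁.cst.M], by simp [hyd, hf₁.cst.B], by simp [hyd, hf₁.cst.P],
    by simp [hyd, hf₁.cst.Kc]⟩, hf₁.heads.1, hf₁.heads.2⟩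
  have hmy : Mid x 2 tc T' N rk y := hm.of_eq_on (fun k _ => by rw [← hA₁]; rfl) (by
    simp only [hyd, HS.set_v, show (19 : ℕ) ≠ 8 by norm_num, show (19 : ℕ) ≠ 7 by norm_num, if_false]
    rw [hF₁.v 19 (by decide)]
    simp)
  refine (flip_spec hx hfy (by norm_num) hmy (a := c) (b := d) (by simp [hyd])
    (by simp [hyd])).mono fun h₂ t₂ ⟨ht₂, hf₂, N₂, hm₂⟩ => ?_
  have fin : ∀ (z : HS) (k : ℕ), z.a = h₂.a → z.v 5 = nextCtr x tc →
      (∀ i, i ≠ 5 → z.v i = h₂.v i) → k ≤ 20 →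
      wp l maint z fun h' t => k + t ≤ maintTime x (nextCtr x tc) + 20 ∧
        Rep x H (nextCtr x tc) (T' * swap c d) h' := by
    intro z k za z5 zi hk
    have hlt : nextCtr x tc < x.P := by
      have := hf.lt
      unfold nextCtr
      split_ifs <;> omega
    have hcz : Cst x z := ⟨(zi 1 (by norm_num)).trans hf₂.cst.M, (zi 2 (by norm_num)).trans hf₂.cst.B,
      (zi 3 (by norm_num)).trans hf₂.cst.P, (zi 4 (by norm_num)).trans hf₂.cst.Kc⟩
    have hfz : Fixed x H (nextCtr x tc) z := ⟨(zi 0 (by norm_num)).trans hf₂.v_n, z5, hlt, hcz,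
      by rw [za]; exact hf₂.heads.1, by rw [za]; exact hf₂.heads.2⟩
    have hdsz := hm₂.ds.of_eq za (zi 19 (by norm_num))
    have hcd := hm₂.cards
    have hac := hm₂.acts
    rw [← za] at hcd hac
    have hkept : Kept x (nextCtr x tc) (T' * swap c d) z := by
      refine fun s hs hnd => ⟨N₂, rk, Part.of_ds_le hdsz hcd hac hs fun k h1 hk => ?_⟩
      have e1 := hm₂.size k h1 (hk.trans hs)
      have e2 : ¬ 2 ^ (x.K - k) ∣ nextCtr x tc := fun hc =>
        hnd ((Nat.pow_dvd_pow 2 (by omega)).trans hc)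
      have e3 : nextCtr x tc = tc + 1 := by
        unfold nextCtr at e2 ⊢
        split_ifs at e2 ⊢
        · exact absurd (dvd_zero _) e2
        · rfl
      rw [e3] at e2 ⊢
      have e4 := Nat.mod_lt tc (Nat.two_pow_pos (x.K - k))
      rw [Nat.dvd_iff_mod_eq_zero, ← Nat.mod_add_mod] at e2
      rw [← Nat.mod_add_mod]
      rcases Nat.lt_or_ge (tc % 2 ^ (x.K - k) + 1) (2 ^ (x.K - k)) with h | h
      · rw [Nat.mod_eq_of_lt h]
        omega
      · rw [show tc % 2 ^ (x.K - k) + 1 = 2 ^ (x.K - k) by omega, Nat.mod_self] at e2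
        exact absurd rfl e2
    refine (maint_spec hx hcz z5 hlt (Part.of_ds_le hdsz hcd hac (Nat.zero_le _)
      fun k h1 hk => by omega) hkept htour).mono fun h' t ⟨q1, q2, q3⟩ => ⟨by omega, ?_, q3⟩
    refine ⟨?_, ?_, hlt, hcz.of_fr q2 (by decide), ?_, ?_⟩
    · rw [q2.v 0 (by decide), hfz.v_n]
    · rw [q2.v 5 (by decide), z5]
    · rw [q2.a 8 (by decide)]
      exact hfz.heads.1
    · rw [q2.a 7 (by decide)]
      exact hfz.heads.2
  have v5 := hf₂.ctr
  have v3 := hf₂.cst.P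
  have hlt := hf.lt
  simp only [wp_asg, wp_ite, wp_skip, Exp.ok, Exp.eval, Op.eval, v5, v3, HS.set_v, if_true,
    show (3 : ℕ) ≠ 5 by norm_num, if_false, Exp.cost]
  refine ⟨by norm_num, ⟨by norm_num, by omega, by omega⟩, ⟨by norm_num, by norm_num,
    by split_ifs <;> omega⟩, fun h0 => ⟨by norm_num, by norm_num, ?_⟩, fun h0 => ?_⟩
  · have h1 : tc + 1 = x.P := by
      by_contra hc
      rw [if_neg hc] at h0
      exact h0 rfl
    refine (fin ((h₂.set 5 (tc + 1)).set 5 0) 15 rfl (by simp [nextCtr, h1])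
      (fun i hi => by simp [hi]) (by norm_num)).mono
      fun h' t ⟨q1, q2⟩ => ⟨by omega, c, d, hy, hcd, hdc, hc1, hda, ?_, by rw [hnext]; exact q2⟩
    exact hc3
  · have h1 : tc + 1 ≠ x.P := by
      intro hc
      rw [if_pos hc] at h0
      exact one_ne_zero h0
    refine (fin (h₂.set 5 (tc + 1)) 15 rfl (by simp [nextCtr, h1]) (fun i hi => by simp [hi])
      (by norm_num)).mono
      fun h' t ⟨q1, q2⟩ => ⟨by omega, c, d, hy, hcd, hdc, hc1, hda, ?_, by rw [hnext]; exact q2⟩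
    exact hc3

end FlipRepair

namespace FlipRepair

theorem exec_rand {S W t k u w : ℕ} [NeZero k] {rest : List Cmd} {s : State} (h : s.reg w = k) :
    exec S W (t + 1) (.rand u w :: rest) s =
      (PMF.uniformOfFintype (Fin k)).bind fun r => exec S W t rest (s.setReg u r) := by
  subst h
  rw [exec, dif_neg (NeZero.ne _)]

theorem uniformOfFintype_map_equiv {α β : Type*} [Fintype α] [Nonempty α] [Fintype β] [Nonempty β]
    (e : α ≃ β) : (PMF.uniformOfFintype α).map e = PMF.uniformOfFintype β := by
  ext b
  rw [PMF.map_apply, tsum_eq_single (e.symm b)]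
  · simp [Fintype.card_congr e]
  · intro a ha
    rw [if_neg fun hb => ha (by rw [hb, e.symm_apply_apply])]

variable {x : Ctx} {l : Lim} {S n tc : ℕ} {H : Graph n x.M}

/-- Allocate the memory, make `B` at most `M`, and build the data structure. -/
def initCmd : Cmd := .seq (.const 50 50) (.seq (.op .mul 50 50 1)
  (ccmd (.ite (.v 1 <~ .v 2) (.asg 2 (.v 1)) .skip ;; prep)))

/-- One step of the chain. -/
def stepCmd : Cmd :=
  .seq (.rand 6 0) (.seq (ccmd openFlip) (.seq (.rand 21 22) (ccmd closeFlip)))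

/-- The machine is ready for the next step, and its tour is `τ`. -/
def Good (x : Ctx) (l : Lim) {n : ℕ} {H : Graph n x.M} (tc : ℕ) (τ : Tour H) (s : State) : Prop :=
  ∃ h, Sim l s h ∧ Rep x H tc τ.1.next h

/-- A bound for the time of a step without its rebuilds. -/
def flatTime (x : Ctx) : ℕ := 2 * flipTime x + queryTime x + selectTime x + 130

theorem Good.table {τ : Tour H} {s : State} (hx : x.Ok l) (hg : Good x l tc τ s) :
    s.table x.M = τ.table := by
  obtain ⟨h, hs, -, N, rk, hp⟩ := hg
  funext e
  have he := e.2
  have hD := hx.D_eq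
  rw [State.table, hs.arr0 e (by omega), hp.acts e]
  rfl

theorem exec_step_vertex (hx : x.Ok l) (hf : l.Fits S) (hn : n ≤ x.M) {τ : Tour H} {s : State}
    (hg : Good x l tc τ s) (v : Fin n) {t : ℕ}
    (ht : flatTime x + maintTime x (nextCtr x tc) ≤ t + 2) :
    ∃ out : {y // y ∈ τ.1.repairs v} → State × ℕ,
      exec S l.W t [.seq (ccmd openFlip) (.seq (.rand 21 22) (ccmd closeFlip))] (s.setReg 6 v) =
        (PMF.uniformOfFintype {y // y ∈ τ.1.repairs v}).map (fun y => some (out y)) ∧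
      ∀ y, Good x l (nextCtr x tc) (τ.move v y) (out y).1 ∧
        t + 2 ≤ (out y).2 + flatTime x + maintTime x (nextCtr x tc) := by
  obtain ⟨h, hs, hfx, N, rk, hp⟩ := hg
  have hv := v.2
  have hD := hx.D_eq
  have hW := hx.W_le
  have hr : Rep x H tc τ.1.next (h.set 6 v) := ⟨⟨by simp [hfx.v_n], by simp [hfx.ctr], hfx.lt,
    ⟨by simp [hfx.cst.M], by simp [hfx.cst.B], by simp [hfx.cst.P], by simp [hfx.cst.Kc]⟩,
    hfx.heads.1, hfx.heads.2⟩, N, rk, hp.congr rfl (by simp)⟩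
  obtain ⟨s₁, h₁, k₁, r₁, hs₁, hk₁, hf₁, a, b, N₁, rk₁, hab, ha, hb, hm₁, hq₁⟩ :=
    wp_run hf (openFlip_spec hx hn hr (v := v) (by simp))
      (hs.setVar (x := 6) (a := v) (by norm_num) (by omega))
  have hcard := card_repairs_le hab ha hb hf₁ hm₁ hq₁
  have htot : h₁.v 22 ≠ 0 := by
    have := Finset.card_pos.mpr (τ.repairs_nonempty v)
    omega
  have : NeZero (h₁.v 22) := ⟨htot⟩
  have h22 : s₁.reg 22 = h₁.v 22 := hs₁.var 22 (by norm_num)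
  have hle : h₁.v 22 ≤ l.W := h22 ▸ hs₁.regW 22
  have key : ∀ r : Fin (h₁.v 22), ∃ (s₂ : State) (k₂ : ℕ) (c d : Fin x.M)
      (hy : H.head c ∈ τ.1.repairs v), Run S l.W (ccmd closeFlip) (s₁.setReg 21 r) s₂ k₂ ∧
      k₂ ≤ selectTime x + flipTime x + maintTime x (nextCtr x tc) + 80 ∧ c ≠ d ∧
      H.head d = H.head c ∧ ¬ (τ.1.next * Equiv.swap a b).SameCycle a c ∧
      (τ.1.next * Equiv.swap a b).SameCycle a d ∧
      arcRank x.M (τ.1.next * Equiv.swap a b) (h₁.a 1) (h₁.a 7) rk₁ a c = r ∧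
      Good x l (nextCtr x tc) (τ.move v ⟨H.head c, hy⟩) s₂ := by
    intro r
    have hr2 := r.2
    obtain ⟨s₂, h₂, k₂, r₂, hs₂, hk₂, c, d, hy, q1, q2, q3, q4, q5, q6⟩ :=
      wp_run hf (closeFlip_spec hx hab ha hb hf₁ hm₁ hq₁ r.2)
        (hs₁.setVar (x := 21) (a := r) (by norm_num) (by omega))
    exact ⟨s₂, k₂, c, d, hy, r₂, hk₂, q1, q2, q3, q4, q5, h₂, hs₂, q6⟩
  choose s₂ k₂ c d hy r₂ hk₂ hcd hdc hns hsc hrank hgood using key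
  have hinj : Function.Injective fun r => (⟨H.head (c r), hy r⟩ : {y // y ∈ τ.1.repairs v}) := by
    intro r r' hrr
    have hcc : H.head (c r') = H.head (c r) := (congrArg Subtype.val hrr).symm
    have : c r = c r' := by
      by_contra hne
      have := H.twoIn.three (c r) (c r).2 (c r') (c r').2 (d r) (d r).2
        (by rw [H.hd_fin, H.hd_fin, hcc]) (by rw [H.hd_fin, H.hd_fin, hdc])
        (fun h => hne (Fin.ext h.symm)) (fun h => hcd r (Fin.ext h.symm))
      exact hns r' (Fin.ext this ▸ hsc r)
    exact Fin.ext (by rw [← hrank r, ← hrank r', this])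
  have hbij := (Fintype.bijective_iff_injective_and_card _).mpr ⟨hinj, by
    have := Fintype.card_le_of_injective _ hinj
    rw [Fintype.card_fin, Fintype.card_coe] at this ⊢
    omega⟩
  set e := Equiv.ofBijective _ hbij with he
  set m := maintTime x (nextCtr x tc)
  unfold flatTime at ht ⊢
  have hk := fun r => hk₂ r
  refine ⟨fun y => (s₂ (e.symm y), t - (k₁ + k₂ (e.symm y) + 3)), ?_, fun y => ?_⟩
  · rw [show t = (t - (k₁ + 3) + 1 + 1 + k₁) + 1 by omega, exec, r₁, exec, exec_rand h22,
      ← uniformOfFintype_map_equiv e, PMF.map_comp, PMF.map]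
    congr 1
    funext r
    have := hk r
    rw [show t - (k₁ + 3) = (t - (k₁ + k₂ r + 3)) + k₂ r by omega, r₂, exec]
    simp only [Function.comp_apply, Equiv.symm_apply_apply]
    congr 4
    omega
  · have := hk (e.symm y)
    refine ⟨?_, by simp only; omega⟩
    have h2 := hgood (e.symm y)
    have h3 : (⟨H.head (c (e.symm y)), hy (e.symm y)⟩ : {y // y ∈ τ.1.repairs v}) = y :=
      e.apply_symm_apply y
    rwa [h3] at h2

theorem exec_step [NeZero n] (hx : x.Ok l) (hf : l.Fits S) (hn : n ≤ x.M) {τ : Tour H} {s : State}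
    (hg : Good x l tc τ s) {t : ℕ} (ht : flatTime x + maintTime x (nextCtr x tc) ≤ t) :
    ∃ out : (v : Fin n) → {y // y ∈ τ.1.repairs v} → State × ℕ,
      exec S l.W t [stepCmd] s = (PMF.uniformOfFintype (Fin n)).bind (fun v =>
        (PMF.uniformOfFintype {y // y ∈ τ.1.repairs v}).map fun y => some (out v y)) ∧
      ∀ v y, Good x l (nextCtr x tc) (τ.move v y) (out v y).1 ∧
        t ≤ (out v y).2 + flatTime x + maintTime x (nextCtr x tc) := by
  have h2 : 2 ≤ t := by unfold flatTime at ht; omega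
  have := fun v => exec_step_vertex hx hf hn hg v (t := t - 2) (by omega)
  choose out h1 h3 using this
  refine ⟨out, ?_, fun v y => ⟨(h3 v y).1, by have := (h3 v y).2; omega⟩⟩
  have h0 : s.reg 0 = n := by
    obtain ⟨h, hs, hfx, -⟩ := hg
    rw [hs.var 0 (by norm_num), hfx.v_n]
  rw [show t = t - 2 + 1 + 1 by omega, stepCmd, exec, exec_rand h0]
  congr 1
  funext v
  exact h1 v

/-- The amortized time of a step. -/
def stepTime (x : Ctx) : ℕ := flatTime x + 41000 * (x.P + x.B) * x.K + 20 * x.K + 20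

theorem runSteps_eq [NeZero n] (hx : x.Ok l) (hf : l.Fits S) (hn : n ≤ x.M) (m : ℕ) {t : ℕ}
    {τ : Tour H} {s : State} (hg : Good x l tc τ s) (ht : m * stepTime x + credit x tc ≤ t) :
    runSteps x.M S l.W stepCmd m t s =
      (Tour.path m τ).map fun L => some (L.map Tour.table) := by
  induction m generalizing t τ s tc with
  | zero => simp [runSteps, Tour.path, PMF.pure_map, hg.table hx]
  | succ m ih =>
    have hc := maintTime_credit (x := x) tc
    rw [Nat.succ_mul] at ht
    have ht' : flatTime x + maintTime x (nextCtr x tc) + (m * stepTime x +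
      credit x (nextCtr x tc)) ≤ t := by
      unfold stepTime at ht ⊢
      omega
    obtain ⟨out, h1, h2⟩ := exec_step hx hf hn hg (t := t) (by omega)
    rw [runSteps, h1, Tour.path, Tour.kernel, PMF.bind_bind, PMF.bind_bind, PMF.map_bind]
    congr 1
    funext v
    rw [PMF.bind_map, PMF.bind_map, PMF.map_bind]
    congr 1
    funext y
    obtain ⟨h3, h4⟩ := h2 v y
    simp only [Function.comp_apply]
    rw [ih h3 (by omega), PMF.map_comp, PMF.map_comp, hg.table hx]
    rfl

theorem sim_of_bounded {s : State} (hr : ∀ i, s.reg i ≤ l.W)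
    (hm : ∀ i, s.mem i ≤ l.W) (h50 : s.reg 50 = l.D) (h51 : s.reg 51 = 0) :
    Sim l s ⟨s.reg, fun k i => if k = 0 then s.mem i else s.mem (l.D + 16 * i + k)⟩ :=
  ⟨fun _ _ => rfl, h50, h51, fun _ _ => rfl, fun k i hk _ => by simp [hk.ne'], hr, hm⟩

theorem implements_of_bounds [NeZero n] (hx : x.Ok l) (hmin : ∀ i < x.L, 2 ^ i * x.B < x.M)
    (hf : l.Fits S) {B : ℕ} (hBx : x.B = min B x.M) (hBW : B ≤ l.W) (τ : Tour H) {t₀ : ℕ}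
    {t : ℕ → ℕ} (h₀ : 200 * x.M + 20 * x.K + 130 + maintTime x 0 ≤ t₀)
    (ht : ∀ T, T * stepTime x ≤ t T) :
    Implements H τ B initCmd stepCmd S l.W t₀ t := by
  intro m
  have hnM := H.two_mul_card
  have hD := hx.D_eq
  have hW := hx.W_le
  have hB := hx.B_pos
  have hM2 := hx.M_two
  set s₀ := (inputState H τ B).setReg 50 50 with hs₀
  have r1 : Run S l.W (.const 50 50) (inputState H τ B) s₀ 1 := Run.const _ (by omega)
  have e2 : Op.mul.eval (s₀.reg 50) (s₀.reg 1) = l.D := by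
    simp [hs₀, inputState, Op.eval, hD]
  have r2 := Run.op (S := S) (W := l.W) (o := .mul) (x := 50) (y := 50) (z := 1) s₀
    (by rw [e2]; omega)
  rw [e2] at r2
  set s := s₀.setReg 50 l.D with hs
  have hreg : ∀ i, i ≠ 50 → s.reg i = if i = 0 then n else if i = 1 then x.M else
      if i = 2 then B else 0 := by
    intro i hi
    simp [hs, hs₀, hi, inputState]
  have hmem : s.mem = (inputState H τ B).mem := rfl
  have hsim := sim_of_bounded (l := l) (s := s) (fun i => ?_) (fun i => ?_) (by simp [hs])
    (by rw [hreg 51 (by norm_num)]; simp)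
  · have v0 := hreg 0 (by norm_num)
    have v1 := hreg 1 (by norm_num)
    have v2 := hreg 2 (by norm_num)
    have hp : ∀ h : HS, h.v 0 = n → h.v 1 = x.M → h.v 2 = x.B → h.a 0 = s.mem →
        wp l prep h _ := fun h e0 e1 e2 e3 =>
      prep_spec hx hmin H.twoIn (by omega) e0 e1 e2
        (fun e he => by simp [e3, hmem, inputState, Graph.hd, he]) (T := τ.1.next)
        (fun e => by simp [e3, hmem, inputState]) τ.2
    obtain ⟨s', h', k, r3, hs', hk, q0, q5, qc, qh, qp⟩ := wp_run hf (c :=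
      .ite (.v 1 <~ .v 2) (.asg 2 (.v 1)) .skip ;; prep) (Q := fun h' t =>
        t ≤ 200 * x.M + 20 * x.K + 120 + maintTime x 0 ∧ h'.v 0 = n ∧ h'.v 5 = 0 ∧ Cst x h' ∧
        Heads x n H.hd h' ∧ ∃ N rk, Part x x.K 0 τ.1.next N rk h') (by
      simp only [wp_seq, wp_ite, wp_asg, wp_skip, Exp.ok, Exp.eval, Op.eval, v1, v2, Exp.cost]
      refine ⟨⟨by norm_num, by norm_num, by split_ifs <;> omega⟩, fun hc => ⟨by norm_num,
        by norm_num, ?_⟩, fun hc => ?_⟩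
      · have : x.M < B := by by_contra h; simp [h] at hc
        exact (hp _ (by simp [v0]) (by simp [v1]) (by simp; omega) rfl).mono
          fun _ _ ⟨q1, q2⟩ => ⟨by omega, q2⟩
      · have : ¬ x.M < B := fun h => by simp [h] at hc
        exact (hp _ (by simp [v0]) (by simp [v1]) (by simp [v2]; omega) rfl).mono
          fun _ _ ⟨q1, q2⟩ => ⟨by omega, q2⟩) hsim
    have hg : Good x l 0 τ s' := ⟨h', hs', ⟨q0, q5, x.P_pos, qc, qh⟩, qp⟩
    have r := (Run.seq r1 (Run.seq r2 r3)) (t₀ - (1 + (1 + k + 1) + 1)) []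
    rw [Nat.sub_add_cancel (by omega), exec] at r
    rw [session, initCmd, r, PMF.pure_bind]
    exact runSteps_eq hx hf (by omega) m hg (by simpa [credit] using ht m)
  · rcases eq_or_ne i 50 with rfl | hi
    · simp only [hs, State.setReg_reg, if_true]
      omega
    · rw [hreg i hi]
      split_ifs <;> omega
  · rw [hmem]
    simp only [inputState]
    split_ifs with h1 h2 h3
    · have := (τ.1.next ⟨i, h1⟩).2
      omega
    · have := (H.head ⟨_, h2⟩).2
      omega
    · have := (H.tail ⟨_, h3⟩).2
      omega
    · omega

end FlipRepair

namespace FlipRepair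

/-- The parameters for a graph with `M` arcs. -/
theorem exists_params {M B : ℕ} (hM : 2 ≤ M) (hB : 1 ≤ B) : ∃ x : Ctx, x.M = M ∧ x.B = min B M ∧
    (∀ i < x.L, 2 ^ i * x.B < x.M) ∧ x.M ≤ x.P * x.B ∧ (x.P = 1 ∨ x.P * x.B ≤ 2 * x.M) := by
  have hex : ∃ L, M ≤ 2 ^ L * min B M :=
    ⟨M, Nat.lt_two_pow_self.le.trans (Nat.le_mul_of_pos_right _ (by omega))⟩
  refine ⟨⟨M, min B M, Nat.find hex⟩, rfl, rfl, fun i hi => not_le.mp (Nat.find_min hex hi),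
    Nat.find_spec hex, ?_⟩
  simp only [Ctx.P]
  rcases Nat.eq_zero_or_eq_succ_pred (Nat.find hex) with h | h
  · exact .inl (by rw [h, pow_zero])
  · have := not_le.mp (Nat.find_min hex (m := (Nat.find hex).pred) (by omega))
    right
    rw [h, pow_succ]
    nlinarith

theorem stepTime_le {x : Ctx} (hB : 1 ≤ x.B) : stepTime x ≤ 120000 * ((x.P + x.B) * x.K) := by
  have hK : 1 ≤ x.K := Ctx.K_pos
  have hP := x.P_pos
  have h1 := Nat.mul_le_mul_left x.P hK
  have h2 := Nat.mul_le_mul_left x.B hK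
  have h3 := Nat.mul_le_mul_right x.K hP
  have e : stepTime x = 93000 * (x.P * x.K) + 41560 * (x.B * x.K) + 1520 * x.B + 16000 * x.P +
      220 * x.K + 870 := by
    simp only [stepTime, flatTime, flipTime, cutTime, queryTime, selectTime]
    ring
  rw [e, add_mul]
  omega

theorem implements_of_real {n M : ℕ} [NeZero n] {H : Graph n M} (τ : Tour H) {B S W t₀ : ℕ}
    {t : ℕ → ℕ} (hB : 1 ≤ B)
    (hS : 3000000 * ((M : ℝ) + (M : ℝ) ^ 2 / (B : ℝ) ^ 2) ≤ S)
    (h₀ : 3000000 * ((M : ℝ) + (M : ℝ) ^ 2 / (B : ℝ) ^ 2) ≤ t₀)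
    (hW : 13000 * M ^ 2 + 10 * B ≤ W)
    (ht : ∀ T : ℕ, (T : ℝ) * (3000000 * (B * Real.log M + M / B * Real.log M)) ≤ t T) :
    Implements H τ B initCmd stepCmd S W t₀ t := by
  have hM : 2 ≤ M := by
    have := H.two_mul_card
    have := NeZero.pos n
    omega
  obtain ⟨x, rfl, hBx, hmin, hle, hP⟩ := exists_params hM hB
  have hB1 : 1 ≤ x.B := by omega
  have hP0 := x.P_pos
  have hP2 : x.P ≤ 2 * x.M := by
    rcases hP with h | h
    · omega
    · exact (Nat.le_mul_of_pos_right _ hB1).trans h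
  have hPP : x.P * x.P ≤ 4 * x.M ^ 2 := by nlinarith
  have hPB : x.P * x.B ≤ 2 * x.M := by
    rcases hP with h | h
    · rw [h]
      omega
    · exact h
  have hKP : x.K ≤ x.P := Nat.lt_two_pow_self
  have hMM : x.M ≤ x.M ^ 2 := by nlinarith
  have hBr : (1 : ℝ) ≤ B := by exact_mod_cast hB
  have hMr : (2 : ℝ) ≤ x.M := by exact_mod_cast hM
  have hPr : (1 : ℝ) ≤ x.P := by exact_mod_cast hP0
  set m : ℝ := (x.M : ℝ) / B with hm
  have hm0 : 0 ≤ m := by positivity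
  rw [← div_pow, ← hm] at hS h₀
  have hPm : (x.P : ℝ) ≤ 2 * m + 2 := by
    rcases le_total B x.M with h | h
    · rw [min_eq_left h] at hBx
      have : (x.P : ℝ) * B ≤ 2 * x.M := by rw [← hBx]; exact_mod_cast hPB
      have : (x.P : ℝ) ≤ 2 * x.M / B := by rwa [le_div_iff₀ (by positivity)]
      rw [mul_div_assoc, ← hm] at this
      linarith
    · rw [min_eq_right h] at hBx
      rw [hBx] at hPB
      have : x.P ≤ 2 := Nat.le_of_mul_le_mul_right hPB (by omega)
      have : (x.P : ℝ) ≤ 2 := by exact_mod_cast this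
      linarith
  have hPm2 : (x.P : ℝ) * x.P ≤ 8 * m ^ 2 + 8 := by nlinarith [sq_nonneg (m - 1)]
  have hlog : (x.K : ℝ) ≤ 5 * Real.log x.M := by
    have h1 : Real.log 2 ≤ Real.log x.M := Real.log_le_log (by norm_num) hMr
    have h2 : Real.log ((2 : ℝ) ^ x.L) ≤ Real.log (2 * x.M) := by
      refine Real.log_le_log (by positivity) ?_
      exact_mod_cast hP2
    rw [Real.log_pow, Real.log_mul (by norm_num) (by positivity)] at h2
    have h3 : (x.K : ℝ) = x.L + 1 := by simp [Ctx.K]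
    have h4 := Real.log_two_gt_d9
    nlinarith
  refine implements_of_bounds (x := x) (l := ⟨50 * x.M, x.M + 200 * (x.P * x.P), W⟩)
    ⟨hM, hB1, hle, hP2, rfl, rfl, by simp only; omega⟩ hmin ⟨?_, by simp only; omega,
      by simp only; omega, ?_⟩ hBx (by simp only; omega) τ ?_ fun T => ?_
  · have : ((50 * x.M + 16 * (x.M + 200 * (x.P * x.P)) : ℕ) : ℝ) ≤ S := by
      push_cast
      nlinarith
    exact_mod_cast this
  · have : ((50 * x.M : ℕ) : ℝ) ≤ S := by
      push_cast
      nlinarith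
    exact_mod_cast this
  · have h1 := maintTime_zero_le (x := x)
    rw [Nat.mul_add] at h1
    have h2 : x.P ≤ x.P * x.P := Nat.le_mul_of_pos_right _ hP0
    have : ((200 * x.M + 150 + 82080 * (x.P * x.P) + 82040 * (2 * x.M) : ℕ) : ℝ) ≤ t₀ := by
      push_cast
      nlinarith
    have : 200 * x.M + 150 + 82080 * (x.P * x.P) + 82040 * (2 * x.M) ≤ t₀ := by exact_mod_cast this
    omega
  · have h1 : ((stepTime x : ℕ) : ℝ) ≤ 120000 * ((x.P + x.B) * x.K) := by
      exact_mod_cast stepTime_le hB1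
    have h2 : (x.B : ℝ) ≤ B := by exact_mod_cast (show x.B ≤ B by omega)
    have h3 : ((x.P : ℝ) + x.B) * x.K ≤ (4 * (B + m)) * (5 * Real.log x.M) :=
      mul_le_mul (by linarith) hlog (by positivity) (by positivity)
    have h4 : 0 ≤ (B + m) * Real.log x.M :=
      mul_nonneg (by positivity) (Real.log_nonneg (by linarith))
    have : ((T * stepTime x : ℕ) : ℝ) ≤ t T := by
      refine le_trans ?_ (ht T)
      push_cast
      refine mul_le_mul_of_nonneg_left ?_ (by positivity)
      nlinarith
    exact_mod_cast this

theorem le_floor_mul {C y z : ℝ} (hC : 10000000 ≤ C) (hy : 1 / 2 ≤ y) (hz : z ≤ 9000000 * y) :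
    z ≤ ⌊C * y⌋₊ := by
  have := Nat.sub_one_lt_floor (C * y)
  nlinarith

end FlipRepair

theorem mainTheorem7 :
    ∃ (init step : FlipRepair.Cmd) (C : ℕ),
      (∀ (n M : ℕ) [NeZero n] (H : FlipRepair.Graph n M) (τ : FlipRepair.Tour H) (B : ℕ), 1 ≤ B →
        FlipRepair.Implements H τ B init step
          ⌊(C : ℝ) * ((M : ℝ) + (M : ℝ) ^ 2 / (B : ℝ) ^ 2)⌋₊
          ((M + B) ^ C)
          ⌊(C : ℝ) * ((M : ℝ) + (M : ℝ) ^ 2 / (B : ℝ) ^ 2)⌋₊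
          (fun T => ⌊(T : ℝ) *
            ((C : ℝ) * ((B : ℝ) * Real.log M + (M : ℝ) / (B : ℝ) * Real.log M))⌋₊)) ∧
      (∀ (n M : ℕ) [NeZero n] (H : FlipRepair.Graph n M) (τ : FlipRepair.Tour H) (B : ℕ),
        B = ⌈Real.sqrt M⌉₊ →
        FlipRepair.Implements H τ B init step
          (C * M)
          (M ^ C)
          (C * M)
          (fun T => ⌊(T : ℝ) * ((C : ℝ) * (Real.sqrt M * Real.log M))⌋₊)) := by
  obtain ⟨C, hC⟩ : ∃ C : ℕ, 10000000 ≤ C := ⟨_, le_rfl⟩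
  have hCr : (10000000 : ℝ) ≤ C := by exact_mod_cast hC
  have hM : ∀ {n M : ℕ} [NeZero n], FlipRepair.Graph n M → 2 ≤ M := fun {n M} _ H => by
    have := H.two_mul_card
    have := NeZero.pos n
    omega
  have hlog : ∀ {M : ℕ}, 2 ≤ M → 1 / 2 ≤ Real.log M := fun {M} h => by
    have h1 : Real.log 2 ≤ Real.log M := Real.log_le_log (by norm_num) (by exact_mod_cast h)
    have := Real.log_two_gt_d9
    linarith
  have htime : ∀ {c y z : ℝ} (T : ℕ), 1 / 2 ≤ y → z ≤ 9000000 * y → c = C * y →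
      (T : ℝ) * z ≤ ⌊(T : ℝ) * c⌋₊ := fun {c y z} T hy hz hc => by
    rcases Nat.eq_zero_or_pos T with rfl | h
    · simp
    · have h1 : (1 : ℝ) ≤ T := by exact_mod_cast h
      rw [hc, mul_left_comm]
      exact FlipRepair.le_floor_mul hCr (by nlinarith) (by nlinarith)
  refine ⟨FlipRepair.initCmd, FlipRepair.stepCmd, C, fun n M _ H τ B hB => ?_,
    fun n M _ H τ B hB => ?_⟩
  · have h2 := hM H
    have h2r : (2 : ℝ) ≤ M := by exact_mod_cast h2
    have hBr : (1 : ℝ) ≤ B := by exact_mod_cast hB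
    have hl := hlog h2
    have hm : (0 : ℝ) ≤ (M : ℝ) ^ 2 / (B : ℝ) ^ 2 := by positivity
    have hm' : (0 : ℝ) ≤ (M : ℝ) / B * Real.log M := by positivity
    refine FlipRepair.implements_of_real τ hB
      (FlipRepair.le_floor_mul hCr (by linarith) (by linarith))
      (FlipRepair.le_floor_mul hCr (by linarith) (by linarith)) ?_
      fun T => htime T (by nlinarith) (by nlinarith) rfl
    have h3 : 3 ^ 10 * (M + B) ^ 2 ≤ (M + B) ^ C :=
      (Nat.mul_le_mul_right _ (Nat.pow_le_pow_left (show 3 ≤ M + B by omega) 10)).trans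
        (by rw [← pow_add]; exact Nat.pow_le_pow_right (by omega) (by omega))
    nlinarith
  · have h2 := hM H
    have h2r : (2 : ℝ) ≤ M := by exact_mod_cast h2
    have hl := hlog h2
    set q := Real.sqrt M with hq
    have hqq : q * q = M := Real.mul_self_sqrt (by positivity)
    have hq1 : 1 ≤ q := Real.one_le_sqrt.mpr (by linarith)
    have hqB : q ≤ B := hB ▸ Nat.le_ceil q
    have hBq : (B : ℝ) < q + 1 := hB ▸ Nat.ceil_lt_add_one (by linarith)
    have hB1 : 1 ≤ B := by
      have : (1 : ℝ) ≤ B := by linarith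
      exact_mod_cast this
    have hBM : B ≤ M := by
      rw [hB, Nat.ceil_le]
      nlinarith
    have hm : (M : ℝ) / B ≤ q := by
      rw [div_le_iff₀ (by linarith)]
      nlinarith
    have hm2 : (M : ℝ) ^ 2 / (B : ℝ) ^ 2 ≤ M := by
      rw [← div_pow, ← hqq, ← sq]
      exact pow_le_pow_left₀ (by positivity) (by rwa [sq, hqq]) 2
    have hS : 3000000 * ((M : ℝ) + (M : ℝ) ^ 2 / (B : ℝ) ^ 2) ≤ (C * M : ℕ) := by
      push_cast
      nlinarith
    refine FlipRepair.implements_of_real τ hB1 hS hS ?_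
      fun T => htime T (y := q * Real.log M) (by nlinarith) ?_ rfl
    · have h3 : 2 ^ 14 * M ^ 2 ≤ M ^ C :=
        (Nat.mul_le_mul_right _ (Nat.pow_le_pow_left h2 14)).trans
          (by rw [← pow_add]; exact Nat.pow_le_pow_right (by omega) (by omega))
      nlinarith
    · have : B * Real.log M + M / B * Real.log M ≤ 3 * q * Real.log M := by
        rw [← add_mul]
        exact mul_le_mul_of_nonneg_right (by linarith) (by linarith)
      linarith
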